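/- Let $M$ be a compact connected smooth $n$-manifold without boundary, with universal covering $p:\tilde M\to M$, and let $\pi_1(M)$ act on $\tilde M$ by deck transformations. Definitions. For a smooth torsion-free connection $\nabla$ on $TM$ and a smooth symmetric two-tensor $h$ on $M$, let $\nabla^h$ be the connection on $TM\oplus L$, $L=M\times\mathbb R$, given by $$\nabla^h_X\begin{pmatrix}Z\\ \lambda\end{pmatrix}=\begin{pmatrix}\nabla_XZ+\lambda X\\ X\cdot\lambda+h(Z,X)\end{pmatrix}.$$ The pair $(\nabla,h)$ satisfies Condition (E) if $\nabla$ preserves a volume form (a nowhere vanishing smooth $n$-form) on $M$ and $\nabla^h$ is flat. Two torsion-free connections are projectively equivalent if $\nabla^1_XY-\nabla^2_XY=\beta(X)Y+\beta(Y)X$ for some one-form $\beta$; $\nabla$ is projectively flat if near every point it is projectively equivalent to a flat torsion-free connection. A flat projective structure on $M$ is a pair $(f,\rho)$ of a representation $\rho:\pi_1(M)\to SL(n+1,\mathbb R)$ and a $\rho$-equivariant local diffeomorphism $f:\tilde M\to\mathbb{RP}^n$ (the developing map). It is defined by $\nabla$ if, locally on $M$, $\nabla$ is projectively equivalent to the pullback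 by $f$ (along local inverses of $p$) of the standard flat connection of an affine chart of $\mathbb{RP}^n$. It is properly convex if $f$ is a homeomorphism onto a subset of an affine chart which is convex and contained in a compact convex subset of that chart. Theorem. (1) If $(\nabla,g)$ satisfies Condition (E) and $g$ is positive definite, then $\nabla$ is projectively flat and defines a properly convex flat projective structure $(f,\rho)$ on $M$. (2) Conversely, suppose that $M$ is orientable. Then for every properly convex flat projective structure $(f,\rho)$ on $M$ there is a pair $(\nabla,g)$ satisfying Condition (E), with $g$ positive definite, such that $\nabla$ is projectively flat and defines $(f,\rho)$. -/

import Mathlib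

open Set Bundle Topology
open scoped Manifold ContDiff LinearAlgebra.Projectivization

/-! ## Connections

Argument order for covariant derivatives, as in Mathlib: `D σ x v` is `(∇_v σ)(x)`. -/

section Connections

variable {n : ℕ} {M : Type*} [TopologicalSpace M] [ChartedSpace (EuclideanSpace ℝ (Fin n)) M]
  [IsManifold (𝓡 n) ∞ M]

/-- The section `σ` of the bundle `V` (with model fibre `F`) is smooth on `U`. -/
def IsSmoothSectionOn (n : ℕ) [ChartedSpace (EuclideanSpace ℝ (Fin n)) M] (F : Type*) [NormedAddCommGroup F] [NormedSpace ℝ F]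
    {V : M → Type*} [TopologicalSpace (TotalSpace F V)]
    [∀ x, TopologicalSpace (V x)] [FiberBundle F V]
    (σ : Π x : M, V x) (U : Set M) : Prop :=
  ContMDiffOn (𝓡 n) ((𝓡 n).prod 𝓘(ℝ, F)) ∞ (fun x => TotalSpace.mk' F x (σ x)) U

/-- The vector field `X` is smooth on `U`. -/
abbrev IsSmoothFieldOn (X : Π x : M, TangentSpace (𝓡 n) x) (U : Set M) : Prop :=
  IsSmoothSectionOn n (EuclideanSpace ℝ (Fin n)) X U

/-- The vector field `X` is differentiable at `x`. -/
abbrev IsDiffFieldAt (X : Π x : M, TangentSpace (𝓡 n) x) (x : M) : Prop :=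
  MDifferentiableAt (𝓡 n) ((𝓡 n).prod 𝓘(ℝ, EuclideanSpace ℝ (Fin n)))
    (fun z => TotalSpace.mk' (EuclideanSpace ℝ (Fin n)) z (X z)) x

variable (n M) in
/-- Connections on the tangent bundle of `M`. -/
abbrev TangentConnection :=
  CovariantDerivative (𝓡 n) (EuclideanSpace ℝ (Fin n)) (TangentSpace (𝓡 n) : M → Type _)

/-- The curvature `R(X,Y)σ = ∇_X ∇_Y σ - ∇_Y ∇_X σ - ∇_[X,Y] σ` of an operator `D` taking sections
of a bundle `V` to `V`-valued one-forms. -/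
noncomputable def curvatureOp {V : M → Type*} [∀ x, AddCommGroup (V x)] [∀ x, Module ℝ (V x)]
    [∀ x, TopologicalSpace (V x)]
    (D : (Π x : M, V x) → (Π x : M, TangentSpace (𝓡 n) x →L[ℝ] V x))
    (X Y : Π x : M, TangentSpace (𝓡 n) x) (σ : Π x : M, V x) (x : M) : V x :=
  D (fun z => D σ z (Y z)) x (X x) - D (fun z => D σ z (X z)) x (Y x)
    - D σ x (VectorField.mlieBracket (𝓡 n) X Y x)

/-- `D` is flat on `U`: its curvature vanishes at the points of `U`, on all vector fields and
sections that are smooth on `U`. -/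
def IsFlatOn (F : Type*) [NormedAddCommGroup F] [NormedSpace ℝ F]
    {V : M → Type*} [TopologicalSpace (TotalSpace F V)]
    [∀ x, AddCommGroup (V x)] [∀ x, Module ℝ (V x)] [∀ x, TopologicalSpace (V x)]
    [FiberBundle F V]
    (D : (Π x : M, V x) → (Π x : M, TangentSpace (𝓡 n) x →L[ℝ] V x)) (U : Set M) : Prop :=
  ∀ (X Y : Π x : M, TangentSpace (𝓡 n) x) (σ : Π x : M, V x),
    IsSmoothFieldOn X U → IsSmoothFieldOn Y U → IsSmoothSectionOn n F σ U →
    ∀ x ∈ U, curvatureOp D X Y σ x = 0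

/-- `D` is torsion free on `U`: `∇_X Y - ∇_Y X = [X,Y]`. -/
def IsTorsionFreeOn
    (D : (Π x : M, TangentSpace (𝓡 n) x) →
      (Π x : M, TangentSpace (𝓡 n) x →L[ℝ] TangentSpace (𝓡 n) x)) (U : Set M) : Prop :=
  ∀ X Y : Π x : M, TangentSpace (𝓡 n) x, ∀ x ∈ U, IsDiffFieldAt X x → IsDiffFieldAt Y x →
    D Y x (X x) - D X x (Y x) = VectorField.mlieBracket (𝓡 n) X Y x

/-- Projective equivalence on `U` of (torsion free) connections: there is a one-form `β` with
`∇¹_X Y - ∇²_X Y = β(X) Y + β(Y) X`.  (For smooth connections such a `β` is automatically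
smooth.) -/
def ProjEquivOn
    (D₁ D₂ : (Π x : M, TangentSpace (𝓡 n) x) →
      (Π x : M, TangentSpace (𝓡 n) x →L[ℝ] TangentSpace (𝓡 n) x)) (U : Set M) : Prop :=
  ∃ β : Π x : M, TangentSpace (𝓡 n) x →L[ℝ] ℝ,
    ∀ Y : Π x : M, TangentSpace (𝓡 n) x, ∀ x ∈ U, IsDiffFieldAt Y x →
      ∀ v : TangentSpace (𝓡 n) x,
        D₁ Y x v - D₂ Y x v = β x v • Y x + β x (Y x) • v

/-- A (torsion free) connection is projectively flat if near every point it is projectively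
equivalent to a smooth torsion free flat connection. -/
def IsProjectivelyFlat (D : TangentConnection n M) : Prop :=
  ∀ x : M, ∃ U : Set M, IsOpen U ∧ x ∈ U ∧
    ∃ D' : (Π x : M, TangentSpace (𝓡 n) x) →
        (Π x : M, TangentSpace (𝓡 n) x →L[ℝ] TangentSpace (𝓡 n) x),
      IsCovariantDerivativeOn (EuclideanSpace ℝ (Fin n)) D' U ∧
      ContMDiffCovariantDerivativeOn (EuclideanSpace ℝ (Fin n)) ∞ D' U ∧
      IsTorsionFreeOn D' U ∧ IsFlatOn (EuclideanSpace ℝ (Fin n)) D' U ∧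
      ProjEquivOn D.toFun D' U

/-! ## Volume forms -/

/-- A volume form: a smooth nowhere vanishing differential form of degree `n = dim M`. -/
structure IsVolumeForm (vol : Π x : M, (TangentSpace (𝓡 n) x) [⋀^Fin n]→ₗ[ℝ] ℝ) : Prop where
  smooth : ∀ X : Fin n → Π x : M, TangentSpace (𝓡 n) x, (∀ i, IsSmoothFieldOn (X i) univ) →
    ContMDiff (𝓡 n) 𝓘(ℝ, ℝ) ∞ fun x => vol x (fun i => X i x)
  ne_zero : ∀ x, vol x ≠ 0

/-- `∇vol = 0`, that is `v(vol(Y₁,…,Yₙ)) = ∑ᵢ vol(Y₁,…,∇_v Yᵢ,…,Yₙ)` for all smooth vector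
fields `Y₁,…,Yₙ` and all tangent vectors `v`. -/
def PreservesForm (D : TangentConnection n M)
    (vol : Π x : M, (TangentSpace (𝓡 n) x) [⋀^Fin n]→ₗ[ℝ] ℝ) : Prop :=
  ∀ Y : Fin n → Π x : M, TangentSpace (𝓡 n) x, (∀ i, IsSmoothFieldOn (Y i) univ) →
    ∀ (x : M) (v : TangentSpace (𝓡 n) x),
      mvfderiv (𝓡 n) (fun z => vol z (fun i => Y i z)) x v =
        ∑ i, vol x (Function.update (fun j => Y j x) i (D (Y i) x v))

variable (n M) in
/-- `M` is orientable: it carries a volume form. -/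
def IsOrientableManifold : Prop :=
  ∃ vol : Π x : M, (TangentSpace (𝓡 n) x) [⋀^Fin n]→ₗ[ℝ] ℝ, IsVolumeForm vol

/-! ## Condition (E) -/

variable (n M) in
/-- A smooth symmetric two-tensor on `M`. -/
structure SymmTwoTensor where
  toFun (x : M) : TangentSpace (𝓡 n) x →L[ℝ] TangentSpace (𝓡 n) x →L[ℝ] ℝ
  symm (x : M) (v w : TangentSpace (𝓡 n) x) : toFun x v w = toFun x w v
  smooth : ContMDiff (𝓡 n)
    ((𝓡 n).prod 𝓘(ℝ, EuclideanSpace ℝ (Fin n) →L[ℝ] EuclideanSpace ℝ (Fin n) →L[ℝ] ℝ)) ∞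
    (fun x => TotalSpace.mk' (EuclideanSpace ℝ (Fin n) →L[ℝ] EuclideanSpace ℝ (Fin n) →L[ℝ] ℝ)
      x (toFun x))

def SymmTwoTensor.IsPosDef (h : SymmTwoTensor n M) : Prop :=
  ∀ (x : M) (v : TangentSpace (𝓡 n) x), v ≠ 0 → 0 < h.toFun x v v

variable (n M) in
/-- The bundle `TM ⊕ L`, with `L` the trivial line bundle. -/
abbrev TangentPlusLine : M → Type _ :=
  (TangentSpace (𝓡 n) : M → Type _) ×ᵇ (Bundle.Trivial M ℝ)

theorem mdifferentiableAt_tangentPlusLine {σ : Π x : M, TangentPlusLine n M x} {x : M}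
    (hσ : MDifferentiableAt (𝓡 n) ((𝓡 n).prod 𝓘(ℝ, EuclideanSpace ℝ (Fin n) × ℝ))
      (fun z => TotalSpace.mk' (EuclideanSpace ℝ (Fin n) × ℝ) z (σ z)) x) :
    IsDiffFieldAt (fun z => (σ z).1) x ∧
      MDifferentiableAt (𝓡 n) 𝓘(ℝ, ℝ) (fun z => ((σ z).2 : ℝ)) x := by
  rw [mdifferentiableAt_section] at hσ
  constructor
  · rw [IsDiffFieldAt, mdifferentiableAt_section]
    exact MDifferentiableAt.comp (I' := 𝓘(ℝ, EuclideanSpace ℝ (Fin n) × ℝ))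
      (f := fun b => (trivializationAt (EuclideanSpace ℝ (Fin n) × ℝ)
        (TangentPlusLine n M) x ⟨b, σ b⟩).2) x
      ((contDiff_fst (𝕜 := ℝ) (n := 1) (E := EuclideanSpace ℝ (Fin n)) (F := ℝ)).contMDiff
        |>.mdifferentiableAt one_ne_zero) hσ
  · exact MDifferentiableAt.comp (I' := 𝓘(ℝ, EuclideanSpace ℝ (Fin n) × ℝ))
      (f := fun b => (trivializationAt (EuclideanSpace ℝ (Fin n) × ℝ)
        (TangentPlusLine n M) x ⟨b, σ b⟩).2) x
      ((contDiff_snd (𝕜 := ℝ) (n := 1) (E := EuclideanSpace ℝ (Fin n)) (F := ℝ)).contMDiff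
        |>.mdifferentiableAt one_ne_zero) hσ

/-- The connection `∇^h_X (Z, l) = (∇_X Z + l X, X·l + h(Z, X))` on `TM ⊕ L`. -/
noncomputable def extendedConnection (D : TangentConnection n M) (h : SymmTwoTensor n M) :
    CovariantDerivative (𝓡 n) (EuclideanSpace ℝ (Fin n) × ℝ) (TangentPlusLine n M) where
  toFun σ x := ContinuousLinearMap.prod
    (D (fun z => (σ z).1) x + ((σ x).2 : ℝ) • ContinuousLinearMap.id ℝ (TangentSpace (𝓡 n) x))
    (mvfderiv (𝓡 n) (fun z => ((σ z).2 : ℝ)) x + h.toFun x (σ x).1)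
  isCovariantDerivativeOnUniv := by
    constructor
    · intro σ σ' x hσ hσ' _
      obtain ⟨a, b⟩ := mdifferentiableAt_tangentPlusLine hσ
      obtain ⟨a', b'⟩ := mdifferentiableAt_tangentPlusLine hσ'
      have e1 := D.isCovariantDerivativeOnUniv.add a a' (mem_univ x)
      have e2 := mvfderiv_add b b'
      refine ContinuousLinearMap.ext fun v => Prod.ext ?_ ?_
      · have key : D.toFun ((fun z => (σ z).1) + (fun z => (σ' z).1)) x v
            + (((σ x).2 : ℝ) + ((σ' x).2 : ℝ)) • v
            = (D.toFun (fun z => (σ z).1) x v + ((σ x).2 : ℝ) • v)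
            + (D.toFun (fun z => (σ' z).1) x v + ((σ' x).2 : ℝ) • v) := by
          rw [e1, add_apply]
          module
        exact key
      · have key : (mvfderiv (𝓡 n) ((fun z => ((σ z).2 : ℝ)) + (fun z => ((σ' z).2 : ℝ))) x v : ℝ)
            + h.toFun x ((σ x).1 + (σ' x).1) v =
            (mvfderiv (𝓡 n) (fun z => ((σ z).2 : ℝ)) x v + h.toFun x (σ x).1 v) +
            (mvfderiv (𝓡 n) (fun z => ((σ' z).2 : ℝ)) x v + h.toFun x (σ' x).1 v) := by
          rw [e2, map_add, add_apply, add_apply]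
          ring
        exact key
    · intro σ g x hσ hg _
      obtain ⟨a, b⟩ := mdifferentiableAt_tangentPlusLine hσ
      have e1 := D.isCovariantDerivativeOnUniv.leibniz a hg (mem_univ x)
      have e2 := mvfderiv_smul hg b
      refine ContinuousLinearMap.ext fun v => Prod.ext ?_ ?_
      · have key : D.toFun (g • (fun z => (σ z).1)) x v + (g x * ((σ x).2 : ℝ)) • v
            = g x • (D.toFun (fun z => (σ z).1) x v + ((σ x).2 : ℝ) • v)
              + mvfderiv (𝓡 n) g x v • (σ x).1 := by
          rw [e1, add_apply, smul_apply,
            ContinuousLinearMap.smulRight_apply]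
          module
        exact key
      · have key : (mvfderiv (𝓡 n) (g • (fun z => ((σ z).2 : ℝ))) x v : ℝ)
            + h.toFun x (g x • (σ x).1) v
            = g x * (mvfderiv (𝓡 n) (fun z => ((σ z).2 : ℝ)) x v + h.toFun x (σ x).1 v)
            + mvfderiv (𝓡 n) g x v * ((σ x).2 : ℝ) := by
          rw [e2, map_smul, add_apply, smul_apply,
            ContinuousLinearMap.smulRight_apply, smul_apply]
          simp only [smul_eq_mul]
          ring
        exact key

/-- Condition (E) for a smooth torsion free connection `D` and a symmetric two-tensor `h`:
`D` preserves a volume form and `∇^h` is flat. -/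
structure ConditionE (D : TangentConnection n M) (h : SymmTwoTensor n M) : Prop where
  smooth : CovariantDerivative.ContMDiffCovariantDerivative D ∞
  torsionFree : D.torsion = 0
  preservesVolume : ∃ vol : Π x : M, (TangentSpace (𝓡 n) x) [⋀^Fin n]→ₗ[ℝ] ℝ,
    IsVolumeForm vol ∧ PreservesForm D vol
  flat : IsFlatOn (EuclideanSpace ℝ (Fin n) × ℝ) (extendedConnection D h).toFun univ

end Connections

/-! ## Real projective space -/

section ProjectiveSpace

/-- The quotient topology on the real projective space `ℙ(ℝⁿ⁺¹)`. -/
noncomputable instance realProjectiveTopology (n : ℕ) : TopologicalSpace (ℙ ℝ (Fin (n + 1) → ℝ)) :=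
  TopologicalSpace.coinduced
    (fun v : {v : Fin (n + 1) → ℝ // v ≠ 0} => Projectivization.mk' ℝ v) inferInstance

/-- The domain `{[v] : vᵢ ≠ 0}` of the `i`-th standard affine chart. -/
def affineDomain {n : ℕ} (i : Fin (n + 1)) : Set (ℙ ℝ (Fin (n + 1) → ℝ)) :=
  {q | q.rep i ≠ 0}

/-- The `i`-th standard affine chart `[v] ↦ (vⱼ / vᵢ)_{j ≠ i}` of projective space. -/
noncomputable def affineChart {n : ℕ} (i : Fin (n + 1)) (q : ℙ ℝ (Fin (n + 1) → ℝ)) :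
    EuclideanSpace ℝ (Fin n) :=
  WithLp.toLp 2 fun j => q.rep (i.succAbove j) / q.rep i

theorem mk_mem_affineDomain {n : ℕ} (i : Fin (n + 1)) (v : Fin (n + 1) → ℝ) (hv : v ≠ 0) :
    Projectivization.mk ℝ v hv ∈ affineDomain i ↔ v i ≠ 0 := by
  obtain ⟨a, ha⟩ := Projectivization.exists_smul_eq_mk_rep ℝ v hv
  change (Projectivization.mk ℝ v hv).rep i ≠ 0 ↔ _
  rw [← ha]
  simp [Units.smul_def]

theorem affineChart_mk {n : ℕ} (i : Fin (n + 1)) (v : Fin (n + 1) → ℝ) (hv : v ≠ 0)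
    (j : Fin n) : affineChart i (Projectivization.mk ℝ v hv) j = v (i.succAbove j) / v i := by
  obtain ⟨a, ha⟩ := Projectivization.exists_smul_eq_mk_rep ℝ v hv
  change (Projectivization.mk ℝ v hv).rep (i.succAbove j) / (Projectivization.mk ℝ v hv).rep i = _
  rw [← ha]
  simp only [Units.smul_def, Pi.smul_apply, smul_eq_mul]
  exact mul_div_mul_left _ _ a.ne_zero

/-- A set `Ω` of projective space is a properly convex set if it lies in the affine chart
`{[v] : ℓ v ≠ 0}` of some nonzero linear form `ℓ`, which is identified with the affine hyperplane
`{v : ℓ v = 1}`, and if in this chart `Ω` is convex and contained in a compact convex set. -/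
def IsProperlyConvexSet {n : ℕ} (Ω : Set (ℙ ℝ (Fin (n + 1) → ℝ))) : Prop :=
  ∃ ℓ : (Fin (n + 1) → ℝ) →ₗ[ℝ] ℝ, ℓ ≠ 0 ∧ (∀ q ∈ Ω, ℓ q.rep ≠ 0) ∧
    Convex ℝ {v | ℓ v = 1 ∧ ∃ hv : v ≠ 0, Projectivization.mk ℝ v hv ∈ Ω} ∧
    ∃ K ⊆ {v | ℓ v = 1}, IsCompact K ∧ Convex ℝ K ∧
      {v | ℓ v = 1 ∧ ∃ hv : v ≠ 0, Projectivization.mk ℝ v hv ∈ Ω} ⊆ K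

end ProjectiveSpace

/-! ## Flat projective structures -/

section ProjectiveStructures

/-- The group of deck transformations of a map `p`; when `p` is a universal covering of `M`
this is the fundamental group of `M` acting on the universal cover. -/
def DeckGroup {M' M : Type*} [TopologicalSpace M'] (p : M' → M) : Subgroup (M' ≃ₜ M') where
  carrier := {γ | ∀ x, p (γ x) = p x}
  one_mem' _ := rfl
  mul_mem' {a b} ha hb x := (ha (b x)).trans (hb x)
  inv_mem' {a} ha x := by
    have h := ha (a⁻¹ x)
    rw [show a (a⁻¹ x) = x from a.apply_symm_apply x] at h
    exact h.symm

variable {M' M : Type*} [TopologicalSpace M'] [TopologicalSpace M]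

/-- A flat projective structure on the `n`-manifold `M` with universal covering `p : M' → M`, given
by a developing map and a holonomy representation in `SL(n+1, ℝ)`: the developing map
`M' → ℙ(ℝⁿ⁺¹)` is a local diffeomorphism (it is continuous, and a smooth local diffeomorphism
when read in the affine charts of projective space) and is equivariant. -/
structure FlatProjStructure (n : ℕ) [ChartedSpace (EuclideanSpace ℝ (Fin n)) M']
    (p : M' → M) where
  dev : M' → ℙ ℝ (Fin (n + 1) → ℝ)
  hol : DeckGroup p →* Matrix.SpecialLinearGroup (Fin (n + 1)) ℝ
  continuous_dev : Continuous dev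
  localDiffeo : ∀ (x : M') (i : Fin (n + 1)), dev x ∈ affineDomain i →
    IsLocalDiffeomorphAt (𝓡 n) (𝓡 n) ∞ (fun z => affineChart i (dev z)) x
  equivariant : ∀ (γ : DeckGroup p) (x : M'), dev (γ.1 x) = hol γ • dev x

variable {n : ℕ} [ChartedSpace (EuclideanSpace ℝ (Fin n)) M'] {p : M' → M}

/-- The structure is properly convex: the developing map is a homeomorphism onto a properly
convex set. -/
def FlatProjStructure.IsProperlyConvex (S : FlatProjStructure n p) : Prop :=
  IsEmbedding S.dev ∧ IsProperlyConvexSet (range S.dev)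

/-- The (torsion free) connection `D` on `M` defines the projective structure `S`, i.e. its
projective class is the one induced from projective space by the developing map: near every
point there is a local section `s` of the universal covering such that `dev ∘ s` takes values in
an affine chart, and such that `D` is projectively equivalent to the pullback `D'` of the standard
flat connection by `y = (affine chart) ∘ dev ∘ s`, that is, `dy(D'_v Y) = v(dy(Y))`. -/
def FlatProjStructure.IsDefinedBy [ChartedSpace (EuclideanSpace ℝ (Fin n)) M]
    [IsManifold (𝓡 n) ∞ M] (S : FlatProjStructure n p) (D : TangentConnection n M) : Prop :=
  ∀ x₀ : M', ∃ (U : Set M) (s : M → M') (i : Fin (n + 1)),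
    IsOpen U ∧ p x₀ ∈ U ∧ s (p x₀) = x₀ ∧ ContMDiffOn (𝓡 n) (𝓡 n) ∞ s U ∧
    (∀ x ∈ U, p (s x) = x ∧ S.dev (s x) ∈ affineDomain i) ∧
    ∃ D' : (Π x : M, TangentSpace (𝓡 n) x) →
        (Π x : M, TangentSpace (𝓡 n) x →L[ℝ] TangentSpace (𝓡 n) x),
      IsCovariantDerivativeOn (EuclideanSpace ℝ (Fin n)) D' U ∧
      (∀ Y : Π x : M, TangentSpace (𝓡 n) x, ∀ x ∈ U, IsDiffFieldAt Y x →
        ∀ v : TangentSpace (𝓡 n) x,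
          mvfderiv (𝓡 n) (fun z => affineChart i (S.dev (s z))) x (D' Y x v) =
            mvfderiv (𝓡 n)
              (fun z => mvfderiv (𝓡 n) (fun w => affineChart i (S.dev (s w))) z (Y z)) x v) ∧
      ProjEquivOn D.toFun D' U

end ProjectiveStructures

/-! Both directions go through centro-affine immersions: maps `f` into `ℝⁿ⁺¹` for which `(Z, l) ↦
df(Z) + l f` is injective and which satisfy the structure equation `X(df(Y)) = df(∇_X Y) + h(X, Y)
f` (`IsRadialFor`). This linear map carries `∇^h` to the trivial connection. Hence flatness of `∇^h`
produces such an `f` near every point, by solving the linear system for a parallel frame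
(`exists_hasFDerivAt_of_flat`, `exists_isRadialFor`), and conversely such `f` force flatness
(`isFlatOn_extendedConnection_of_isRadialFor`). The map `f` is unique up to a linear automorphism
(`IsRadialFor.eventually_transition_eq`). Read in an affine chart of projective space it shows that
`∇` is projectively flat (`IsRadialFor.projEquivOn`), and `det(f, df, …, df)` is a parallel volume
form (`IsRadialFor.mvfderiv_radialVol`).

From Condition (E) to convexity. Normalising the local immersions by the given parallel volume form
makes their transition maps locally constant with values in `SL`. They glue to a covering space of
`M`, and lifting `p` to it over the simply connected `M'` gives an equivariant `F : M' → ℝⁿ⁺¹`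
(`RadialAtlas.exists_isDevelopment`, `IsDevelopment.existsUnique_holonomy`). The cone map `(x, t) ↦
exp(t) F(x)` is a local homeomorphism `M' × ℝ → ℝⁿ⁺¹`. In the flat coordinates it provides, the
function `τ = -t` has Hessian `g + dt²` (`hess_of_coneMap`), which is positive definite. This
Hessian is invariant under deck transformations and translations in `t`, and together these act
cocompactly. That is the setting of Koszul's theorem: by cocompactness there is a uniform `ε` such
that straight segments of squared Hessian length below `ε` can always be lifted, so along a segment
whose lift stops at time `1` the second derivative of `τ` is at least `ε / (1 - t)²` and `τ` tends
to infinity (`KoszulData.tendsto_atTop`). Convexity of `τ` along segments excludes this inside a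
triangle two of whose sides lift. So the domain of straight lifts from a point is convex, its lift
is all of `M' × ℝ`, and the cone map is injective with convex image (`KoszulData.convex_reach`,
`KoszulData.image_expo_eq_univ`, `KoszulData.injective`).

Proper convexity comes from `(dτ)² ≤ Hess τ`: along a complete ray in the cone, `y = dτ(w)`
satisfies `y' ≥ y²` and would blow up if it were ever positive, so `dτ(w) < 0`. Thus `-dτ` at one
point is a linear form that bounds the norm on the cone, and the slice of the cone by a level of
this form is bounded (`KoszulData.exists_bound`, `isProperlyConvexSet_range_projMap`).

From convexity to Condition (E). A properly convex image spans an open cone `C` on which some linear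
form dominates the norm. Its Koszul–Vinberg characteristic function, the integral of `exp(-⟨v, y⟩)`
over the dual cone, is smooth, strictly log-convex, and invariant under unimodular automorphisms of
`C`. Its normalised logarithm `φ` satisfies `φ(c v) = φ(v) - log c` (`isConePotential_logChar`).
Lifting the developing map to the level set `φ = 0` gives an immersion that is equivariant under
linear maps of determinant `±1` (`FlatProjStructure.IsProperlyConvex.exists_lift`). On the level set
`dφ(df) = 0` and `dφ(f) = -1`, so the tangential part of the second derivative is a torsion-free
connection and the radial part is the Hessian of `φ` (`IsRadialImmersionOn.isRadialFor`). Both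
descend to `M` (`LevelAtlas`). The parallel volume form descends only up to sign, and an orientation
of `M` removes this ambiguity (`LevelAtlas.exists_parallel_volumeForm`). -/

set_option linter.unusedSectionVars false

/-! ## Flat linear systems -/

section FlatSystem

variable {E : Type*} [NormedAddCommGroup E] [NormedSpace ℝ E]
  {𝔸 : Type*} [NormedRing 𝔸] [NormedAlgebra ℝ 𝔸]

/-- A linear differential equation `P' = P a(t)` with small continuous coefficient has a solution
on the unit interval. -/
theorem exists_linear_ode_solution [CompleteSpace 𝔸] {a : ℝ → 𝔸} (ha : ContinuousOn a (Icc 0 1))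
    (hb : ∀ t ∈ Icc (0 : ℝ) 1, ‖a t‖ * (1 + ‖(1 : 𝔸)‖) ≤ 1) :
    ∃ P : ℝ → 𝔸, P 0 = 1 ∧ ∀ t ∈ Icc (0 : ℝ) 1, HasDerivWithinAt P (P t * a t) (Icc 0 1) t := by
  -- The solution is sought in the ball of radius `1` about `1`, where norms are at most `1 + ‖1‖`;
  -- a normed ring need not have `‖1‖ = 1`. The smallness of `a` then makes both the speed and the
  -- Lipschitz constant at most `1`, which suffices for unit time.
  have hP : IsPicardLindelof (fun t p => p * a t) (tmin := 0) (tmax := 1)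
      ⟨0, by simp⟩ (1 : 𝔸) 1 0 1 1 := by
    refine ⟨fun t ht => ?_, fun x _ => continuousOn_const.mul ha, fun t ht x hx => ?_, by simp⟩
    · refine LipschitzOnWith.of_dist_le_mul fun x _ y _ => ?_
      rw [dist_eq_norm, ← sub_mul, dist_eq_norm, NNReal.coe_one, one_mul]
      refine (norm_mul_le _ _).trans ?_
      have := hb t ht
      have h1 := norm_nonneg (a t)
      have h2 := norm_nonneg (1 : 𝔸)
      have h3 := norm_nonneg (x - y)
      nlinarith [mul_nonneg h1 h2]
    · have hx' : ‖x‖ ≤ 1 + ‖(1 : 𝔸)‖ := by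
        have := norm_add_le (x - 1) 1
        rw [mem_closedBall_iff_norm, NNReal.coe_one] at hx
        simp only [sub_add_cancel] at this
        linarith
      refine (norm_mul_le _ _).trans ?_
      rw [mul_comm, NNReal.coe_one]
      exact (mul_le_mul_of_nonneg_left hx' (norm_nonneg _)).trans (hb t ht)
  obtain ⟨P, h0, h⟩ := hP.exists_eq_forall_mem_Icc_hasDerivWithinAt₀
  exact ⟨P, h0, h⟩

/-- The value at `1` of a solution of `P' = P a(t)`, compared with an approximate solution. -/
theorem norm_sub_le_of_approx_linear_ode {a P q q' : ℝ → 𝔸} {ε : ℝ}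
    (hb : ∀ t ∈ Icc (0 : ℝ) 1, ‖a t‖ ≤ 1)
    (hP : ∀ t ∈ Icc (0 : ℝ) 1, HasDerivWithinAt P (P t * a t) (Icc 0 1) t)
    (hq : ∀ t ∈ Icc (0 : ℝ) 1, HasDerivWithinAt q (q' t) (Icc 0 1) t)
    (hε : ∀ t ∈ Icc (0 : ℝ) 1, ‖q' t - q t * a t‖ ≤ ε) (h0 : P 0 = q 0) :
    ‖P 1 - q 1‖ ≤ ε * (Real.exp 1 - 1) := by
  have key := dist_le_of_approx_trajectories_ODE_of_mem (v := fun t p => p * a t) (K := 1)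
    (s := fun _ => univ) (f := P) (g := q) (a := 0) (b := 1) (f' := fun t => P t * a t) (g' := q')
    (εf := 0) (εg := ε) (δ := 0)
    (fun t ht => LipschitzOnWith.of_dist_le_mul fun x _ y _ => by
      rw [dist_eq_norm, ← sub_mul, dist_eq_norm, NNReal.coe_one, one_mul]
      exact (norm_mul_le _ _).trans
        (mul_le_of_le_one_right (norm_nonneg _) (hb t (Ico_subset_Icc_self ht))))
    (fun t ht => (hP t ht).continuousWithinAt)
    (fun t ht => (hP t (Ico_subset_Icc_self ht)).mono_of_mem_nhdsWithin
      (Icc_mem_nhdsGE_of_mem ht))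
    (fun t ht => by simp) (fun _ _ => mem_univ _)
    (fun t ht => (hq t ht).continuousWithinAt)
    (fun t ht => (hq t (Ico_subset_Icc_self ht)).mono_of_mem_nhdsWithin
      (Icc_mem_nhdsGE_of_mem ht))
    (fun t ht => by rw [dist_eq_norm]; exact hε t (Ico_subset_Icc_self ht))
    (fun _ _ => mem_univ _) (by simp [h0]) 1 (by simp)
  rw [dist_eq_norm] at key
  refine key.trans (le_of_eq ?_)
  rw [gronwallBound_of_K_ne_0 (by simp)]
  simp

/-- The algebraic identity behind the existence of parallel transport for a flat system. -/
theorem flat_transport_identity (t : ℝ) (P a b c₁ c₂ R : 𝔸) (h : c₁ - c₂ + (a * b - b * a) = 0) :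
    P * a * (1 + t • b) + P * (b + t • c₁) - P * (1 + t • b) * (a + b + t • c₂ + R) =
      P * (-(t • (b * b)) - (t * t) • (b * c₂) - (1 + t • b) * R) := by
  have h1 : c₁ = c₂ - (a * b - b * a) := by rw [← sub_eq_zero, ← h]; abel
  subst h1
  simp only [mul_add, add_mul, mul_sub, mul_smul_comm, smul_mul_assoc, smul_add, smul_sub,
    mul_one, one_mul, mul_neg, mul_assoc, smul_smul]
  abel

/-- Frobenius' theorem for linear systems `dP = P θ`. -/
theorem exists_hasFDerivAt_of_flat [CompleteSpace 𝔸] {θ : E → E →L[ℝ] 𝔸} (hθ : ContDiffAt ℝ 2 θ 0)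
    (hflat : ∀ᶠ x in 𝓝 (0 : E), ∀ a b : E,
      fderiv ℝ θ x a b - fderiv ℝ θ x b a + (θ x a * θ x b - θ x b * θ x a) = 0) :
    ∃ P : E → 𝔸, P 0 = 1 ∧
      ∀ᶠ x in 𝓝 (0 : E), HasFDerivAt P ((ContinuousLinearMap.mul ℝ 𝔸 (P x)).comp (θ x)) x := by
  -- The second-order remainder of `θ` is controlled through a Lipschitz constant of its derivative.
  obtain ⟨K, s, hs, hK⟩ := ((hθ.fderiv_right (m := 1) (by norm_num))).exists_lipschitzOnWith
  have hd : ∀ᶠ x in 𝓝 (0 : E), DifferentiableAt ℝ θ x := by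
    filter_upwards [hθ.eventually (by simp)] with x hx using hx.differentiableAt (by norm_num)
  have hB1 : ∀ᶠ x in 𝓝 (0 : E), ‖θ x‖ < ‖θ 0‖ + 1 :=
    (hθ.continuousAt.norm).eventually_lt_const (by linarith)
  have hB2 : ∀ᶠ x in 𝓝 (0 : E), ‖fderiv ℝ θ x‖ < ‖fderiv ℝ θ 0‖ + 1 :=
    ((hθ.fderiv_right (m := 1) (by norm_num)).continuousAt.norm).eventually_lt_const (by linarith)
  obtain ⟨R, hR, hall⟩ := Metric.eventually_nhds_iff_ball.1
    (((hflat.and hd).and (hB1.and hB2)).and hs)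
  set B : ℝ := ‖θ 0‖ + ‖fderiv ℝ θ 0‖ + 1 with hBdef
  have hBpos : 0 < B := by positivity
  -- The last condition makes the radial equation on `[0, 1]` small enough for
  -- `exists_linear_ode_solution`; `ρ ≤ 1` simplifies the estimates below.
  obtain ⟨ρ, hρ, hρR, hρ1, hρB⟩ : ∃ ρ : ℝ, 0 < ρ ∧ ρ ≤ R ∧ ρ ≤ 1 ∧ B * ρ * (1 + ‖(1 : 𝔸)‖) ≤ 1 := by
    refine ⟨min (min R 1) (1 / (B * (1 + ‖(1 : 𝔸)‖))), by positivity,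
      (min_le_left _ _).trans (min_le_left _ _), (min_le_left _ _).trans (min_le_right _ _), ?_⟩
    have := min_le_right (min R 1) (1 / (B * (1 + ‖(1 : 𝔸)‖)))
    rw [le_div_iff₀ (by positivity)] at this
    linarith
  have hball : ∀ x ∈ Metric.ball (0 : E) ρ, x ∈ Metric.ball (0 : E) R :=
    fun x hx => Metric.ball_subset_ball hρR hx
  have hθB : ∀ x ∈ Metric.ball (0 : E) ρ, ‖θ x‖ ≤ B := fun x hx => by
    have := (hall x (hball x hx)).1.2.1
    have := norm_nonneg (fderiv ℝ θ 0)
    linarith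
  have hθB' : ∀ x ∈ Metric.ball (0 : E) ρ, ‖fderiv ℝ θ x‖ ≤ B := fun x hx => by
    have := (hall x (hball x hx)).1.2.2
    have := norm_nonneg (θ 0)
    linarith
  have hθd : ∀ x ∈ Metric.ball (0 : E) ρ, HasFDerivAt θ (fderiv ℝ θ x) x :=
    fun x hx => (hall x (hball x hx)).1.1.2.hasFDerivAt
  have hray : ∀ x ∈ Metric.ball (0 : E) ρ, ∀ t ∈ Icc (0 : ℝ) 1, t • x ∈ Metric.ball (0 : E) ρ := by
    intro x hx t ht
    rw [mem_ball_zero_iff] at hx ⊢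
    rw [norm_smul, Real.norm_of_nonneg ht.1]
    exact (mul_le_of_le_one_left (norm_nonneg _) ht.2).trans_lt hx
  have hasmall : ∀ x ∈ Metric.ball (0 : E) ρ, ∀ t ∈ Icc (0 : ℝ) 1,
      ‖θ (t • x) x‖ * (1 + ‖(1 : 𝔸)‖) ≤ 1 := by
    intro x hx t ht
    refine le_trans (mul_le_mul_of_nonneg_right ?_ (by positivity)) hρB
    refine (ContinuousLinearMap.le_opNorm _ _).trans ?_
    exact mul_le_mul (hθB _ (hray x hx t ht)) (mem_ball_zero_iff.1 hx).le (norm_nonneg _) hBpos.le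
  have hderiv : ∀ x ∈ Metric.ball (0 : E) ρ, ∀ t ∈ Icc (0 : ℝ) 1, ∀ h : E,
      HasDerivWithinAt (fun t : ℝ => θ (t • x) h) (fderiv ℝ θ (t • x) x h) (Icc 0 1) t := by
    intro x hx t ht h
    have h1 : HasDerivAt (fun t : ℝ => t • x) x t := by
      simpa using (hasDerivAt_id t).smul_const x
    have h2 := (hθd _ (hray x hx t ht)).comp_hasDerivAt t h1
    exact (((ContinuousLinearMap.apply ℝ 𝔸 h).hasFDerivAt).comp_hasDerivAt t h2).hasDerivWithinAt
  -- The system is solved along each ray from the origin, and the candidate is the value at time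
  -- `1`. Flatness is needed only to see that it solves the system in the other directions.
  have hex : ∀ x : E, ∃ P : ℝ → 𝔸, x ∈ Metric.ball (0 : E) ρ → P 0 = 1 ∧
      ∀ t ∈ Icc (0 : ℝ) 1, HasDerivWithinAt P (P t * θ (t • x) x) (Icc 0 1) t := by
    intro x
    by_cases hx : x ∈ Metric.ball (0 : E) ρ
    · obtain ⟨P, h⟩ := exists_linear_ode_solution (a := fun t : ℝ => θ (t • x) x)
        (fun t ht => (hderiv x hx t ht x).continuousWithinAt) (hasmall x hx)
      exact ⟨P, fun _ => h⟩
    · exact ⟨0, fun h => absurd h hx⟩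
  choose P hP using hex
  refine ⟨fun x => P x 1, ?_, ?_⟩
  · have h := hP 0 (Metric.mem_ball_self hρ)
    have hc : ∀ t ∈ Icc (0 : ℝ) 1, HasDerivWithinAt (P 0) 0 (Icc 0 1) t := fun t ht => by
      simpa using h.2 t ht
    have := norm_sub_le_of_approx_linear_ode (a := fun _ => 0) (P := P 0) (q := fun _ => 1)
      (q' := fun _ => 0) (ε := 0) (by simp) (by simpa using hc)
      (fun t _ => hasDerivWithinAt_const _ _ _) (by simp) h.1
    simpa [sub_eq_zero] using this
  filter_upwards [Metric.ball_mem_nhds (0 : E) hρ] with x hx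
  obtain ⟨hP0, hPd⟩ := hP x hx
  obtain ⟨C, hC⟩ : ∃ C, ∀ t ∈ Icc (0 : ℝ) 1, ‖P x t‖ ≤ C :=
    isCompact_Icc.exists_bound_of_continuousOn fun t ht => (hPd t ht).continuousWithinAt
  have hC0 : 0 ≤ C := (norm_nonneg _).trans (hC 0 (by simp))
  set c : ℝ := ‖(1 : 𝔸)‖
  have hc0 : 0 ≤ c := norm_nonneg _
  rw [hasFDerivAt_iff_isLittleO_nhds_zero]
  have hO : (fun h : E => P (x + h) 1 - P x 1
      - ((ContinuousLinearMap.mul ℝ 𝔸 (P x 1)).comp (θ x)) h) =O[𝓝 0] fun h => ‖h‖ ^ 2 := by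
    refine Asymptotics.IsBigO.of_bound
      (C * (B * B + B * B + (c + B) * (K + B)) * (Real.exp 1 - 1)) ?_
    have hev : ∀ᶠ h in 𝓝 (0 : E), x + h ∈ Metric.ball (0 : E) ρ := by
      have : ContinuousAt (fun h : E => x + h) 0 := by fun_prop
      exact this.eventually_mem (by simpa using Metric.isOpen_ball.mem_nhds hx)
    filter_upwards [hev, Metric.ball_mem_nhds (0 : E) one_pos] with h hh hh1
    rw [mem_ball_zero_iff] at hh1
    obtain ⟨hQ0, hQd⟩ := hP _ hh
    -- The solution along the ray through `x + h` is compared with the solution along the ray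
    -- through `x`, corrected by the factor `1 + t θ(tx)h`. At `t = 1` this is the expected
    -- first-order expansion. By `flat_transport_identity` the terms of first order in `h` cancel,
    -- so the defect is quadratic and Grönwall's inequality applies.
    have key := norm_sub_le_of_approx_linear_ode (a := fun t : ℝ => θ (t • (x + h)) (x + h))
      (P := P (x + h)) (q := fun t => P x t * (1 + t • θ (t • x) h))
      (q' := fun t => P x t * θ (t • x) x * (1 + t • θ (t • x) h)
        + P x t * (θ (t • x) h + t • fderiv ℝ θ (t • x) x h))
      (ε := C * (B * B + B * B + (c + B) * (K + B)) * ‖h‖ ^ 2) ?_ hQd ?_ ?_ ?_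
    · have e : P (x + h) 1 - P x 1 - ((ContinuousLinearMap.mul ℝ 𝔸 (P x 1)).comp (θ x)) h
          = P (x + h) 1 - P x 1 * (1 + (1 : ℝ) • θ ((1 : ℝ) • x) h) := by
        simp [mul_add, sub_sub]
      rw [e]
      refine key.trans (le_of_eq ?_)
      rw [Real.norm_of_nonneg (by positivity)]
      ring
    · intro t ht
      have := hasmall _ hh t ht
      nlinarith [norm_nonneg (θ (t • (x + h)) (x + h))]
    · intro t ht
      have h1 : HasDerivWithinAt (fun t : ℝ => 1 + t • θ (t • x) h)
          (θ (t • x) h + t • fderiv ℝ θ (t • x) x h) (Icc 0 1) t := by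
        have := ((hasDerivWithinAt_id t (Icc 0 1)).smul (hderiv x hx t ht h)).const_add (1 : 𝔸)
        simpa [add_comm] using this
      exact (hPd t ht).mul h1
    · intro t ht
      have hb := hray x hx t ht
      have hb' := hray _ hh t ht
      set b := θ (t • x) h
      -- `R₁` is the Taylor remainder of `θ`; `Rm` collects everything of second order in `h` in the
      -- coefficient of the equation.
      set R₁ := θ (t • (x + h)) - θ (t • x) - fderiv ℝ θ (t • x) (t • h)
      set Rm := R₁ (x + h) + t • fderiv ℝ θ (t • x) h h
      have e : θ (t • (x + h)) (x + h)
          = θ (t • x) x + b + t • fderiv ℝ θ (t • x) h x + Rm := by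
        simp only [Rm, R₁, b, map_add, map_smul, sub_apply, smul_apply, smul_add]
        abel
      have ht0 : |t| ≤ 1 := by rw [abs_of_nonneg ht.1]; exact ht.2
      have nb : ‖b‖ ≤ B * ‖h‖ := (ContinuousLinearMap.le_opNorm _ _).trans
        (mul_le_mul_of_nonneg_right (hθB _ hb) (norm_nonneg _))
      have nb1 : ‖b‖ ≤ B := nb.trans (mul_le_of_le_one_right hBpos.le hh1.le)
      have nd : ∀ u : E, ‖fderiv ℝ θ (t • x) h u‖ ≤ B * ‖h‖ * ‖u‖ := fun u =>
        (ContinuousLinearMap.le_opNorm _ _).trans (mul_le_mul_of_nonneg_right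
          ((ContinuousLinearMap.le_opNorm _ _).trans
            (mul_le_mul_of_nonneg_right (hθB' _ hb) (norm_nonneg _))) (norm_nonneg _))
      have hx1 : ‖x‖ ≤ 1 := (mem_ball_zero_iff.1 hx).le.trans hρ1
      have hxh1 : ‖x + h‖ ≤ 1 := (mem_ball_zero_iff.1 hh).le.trans hρ1
      have nc : ‖fderiv ℝ θ (t • x) h x‖ ≤ B * ‖h‖ :=
        (nd x).trans (mul_le_of_le_one_right (by positivity) hx1)
      have nR₁ : ‖R₁‖ ≤ K * ‖h‖ ^ 2 := by
        have hseg : segment ℝ (t • x) (t • (x + h)) ⊆ Metric.ball (0 : E) ρ :=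
          (convex_ball _ _).segment_subset hb hb'
        have := (convex_segment (𝕜 := ℝ) (t • x) (t • (x + h))).norm_image_sub_le_of_norm_hasFDerivWithin_le'
          (f := θ) (f' := fderiv ℝ θ) (φ := fderiv ℝ θ (t • x)) (C := K * ‖h‖)
          (fun y hy => (hθd y (hseg hy)).hasFDerivWithinAt) (fun y hy => ?_)
          (left_mem_segment ℝ _ _) (right_mem_segment ℝ _ _)
        · have e2 : t • (x + h) - t • x = t • h := by rw [smul_add]; abel
          rw [e2] at this
          refine this.trans ?_
          rw [norm_smul, Real.norm_eq_abs, mul_comm |t|, ← mul_assoc, mul_assoc (K : ℝ), ← pow_two]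
          exact mul_le_of_le_one_right (by positivity) ht0
        · have := hK.dist_le_mul _ (hall y (hball _ (hseg hy))).2 _ (hall _ (hball _ hb)).2
          rw [dist_eq_norm] at this
          refine this.trans (mul_le_mul_of_nonneg_left ?_ K.2)
          obtain ⟨τ, hτ, rfl⟩ := segment_eq_image_lineMap ℝ (t • x) (t • (x + h)) ▸ hy
          rw [dist_lineMap_left, dist_eq_norm, Real.norm_of_nonneg hτ.1]
          have e2 : t • x - t • (x + h) = -(t • h) := by rw [smul_add]; abel
          rw [e2, norm_neg, norm_smul, Real.norm_eq_abs]
          exact (mul_le_of_le_one_left (by positivity) hτ.2).trans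
            (mul_le_of_le_one_left (norm_nonneg _) ht0)
      have nRm : ‖Rm‖ ≤ (K + B) * ‖h‖ ^ 2 := by
        have h1 : ‖R₁ (x + h)‖ ≤ K * ‖h‖ ^ 2 := (ContinuousLinearMap.le_opNorm _ _).trans
          ((mul_le_of_le_one_right (norm_nonneg _) hxh1).trans nR₁)
        have h2 : ‖t • fderiv ℝ θ (t • x) h h‖ ≤ B * ‖h‖ ^ 2 := by
          rw [norm_smul, Real.norm_eq_abs]
          refine (mul_le_of_le_one_left (norm_nonneg _) ht0).trans ((nd h).trans (le_of_eq ?_))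
          ring
        calc ‖Rm‖ ≤ _ := norm_add_le _ _
          _ ≤ _ := by linarith
      have hfl := (hall _ (hball _ hb)).1.1.1 x h
      rw [e, flat_transport_identity t _ _ _ _ _ _ hfl]
      have n1 : ‖t • (b * b)‖ ≤ B * B * ‖h‖ ^ 2 := by
        rw [norm_smul, Real.norm_eq_abs]
        refine (mul_le_of_le_one_left (norm_nonneg _) ht0).trans ((norm_mul_le _ _).trans ?_)
        calc ‖b‖ * ‖b‖ ≤ (B * ‖h‖) * (B * ‖h‖) := mul_le_mul nb nb (norm_nonneg _) (by positivity)
          _ = _ := by ring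
      have n2 : ‖(t * t) • (b * fderiv ℝ θ (t • x) h x)‖ ≤ B * B * ‖h‖ ^ 2 := by
        rw [norm_smul, Real.norm_eq_abs, abs_mul]
        refine (mul_le_of_le_one_left (norm_nonneg _) (mul_le_one₀ ht0 (abs_nonneg _) ht0)).trans
          ((norm_mul_le _ _).trans ?_)
        calc ‖b‖ * ‖fderiv ℝ θ (t • x) h x‖ ≤ (B * ‖h‖) * (B * ‖h‖) :=
              mul_le_mul nb nc (norm_nonneg _) (by positivity)
          _ = _ := by ring
      have n3 : ‖(1 + t • b) * Rm‖ ≤ (c + B) * (K + B) * ‖h‖ ^ 2 := by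
        refine (norm_mul_le _ _).trans ?_
        rw [mul_assoc]
        refine mul_le_mul ((norm_add_le _ _).trans ?_) nRm (norm_nonneg _) (by positivity)
        gcongr
        rw [norm_smul, Real.norm_eq_abs]
        exact (mul_le_of_le_one_left (norm_nonneg _) ht0).trans nb1
      refine (norm_mul_le _ _).trans ?_
      rw [mul_assoc]
      refine mul_le_mul (hC t ht) ?_ (norm_nonneg _) hC0
      refine (norm_sub_le _ _).trans ?_
      have := norm_sub_le (-(t • (b * b))) ((t * t) • (b * fderiv ℝ θ (t • x) h x))
      rw [norm_neg] at this
      linarith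
    · simp [hP0, hQ0]
  exact hO.trans_isLittleO (Asymptotics.isLittleO_norm_pow_id one_lt_two)

/-- Solutions of `dP = P θ` with `θ` smooth are smooth. -/
theorem contDiffOn_of_hasFDerivAt_mul {θ : E → E →L[ℝ] 𝔸} {P : E → 𝔸} {O : Set E} (hO : IsOpen O)
    (hθ : ContDiffOn ℝ ∞ θ O)
    (hP : ∀ x ∈ O, HasFDerivAt P ((ContinuousLinearMap.mul ℝ 𝔸 (P x)).comp (θ x)) x) :
    ContDiffOn ℝ ∞ P O := by
  rw [contDiffOn_infty]
  intro k
  induction k with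
  | zero => exact contDiffOn_zero.2 fun x hx => (hP x hx).continuousAt.continuousWithinAt
  | succ k ih =>
    push_cast
    rw [contDiffOn_succ_iff_fderiv_of_isOpen hO]
    refine ⟨fun x hx => (hP x hx).differentiableAt.differentiableWithinAt, by simp, ?_⟩
    -- Bootstrapping: if `P` is of class `Cᵏ`, then so is its derivative `P θ`.
    have : ContDiffOn ℝ k (fun x => (ContinuousLinearMap.mul ℝ 𝔸 (P x)).comp (θ x)) O :=
      ((ContinuousLinearMap.mul ℝ 𝔸).contDiff.comp_contDiffOn ih).clm_comp
        (hθ.of_le (by exact_mod_cast le_top))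
    exact this.congr fun x hx => (hP x hx).fderiv

end FlatSystem

/-! ## Calculus of vector valued functions on manifolds -/

set_option linter.unusedSectionVars false

section ManifoldCalculus

theorem two_le_infty : (2 : ℕ∞ω) ≤ ∞ := 
  WithTop.coe_le_coe.2 (le_top : (2 : ℕ∞) ≤ ⊤)

theorem one_add_one_le_infty : (1 + 1 : ℕ∞ω) ≤ ∞ := by
  rw [one_add_one_eq_two]
  exact two_le_infty

variable {n : ℕ} {M : Type*} [TopologicalSpace M] [ChartedSpace (EuclideanSpace ℝ (Fin n)) M]
  {F F' : Type*} [NormedAddCommGroup F] [NormedSpace ℝ F] [NormedAddCommGroup F'] [NormedSpace ℝ F']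

theorem mvfderiv_congr {f g : M → F} {x : M} (h : f =ᶠ[𝓝 x] g) :
    mvfderiv (𝓡 n) f x = mvfderiv (𝓡 n) g x := by
  ext v
  exact congrArg (fun A : TangentSpace (𝓡 n) x →L[ℝ] F => A v) (show
    (mfderiv (𝓡 n) 𝓘(ℝ, F) f x : TangentSpace (𝓡 n) x →L[ℝ] F) = mfderiv (𝓡 n) 𝓘(ℝ, F) g x from
    h.mfderiv_eq)

theorem mvfderiv_comp_fderiv {f : M → F} {h : F → F'} {x : M} (hh : DifferentiableAt ℝ h (f x))
    (hf : MDifferentiableAt (𝓡 n) 𝓘(ℝ, F) f x) (v : TangentSpace (𝓡 n) x) :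
    mvfderiv (𝓡 n) (fun z => h (f z)) x v = fderiv ℝ h (f x) (mvfderiv (𝓡 n) f x v) := by
  have := mfderiv_comp_apply x hh.mdifferentiableAt hf v
  rw [mfderiv_eq_fderiv] at this
  exact this

theorem mvfderiv_clm_comp {f : M → F} (L : F →L[ℝ] F') {x : M}
    (hf : MDifferentiableAt (𝓡 n) 𝓘(ℝ, F) f x) (v : TangentSpace (𝓡 n) x) :
    mvfderiv (𝓡 n) (fun z => L (f z)) x v = L (mvfderiv (𝓡 n) f x v) := by
  rw [mvfderiv_comp_fderiv L.differentiableAt hf, L.fderiv]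

theorem mvfderiv_comp_mfderiv {m : ℕ} {N : Type*} [TopologicalSpace N]
    [ChartedSpace (EuclideanSpace ℝ (Fin m)) N] {f : M → F} {s : N → M} {x : N}
    (hf : MDifferentiableAt (𝓡 n) 𝓘(ℝ, F) f (s x)) (hs : MDifferentiableAt (𝓡 m) (𝓡 n) s x)
    (v : TangentSpace (𝓡 m) x) :
    mvfderiv (𝓡 m) (fun z => f (s z)) x v = mvfderiv (𝓡 n) f (s x) (mfderiv (𝓡 m) (𝓡 n) s x v) :=
  mfderiv_comp_apply x hf hs v

variable (n) in
/-- The chart at `x₀`, as a map to Euclidean space. -/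
noncomputable abbrev chartMap (x₀ : M) : M → EuclideanSpace ℝ (Fin n) := extChartAt (𝓡 n) x₀

variable (n) in
/-- The domain of the chart at `x₀`. -/
abbrev chartSource (x₀ : M) : Set M :=
  (chartAt (EuclideanSpace ℝ (Fin n)) x₀).source

variable [IsManifold (𝓡 n) ∞ M]

theorem contMDiffOn_chartMap (x₀ : M) :
    ContMDiffOn (𝓡 n) 𝓘(ℝ, EuclideanSpace ℝ (Fin n)) ∞ (chartMap n x₀) (chartSource n x₀) :=
  contMDiffOn_extChartAt

theorem isOpen_chartSource (x₀ : M) : IsOpen (chartSource n x₀) :=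
  (chartAt (EuclideanSpace ℝ (Fin n)) x₀).open_source

theorem mdifferentiableAt_chartMap {x₀ x : M} (hx : x ∈ chartSource n x₀) :
    MDifferentiableAt (𝓡 n) 𝓘(ℝ, EuclideanSpace ℝ (Fin n)) (chartMap n x₀) x :=
  ((contMDiffOn_chartMap x₀).contMDiffAt ((isOpen_chartSource x₀).mem_nhds hx)).mdifferentiableAt
    (by simp)

/-- Both sides are the tangent coordinate change to the chart at `x₀`. Regularity of a vector field
can therefore be tested on its coordinate functions. -/
theorem trivializationAt_tangent_apply {x₀ x : M} (hx : x ∈ chartSource n x₀)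
    (v : TangentSpace (𝓡 n) x) :
    (trivializationAt (EuclideanSpace ℝ (Fin n)) (TangentSpace (𝓡 n)) x₀
      (TotalSpace.mk' (EuclideanSpace ℝ (Fin n)) x v)).2 = mvfderiv (𝓡 n) (chartMap n x₀) x v := by
  have h := (hasMFDerivAt_extChartAt (I := 𝓡 n) hx).mfderiv
  have h2 : mvfderiv (𝓡 n) (chartMap n x₀) x v
      = mfderiv (𝓡 n) (𝓡 n) (chartAt (EuclideanSpace ℝ (Fin n)) x₀) x v := by
    change (mfderiv (𝓡 n) 𝓘(ℝ, EuclideanSpace ℝ (Fin n)) (extChartAt (𝓡 n) x₀) x) v = _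
    rw [h]
    rfl
  rw [h2, mfderiv_chartAt_eq_tangentCoordChange hx]
  rfl

theorem isInvertible_mvfderiv_chartMap {x₀ x : M} (hx : x ∈ chartSource n x₀) :
    (mvfderiv (𝓡 n) (chartMap n x₀) x).IsInvertible :=
  isInvertible_mfderiv_extChartAt (by simpa using hx)

theorem isDiffFieldAt_iff {X : Π x : M, TangentSpace (𝓡 n) x} {x₀ x : M}
    (hx : x ∈ chartSource n x₀) :
    IsDiffFieldAt X x ↔ MDifferentiableAt (𝓡 n) 𝓘(ℝ, EuclideanSpace ℝ (Fin n))
      (fun z => mvfderiv (𝓡 n) (chartMap n x₀) z (X z)) x := by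
  rw [IsDiffFieldAt, Trivialization.mdifferentiableAt_section_iff (𝓡 n)
    (trivializationAt (EuclideanSpace ℝ (Fin n)) (TangentSpace (𝓡 n)) x₀) X (by simpa using hx)]
  refine Filter.EventuallyEq.mdifferentiableAt_iff ?_
  filter_upwards [(isOpen_chartSource x₀).mem_nhds hx] with z hz
  exact trivializationAt_tangent_apply hz _

theorem contMDiffAt_field_iff {X : Π x : M, TangentSpace (𝓡 n) x} {x₀ x : M}
    (hx : x ∈ chartSource n x₀) :
    ContMDiffAt (𝓡 n) ((𝓡 n).prod 𝓘(ℝ, EuclideanSpace ℝ (Fin n))) ∞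
      (fun x => TotalSpace.mk' (EuclideanSpace ℝ (Fin n)) x (X x)) x ↔
    ContMDiffAt (𝓡 n) 𝓘(ℝ, EuclideanSpace ℝ (Fin n)) ∞
      (fun z => mvfderiv (𝓡 n) (chartMap n x₀) z (X z)) x := by
  rw [Trivialization.contMDiffAt_section_iff (IB := 𝓡 n)
    (trivializationAt (EuclideanSpace ℝ (Fin n)) (TangentSpace (𝓡 n)) x₀) (s := X)
      (by simpa using hx)]
  refine Filter.EventuallyEq.contMDiffAt_iff ?_
  filter_upwards [(isOpen_chartSource x₀).mem_nhds hx] with z hz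
  exact trivializationAt_tangent_apply hz _

theorem IsSmoothFieldOn.isDiffFieldAt {X : Π x : M, TangentSpace (𝓡 n) x} {U : Set M}
    (hX : IsSmoothFieldOn X U) (hU : IsOpen U) {x : M} (hx : x ∈ U) : IsDiffFieldAt X x :=
  (ContMDiffOn.contMDiffAt hX (hU.mem_nhds hx)).mdifferentiableAt (by simp)

variable (n) in
/-- The expression of a function in the chart at `x₀`. -/
noncomputable abbrev inChart (x₀ : M) (h : M → F) : EuclideanSpace ℝ (Fin n) → F :=
  h ∘ (extChartAt (𝓡 n) x₀).symm

theorem inChart_chartMap {x₀ x : M} (hx : x ∈ chartSource n x₀) (h : M → F) :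
    inChart n x₀ h (chartMap n x₀ x) = h x := by
  simp only [Function.comp_apply]
  rw [(extChartAt (𝓡 n) x₀).left_inv (by simpa using hx)]

variable (n) in
/-- The part of the image of the chart at `x₀` that corresponds to `U`. -/
abbrev chartImage (x₀ : M) (U : Set M) : Set (EuclideanSpace ℝ (Fin n)) :=
  (extChartAt (𝓡 n) x₀).target ∩ (extChartAt (𝓡 n) x₀).symm ⁻¹' U

theorem isOpen_chartImage (x₀ : M) {U : Set M} (hU : IsOpen U) : IsOpen (chartImage n x₀ U) :=
  (continuousOn_extChartAt_symm x₀).isOpen_inter_preimage (isOpen_extChartAt_target x₀) hU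

theorem chartMap_mem_chartImage {x₀ x : M} {U : Set M} (hx : x ∈ chartSource n x₀) (hU : x ∈ U) :
    chartMap n x₀ x ∈ chartImage n x₀ U := by
  have hx' : x ∈ (extChartAt (𝓡 n) x₀).source := by simpa using hx
  refine ⟨(extChartAt (𝓡 n) x₀).map_source hx', ?_⟩
  rw [mem_preimage, (extChartAt (𝓡 n) x₀).left_inv hx']
  exact hU

theorem contDiffOn_inChart {h : M → F} {U : Set M} {k : ℕ∞ω} (hk : k ≤ ∞)
    (hh : ContMDiffOn (𝓡 n) 𝓘(ℝ, F) k h U)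
    (x₀ : M) : ContDiffOn ℝ k (inChart n x₀ h) (chartImage n x₀ U) := by
  rw [← contMDiffOn_iff_contDiffOn]
  refine hh.comp (((contMDiffOn_extChartAt_symm x₀).mono inter_subset_left).of_le hk) ?_
  exact fun z hz => hz.2

theorem mvfderiv_eq_inChart {h : M → F} {x₀ x : M} (hx : x ∈ chartSource n x₀)
    (hh : DifferentiableAt ℝ (inChart n x₀ h) (chartMap n x₀ x)) (v : TangentSpace (𝓡 n) x) :
    mvfderiv (𝓡 n) h x v = fderiv ℝ (inChart n x₀ h) (chartMap n x₀ x)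
      (mvfderiv (𝓡 n) (chartMap n x₀) x v) := by
  rw [← mvfderiv_comp_fderiv hh (mdifferentiableAt_chartMap hx)]
  refine congrArg (fun A : TangentSpace (𝓡 n) x →L[ℝ] F => A v) (mvfderiv_congr ?_)
  filter_upwards [(isOpen_chartSource x₀).mem_nhds hx] with z hz
  exact (inChart_chartMap hz h).symm

theorem mvfderiv_field_eventuallyEq {h : M → F} {U : Set M} (hU : IsOpen U)
    (hh : ContMDiffOn (𝓡 n) 𝓘(ℝ, F) 1 h U) {x₀ x : M} (hx : x ∈ chartSource n x₀) (hxU : x ∈ U)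
    (X : Π x : M, TangentSpace (𝓡 n) x) :
    (fun z => mvfderiv (𝓡 n) h z (X z)) =ᶠ[𝓝 x] fun z =>
      fderiv ℝ (inChart n x₀ h) (chartMap n x₀ z) (mvfderiv (𝓡 n) (chartMap n x₀) z (X z)) := by
  filter_upwards [(isOpen_chartSource x₀).mem_nhds hx, hU.mem_nhds hxU] with z hz hzU
  refine mvfderiv_eq_inChart hz ?_ _
  exact ((contDiffOn_inChart (by simp) hh x₀).contDiffAt
    ((isOpen_chartImage x₀ hU).mem_nhds (chartMap_mem_chartImage hz hzU))).differentiableAt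
    one_ne_zero

theorem mdifferentiableAt_mvfderiv_apply {h : M → F} {U : Set M} (hU : IsOpen U)
    (hh : ContMDiffOn (𝓡 n) 𝓘(ℝ, F) ∞ h U) {X : Π x : M, TangentSpace (𝓡 n) x} {x : M}
    (hxU : x ∈ U) (hX : IsDiffFieldAt X x) :
    MDifferentiableAt (𝓡 n) 𝓘(ℝ, F) (fun z => mvfderiv (𝓡 n) h z (X z)) x := by
  have hx : x ∈ chartSource n x := mem_chart_source _ x
  refine ((mvfderiv_field_eventuallyEq hU (hh.of_le (by simp)) hx hxU X).mdifferentiableAt_iff).2 ?_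
  refine MDifferentiableAt.clm_apply ?_ ((isDiffFieldAt_iff hx).1 hX)
  have h1 : ContDiffAt ℝ ∞ (inChart n x h) (chartMap n x x) :=
    (contDiffOn_inChart le_rfl hh x).contDiffAt
      ((isOpen_chartImage x hU).mem_nhds (chartMap_mem_chartImage hx hxU))
  exact ((h1.fderiv_right (m := 1) one_add_one_le_infty).differentiableAt
    one_ne_zero).mdifferentiableAt.comp x (mdifferentiableAt_chartMap hx)

theorem contMDiffOn_mvfderiv_apply {h : M → F} {U : Set M} (hU : IsOpen U)
    (hh : ContMDiffOn (𝓡 n) 𝓘(ℝ, F) ∞ h U) {X : Π x : M, TangentSpace (𝓡 n) x}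
    (hX : IsSmoothFieldOn X U) :
    ContMDiffOn (𝓡 n) 𝓘(ℝ, F) ∞ (fun z => mvfderiv (𝓡 n) h z (X z)) U := by
  intro x hxU
  have hx : x ∈ chartSource n x := mem_chart_source _ x
  refine ContMDiffAt.contMDiffWithinAt ?_
  refine ((mvfderiv_field_eventuallyEq hU (hh.of_le (by simp)) hx hxU X).contMDiffAt_iff).2 ?_
  refine ContMDiffAt.clm_apply ?_
    ((contMDiffAt_field_iff hx).1 (ContMDiffOn.contMDiffAt hX (hU.mem_nhds hxU)))
  have h1 : ContDiffAt ℝ ∞ (inChart n x h) (chartMap n x x) :=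
    (contDiffOn_inChart le_rfl hh x).contDiffAt
      ((isOpen_chartImage x hU).mem_nhds (chartMap_mem_chartImage hx hxU))
  exact (h1.fderiv_right (m := ∞) (by simp)).contMDiffAt.comp x
    ((contMDiffOn_chartMap x).contMDiffAt ((isOpen_chartSource x).mem_nhds hx))

/-- The Lie bracket, read in a chart. -/
theorem mvfderiv_chartMap_mlieBracket {X Y : Π x : M, TangentSpace (𝓡 n) x} {x : M}
    (hX : IsDiffFieldAt X x) (hY : IsDiffFieldAt Y x) :
    mvfderiv (𝓡 n) (chartMap n x) x (VectorField.mlieBracket (𝓡 n) X Y x) =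
      mvfderiv (𝓡 n) (fun z => mvfderiv (𝓡 n) (chartMap n x) z (Y z)) x (X x) -
        mvfderiv (𝓡 n) (fun z => mvfderiv (𝓡 n) (chartMap n x) z (X z)) x (Y x) := by
  have hx : x ∈ chartSource n x := mem_chart_source _ x
  have hx' : x ∈ (extChartAt (𝓡 n) x).source := mem_extChartAt_source x
  -- The manifold bracket is defined by pulling fields back along the inverse chart. The derivatives
  -- of the chart and of its inverse are mutually inverse, so this pullback is the coordinate
  -- expression of the field.
  have key : ∀ Z : Π x : M, TangentSpace (𝓡 n) x,
      (fun e => VectorField.mpullbackWithin 𝓘(ℝ, EuclideanSpace ℝ (Fin n)) (𝓡 n)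
        (extChartAt (𝓡 n) x).symm Z (range (𝓡 n)) e) =ᶠ[𝓝 (chartMap n x x)]
      inChart n x (fun z => mvfderiv (𝓡 n) (chartMap n x) z (Z z)) := by
    intro Z
    filter_upwards [extChartAt_target_mem_nhds (I := 𝓡 n) x] with e he
    rw [VectorField.mpullbackWithin_apply]
    have h1 := mfderivWithin_extChartAt_symm_comp_mfderiv_extChartAt he
    have h2 := mfderiv_extChartAt_comp_mfderivWithin_extChartAt_symm he
    rw [ContinuousLinearMap.inverse_eq h1 h2]
    rfl
  have hdiff : ∀ Z : Π x : M, TangentSpace (𝓡 n) x, IsDiffFieldAt Z x → DifferentiableAt ℝ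
      (inChart n x (fun z => mvfderiv (𝓡 n) (chartMap n x) z (Z z))) (chartMap n x x) := by
    intro Z hZ
    rw [← mdifferentiableAt_iff_differentiableAt]
    have h1 := (isDiffFieldAt_iff hx).1 hZ
    have hs : MDifferentiableAt 𝓘(ℝ, EuclideanSpace ℝ (Fin n)) (𝓡 n) (extChartAt (𝓡 n) x).symm
        (chartMap n x x) :=
      ((contMDiffOn_extChartAt_symm (n := ∞) x).contMDiffAt
        (extChartAt_target_mem_nhds x)).mdifferentiableAt (by simp)
    refine MDifferentiableAt.comp (I' := 𝓡 n) _ ?_ hs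
    rwa [(extChartAt (𝓡 n) x).left_inv hx']
  rw [← VectorField.mlieBracketWithin_univ, VectorField.mlieBracketWithin_apply]
  have hinv : ∀ w, mvfderiv (𝓡 n) (chartMap n x) x
      ((mfderiv (𝓡 n) 𝓘(ℝ, EuclideanSpace ℝ (Fin n)) (extChartAt (𝓡 n) x) x).inverse w) = w := by
    intro w
    have := ContinuousLinearMap.IsInvertible.self_apply_inverse
      (isInvertible_mvfderiv_chartMap (n := n) hx) w
    exact this
  erw [hinv]
  simp only [preimage_univ, univ_inter, ModelWithCorners.range_eq_univ]
  erw [VectorField.lieBracketWithin_univ]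
  refine (show ∀ (A B : EuclideanSpace ℝ (Fin n) → EuclideanSpace ℝ (Fin n)) e,
    VectorField.lieBracket ℝ A B e = fderiv ℝ B e (A e) - fderiv ℝ A e (B e) from
    fun _ _ _ => rfl) _ _ _ |>.trans ?_
  have e1 : ∀ Z : Π x : M, TangentSpace (𝓡 n) x, VectorField.mpullbackWithin
      𝓘(ℝ, EuclideanSpace ℝ (Fin n)) (𝓡 n) (extChartAt (𝓡 n) x).symm Z univ
        (chartMap n x x) = mvfderiv (𝓡 n) (chartMap n x) x (Z x) := by
    intro Z
    have := (key Z).self_of_nhds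
    rw [ModelWithCorners.range_eq_univ, inChart_chartMap hx] at this
    exact this
  have e2 : ∀ Z : Π x : M, TangentSpace (𝓡 n) x, fderiv ℝ (VectorField.mpullbackWithin
      𝓘(ℝ, EuclideanSpace ℝ (Fin n)) (𝓡 n) (extChartAt (𝓡 n) x).symm Z univ)
        (chartMap n x x) = fderiv ℝ
          (inChart n x (fun z => mvfderiv (𝓡 n) (chartMap n x) z (Z z))) (chartMap n x x) := by
    intro Z
    have := (key Z)
    rw [ModelWithCorners.range_eq_univ] at this
    exact this.fderiv_eq
  erw [e1, e1, e2, e2]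
  rw [mvfderiv_eq_inChart hx (hdiff X hX), mvfderiv_eq_inChart hx (hdiff Y hY)]

theorem MDifferentiableAt.mvfderiv_clm_apply {A : M → F →L[ℝ] F'} {b : M → F} {x : M}
    (hA : MDifferentiableAt (𝓡 n) 𝓘(ℝ, F →L[ℝ] F') A x)
    (hb : MDifferentiableAt (𝓡 n) 𝓘(ℝ, F) b x) (v : TangentSpace (𝓡 n) x) :
    mvfderiv (𝓡 n) (fun z => A z (b z)) x v =
      mvfderiv (𝓡 n) A x v (b x) + A x (mvfderiv (𝓡 n) b x v) := by
  have hp : MDifferentiableAt (𝓡 n) 𝓘(ℝ, (F →L[ℝ] F') × F) (fun z => (A z, b z)) x :=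
    hA.prodMk_space hb
  have h1 := mvfderiv_comp_fderiv (h := fun p : (F →L[ℝ] F') × F => p.1 p.2)
    (by fun_prop) hp v
  rw [h1]
  have h2 : fderiv ℝ (fun p : (F →L[ℝ] F') × F => p.1 p.2) (A x, b x) =
    _ := (hasFDerivAt_fst.clm_apply hasFDerivAt_snd).fderiv
  rw [h2]
  have h3 : (mvfderiv (𝓡 n) (fun z => (A z, b z)) x v) =
      (mvfderiv (𝓡 n) A x v, mvfderiv (𝓡 n) b x v) := by
    refine Prod.ext ?_ ?_
    · exact (mvfderiv_clm_comp (ContinuousLinearMap.fst ℝ (F →L[ℝ] F') F) hp v).symm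
    · exact (mvfderiv_clm_comp (ContinuousLinearMap.snd ℝ (F →L[ℝ] F') F) hp v).symm
  rw [h3]
  simp [add_comm]

/-- `X(Yh) - Y(Xh) = [X,Y]h`. -/
theorem mvfderiv_commutator {h : M → F} {U : Set M} (hU : IsOpen U)
    (hh : ContMDiffOn (𝓡 n) 𝓘(ℝ, F) ∞ h U) {X Y : Π x : M, TangentSpace (𝓡 n) x} {x : M}
    (hxU : x ∈ U) (hX : IsDiffFieldAt X x) (hY : IsDiffFieldAt Y x) :
    mvfderiv (𝓡 n) (fun z => mvfderiv (𝓡 n) h z (Y z)) x (X x) -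
      mvfderiv (𝓡 n) (fun z => mvfderiv (𝓡 n) h z (X z)) x (Y x) =
      mvfderiv (𝓡 n) h x (VectorField.mlieBracket (𝓡 n) X Y x) := by
  have hx : x ∈ chartSource n x := mem_chart_source _ x
  have h1 : ContDiffAt ℝ ∞ (inChart n x h) (chartMap n x x) :=
    (contDiffOn_inChart le_rfl hh x).contDiffAt
      ((isOpen_chartImage x hU).mem_nhds (chartMap_mem_chartImage hx hxU))
  have h2 : DifferentiableAt ℝ (fderiv ℝ (inChart n x h)) (chartMap n x x) :=
    (h1.fderiv_right (m := 1) one_add_one_le_infty).differentiableAt one_ne_zero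
  have hh1 := hh.of_le (m := 1) (by simp)
  -- In the chart, the iterated derivative is a Hessian term plus `dh` applied to the derivative of
  -- the components of `Z`. The Hessian terms cancel in the commutator by symmetry, and the others
  -- form the bracket.
  have key : ∀ Z : Π x : M, TangentSpace (𝓡 n) x, IsDiffFieldAt Z x → ∀ v : TangentSpace (𝓡 n) x,
      mvfderiv (𝓡 n) (fun z => mvfderiv (𝓡 n) h z (Z z)) x v =
      fderiv ℝ (fderiv ℝ (inChart n x h)) (chartMap n x x) (mvfderiv (𝓡 n) (chartMap n x) x v)
        (mvfderiv (𝓡 n) (chartMap n x) x (Z x)) +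
      fderiv ℝ (inChart n x h) (chartMap n x x)
        (mvfderiv (𝓡 n) (fun z => mvfderiv (𝓡 n) (chartMap n x) z (Z z)) x v) := by
    intro Z hZ v
    rw [mvfderiv_congr (mvfderiv_field_eventuallyEq hU hh1 hx hxU Z),
      MDifferentiableAt.mvfderiv_clm_apply
        (A := fun z => fderiv ℝ (inChart n x h) (chartMap n x z)) (h2.mdifferentiableAt.comp x (mdifferentiableAt_chartMap hx)) ((isDiffFieldAt_iff hx).1 hZ)]
    rw [mvfderiv_comp_fderiv h2 (mdifferentiableAt_chartMap hx)]
  rw [key Y hY, key X hX, mvfderiv_eq_inChart hx (h1.differentiableAt (by simp)),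
    mvfderiv_chartMap_mlieBracket hX hY, map_sub]
  have hsymm : IsSymmSndFDerivAt ℝ (inChart n x h) (chartMap n x x) :=
    h1.isSymmSndFDerivAt (by simpa using two_le_infty)
  rw [hsymm.eq (mvfderiv (𝓡 n) (chartMap n x) x (X x)) (mvfderiv (𝓡 n) (chartMap n x) x (Y x))]
  abel

end ManifoldCalculus

/-! ## Local diffeomorphisms and pulled back flat connections -/

section LocalDiffeo

variable {n : ℕ} {M : Type*} [TopologicalSpace M] [ChartedSpace (EuclideanSpace ℝ (Fin n)) M]
  [IsManifold (𝓡 n) ∞ M]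
  {F : Type*} [NormedAddCommGroup F] [NormedSpace ℝ F]

instance (x : M) : FiniteDimensional ℝ (TangentSpace (𝓡 n) x) :=
  inferInstanceAs (FiniteDimensional ℝ (EuclideanSpace ℝ (Fin n)))

instance (x : M) : T2Space (TangentSpace (𝓡 n) x) :=
  inferInstanceAs (T2Space (EuclideanSpace ℝ (Fin n)))

theorem finrank_tangentSpace (x : M) : Module.finrank ℝ (TangentSpace (𝓡 n) x) = n := by
  change Module.finrank ℝ (EuclideanSpace ℝ (Fin n)) = n
  simp

theorem isInvertible_of_injective {x : M} {A : TangentSpace (𝓡 n) x →L[ℝ] F}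
    [FiniteDimensional ℝ F] (hF : Module.finrank ℝ F = n) (hA : Function.Injective A) :
    A.IsInvertible := by
  exact ⟨(LinearEquiv.ofInjectiveOfFinrankEq (A : TangentSpace (𝓡 n) x →ₗ[ℝ] F) hA
    (by rw [hF, finrank_tangentSpace])).toContinuousLinearEquiv, by ext v; rfl⟩

theorem inverse_apply_apply {x : M} {A : TangentSpace (𝓡 n) x →L[ℝ] F} (hA : A.IsInvertible)
    (v : TangentSpace (𝓡 n) x) : A.inverse (A v) = v := by
  obtain ⟨e, rfl⟩ := hA
  simp

theorem apply_inverse_apply {x : M} {A : TangentSpace (𝓡 n) x →L[ℝ] F} (hA : A.IsInvertible)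
    (w : F) : A (A.inverse w) = w := by
  obtain ⟨e, rfl⟩ := hA
  simp

/-- A function with invertible derivative is read in a chart as a function with invertible
derivative. -/
theorem isInvertible_fderiv_inChart {h : M → F} {x₀ x : M} (hx : x ∈ chartSource n x₀)
    (hh : DifferentiableAt ℝ (inChart n x₀ h) (chartMap n x₀ x))
    (hinv : (mvfderiv (𝓡 n) h x).IsInvertible) :
    (fderiv ℝ (inChart n x₀ h) (chartMap n x₀ x)).IsInvertible := by
  obtain ⟨e, he⟩ := hinv
  obtain ⟨c, hc⟩ := isInvertible_mvfderiv_chartMap (n := n) hx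
  refine ⟨c.symm.trans e, ?_⟩
  ext w
  have h1 := mvfderiv_eq_inChart hx hh (c.symm w)
  rw [← he, ← hc] at h1
  simpa using h1

/-- The inverse function theorem. -/
theorem isLocalDiffeomorphAt_of_isInvertible {y : M → EuclideanSpace ℝ (Fin n)} {U : Set M}
    (hU : IsOpen U) (hy : ContMDiffOn (𝓡 n) (𝓡 n) ∞ y U)
    (hinv : ∀ z ∈ U, (mvfderiv (𝓡 n) y z).IsInvertible) {x : M} (hxU : x ∈ U) :
    IsLocalDiffeomorphAt (𝓡 n) (𝓡 n) ∞ y x := by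
  have hx : x ∈ chartSource n x := mem_chart_source _ x
  have hc := contDiffOn_inChart le_rfl hy x
  have hO := isOpen_chartImage x hU (n := n)
  have hcd : ∀ e ∈ chartImage n x U, ContDiffAt ℝ ∞ (inChart n x y) e :=
    fun e he => hc.contDiffAt (hO.mem_nhds he)
  have hci : ∀ e ∈ chartImage n x U, (fderiv ℝ (inChart n x y) e).IsInvertible := by
    intro e he
    have h1 : (extChartAt (𝓡 n) x).symm e ∈ chartSource n x := by
      simpa using (extChartAt (𝓡 n) x).map_target he.1
    have h2 : chartMap n x ((extChartAt (𝓡 n) x).symm e) = e := (extChartAt (𝓡 n) x).right_inv he.1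
    have := isInvertible_fderiv_inChart (F := EuclideanSpace ℝ (Fin n)) h1 (h := y)
      (by rw [h2]; exact (hcd e he).differentiableAt (by simp)) (hinv _ he.2)
    rwa [h2] at this
  have hxe := chartMap_mem_chartImage hx hxU (n := n)
  obtain ⟨A, hA⟩ := hci _ hxe
  have hA' : HasFDerivAt (inChart n x y) (A : EuclideanSpace ℝ (Fin n) →L[ℝ] _) (chartMap n x x) := by
    rw [hA]
    exact ((hcd _ hxe).differentiableAt (by simp)).hasFDerivAt
  set e₀ := (hcd _ hxe).toOpenPartialHomeomorph (inChart n x y) hA' (by simp)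
  -- The restriction keeps the source inside the region where the derivative is invertible, so that
  -- the inverse is smooth on the whole target and not only at the image of `x`.
  set e := e₀.restrOpen _ hO
  have hesource : e.source ⊆ chartImage n x U := fun z hz => hz.2
  have hecoe : ∀ z, e z = inChart n x y z := fun z => rfl
  set Ψ := (chartAt (EuclideanSpace ℝ (Fin n)) x).trans e
  have hchart : ∀ z, chartAt (EuclideanSpace ℝ (Fin n)) x z = chartMap n x z := fun z => rfl
  have hsrc : Ψ.source ⊆ chartSource n x := fun z hz => hz.1
  refine ⟨⟨Ψ.toPartialEquiv, Ψ.open_source, Ψ.open_target, ?_, ?_⟩, ?_, ?_⟩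
  · refine ContMDiffOn.congr (f := y) ?_ ?_
    · refine hy.mono fun z hz => ?_
      have := (hesource hz.2).2
      change (extChartAt (𝓡 n) x).symm (chartMap n x z) ∈ U at this
      rw [(extChartAt (𝓡 n) x).left_inv (by simpa using hsrc hz)] at this
      exact this
    · intro z hz
      exact inChart_chartMap (hsrc hz) y
  · have h1 : ContMDiffOn (𝓡 n) (𝓡 n) ∞ e.symm Ψ.target := by
      rw [contMDiffOn_iff_contDiffOn]
      intro w hw
      have hw' : w ∈ e.target := hw.1
      obtain ⟨B, hB⟩ := hci _ (hesource (e.map_target hw'))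
      refine (e.contDiffAt_symm (f₀' := B) hw' ?_ ?_).contDiffWithinAt
      · rw [hB]
        exact ((hcd _ (hesource (e.map_target hw'))).differentiableAt (by simp)).hasFDerivAt
      · exact hcd _ (hesource (e.map_target hw'))
    exact (contMDiffOn_chart_symm (I := 𝓡 n) (n := ∞) (x := x)).comp h1 fun w hw => hw.2
  · refine ⟨hx, (hcd _ hxe).mem_toOpenPartialHomeomorph_source hA' (by simp), hxe⟩
  · intro z hz
    exact (inChart_chartMap (hsrc hz) y).symm

/-- The vector field with constant coordinates `e` in the chart at `x₀`. -/
noncomputable def coordField (x₀ : M) (e : EuclideanSpace ℝ (Fin n)) (x : M) :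
    TangentSpace (𝓡 n) x :=
  (mvfderiv (𝓡 n) (chartMap n x₀) x).inverse e

theorem mvfderiv_chartMap_coordField {x₀ x : M} (hx : x ∈ chartSource n x₀)
    (e : EuclideanSpace ℝ (Fin n)) :
    mvfderiv (𝓡 n) (chartMap n x₀) x (coordField x₀ e x) = e :=
  apply_inverse_apply (isInvertible_mvfderiv_chartMap hx) e

theorem coordField_mvfderiv_chartMap {x₀ x : M} (hx : x ∈ chartSource n x₀)
    (v : TangentSpace (𝓡 n) x) :
    coordField x₀ (mvfderiv (𝓡 n) (chartMap n x₀) x v) x = v :=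
  inverse_apply_apply (isInvertible_mvfderiv_chartMap hx) v

theorem isSmoothFieldOn_coordField (x₀ : M) (e : EuclideanSpace ℝ (Fin n)) :
    IsSmoothFieldOn (coordField x₀ e) (chartSource n x₀) := by
  intro x hx
  refine ContMDiffAt.contMDiffWithinAt ((contMDiffAt_field_iff hx).2 ?_)
  refine ContMDiffAt.congr_of_eventuallyEq (contMDiffAt_const (c := e)) ?_
  filter_upwards [(isOpen_chartSource x₀).mem_nhds hx] with z hz
  exact mvfderiv_chartMap_coordField hz e

/-- A section of `Hom(TM, V)` is smooth if it maps coordinate fields to smooth sections. -/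
theorem contMDiffAt_hom_of_coordField {V : M → Type*} [TopologicalSpace (TotalSpace F V)]
    [∀ x, AddCommGroup (V x)] [∀ x, Module ℝ (V x)] [∀ x, TopologicalSpace (V x)]
    [FiberBundle F V] [VectorBundle ℝ F V] [ContMDiffVectorBundle ∞ F V (𝓡 n)]
    [∀ x, IsTopologicalAddGroup (V x)] [∀ x, ContinuousSMul ℝ (V x)]
    (A : Π x : M, TangentSpace (𝓡 n) x →L[ℝ] V x) (x₀ : M)
    (hA : ∀ e, ContMDiffAt (𝓡 n) ((𝓡 n).prod 𝓘(ℝ, F)) ∞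
      (fun x => TotalSpace.mk' F x (A x (coordField x₀ e x))) x₀) :
    ContMDiffAt (𝓡 n) ((𝓡 n).prod 𝓘(ℝ, EuclideanSpace ℝ (Fin n) →L[ℝ] F)) ∞
      (fun x => TotalSpace.mk' (E := fun x => TangentSpace (𝓡 n) x →L[ℝ] V x)
        (EuclideanSpace ℝ (Fin n) →L[ℝ] F) x (A x)) x₀ := by
  rw [contMDiffAt_hom_bundle]
  refine ⟨contMDiffAt_id, ?_⟩
  set G : M → EuclideanSpace ℝ (Fin n) →L[ℝ] F := fun x =>
    ContinuousLinearMap.inCoordinates (EuclideanSpace ℝ (Fin n)) (TangentSpace (𝓡 n) : M → Type _)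
      F V x₀ x x₀ x (A x)
  have hG : ∀ e, ContMDiffAt (𝓡 n) 𝓘(ℝ, F) ∞ (fun x => G x e) x₀ := by
    intro e
    have h1 := (Bundle.contMDiffAt_section x₀).1 (hA e)
    refine h1.congr_of_eventuallyEq ?_
    have hV : ∀ᶠ z in 𝓝 x₀, z ∈ (trivializationAt F V x₀).baseSet :=
      (trivializationAt F V x₀).open_baseSet.mem_nhds (mem_baseSet_trivializationAt F V x₀)
    filter_upwards [(isOpen_chartSource (n := n) x₀).mem_nhds (mem_chart_source _ x₀), hV] with z hz hzV
    have hz' : z ∈ (trivializationAt (EuclideanSpace ℝ (Fin n))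
        (TangentSpace (𝓡 n) : M → Type _) x₀).baseSet := by simpa using hz
    simp only [G, ContinuousLinearMap.inCoordinates, ContinuousLinearMap.comp_apply]
    have h2 : Trivialization.symmL ℝ (trivializationAt (EuclideanSpace ℝ (Fin n))
        (TangentSpace (𝓡 n) : M → Type _) x₀) z e = coordField x₀ e z := by
      rw [← coordField_mvfderiv_chartMap hz (Trivialization.symmL ℝ _ z e),
        ← trivializationAt_tangent_apply hz]
      congr 1
      have := Trivialization.continuousLinearMapAt_symmL (R := ℝ) (trivializationAt
        (EuclideanSpace ℝ (Fin n)) (TangentSpace (𝓡 n) : M → Type _) x₀) hz' e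
      rwa [Trivialization.continuousLinearMapAt_apply, Trivialization.linearMapAt_apply,
        if_pos hz'] at this
    rw [h2, Trivialization.continuousLinearMapAt_apply, Trivialization.linearMapAt_apply, if_pos hzV]
  -- In finite dimensions a family of linear maps is smooth once its values on a basis are.
  let b := Module.finBasis ℝ (EuclideanSpace ℝ (Fin n))
  have hsum : G = fun x => ∑ i, (ContinuousLinearMap.smulRightL ℝ (EuclideanSpace ℝ (Fin n)) F
      (b.coord i).toContinuousLinearMap) (G x (b i)) := by
    funext x
    ext1 v
    rw [sum_apply]
    calc G x v = G x (∑ i, b.repr v i • b i) := by rw [b.sum_repr]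
      _ = ∑ i, b.repr v i • G x (b i) := by rw [map_sum]; simp only [map_smul]
  change ContMDiffAt (𝓡 n) 𝓘(ℝ, EuclideanSpace ℝ (Fin n) →L[ℝ] F) ∞ G x₀
  rw [hsum]
  refine contMDiffAt_finsetSum fun i _ => ?_
  exact ((ContinuousLinearMap.contDiff _).contMDiff.contMDiffAt).comp x₀ (hG (b i))

/-- Vector fields with smooth image under a local diffeomorphism are smooth. -/
theorem isSmoothFieldOn_inverse {y : M → EuclideanSpace ℝ (Fin n)} {U : Set M}
    (hU : IsOpen U) (hy : ContMDiffOn (𝓡 n) (𝓡 n) ∞ y U)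
    (hinv : ∀ z ∈ U, (mvfderiv (𝓡 n) y z).IsInvertible) {w : M → EuclideanSpace ℝ (Fin n)}
    (hw : ContMDiffOn (𝓡 n) (𝓡 n) ∞ w U) :
    IsSmoothFieldOn (fun z => (mvfderiv (𝓡 n) y z).inverse (w z)) U := by
  intro x hxU
  have hx : x ∈ chartSource n x := mem_chart_source _ x
  have hc : ∀ z ∈ chartSource n x, z ∈ U → ContDiffAt ℝ ∞ (inChart n x y) (chartMap n x z) :=
    fun z hz hzU => (contDiffOn_inChart le_rfl hy x).contDiffAt
      ((isOpen_chartImage x hU).mem_nhds (chartMap_mem_chartImage hz hzU))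
  refine ContMDiffAt.contMDiffWithinAt ((contMDiffAt_field_iff hx).2 ?_)
  have heq : (fun z => mvfderiv (𝓡 n) (chartMap n x) z ((mvfderiv (𝓡 n) y z).inverse (w z)))
      =ᶠ[𝓝 x] fun z => (fderiv ℝ (inChart n x y) (chartMap n x z)).inverse (w z) := by
    filter_upwards [(isOpen_chartSource x).mem_nhds hx, hU.mem_nhds hxU] with z hz hzU
    have h1 := mvfderiv_eq_inChart hz ((hc z hz hzU).differentiableAt (by simp))
      ((mvfderiv (𝓡 n) y z).inverse (w z))
    rw [apply_inverse_apply (hinv z hzU)] at h1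
    obtain ⟨B, hB⟩ := isInvertible_fderiv_inChart hz ((hc z hz hzU).differentiableAt (by simp))
      (hinv z hzU)
    rw [← hB] at h1 ⊢
    conv_rhs => rw [h1]
    simp
  refine ContMDiffAt.congr_of_eventuallyEq ?_ heq
  refine ContMDiffAt.clm_apply ?_ (hw.contMDiffAt (hU.mem_nhds hxU))
  obtain ⟨B, hB⟩ := isInvertible_fderiv_inChart hx ((hc x hx hxU).differentiableAt (by simp))
    (hinv x hxU)
  have h2 : ContDiffAt ℝ ∞ (fun e => (fderiv ℝ (inChart n x y) e).inverse) (chartMap n x x) := by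
    refine ContDiffAt.comp (g := ContinuousLinearMap.inverse) (chartMap n x x) ?_
      ((hc x hx hxU).fderiv_right (m := ∞) (by simp))
    rw [← hB]
    exact contDiffAt_map_inverse B
  exact h2.contMDiffAt.comp x
    ((contMDiffOn_chartMap x).contMDiffAt ((isOpen_chartSource x).mem_nhds hx))

/-- A connection `D` that becomes the trivial connection under `Φ` has vanishing curvature. -/
theorem curvatureOp_eq_zero_of_trivialization {V : M → Type*} [∀ x, AddCommGroup (V x)]
    [∀ x, Module ℝ (V x)] [∀ x, TopologicalSpace (V x)]
    {D : (Π x : M, V x) → (Π x : M, TangentSpace (𝓡 n) x →L[ℝ] V x)} {Φ : Π x : M, V x →ₗ[ℝ] F}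
    {U : Set M} (hU : IsOpen U) (hΦ : ∀ x ∈ U, Function.Injective (Φ x))
    {X Y : Π x : M, TangentSpace (𝓡 n) x} {σ : Π x : M, V x}
    (hσ : ContMDiffOn (𝓡 n) 𝓘(ℝ, F) ∞ (fun z => Φ z (σ z)) U)
    (h : ∀ x ∈ U, ∀ v, Φ x (D σ x v) = mvfderiv (𝓡 n) (fun z => Φ z (σ z)) x v)
    (hX : ∀ x ∈ U, ∀ v, Φ x (D (fun z => D σ z (X z)) x v) =
      mvfderiv (𝓡 n) (fun z => Φ z (D σ z (X z))) x v)
    (hY : ∀ x ∈ U, ∀ v, Φ x (D (fun z => D σ z (Y z)) x v) =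
      mvfderiv (𝓡 n) (fun z => Φ z (D σ z (Y z))) x v)
    {x : M} (hx : x ∈ U) (hXx : IsDiffFieldAt X x) (hYx : IsDiffFieldAt Y x) :
    curvatureOp D X Y σ x = 0 := by
  refine hΦ x hx ?_
  have e : ∀ Z : Π x : M, TangentSpace (𝓡 n) x, (fun z => Φ z (D σ z (Z z))) =ᶠ[𝓝 x]
      fun z => mvfderiv (𝓡 n) (fun z => Φ z (σ z)) z (Z z) := by
    intro Z
    filter_upwards [hU.mem_nhds hx] with z hz using h z hz _
  rw [curvatureOp, map_sub, map_sub, map_zero, hX x hx, hY x hx, h x hx, mvfderiv_congr (e X),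
    mvfderiv_congr (e Y), mvfderiv_commutator hU hσ hx hXx hYx, sub_self]

/-- The pullback of the standard flat connection under `y`. -/
noncomputable def pullbackFlat (y : M → EuclideanSpace ℝ (Fin n))
    (σ : Π x : M, TangentSpace (𝓡 n) x) (x : M) :
    TangentSpace (𝓡 n) x →L[ℝ] TangentSpace (𝓡 n) x :=
  (mvfderiv (𝓡 n) y x).inverse.comp
    (mvfderiv (𝓡 n) (fun z => mvfderiv (𝓡 n) y z (σ z)) x)

variable {y : M → EuclideanSpace ℝ (Fin n)} {U : Set M}

theorem mvfderiv_pullbackFlat (hinv : ∀ z ∈ U, (mvfderiv (𝓡 n) y z).IsInvertible)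
    (σ : Π x : M, TangentSpace (𝓡 n) x) {x : M} (hx : x ∈ U) (v : TangentSpace (𝓡 n) x) :
    mvfderiv (𝓡 n) y x (pullbackFlat y σ x v) =
      mvfderiv (𝓡 n) (fun z => mvfderiv (𝓡 n) y z (σ z)) x v :=
  apply_inverse_apply (hinv x hx) _

theorem isCovariantDerivativeOn_pullbackFlat (hU : IsOpen U) (hy : ContMDiffOn (𝓡 n) (𝓡 n) ∞ y U)
    (hinv : ∀ z ∈ U, (mvfderiv (𝓡 n) y z).IsInvertible) :
    IsCovariantDerivativeOn (EuclideanSpace ℝ (Fin n)) (pullbackFlat y) U where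
  add {σ σ' x} hσ hσ' hx := by
    have h1 := mdifferentiableAt_mvfderiv_apply hU hy hx hσ
    have h2 := mdifferentiableAt_mvfderiv_apply hU hy hx hσ'
    have h3 := mvfderiv_add h1 h2
    have h4 : (fun z => mvfderiv (𝓡 n) y z ((σ + σ') z)) =
      (fun z => mvfderiv (𝓡 n) y z (σ z)) + fun z => mvfderiv (𝓡 n) y z (σ' z) := by
      funext z
      exact map_add _ _ _
    rw [pullbackFlat, h4, h3, ContinuousLinearMap.comp_add]
    rfl
  leibniz {σ g x} hσ hg hx := by
    have h1 := mdifferentiableAt_mvfderiv_apply hU hy hx hσ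
    have h3 := mvfderiv_smul hg h1
    have h4 : (fun z => mvfderiv (𝓡 n) y z ((g • σ) z)) =
      g • (fun z => mvfderiv (𝓡 n) y z (σ z)) := by
      funext z
      exact (mvfderiv (𝓡 n) y z).map_smul (g z) (σ z)
    rw [pullbackFlat, h4, h3]
    ext1 v
    simp only [ContinuousLinearMap.comp_apply, add_apply, smul_apply,
      ContinuousLinearMap.smulRight_apply, map_add, map_smul, pullbackFlat]
    rw [inverse_apply_apply (hinv x hx)]

theorem isSmoothFieldOn_pullbackFlat (hy : ContMDiffOn (𝓡 n) (𝓡 n) ∞ y U)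
    (hinv : ∀ z ∈ U, (mvfderiv (𝓡 n) y z).IsInvertible) {O : Set M} (hO : IsOpen O) (hOU : O ⊆ U)
    {σ X : Π x : M, TangentSpace (𝓡 n) x} (hσ : IsSmoothFieldOn σ O) (hX : IsSmoothFieldOn X O) :
    IsSmoothFieldOn (fun z => pullbackFlat y σ z (X z)) O :=
  isSmoothFieldOn_inverse hO (hy.mono hOU) (fun z hz => hinv z (hOU hz))
    (contMDiffOn_mvfderiv_apply hO (contMDiffOn_mvfderiv_apply hO (hy.mono hOU) hσ) hX)

theorem contMDiffCovariantDerivativeOn_pullbackFlat (hU : IsOpen U)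
    (hy : ContMDiffOn (𝓡 n) (𝓡 n) ∞ y U)
    (hinv : ∀ z ∈ U, (mvfderiv (𝓡 n) y z).IsInvertible) :
    ContMDiffCovariantDerivativeOn (EuclideanSpace ℝ (Fin n)) ∞ (pullbackFlat y) U where
  contMDiff {σ} hσ x hx := by
    refine (contMDiffAt_hom_of_coordField _ x fun e => ?_).contMDiffWithinAt
    have hO := hU.inter (isOpen_chartSource (n := n) x)
    have h1 : IsSmoothFieldOn σ (U ∩ chartSource n x) :=
      ContMDiffOn.mono (ContMDiffOn.of_le hσ (by simp)) inter_subset_left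
    have h2 : IsSmoothFieldOn (coordField x e) (U ∩ chartSource n x) :=
      ContMDiffOn.mono (isSmoothFieldOn_coordField x e) inter_subset_right
    exact (isSmoothFieldOn_pullbackFlat hy hinv hO inter_subset_left h1 h2).contMDiffAt
      (hO.mem_nhds ⟨hx, mem_chart_source _ x⟩)

theorem isTorsionFreeOn_pullbackFlat (hU : IsOpen U) (hy : ContMDiffOn (𝓡 n) (𝓡 n) ∞ y U)
    (hinv : ∀ z ∈ U, (mvfderiv (𝓡 n) y z).IsInvertible) :
    IsTorsionFreeOn (pullbackFlat y) U := by
  intro X Y x hx hX hY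
  obtain ⟨e, he⟩ := hinv x hx
  have : Function.Injective (mvfderiv (𝓡 n) y x) := by rw [← he]; exact e.injective
  apply this
  rw [map_sub, mvfderiv_pullbackFlat hinv _ hx, mvfderiv_pullbackFlat hinv _ hx,
    mvfderiv_commutator hU hy hx hX hY]

theorem isFlatOn_pullbackFlat (hU : IsOpen U) (hy : ContMDiffOn (𝓡 n) (𝓡 n) ∞ y U)
    (hinv : ∀ z ∈ U, (mvfderiv (𝓡 n) y z).IsInvertible) :
    IsFlatOn (EuclideanSpace ℝ (Fin n)) (pullbackFlat y) U := by
  intro X Y σ hX hY hσ x hx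
  refine curvatureOp_eq_zero_of_trivialization (F := EuclideanSpace ℝ (Fin n))
    (Φ := fun x => (mvfderiv (𝓡 n) y x).toLinearMap) hU (fun z hz => ?_)
    (contMDiffOn_mvfderiv_apply hU hy hσ)
    (fun z hz v => mvfderiv_pullbackFlat hinv _ hz v)
    (fun z hz v => mvfderiv_pullbackFlat hinv _ hz v)
    (fun z hz v => mvfderiv_pullbackFlat hinv _ hz v) hx
    (hX.isDiffFieldAt hU hx) (hY.isDiffFieldAt hU hx)
  obtain ⟨e, he⟩ := hinv z hz
  have : Function.Injective (mvfderiv (𝓡 n) y z) := by rw [← he]; exact e.injective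
  exact this

end LocalDiffeo

/-! ## Radial immersions -/

section Radial

variable {n : ℕ} {M : Type*} [TopologicalSpace M] [ChartedSpace (EuclideanSpace ℝ (Fin n)) M]
  [IsManifold (𝓡 n) ∞ M]

/-- The linear map `(v, r) ↦ df(v) + r f(x)`. -/
noncomputable def radialFrame (f : M → Fin (n + 1) → ℝ) (x : M) :
    TangentSpace (𝓡 n) x × ℝ →L[ℝ] (Fin (n + 1) → ℝ) :=
  (mvfderiv (𝓡 n) f x).coprod (ContinuousLinearMap.toSpanSingleton ℝ (f x))

theorem radialFrame_apply (f : M → Fin (n + 1) → ℝ) (x : M) (v : TangentSpace (𝓡 n) x) (r : ℝ) :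
    radialFrame f x (v, r) = mvfderiv (𝓡 n) f x v + r • f x := by
  simp [radialFrame]

/-- A smooth map to `ℝⁿ⁺¹` that is an immersion transverse to the radial direction. -/
structure IsRadialImmersionOn (f : M → Fin (n + 1) → ℝ) (U : Set M) : Prop where
  isOpen : IsOpen U
  smooth : ContMDiffOn (𝓡 n) 𝓘(ℝ, Fin (n + 1) → ℝ) ∞ f U
  injective : ∀ x ∈ U, Function.Injective (radialFrame f x)

theorem radialFrame_congr {f g : M → Fin (n + 1) → ℝ} {x : M} (h : f =ᶠ[𝓝 x] g) :
    radialFrame f x = radialFrame g x := by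
  rw [radialFrame, radialFrame, mvfderiv_congr h, h.self_of_nhds]

variable {f : M → Fin (n + 1) → ℝ} {U : Set M}

theorem IsRadialImmersionOn.mono (hf : IsRadialImmersionOn f U) {O : Set M} (hO : IsOpen O)
    (hOU : O ⊆ U) : IsRadialImmersionOn f O :=
  ⟨hO, hf.smooth.mono hOU, fun x hx => hf.injective x (hOU hx)⟩

theorem IsRadialImmersionOn.mdifferentiableAt (hf : IsRadialImmersionOn f U) {x : M} (hx : x ∈ U) :
    MDifferentiableAt (𝓡 n) 𝓘(ℝ, Fin (n + 1) → ℝ) f x :=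
  (hf.smooth.contMDiffAt (hf.isOpen.mem_nhds hx)).mdifferentiableAt (by simp)

theorem IsRadialImmersionOn.ne_zero (hf : IsRadialImmersionOn f U) {x : M} (hx : x ∈ U) :
    f x ≠ 0 := by
  intro h
  have h1 : radialFrame f x (0, 1) = radialFrame f x (0, 0) := by
    simp [radialFrame_apply, h]
  simpa using hf.injective x hx h1

theorem IsRadialImmersionOn.injective_mvfderiv (hf : IsRadialImmersionOn f U) {x : M}
    (hx : x ∈ U) : Function.Injective (mvfderiv (𝓡 n) f x) := by
  intro v w h
  have h1 : radialFrame f x (v, 0) = radialFrame f x (w, 0) := by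
    simp [radialFrame_apply, h]
  simpa using hf.injective x hx h1

theorem IsRadialImmersionOn.isInvertible (hf : IsRadialImmersionOn f U) {x : M} (hx : x ∈ U) :
    (radialFrame f x).IsInvertible := by
  have h : Module.finrank ℝ (TangentSpace (𝓡 n) x × ℝ) = Module.finrank ℝ (Fin (n + 1) → ℝ) := by
    rw [Module.finrank_prod, finrank_tangentSpace]
    simp
  exact ⟨(LinearEquiv.ofInjectiveOfFinrankEq (radialFrame f x : _ →ₗ[ℝ] (Fin (n + 1) → ℝ))
    (hf.injective x hx) h).toContinuousLinearEquiv, by ext v <;> rfl⟩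

/-- The tangential part of `w` in the decomposition given by `radialFrame`. -/
noncomputable def radialTangent (f : M → Fin (n + 1) → ℝ) (x : M) :
    (Fin (n + 1) → ℝ) →L[ℝ] TangentSpace (𝓡 n) x :=
  (ContinuousLinearMap.fst ℝ (TangentSpace (𝓡 n) x) ℝ).comp (radialFrame f x).inverse

/-- The radial part of `w` in the decomposition given by `radialFrame`. -/
noncomputable def radialCoeff (f : M → Fin (n + 1) → ℝ) (x : M) :
    (Fin (n + 1) → ℝ) →L[ℝ] ℝ :=
  (ContinuousLinearMap.snd ℝ (TangentSpace (𝓡 n) x) ℝ).comp (radialFrame f x).inverse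

theorem IsRadialImmersionOn.decomp (hf : IsRadialImmersionOn f U) {x : M} (hx : x ∈ U)
    (w : Fin (n + 1) → ℝ) :
    mvfderiv (𝓡 n) f x (radialTangent f x w) + radialCoeff f x w • f x = w := by
  obtain ⟨e, he⟩ := hf.isInvertible hx
  have h1 : radialFrame f x ((radialFrame f x).inverse w) = w := by
    rw [← he]; simp
  rw [← radialFrame_apply]
  exact h1

theorem IsRadialImmersionOn.radialTangent_eq (hf : IsRadialImmersionOn f U) {x : M} (hx : x ∈ U)
    {w : Fin (n + 1) → ℝ} {v : TangentSpace (𝓡 n) x} {r : ℝ}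
    (h : mvfderiv (𝓡 n) f x v + r • f x = w) :
    radialTangent f x w = v ∧ radialCoeff f x w = r := by
  have h1 := hf.decomp hx w
  rw [← h, ← radialFrame_apply, ← radialFrame_apply] at h1
  have h2 := hf.injective x hx h1
  rw [radialFrame_apply, h] at h2
  exact Prod.ext_iff.1 h2

/-- The coordinates of `w` other than the `i`-th one. -/
noncomputable def affinePart (i : Fin (n + 1)) : (Fin (n + 1) → ℝ) →L[ℝ] EuclideanSpace ℝ (Fin n) :=
  ((PiLp.continuousLinearEquiv 2 ℝ (fun _ : Fin n => ℝ)).symm : (Fin n → ℝ) →L[ℝ] _).comp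
    (ContinuousLinearMap.pi fun j => ContinuousLinearMap.proj (i.succAbove j))

theorem affinePart_apply (i : Fin (n + 1)) (w : Fin (n + 1) → ℝ) (j : Fin n) :
    affinePart i w j = w (i.succAbove j) := rfl

theorem eq_zero_of_affinePart {i : Fin (n + 1)} {w : Fin (n + 1) → ℝ} (h : affinePart i w = 0)
    (hi : w i = 0) : w = 0 := by
  funext k
  rcases eq_or_ne k i with rfl | hk
  · exact hi
  · obtain ⟨j, rfl⟩ := Fin.exists_succAbove_eq hk
    exact congrArg (fun y : EuclideanSpace ℝ (Fin n) => y j) h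

/-- The map `f` to `ℝⁿ⁺¹`, read in the `i`-th affine chart of projective space. -/
noncomputable def affineCoord (i : Fin (n + 1)) (f : M → Fin (n + 1) → ℝ) (x : M) :
    EuclideanSpace ℝ (Fin n) :=
  (f x i)⁻¹ • affinePart i (f x)

omit [IsManifold (𝓡 n) ∞ M] [ChartedSpace (EuclideanSpace ℝ (Fin n)) M] [TopologicalSpace M] in
theorem affineChart_mk_eq (i : Fin (n + 1)) {x : M} (hx : f x ≠ 0) :
    affineChart i (Projectivization.mk ℝ (f x) hx) = affineCoord i f x := by
  ext j
  rw [affineChart_mk, affineCoord, PiLp.smul_apply, affinePart_apply, smul_eq_mul, div_eq_inv_mul]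

variable {i : Fin (n + 1)}

theorem contMDiffOn_apply (hf : ContMDiffOn (𝓡 n) 𝓘(ℝ, Fin (n + 1) → ℝ) ∞ f U) (k : Fin (n + 1)) :
    ContMDiffOn (𝓡 n) 𝓘(ℝ, ℝ) ∞ (fun z => f z k) U :=
  ((ContinuousLinearMap.proj (R := ℝ) (φ := fun _ : Fin (n + 1) => ℝ) k).contDiff.contMDiff
    (n := ∞)).comp_contMDiffOn hf

theorem contMDiffOn_affineCoord (hf : ContMDiffOn (𝓡 n) 𝓘(ℝ, Fin (n + 1) → ℝ) ∞ f U)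
    (hi : ∀ z ∈ U, f z i ≠ 0) : ContMDiffOn (𝓡 n) (𝓡 n) ∞ (affineCoord i f) U := by
  exact ContMDiffOn.smul (f := fun z => (f z i)⁻¹) (g := fun z => affinePart i (f z))
    ((contMDiffOn_apply hf i).inv₀ hi)
    (((affinePart i).contDiff.contMDiff (n := ∞)).comp_contMDiffOn hf)

theorem mvfderiv_apply {x : M} (hf : MDifferentiableAt (𝓡 n) 𝓘(ℝ, Fin (n + 1) → ℝ) f x)
    (v : TangentSpace (𝓡 n) x) (k : Fin (n + 1)) :
    mvfderiv (𝓡 n) (fun z => f z k) x v = mvfderiv (𝓡 n) f x v k :=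
  mvfderiv_clm_comp (ContinuousLinearMap.proj (R := ℝ) (φ := fun _ : Fin (n + 1) => ℝ) k) hf v

theorem mvfderiv_smul_apply {F : Type*} [NormedAddCommGroup F] [NormedSpace ℝ F] {x : M}
    {φ : M → ℝ} {h : M → F} (hφ : MDifferentiableAt (𝓡 n) 𝓘(ℝ, ℝ) φ x)
    (hh : MDifferentiableAt (𝓡 n) 𝓘(ℝ, F) h x) (v : TangentSpace (𝓡 n) x) :
    mvfderiv (𝓡 n) (fun z => φ z • h z) x v =
      mvfderiv (𝓡 n) φ x v • h x + φ x • mvfderiv (𝓡 n) h x v := by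
  have := mvfderiv_smul hφ hh
  rw [show (fun z => φ z • h z) = φ • h from rfl, this, add_comm]
  rfl

theorem mvfderiv_add_apply {F : Type*} [NormedAddCommGroup F] [NormedSpace ℝ F] {x : M}
    {φ : M → F} {h : M → F} (hφ : MDifferentiableAt (𝓡 n) 𝓘(ℝ, F) φ x)
    (hh : MDifferentiableAt (𝓡 n) 𝓘(ℝ, F) h x) (v : TangentSpace (𝓡 n) x) :
    mvfderiv (𝓡 n) (fun z => φ z + h z) x v =
      mvfderiv (𝓡 n) φ x v + mvfderiv (𝓡 n) h x v := by
  have := mvfderiv_add hφ hh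
  rw [show (fun z => φ z + h z) = φ + h from rfl, this]
  rfl

/-- `P(df) = (df)ᵢ y + fᵢ dy`, where `P` forgets the `i`-th coordinate. -/
theorem affinePart_mvfderiv (hU : IsOpen U)
    (hf : ContMDiffOn (𝓡 n) 𝓘(ℝ, Fin (n + 1) → ℝ) ∞ f U) (hi : ∀ z ∈ U, f z i ≠ 0) {x : M}
    (hx : x ∈ U) (v : TangentSpace (𝓡 n) x) :
    affinePart i (mvfderiv (𝓡 n) f x v) =
      mvfderiv (𝓡 n) f x v i • affineCoord i f x + f x i • mvfderiv (𝓡 n) (affineCoord i f) x v := by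
  have hfx := (hf.contMDiffAt (hU.mem_nhds hx)).mdifferentiableAt (by simp)
  have hyx := ((contMDiffOn_affineCoord hf hi).contMDiffAt (hU.mem_nhds hx)).mdifferentiableAt
    (by simp)
  have hix := ((contMDiffOn_apply hf i).contMDiffAt (hU.mem_nhds hx)).mdifferentiableAt (by simp)
  have h1 := mvfderiv_smul_apply hix hyx v
  rw [mvfderiv_apply hfx] at h1
  rw [← h1, ← mvfderiv_clm_comp (affinePart i) hfx]
  refine congrArg (fun A : TangentSpace (𝓡 n) x →L[ℝ] _ => A v) (mvfderiv_congr ?_)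
  filter_upwards [hU.mem_nhds hx] with z hz
  rw [affineCoord, smul_smul, mul_inv_cancel₀ (hi z hz), one_smul]

/-- If `dy(v) = 0` then `affinePart_mvfderiv` makes `df(v)` a multiple of `f`, which transversality
to the radial direction allows only for `v = 0`. Dimensions agree, so injectivity is enough. -/
theorem IsRadialImmersionOn.isInvertible_affineCoord (hf : IsRadialImmersionOn f U)
    (hi : ∀ z ∈ U, f z i ≠ 0) {x : M} (hx : x ∈ U) :
    (mvfderiv (𝓡 n) (affineCoord i f) x).IsInvertible := by
  refine isInvertible_of_injective (by simp) ?_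
  refine (injective_iff_map_eq_zero (mvfderiv (𝓡 n) (affineCoord i f) x)).2 fun v hv => ?_
  have h1 := affinePart_mvfderiv hf.isOpen hf.smooth hi hx v
  rw [hv, smul_zero, add_zero] at h1
  set c := mvfderiv (𝓡 n) f x v i * (f x i)⁻¹
  have h2 : mvfderiv (𝓡 n) f x v + (-c) • f x = 0 := by
    refine eq_zero_of_affinePart (i := i) ?_ ?_
    · rw [map_add, h1, map_smul, affineCoord, smul_smul]
      module
    · have := hi x hx
      simp only [Pi.add_apply, Pi.smul_apply, smul_eq_mul, c]
      field_simp
      ring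
  have h3 : radialFrame f x (v, -c) = radialFrame f x 0 := by
    rw [radialFrame_apply, h2, map_zero]
  exact (Prod.ext_iff.1 (hf.injective x hx h3)).1

/-- Near each point, one of the affine charts of projective space can be used. -/
theorem IsRadialImmersionOn.exists_affine (hf : IsRadialImmersionOn f U) {x : M} (hx : x ∈ U) :
    ∃ (O : Set M) (i : Fin (n + 1)), IsOpen O ∧ x ∈ O ∧ O ⊆ U ∧ ∀ z ∈ O, f z i ≠ 0 := by
  obtain ⟨i, hi⟩ := Function.ne_iff.1 (hf.ne_zero hx)
  have hc : ContinuousOn (fun z => f z i) U := (contMDiffOn_apply hf.smooth i).continuousOn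
  refine ⟨U ∩ (fun z => f z i) ⁻¹' {0}ᶜ, i, hc.isOpen_inter_preimage hf.isOpen
    isOpen_compl_singleton, ⟨hx, hi⟩, inter_subset_left, fun z hz => hz.2⟩

/-- Write `P` for `affinePart i` and `y` for `affineCoord i f`. If `w = df(u) + r f`, then `P(w) -
wᵢ y = fᵢ dy(u)`, so `u` is obtained from a smooth function by inverting `dy`, and
`isSmoothFieldOn_inverse` applies. -/
theorem IsRadialImmersionOn.isSmoothFieldOn_radialTangent (hf : IsRadialImmersionOn f U)
    {w : M → Fin (n + 1) → ℝ} (hw : ContMDiffOn (𝓡 n) 𝓘(ℝ, Fin (n + 1) → ℝ) ∞ w U) :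
    IsSmoothFieldOn (fun x => radialTangent f x (w x)) U := by
  intro x hx
  obtain ⟨O, i, hO, hxO, hOU, hi⟩ := hf.exists_affine hx
  have hfO := hf.mono hO hOU
  have hy := contMDiffOn_affineCoord hfO.smooth hi
  have hwO := hw.mono hOU
  set w' : M → EuclideanSpace ℝ (Fin n) := fun z =>
    (f z i)⁻¹ • (affinePart i (w z) - w z i • affineCoord i f z)
  have hw' : ContMDiffOn (𝓡 n) (𝓡 n) ∞ w' O := by
    refine ContMDiffOn.smul (f := fun z => (f z i)⁻¹) ((contMDiffOn_apply hfO.smooth i).inv₀ hi) ?_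
    refine ContMDiffOn.sub (((affinePart i).contDiff.contMDiff (n := ∞)).comp_contMDiffOn hwO) ?_
    exact ContMDiffOn.smul (f := fun z => w z i) (contMDiffOn_apply hwO i) hy
  have h1 := isSmoothFieldOn_inverse hO hy (fun z hz => hfO.isInvertible_affineCoord hi hz) hw'
  refine ContMDiffAt.contMDiffWithinAt ?_
  refine (ContMDiffOn.contMDiffAt h1 (hO.mem_nhds hxO)).congr_of_eventuallyEq ?_
  filter_upwards [hO.mem_nhds hxO] with z hz
  congr 1
  obtain ⟨e, he⟩ := hfO.isInvertible_affineCoord hi hz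
  rw [← inverse_apply_apply ⟨e, he⟩ (radialTangent f z (w z))]
  congr 1
  have h2 := hfO.decomp hz (w z)
  have h3 := affinePart_mvfderiv hO hfO.smooth hi hz (radialTangent f z (w z))
  have h4 : mvfderiv (𝓡 n) f z (radialTangent f z (w z)) = w z - radialCoeff f z (w z) • f z :=
    eq_sub_of_add_eq h2
  rw [h4, map_sub, map_smul] at h3
  have h5 := hi z hz
  have h6 : affinePart i (f z) = f z i • affineCoord i f z := by
    rw [affineCoord, smul_smul, mul_inv_cancel₀ h5, one_smul]
  rw [h6] at h3
  simp only [w', Pi.sub_apply, Pi.smul_apply, smul_eq_mul] at h3 ⊢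
  rw [eq_inv_smul_iff₀ h5, eq_sub_of_add_eq' h3.symm]
  module

/-- Once the tangential part is smooth, the radial coefficient is read off from a coordinate `i`
with `fᵢ ≠ 0`. -/
theorem IsRadialImmersionOn.contMDiffOn_radialCoeff (hf : IsRadialImmersionOn f U)
    {w : M → Fin (n + 1) → ℝ} (hw : ContMDiffOn (𝓡 n) 𝓘(ℝ, Fin (n + 1) → ℝ) ∞ w U) :
    ContMDiffOn (𝓡 n) 𝓘(ℝ, ℝ) ∞ (fun x => radialCoeff f x (w x)) U := by
  intro x hx
  obtain ⟨O, i, hO, hxO, hOU, hi⟩ := hf.exists_affine hx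
  have h1 := contMDiffOn_mvfderiv_apply hf.isOpen hf.smooth (hf.isSmoothFieldOn_radialTangent hw)
  have h2 : ContMDiffOn (𝓡 n) 𝓘(ℝ, ℝ) ∞ (fun z => (f z i)⁻¹ *
      (w z i - mvfderiv (𝓡 n) f z (radialTangent f z (w z)) i)) O := by
    refine ContMDiffOn.smul (f := fun z => (f z i)⁻¹)
      ((contMDiffOn_apply (hf.smooth.mono hOU) i).inv₀ hi) ?_
    exact ContMDiffOn.sub (contMDiffOn_apply (hw.mono hOU) i) (contMDiffOn_apply (h1.mono hOU) i)
  refine ContMDiffAt.contMDiffWithinAt ?_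
  refine (h2.contMDiffAt (hO.mem_nhds hxO)).congr_of_eventuallyEq ?_
  filter_upwards [hO.mem_nhds hxO] with z hz
  have h3 := congrFun (hf.decomp (hOU hz) (w z)) i
  have h5 := hi z hz
  simp only [Pi.add_apply, Pi.smul_apply, smul_eq_mul] at h3
  rw [eq_inv_mul_iff_mul_eq₀ h5, ← h3]
  ring

/-- The connection induced by a radial immersion: the tangential part of the second
derivative. -/
noncomputable def radialConnection (f : M → Fin (n + 1) → ℝ)
    (σ : Π x : M, TangentSpace (𝓡 n) x) (x : M) :
    TangentSpace (𝓡 n) x →L[ℝ] TangentSpace (𝓡 n) x :=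
  (radialTangent f x).comp (mvfderiv (𝓡 n) (fun z => mvfderiv (𝓡 n) f z (σ z)) x)

theorem IsRadialImmersionOn.isCovariantDerivativeOn (hf : IsRadialImmersionOn f U) :
    IsCovariantDerivativeOn (EuclideanSpace ℝ (Fin n)) (radialConnection f) U where
  add {σ σ' x} hσ hσ' hx := by
    have h1 := mdifferentiableAt_mvfderiv_apply hf.isOpen hf.smooth hx hσ
    have h2 := mdifferentiableAt_mvfderiv_apply hf.isOpen hf.smooth hx hσ'
    have h3 := mvfderiv_add h1 h2
    have h4 : (fun z => mvfderiv (𝓡 n) f z ((σ + σ') z)) =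
      (fun z => mvfderiv (𝓡 n) f z (σ z)) + fun z => mvfderiv (𝓡 n) f z (σ' z) := by
      funext z
      exact map_add _ _ _
    rw [radialConnection, h4, h3, ContinuousLinearMap.comp_add]
    rfl
  leibniz {σ g x} hσ hg hx := by
    have h1 := mdifferentiableAt_mvfderiv_apply hf.isOpen hf.smooth hx hσ
    have h3 := mvfderiv_smul hg h1
    have h4 : (fun z => mvfderiv (𝓡 n) f z ((g • σ) z)) =
      g • (fun z => mvfderiv (𝓡 n) f z (σ z)) := by
      funext z
      exact (mvfderiv (𝓡 n) f z).map_smul (g z) (σ z)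
    rw [radialConnection, h4, h3]
    ext1 v
    have h5 : radialTangent f x (mvfderiv (𝓡 n) f x (σ x)) = σ x :=
      (hf.radialTangent_eq hx (r := 0) (by rw [zero_smul, add_zero])).1
    simp only [ContinuousLinearMap.comp_apply, add_apply, smul_apply,
      ContinuousLinearMap.smulRight_apply, map_add, map_smul, radialConnection, h5]

theorem IsRadialImmersionOn.isSmoothFieldOn_radialConnection (hf : IsRadialImmersionOn f U)
    {σ X : Π x : M, TangentSpace (𝓡 n) x} (hσ : IsSmoothFieldOn σ U) (hX : IsSmoothFieldOn X U) :
    IsSmoothFieldOn (fun z => radialConnection f σ z (X z)) U :=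
  hf.isSmoothFieldOn_radialTangent (contMDiffOn_mvfderiv_apply hf.isOpen
    (contMDiffOn_mvfderiv_apply hf.isOpen hf.smooth hσ) hX)

/-- The antisymmetric part of the second derivative of `f` is `df([X, Y])`, which has no radial
component. -/
theorem IsRadialImmersionOn.isTorsionFreeOn (hf : IsRadialImmersionOn f U) :
    IsTorsionFreeOn (radialConnection f) U := by
  intro X Y x hx hX hY
  rw [radialConnection, radialConnection, ContinuousLinearMap.comp_apply,
    ContinuousLinearMap.comp_apply, ← map_sub, mvfderiv_commutator hf.isOpen hf.smooth hx hX hY]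
  exact (hf.radialTangent_eq hx (r := 0) (by rw [zero_smul, add_zero])).1

/-- `f` is a radial immersion whose second derivative is described by `D` and `g`. -/
structure IsRadialFor (D : (Π x : M, TangentSpace (𝓡 n) x) →
      (Π x : M, TangentSpace (𝓡 n) x →L[ℝ] TangentSpace (𝓡 n) x))
    (g : Π x : M, TangentSpace (𝓡 n) x →L[ℝ] TangentSpace (𝓡 n) x →L[ℝ] ℝ)
    (f : M → Fin (n + 1) → ℝ) (U : Set M) : Prop extends IsRadialImmersionOn f U where
  second : ∀ x ∈ U, ∀ Y : Π x : M, TangentSpace (𝓡 n) x, IsDiffFieldAt Y x →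
    ∀ v, mvfderiv (𝓡 n) (fun z => mvfderiv (𝓡 n) f z (Y z)) x v =
      mvfderiv (𝓡 n) f x (D Y x v) + g x (Y x) v • f x

variable {D : (Π x : M, TangentSpace (𝓡 n) x) →
      (Π x : M, TangentSpace (𝓡 n) x →L[ℝ] TangentSpace (𝓡 n) x)}
    {g : Π x : M, TangentSpace (𝓡 n) x →L[ℝ] TangentSpace (𝓡 n) x →L[ℝ] ℝ}

theorem IsRadialFor.restrict (hf : IsRadialFor D g f U) {O : Set M} (hO : IsOpen O)
    (hOU : O ⊆ U) : IsRadialFor D g f O :=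
  ⟨hf.toIsRadialImmersionOn.mono hO hOU, fun x hx => hf.second x (hOU hx)⟩

theorem radialFrame_clm_comp (hf : IsRadialImmersionOn f U)
    (T : (Fin (n + 1) → ℝ) →L[ℝ] (Fin (n + 1) → ℝ)) {x : M} (hx : x ∈ U)
    (p : TangentSpace (𝓡 n) x × ℝ) :
    radialFrame (fun z => T (f z)) x p = T (radialFrame f x p) := by
  obtain ⟨v, r⟩ := p
  rw [radialFrame_apply, radialFrame_apply, mvfderiv_clm_comp T (hf.mdifferentiableAt hx),
    map_add, map_smul]

theorem IsRadialImmersionOn.clm_comp (hf : IsRadialImmersionOn f U)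
    {T : (Fin (n + 1) → ℝ) →L[ℝ] (Fin (n + 1) → ℝ)} (hT : Function.Injective T) :
    IsRadialImmersionOn (fun z => T (f z)) U where
  isOpen := hf.isOpen
  smooth := (T.contDiff.contMDiff (n := ∞)).comp_contMDiffOn hf.smooth
  injective x hx p q h := by
    rw [radialFrame_clm_comp hf T hx, radialFrame_clm_comp hf T hx] at h
    exact hf.injective x hx (hT h)

theorem mvfderiv_mvfderiv_clm_comp (hf : IsRadialImmersionOn f U)
    (T : (Fin (n + 1) → ℝ) →L[ℝ] (Fin (n + 1) → ℝ)) {x : M} (hx : x ∈ U)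
    {Y : Π x : M, TangentSpace (𝓡 n) x} (hY : IsDiffFieldAt Y x) (v : TangentSpace (𝓡 n) x) :
    mvfderiv (𝓡 n) (fun z => mvfderiv (𝓡 n) (fun z => T (f z)) z (Y z)) x v =
      T (mvfderiv (𝓡 n) (fun z => mvfderiv (𝓡 n) f z (Y z)) x v) := by
  rw [← mvfderiv_clm_comp T (mdifferentiableAt_mvfderiv_apply hf.isOpen hf.smooth hx hY)]
  refine congrArg (fun A : TangentSpace (𝓡 n) x →L[ℝ] _ => A v) (mvfderiv_congr ?_)
  filter_upwards [hf.isOpen.mem_nhds hx] with z hz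
  exact mvfderiv_clm_comp T (hf.mdifferentiableAt hz) _

theorem IsRadialFor.clm_comp (hf : IsRadialFor D g f U)
    {T : (Fin (n + 1) → ℝ) →L[ℝ] (Fin (n + 1) → ℝ)} (hT : Function.Injective T) :
    IsRadialFor D g (fun z => T (f z)) U where
  toIsRadialImmersionOn := hf.toIsRadialImmersionOn.clm_comp hT
  second x hx Y hY v := by
    rw [mvfderiv_mvfderiv_clm_comp hf.toIsRadialImmersionOn T hx hY, hf.second x hx Y hY v,
      mvfderiv_clm_comp T (hf.mdifferentiableAt hx), map_add, map_smul]

/-- The connection of a radial immersion is projectively equivalent to the pullback of the standard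
flat connection of the affine charts of projective space. -/
theorem IsRadialFor.projEquivOn (hf : IsRadialFor D g f U) (hi : ∀ z ∈ U, f z i ≠ 0) :
    ProjEquivOn D (pullbackFlat (affineCoord i f)) U := by
  set y := affineCoord i f
  have hy := contMDiffOn_affineCoord hf.smooth hi
  -- The one-form is the logarithmic derivative of `fᵢ`: differentiating `P(df(Y)) = (df(Y))ᵢ y + fᵢ
  -- dy(Y)` produces the cross terms `(df(Y))ᵢ dy(v)` and `(df(v))ᵢ dy(Y)`, and the radial terms
  -- match and drop out.
  refine ⟨fun x => (f x i)⁻¹ • (ContinuousLinearMap.proj (R := ℝ)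
    (φ := fun _ : Fin (n + 1) => ℝ) i).comp (mvfderiv (𝓡 n) f x), fun Y x hx hY v => ?_⟩
  have hinv := fun z hz => hf.isInvertible_affineCoord hi (x := z) hz
  have hnhds := hf.isOpen.mem_nhds hx
  have hyx := (hy.contMDiffAt hnhds).mdifferentiableAt (by simp)
  have hfY := mdifferentiableAt_mvfderiv_apply hf.isOpen hf.smooth hx hY
  have hyY := mdifferentiableAt_mvfderiv_apply hf.isOpen hy hx hY
  have hix := ((contMDiffOn_apply hf.smooth i).contMDiffAt hnhds).mdifferentiableAt (by simp)
  have hfYi : MDifferentiableAt (𝓡 n) 𝓘(ℝ, ℝ) (fun z => mvfderiv (𝓡 n) f z (Y z) i) x :=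
    ((ContinuousLinearMap.proj (R := ℝ) (φ := fun _ : Fin (n + 1) => ℝ)
      i).differentiableAt.mdifferentiableAt).comp x hfY
  have h1 : affinePart i (mvfderiv (𝓡 n) (fun z => mvfderiv (𝓡 n) f z (Y z)) x v) =
      mvfderiv (𝓡 n) (fun z => mvfderiv (𝓡 n) f z (Y z) i • y z +
        f z i • mvfderiv (𝓡 n) y z (Y z)) x v := by
    rw [← mvfderiv_clm_comp (affinePart i) hfY]
    refine congrArg (fun A : TangentSpace (𝓡 n) x →L[ℝ] _ => A v) (mvfderiv_congr ?_)
    filter_upwards [hnhds] with z hz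
    exact affinePart_mvfderiv hf.isOpen hf.smooth hi hz _
  rw [mvfderiv_add_apply (φ := fun z => mvfderiv (𝓡 n) f z (Y z) i • y z)
    (h := fun z => f z i • mvfderiv (𝓡 n) y z (Y z)) (hfYi.smul hyx) (hix.smul hyY), mvfderiv_smul_apply hfYi hyx,
    mvfderiv_smul_apply hix hyY, mvfderiv_apply hfY, mvfderiv_apply (hf.mdifferentiableAt hx),
    ← mvfderiv_pullbackFlat hinv Y hx, hf.second x hx Y hY v, map_add, map_smul,
    affinePart_mvfderiv hf.isOpen hf.smooth hi hx] at h1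
  have h6 : affinePart i (f x) = f x i • y x := by
    simp only [y]
    rw [affineCoord, smul_smul, mul_inv_cancel₀ (hi x hx), one_smul]
  rw [h6] at h1
  obtain ⟨e, he⟩ := hinv x hx
  have hinj : Function.Injective (mvfderiv (𝓡 n) y x) := by
    rw [← he]; exact e.injective
  refine hinj ?_
  simp only [Pi.add_apply, Pi.smul_apply, smul_eq_mul] at h1
  have h7 : f x i • mvfderiv (𝓡 n) y x (D Y x v) = f x i • mvfderiv (𝓡 n) y x
      (pullbackFlat y Y x v) + mvfderiv (𝓡 n) f x v i • mvfderiv (𝓡 n) y x (Y x) +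
      mvfderiv (𝓡 n) f x (Y x) i • mvfderiv (𝓡 n) y x v := by
    rw [← sub_eq_zero] at h1 ⊢
    rw [← h1]
    module
  have h8 := congrArg (fun w => (f x i)⁻¹ • w) h7
  simp only [smul_add, smul_smul, inv_mul_cancel₀ (hi x hx), one_smul] at h8
  rw [map_sub, h8, map_add, map_smul, map_smul]
  simp only [smul_apply, ContinuousLinearMap.comp_apply, ContinuousLinearMap.proj_apply, smul_eq_mul]
  module

end Radial

/-! ## Local existence of radial immersions -/

section LocalExistence

variable {n : ℕ} {M : Type*} [TopologicalSpace M] [ChartedSpace (EuclideanSpace ℝ (Fin n)) M]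
  [IsManifold (𝓡 n) ∞ M]

/-- Cutting off by a bump function. The hypotheses on `D` and on volume forms concern globally
smooth sections, while coordinate fields are only defined on a chart. -/
theorem exists_smooth_field_eventuallyEq [T2Space M] {σ : Π x : M, TangentSpace (𝓡 n) x} {U : Set M}
    (hU : IsOpen U) (hσ : IsSmoothFieldOn σ U) {x : M} (hx : x ∈ U) :
    ∃ σ' : Π x : M, TangentSpace (𝓡 n) x, IsSmoothFieldOn σ' univ ∧ ∀ᶠ z in 𝓝 x, σ' z = σ z := by
  obtain ⟨ψ, hψ, -⟩ := (SmoothBumpFunction.nhds_basis_support (I := 𝓡 n)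
    (hU.mem_nhds hx)).mem_iff.1 (hU.mem_nhds hx)
  refine ⟨(ψ : M → ℝ) • σ, ?_, ?_⟩
  · rw [IsSmoothFieldOn, IsSmoothSectionOn, contMDiffOn_univ]
    exact ContMDiffOn.smul_section_of_tsupport ψ.contMDiff.contMDiffOn hU hψ hσ
  · filter_upwards [ψ.eventuallyEq_one] with z hz
    simp [hz]

variable {D : TangentConnection n M}

theorem connection_congr {σ σ' : Π x : M, TangentSpace (𝓡 n) x} {x : M} (hσ : IsDiffFieldAt σ x)
    (hσ' : IsDiffFieldAt σ' x) (h : ∀ᶠ z in 𝓝 x, σ z = σ' z) : D σ x = D σ' x :=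
  D.isCovariantDerivativeOnUniv.congr_of_eventuallyEq hσ hσ' Filter.univ_mem h

theorem isSmoothFieldOn_connection [T2Space M]
    (hD : CovariantDerivative.ContMDiffCovariantDerivative D ∞)
    {U : Set M} (hU : IsOpen U) {σ X : Π x : M, TangentSpace (𝓡 n) x}
    (hσ : IsSmoothFieldOn σ U) (hX : IsSmoothFieldOn X U) :
    IsSmoothFieldOn (fun z => D σ z (X z)) U := by
  intro x hx
  obtain ⟨σ', hσ', he⟩ := exists_smooth_field_eventuallyEq hU hσ hx
  have h1 := (hD.contMDiff.contMDiff (σ := σ') (ContMDiffOn.of_le hσ' (by simp))) x (mem_univ x)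
  rw [contMDiffWithinAt_univ] at h1
  have h2 := ContMDiffAt.clm_bundle_apply (F₁ := EuclideanSpace ℝ (Fin n))
    (F₂ := EuclideanSpace ℝ (Fin n)) (E₁ := fun x : M => TangentSpace (𝓡 n) x)
    (E₂ := fun x : M => TangentSpace (𝓡 n) x) h1 (ContMDiffOn.contMDiffAt hX (hU.mem_nhds hx))
  refine ContMDiffAt.contMDiffWithinAt (h2.congr_of_eventuallyEq ?_)
  filter_upwards [he.eventually_nhds, hU.mem_nhds hx] with z hz hzU
  congr 2
  exact connection_congr (hσ.isDiffFieldAt hU hzU) (hσ'.isDiffFieldAt isOpen_univ (mem_univ z))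
    (hz.mono fun w hw => hw.symm)

/-- The Christoffel tensor of `D` in the chart at `x₀`. -/
noncomputable def christoffel (D : TangentConnection n M) (x₀ : M) (z : M) :
    TangentSpace (𝓡 n) z →L[ℝ] TangentSpace (𝓡 n) z →L[ℝ] TangentSpace (𝓡 n) z :=
  IsCovariantDerivativeOn.difference (D.isCovariantDerivativeOn (s := chartSource n x₀))
    (isCovariantDerivativeOn_pullbackFlat (isOpen_chartSource x₀) (contMDiffOn_chartMap x₀)
      fun _ hz => isInvertible_mvfderiv_chartMap hz) z

theorem christoffel_apply {x₀ z : M} (hz : z ∈ chartSource n x₀)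
    {σ : Π x : M, TangentSpace (𝓡 n) x} (hσ : IsDiffFieldAt σ z) (v : TangentSpace (𝓡 n) z) :
    mvfderiv (𝓡 n) (chartMap n x₀) z (christoffel D x₀ z (σ z) v) =
      mvfderiv (𝓡 n) (chartMap n x₀) z (D σ z v) -
        mvfderiv (𝓡 n) (fun w => mvfderiv (𝓡 n) (chartMap n x₀) w (σ w)) z v := by
  rw [christoffel, IsCovariantDerivativeOn.difference_apply _ _ hz hσ, sub_apply, map_sub,
    mvfderiv_pullbackFlat (fun _ hz => isInvertible_mvfderiv_chartMap hz) σ hz]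

theorem mvfderiv_eq_zero_of_eventually_const {F : Type*} [NormedAddCommGroup F] [NormedSpace ℝ F]
    {f : M → F} {x : M} {c : F} (h : ∀ᶠ z in 𝓝 x, f z = c) (v : TangentSpace (𝓡 n) x) :
    mvfderiv (𝓡 n) f x v = 0 := by
  rw [mvfderiv_congr (g := fun _ => c) h]
  have h1 : mvfderiv (𝓡 n) (fun _ : M => c) x = 0 := mvfderiv_const c
  rw [h1]
  rfl

/-- Coordinate fields are parallel for the flat connection of the chart, so the difference tensor
reduces to `D` on them. -/
theorem christoffel_coordField {x₀ z : M} (hz : z ∈ chartSource n x₀) (c : EuclideanSpace ℝ (Fin n))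
    (v : TangentSpace (𝓡 n) z) :
    christoffel D x₀ z (coordField x₀ c z) v = D (coordField x₀ c) z v := by
  have h1 := christoffel_apply (D := D) hz
    ((isSmoothFieldOn_coordField x₀ c).isDiffFieldAt (isOpen_chartSource x₀) hz) v
  have h2 : mvfderiv (𝓡 n) (fun w => mvfderiv (𝓡 n) (chartMap n x₀) w (coordField x₀ c w)) z v
      = 0 := by
    refine mvfderiv_eq_zero_of_eventually_const (c := c) ?_ v
    filter_upwards [(isOpen_chartSource x₀).mem_nhds hz] with w hw
    exact mvfderiv_chartMap_coordField hw c
  rw [h2, sub_zero] at h1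
  rw [← coordField_mvfderiv_chartMap hz (christoffel D x₀ z (coordField x₀ c z) v), h1,
    coordField_mvfderiv_chartMap hz]

/-- The connection form of `∇^h` in the coordinate frame of the chart at `x₀`. -/
noncomputable def extendedForm (D : TangentConnection n M) (h : SymmTwoTensor n M) (x₀ z : M) :
    EuclideanSpace ℝ (Fin n) →L[ℝ]
      (EuclideanSpace ℝ (Fin n) × ℝ) →L[ℝ] (EuclideanSpace ℝ (Fin n) × ℝ) :=
  LinearMap.toContinuousLinearMap (LinearMap.toContinuousLinearMap.toLinearMap ∘ₗ
    LinearMap.mk₂ ℝ (fun a p =>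
      (mvfderiv (𝓡 n) (chartMap n x₀) z
          (christoffel D x₀ z (coordField x₀ p.1 z) (coordField x₀ a z)) + p.2 • a,
        h.toFun z (coordField x₀ p.1 z) (coordField x₀ a z)))
      (fun a a' p => by simp only [coordField, map_add, smul_add, Prod.mk_add_mk]; congr 1; abel)
      (fun c a p => by simp only [coordField, map_smul, Prod.smul_mk, smul_add, smul_comm c])
      (fun a p p' => by
        simp only [coordField, map_add, Prod.fst_add, Prod.snd_add, add_apply, add_smul,
          Prod.mk_add_mk]
        congr 1
        abel)
      (fun c a p => by
        simp only [coordField, map_smul, Prod.smul_fst, Prod.smul_snd, smul_apply, Prod.smul_mk,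
          smul_add, smul_assoc]))

theorem extendedForm_apply (D : TangentConnection n M) (h : SymmTwoTensor n M) (x₀ z : M)
    (a : EuclideanSpace ℝ (Fin n)) (p : EuclideanSpace ℝ (Fin n) × ℝ) :
    extendedForm D h x₀ z a p = (mvfderiv (𝓡 n) (chartMap n x₀) z
          (christoffel D x₀ z (coordField x₀ p.1 z) (coordField x₀ a z)) + p.2 • a,
        h.toFun z (coordField x₀ p.1 z) (coordField x₀ a z)) := rfl

theorem contMDiffOn_symmTwoTensor (h : SymmTwoTensor n M) {U : Set M}
    {X Y : Π x : M, TangentSpace (𝓡 n) x} (hX : IsSmoothFieldOn X U) (hY : IsSmoothFieldOn Y U) :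
    ContMDiffOn (𝓡 n) 𝓘(ℝ, ℝ) ∞ (fun z => h.toFun z (X z) (Y z)) U := by
  have h2 := ContMDiffOn.clm_bundle_apply₂ (F₁ := EuclideanSpace ℝ (Fin n))
    (F₂ := EuclideanSpace ℝ (Fin n)) (F₃ := ℝ) (E₁ := fun x : M => TangentSpace (𝓡 n) x)
    (E₂ := fun x : M => TangentSpace (𝓡 n) x) (E₃ := Bundle.Trivial M ℝ)
    (h.smooth.contMDiffOn (s := U)) hX hY
  intro x hx
  exact (contMDiffWithinAt_section (F := ℝ) (E := Bundle.Trivial M ℝ)).1 (h2 x hx)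

theorem contMDiffOn_extendedForm [T2Space M]
    (hD : CovariantDerivative.ContMDiffCovariantDerivative D ∞) (h : SymmTwoTensor n M) (x₀ : M)
    (a : EuclideanSpace ℝ (Fin n)) (p : EuclideanSpace ℝ (Fin n) × ℝ) :
    ContMDiffOn (𝓡 n) 𝓘(ℝ, EuclideanSpace ℝ (Fin n) × ℝ) ∞
      (fun z => extendedForm D h x₀ z a p) (chartSource n x₀) := by
  have hO := isOpen_chartSource (n := n) x₀
  refine ContMDiffOn.prodMk_space ?_ (contMDiffOn_symmTwoTensor h
    (isSmoothFieldOn_coordField x₀ p.1) (isSmoothFieldOn_coordField x₀ a))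
  refine ContMDiffOn.add ?_ contMDiffOn_const
  refine (contMDiffOn_mvfderiv_apply hO (contMDiffOn_chartMap x₀) (isSmoothFieldOn_connection hD hO
    (isSmoothFieldOn_coordField x₀ p.1) (isSmoothFieldOn_coordField x₀ a))).congr fun z hz => ?_
  rw [christoffel_coordField hz]

/-- The coordinates of an element of `TM ⊕ L` in the chart at `x₀`. -/
noncomputable def chartPair (x₀ z : M) (q : TangentPlusLine n M z) : EuclideanSpace ℝ (Fin n) × ℝ :=
  (mvfderiv (𝓡 n) (chartMap n x₀) z q.1, q.2)

/-- In the coordinate frame `∇^h = d + θ` with `θ = extendedForm D h x₀`: the Christoffel tensor is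
the difference between `D` and the derivative of components. -/
theorem chartPair_extendedConnection (h : SymmTwoTensor n M) {x₀ z : M}
    (hz : z ∈ chartSource n x₀) {σ : Π x : M, TangentPlusLine n M x}
    (hσ1 : IsDiffFieldAt (fun x => (σ x).1) z)
    (hσ2 : MDifferentiableAt (𝓡 n) 𝓘(ℝ, ℝ) (fun x => ((σ x).2 : ℝ)) z) (v : TangentSpace (𝓡 n) z) :
    chartPair x₀ z (extendedConnection D h σ z v) =
      mvfderiv (𝓡 n) (fun w => chartPair x₀ w (σ w)) z v +
        extendedForm D h x₀ z (mvfderiv (𝓡 n) (chartMap n x₀) z v) (chartPair x₀ z (σ z)) := by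
  have hd1 := mdifferentiableAt_mvfderiv_apply (isOpen_chartSource x₀) (contMDiffOn_chartMap x₀)
    hz hσ1
  have hd := hd1.prodMk_space hσ2
  have e1 : _ = (mvfderiv (𝓡 n) (fun w => (mvfderiv (𝓡 n) (chartMap n x₀) w (σ w).1,
      ((σ w).2 : ℝ))) z v).1 :=
    mvfderiv_clm_comp (ContinuousLinearMap.fst ℝ (EuclideanSpace ℝ (Fin n)) ℝ) hd v
  have e2 : _ = (mvfderiv (𝓡 n) (fun w => (mvfderiv (𝓡 n) (chartMap n x₀) w (σ w).1,
      ((σ w).2 : ℝ))) z v).2 :=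
    mvfderiv_clm_comp (ContinuousLinearMap.snd ℝ (EuclideanSpace ℝ (Fin n)) ℝ) hd v
  have e3 := christoffel_apply (D := D) hz hσ1 v
  rw [extendedForm_apply]
  simp only [chartPair]
  rw [coordField_mvfderiv_chartMap hz, coordField_mvfderiv_chartMap hz]
  refine Prod.ext ?_ ?_
  · change mvfderiv (𝓡 n) (chartMap n x₀) z (D (fun x => (σ x).1) z v + ((σ z).2 : ℝ) • v) =
      (mvfderiv (𝓡 n) (fun w => (mvfderiv (𝓡 n) (chartMap n x₀) w (σ w).1, ((σ w).2 : ℝ))) z v).1 +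
      (mvfderiv (𝓡 n) (chartMap n x₀) z (christoffel D x₀ z (σ z).1 v) +
        ((σ z).2 : ℝ) • mvfderiv (𝓡 n) (chartMap n x₀) z v)
    rw [e3, map_add, map_smul, ← e1]
    simp only [ContinuousLinearMap.coe_fst']
    abel
  · change mvfderiv (𝓡 n) (fun x => ((σ x).2 : ℝ)) z v + h.toFun z (σ z).1 v =
      (mvfderiv (𝓡 n) (fun w => (mvfderiv (𝓡 n) (chartMap n x₀) w (σ w).1, ((σ w).2 : ℝ))) z v).2 +
      h.toFun z (σ z).1 v
    rw [← e2]
    simp only [ContinuousLinearMap.coe_snd']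

theorem mlieBracket_eq_zero_of_coord {x₀ z : M} (hz : z ∈ chartSource n x₀)
    {A B : Π x : M, TangentSpace (𝓡 n) x} (hA : IsDiffFieldAt A z) (hB : IsDiffFieldAt B z)
    {a b : EuclideanSpace ℝ (Fin n)} (ha : ∀ᶠ w in 𝓝 z, A w = coordField x₀ a w)
    (hb : ∀ᶠ w in 𝓝 z, B w = coordField x₀ b w) : VectorField.mlieBracket (𝓡 n) A B z = 0 := by
  have h1 := mvfderiv_commutator (isOpen_chartSource x₀) (contMDiffOn_chartMap x₀) hz hA hB
  have hn := (isOpen_chartSource (n := n) x₀).mem_nhds hz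
  rw [mvfderiv_eq_zero_of_eventually_const (c := b), mvfderiv_eq_zero_of_eventually_const (c := a),
    sub_zero] at h1
  · rw [← coordField_mvfderiv_chartMap hz (VectorField.mlieBracket (𝓡 n) A B z), ← h1, coordField,
      map_zero]
  · filter_upwards [ha, hn] with w hw hws
    rw [hw, mvfderiv_chartMap_coordField hws]
  · filter_upwards [hb, hn] with w hw hws
    rw [hw, mvfderiv_chartMap_coordField hws]

theorem isSmoothSectionOn_tangentPlusLine {σ : Π x : M, TangentPlusLine n M x} {U : Set M}
    (h1 : IsSmoothFieldOn (fun x => (σ x).1) U)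
    (h2 : ContMDiffOn (𝓡 n) 𝓘(ℝ, ℝ) ∞ (fun x => ((σ x).2 : ℝ)) U) :
    IsSmoothSectionOn n (EuclideanSpace ℝ (Fin n) × ℝ) σ U := by
  intro x hx
  rw [contMDiffWithinAt_section]
  exact (contMDiffWithinAt_section.1 (h1 x hx)).prodMk_space (h2 x hx)

/-- Flatness of `∇^h` in coordinates. -/
theorem extendedForm_flat [T2Space M] {h : SymmTwoTensor n M}
    (hD : CovariantDerivative.ContMDiffCovariantDerivative D ∞)
    (hflat : IsFlatOn (EuclideanSpace ℝ (Fin n) × ℝ) (extendedConnection D h).toFun univ)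
    {x₀ z : M} (hz : z ∈ chartSource n x₀) (a b : EuclideanSpace ℝ (Fin n))
    (p : EuclideanSpace ℝ (Fin n) × ℝ) :
    mvfderiv (𝓡 n) (fun w => extendedForm D h x₀ w b p) z (coordField x₀ a z) -
      mvfderiv (𝓡 n) (fun w => extendedForm D h x₀ w a p) z (coordField x₀ b z) +
      (extendedForm D h x₀ z a (extendedForm D h x₀ z b p) -
        extendedForm D h x₀ z b (extendedForm D h x₀ z a p)) = 0 := by
  have hO := isOpen_chartSource (n := n) x₀
  have hn := hO.mem_nhds hz
  have ext := fun c => exists_smooth_field_eventuallyEq hO (isSmoothFieldOn_coordField x₀ c) hz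
  obtain ⟨A, hA, hAe⟩ := ext a
  obtain ⟨B, hB, hBe⟩ := ext b
  obtain ⟨Z, hZ, hZe⟩ := ext p.1
  -- Near `z` this section has constant coordinates `p`, so its covariant derivative along the field
  -- of `c` has coordinates `θ(c) p`. A second derivative gives `d(θ(c) p) + θ θ(c) p`; coordinate
  -- fields commute, so vanishing curvature is `dθ + θ ∧ θ = 0`.
  set σ : Π x : M, TangentPlusLine n M x := fun x => (Z x, p.2)
  have hσ : IsSmoothSectionOn n (EuclideanSpace ℝ (Fin n) × ℝ) σ univ :=
    isSmoothSectionOn_tangentPlusLine hZ contMDiffOn_const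
  have hdiff : ∀ {Y : Π x : M, TangentSpace (𝓡 n) x}, IsSmoothFieldOn Y univ → ∀ w,
    IsDiffFieldAt Y w := fun hY w => hY.isDiffFieldAt isOpen_univ (mem_univ w)
  have key : ∀ (c : EuclideanSpace ℝ (Fin n)) (C : Π x : M, TangentSpace (𝓡 n) x),
      IsSmoothFieldOn C univ → (∀ᶠ w in 𝓝 z, C w = coordField x₀ c w) → ∀ v,
      chartPair x₀ z (extendedConnection D h (fun w => extendedConnection D h σ w (C w)) z v) =
        mvfderiv (𝓡 n) (fun w => extendedForm D h x₀ w c p) z v +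
        extendedForm D h x₀ z (mvfderiv (𝓡 n) (chartMap n x₀) z v)
          (extendedForm D h x₀ z c p) := by
    intro c C hC hCe v
    have e1 : (fun w => chartPair x₀ w (extendedConnection D h σ w (C w))) =ᶠ[𝓝 z]
        fun w => extendedForm D h x₀ w c p := by
      filter_upwards [hn, hCe, hZe.eventually_nhds] with w hws hw hwZ
      rw [chartPair_extendedConnection h hws (hdiff hZ w) mdifferentiableAt_const,
        mvfderiv_eq_zero_of_eventually_const (c := p), zero_add, hw,
        mvfderiv_chartMap_coordField hws]
      · congr 1
        refine Prod.ext ?_ rfl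
        simp only [σ, chartPair]
        rw [hwZ.self_of_nhds, mvfderiv_chartMap_coordField hws]
      · filter_upwards [hwZ, hO.mem_nhds hws] with u hu hus
        refine Prod.ext ?_ rfl
        simp only [σ, chartPair]
        rw [hu, mvfderiv_chartMap_coordField hus]
    have hs1 : IsSmoothFieldOn (fun w => D Z w (C w) + p.2 • C w) univ := by
      have := isSmoothFieldOn_connection hD isOpen_univ hZ hC
      exact ContMDiffOn.add_section this (ContMDiffOn.const_smul_section hC)
    have hs2 : ContMDiffOn (𝓡 n) 𝓘(ℝ, ℝ) ∞ (fun w => mvfderiv (𝓡 n) (fun _ : M => p.2) w (C w) +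
        h.toFun w (Z w) (C w)) univ := by
      refine (contMDiffOn_symmTwoTensor h hZ hC).congr fun w _ => ?_
      rw [mvfderiv_eq_zero_of_eventually_const (c := p.2) (by simp), zero_add]
    have e2 : chartPair x₀ z (extendedConnection D h σ z (C z)) = extendedForm D h x₀ z c p :=
      e1.eq_of_nhds
    rw [chartPair_extendedConnection h hz, mvfderiv_congr e1, e2]
    · exact hdiff hs1 z
    · exact (hs2.contMDiffAt Filter.univ_mem).mdifferentiableAt (by simp)
  have h0 := hflat A B σ hA hB hσ z (mem_univ z)
  rw [curvatureOp, mlieBracket_eq_zero_of_coord hz (hdiff hA z) (hdiff hB z) hAe hBe, map_zero,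
    sub_zero, sub_eq_zero] at h0
  have h1 := key b B hB hBe (A z)
  have h2 := key a A hA hAe (B z)
  have h3 := congrArg (chartPair x₀ z) h0
  rw [hAe.self_of_nhds] at h1 h3
  rw [hBe.self_of_nhds] at h2 h3
  have h4 := h1.symm.trans (h3.trans h2)
  rw [mvfderiv_chartMap_coordField hz, mvfderiv_chartMap_coordField hz] at h4
  rw [← sub_eq_zero] at h4
  rw [← h4]
  abel

end LocalExistence

/-! ### Local radial immersions from parallel frames. -/

section LocalRadial

variable {n : ℕ} {M : Type*} [TopologicalSpace M] [ChartedSpace (EuclideanSpace ℝ (Fin n)) M]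
  [IsManifold (𝓡 n) ∞ M] {D : TangentConnection n M} {h : SymmTwoTensor n M}

/-- This is `∇^h_X (0, 1) = (X, 0)`: the derivative of the last vector of a parallel frame recovers
the rest of the frame. -/
theorem extendedForm_last (x₀ z : M) (a : EuclideanSpace ℝ (Fin n)) :
    extendedForm D h x₀ z a (0, 1) = (a, 0) := by
  rw [extendedForm_apply]
  simp only [coordField, map_zero, zero_apply, zero_add, one_smul]

/-- A parallel frame of `∇^h` gives a radial immersion. -/
theorem isRadialFor_of_parallel {x₀ : M} {U : Set M} (hU : IsOpen U)
    (hUs : U ⊆ chartSource n x₀)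
    {Q : M → (EuclideanSpace ℝ (Fin n) × ℝ) →L[ℝ] (Fin (n + 1) → ℝ)}
    (hQ : ContMDiffOn (𝓡 n) 𝓘(ℝ, (EuclideanSpace ℝ (Fin n) × ℝ) →L[ℝ] (Fin (n + 1) → ℝ)) ∞ Q U)
    (hinj : ∀ z ∈ U, Function.Injective (Q z))
    (hder : ∀ z ∈ U, ∀ v p, mvfderiv (𝓡 n) Q z v p =
      Q z (extendedForm D h x₀ z (mvfderiv (𝓡 n) (chartMap n x₀) z v) p)) :
    IsRadialFor D.toFun h.toFun (fun z => Q z (0, 1)) U := by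
  have hQd : ∀ z ∈ U, MDifferentiableAt (𝓡 n)
      𝓘(ℝ, (EuclideanSpace ℝ (Fin n) × ℝ) →L[ℝ] (Fin (n + 1) → ℝ)) Q z := fun z hz =>
    (hQ.contMDiffAt (hU.mem_nhds hz)).mdifferentiableAt (by simp)
  have hd : ∀ z ∈ U, ∀ v, mvfderiv (𝓡 n) (fun z => Q z (0, 1)) z v =
      Q z (mvfderiv (𝓡 n) (chartMap n x₀) z v, 0) := by
    intro z hz v
    rw [(hQd z hz).mvfderiv_clm_apply mdifferentiableAt_const, hder z hz,
      extendedForm_last, mvfderiv_eq_zero_of_eventually_const (c := ((0 : EuclideanSpace ℝ (Fin n)),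
        (1 : ℝ))) (by simp), map_zero, add_zero]
  refine ⟨⟨hU, hQ.clm_apply contMDiffOn_const, ?_⟩, ?_⟩
  · intro z hz
    refine (injective_iff_map_eq_zero (radialFrame (fun z => Q z (0, 1)) z)).2 ?_
    rintro ⟨v, r⟩ h0
    rw [radialFrame_apply, hd z hz, ← map_smul, ← map_add] at h0
    have h1 := (injective_iff_map_eq_zero (Q z)).1 (hinj z hz) _ h0
    simp only [Prod.smul_mk, smul_zero, smul_eq_mul, mul_one, Prod.mk_add_mk, add_zero, zero_add,
      Prod.mk_eq_zero] at h1
    obtain ⟨h1, rfl⟩ := h1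
    rw [← coordField_mvfderiv_chartMap (hUs hz) v, h1, coordField, map_zero]
    rfl
  · intro z hz Y hY v
    have hχY := mdifferentiableAt_mvfderiv_apply (isOpen_chartSource x₀) (contMDiffOn_chartMap x₀)
      (hUs hz) hY
    have hpair : MDifferentiableAt (𝓡 n) 𝓘(ℝ, EuclideanSpace ℝ (Fin n) × ℝ)
        (fun w => (mvfderiv (𝓡 n) (chartMap n x₀) w (Y w), (0 : ℝ))) z :=
      hχY.prodMk_space mdifferentiableAt_const
    -- Since `df(Y) = Q(Y, 0)`, one more derivative gives `Q(∇^h_v (Y, 0)) = Q(∇_v Y, h(Y, v))`,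
    -- which is the structure equation.
    have e1 : (fun w => mvfderiv (𝓡 n) (fun z => Q z (0, 1)) w (Y w)) =ᶠ[𝓝 z]
        fun w => Q w (mvfderiv (𝓡 n) (chartMap n x₀) w (Y w), 0) := by
      filter_upwards [hU.mem_nhds hz] with w hw using hd w hw _
    have e2 : mvfderiv (𝓡 n) (fun w => (mvfderiv (𝓡 n) (chartMap n x₀) w (Y w), (0 : ℝ))) z v =
        (mvfderiv (𝓡 n) (fun w => mvfderiv (𝓡 n) (chartMap n x₀) w (Y w)) z v, 0) :=
      mvfderiv_clm_comp (ContinuousLinearMap.inl ℝ (EuclideanSpace ℝ (Fin n)) ℝ) hχY v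
    rw [mvfderiv_congr e1, (hQd z hz).mvfderiv_clm_apply hpair, e2, hder z hz, hd z hz, ← map_smul,
      ← map_add, ← map_add, extendedForm_apply]
    congr 1
    simp only [zero_smul, add_zero]
    rw [coordField_mvfderiv_chartMap (hUs hz), coordField_mvfderiv_chartMap (hUs hz),
      christoffel_apply (hUs hz) hY]
    simp

-- Flatness makes the system `dP = P θ` solvable near the centre of the chart; the solution,
-- followed by a linear identification with `ℝⁿ⁺¹`, is the parallel frame needed for
-- `isRadialFor_of_parallel`.
set_option maxHeartbeats 1000000 in
theorem exists_isRadialFor [T2Space M]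
    (hD : CovariantDerivative.ContMDiffCovariantDerivative D ∞)
    (hflat : IsFlatOn (EuclideanSpace ℝ (Fin n) × ℝ) (extendedConnection D h).toFun univ) (x₀ : M) :
    ∃ (f : M → Fin (n + 1) → ℝ) (U : Set M), x₀ ∈ U ∧ IsRadialFor D.toFun h.toFun f U := by
  set e₀ := chartMap n x₀ x₀
  set χ := extChartAt (𝓡 n) x₀
  have hx₀ : x₀ ∈ chartSource n x₀ := mem_chart_source _ x₀
  have hI := isOpen_chartImage (n := n) x₀ (isOpen_chartSource (n := n) x₀)
  -- The chart is translated so that the base point is the origin, where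
  -- `exists_hasFDerivAt_of_flat` applies.
  set O : Set (EuclideanSpace ℝ (Fin n)) := (fun e => e + e₀) ⁻¹' chartImage n x₀ (chartSource n x₀)
  have hO : IsOpen O := hI.preimage (by fun_prop)
  have h0O : (0 : EuclideanSpace ℝ (Fin n)) ∈ O := by
    simp only [O, mem_preimage, zero_add]
    exact chartMap_mem_chartImage hx₀ hx₀
  set θ := extendedForm D h x₀
  set Θ := fun e : EuclideanSpace ℝ (Fin n) => θ (χ.symm (e + e₀))
  have hθ : ∀ b p, ContDiffOn ℝ ∞ (inChart n x₀ fun w => θ w b p)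
      (chartImage n x₀ (chartSource n x₀)) := fun b p =>
    contDiffOn_inChart le_rfl (contMDiffOn_extendedForm hD h x₀ b p) x₀
  have hΘ : ContDiffOn ℝ ∞ Θ O := by
    refine contDiffOn_clm_apply.2 fun b => contDiffOn_clm_apply.2 fun p => ?_
    exact (hθ b p).comp (contDiff_id.add contDiff_const).contDiffOn fun e he => he
  have hflat' : ∀ e ∈ O, ∀ a b, fderiv ℝ Θ e a b - fderiv ℝ Θ e b a +
      (Θ e a * Θ e b - Θ e b * Θ e a) = 0 := by
    intro e he a b
    set z := χ.symm (e + e₀)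
    have hz : z ∈ chartSource n x₀ := he.2
    have hχz : chartMap n x₀ z = e + e₀ := χ.right_inv he.1
    have key : ∀ a b p, fderiv ℝ Θ e a b p =
        mvfderiv (𝓡 n) (fun w => θ w b p) z (coordField x₀ a z) := by
      intro a b p
      have h1 : DifferentiableAt ℝ (inChart n x₀ fun w => θ w b p) (chartMap n x₀ z) := by
        rw [hχz]
        exact ((hθ b p).contDiffAt (hI.mem_nhds he)).differentiableAt (by simp)
      rw [mvfderiv_eq_inChart hz h1, mvfderiv_chartMap_coordField hz, hχz,
        ← fderiv_comp_add_right]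
      have h2 : DifferentiableAt ℝ Θ e :=
        (hΘ.contDiffAt (hO.mem_nhds he)).differentiableAt (by simp)
      have h3 := ((h2.hasFDerivAt.clm_apply (hasFDerivAt_const b e)).clm_apply
        (hasFDerivAt_const p e)).fderiv
      change _ = fderiv ℝ (fun e => Θ e b p) e a
      rw [h3]
      simp
    refine ContinuousLinearMap.ext fun p => ?_
    have := extendedForm_flat hD hflat hz a b p
    simp only [add_apply, sub_apply, mul_apply_eq_comp, key, zero_apply]
    exact this
  obtain ⟨P, hP0, hP⟩ := exists_hasFDerivAt_of_flat
    ((hΘ.contDiffAt (hO.mem_nhds h0O)).of_le two_le_infty)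
    (Filter.mem_of_superset (hO.mem_nhds h0O) hflat')
  -- The frame is the identity at the origin and units are open.
  have hunit : ∀ᶠ e in 𝓝 0, IsUnit (P e) := by
    have hc : ContinuousAt P 0 := hP.self_of_nhds.continuousAt
    refine hc.eventually (Units.isOpen.mem_nhds ?_)
    rw [hP0]
    exact isUnit_one
  obtain ⟨B, hBsub, hB, h0B⟩ := mem_nhds_iff.1 (Filter.inter_mem (Filter.inter_mem hP hunit)
    (hO.mem_nhds h0O))
  have hPs : ContDiffOn ℝ ∞ P B := contDiffOn_of_hasFDerivAt_mul hB
    (hΘ.mono fun e he => (hBsub he).2) fun e he => (hBsub he).1.1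
  set U : Set M := chartSource n x₀ ∩ (fun z => chartMap n x₀ z - e₀) ⁻¹' B
  have hU : IsOpen U := by
    refine ContinuousOn.isOpen_inter_preimage ?_ (isOpen_chartSource x₀) hB
    exact (contMDiffOn_chartMap x₀).continuousOn.sub continuousOn_const
  -- Any identification will do; the volume normalisation is made later, in
  -- `exists_isRadialFor_vol`.
  let Lin : (EuclideanSpace ℝ (Fin n) × ℝ) ≃L[ℝ] (Fin (n + 1) → ℝ) :=
    ContinuousLinearEquiv.ofFinrankEq (by simp)
  set A := ContinuousLinearMap.compL ℝ (EuclideanSpace ℝ (Fin n) × ℝ)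
    (EuclideanSpace ℝ (Fin n) × ℝ) (Fin (n + 1) → ℝ) (Lin : _ →L[ℝ] _)
  set Q : M → (EuclideanSpace ℝ (Fin n) × ℝ) →L[ℝ] (Fin (n + 1) → ℝ) :=
    fun z => A (P (chartMap n x₀ z - e₀))
  have hsub : ContMDiffOn (𝓡 n) 𝓘(ℝ, EuclideanSpace ℝ (Fin n)) ∞
      (fun z => chartMap n x₀ z - e₀) U :=
    ((contMDiffOn_chartMap x₀).mono inter_subset_left).sub contMDiffOn_const
  refine ⟨fun z => Q z (0, 1), U, ⟨hx₀, by simpa [e₀] using h0B⟩,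
    isRadialFor_of_parallel (x₀ := x₀) hU inter_subset_left ?_ ?_ ?_⟩
  · refine (A.contDiff.contMDiff (n := ∞)).comp_contMDiffOn ?_
    exact hPs.contMDiffOn.comp hsub fun z hz => hz.2
  · intro z hz p q hpq
    have h1 : P (chartMap n x₀ z - e₀) p = P (chartMap n x₀ z - e₀) q := Lin.injective hpq
    obtain ⟨u, hu⟩ := (hBsub hz.2).1.2
    have h2 : ∀ p, (↑u⁻¹ : (EuclideanSpace ℝ (Fin n) × ℝ) →L[ℝ] (EuclideanSpace ℝ (Fin n) × ℝ))
        (P (chartMap n x₀ z - e₀) p) = p := by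
      intro p
      rw [← hu, ← mul_apply_eq_comp, Units.inv_mul]
      rfl
    rw [← h2 p, h1, h2]
  · intro z hz v p
    have hPz := (hBsub hz.2).1.1
    have hs : MDifferentiableAt (𝓡 n) 𝓘(ℝ, EuclideanSpace ℝ (Fin n))
        (fun z => chartMap n x₀ z - e₀) z :=
      (hsub.contMDiffAt (hU.mem_nhds hz)).mdifferentiableAt (by simp)
    have hv : mvfderiv (𝓡 n) (fun z => chartMap n x₀ z - e₀) z v =
        mvfderiv (𝓡 n) (chartMap n x₀) z v := by
      have := mvfderiv_comp_fderiv (h := fun e : EuclideanSpace ℝ (Fin n) => e - e₀)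
        (f := chartMap n x₀) (x := z) (by fun_prop) (mdifferentiableAt_chartMap hz.1) v
      rw [this, fderiv_sub_const]
      simp
    have hAP := A.hasFDerivAt.comp (chartMap n x₀ z - e₀) hPz
    have h1 := mvfderiv_comp_fderiv (f := fun z => chartMap n x₀ z - e₀) (h := fun e => A (P e)) hAP.differentiableAt hs v
    have hz' : Θ (chartMap n x₀ z - e₀) = θ z := by
      simp only [Θ, sub_add_cancel]
      rw [χ.left_inv (by simpa [χ] using hz.1)]
    rw [show mvfderiv (𝓡 n) Q z v = _ from h1, hv, show fderiv ℝ (fun e => A (P e))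
      (chartMap n x₀ z - e₀) = _ from hAP.fderiv]
    simp only [ContinuousLinearMap.comp_apply, hz']
    rfl

end LocalRadial

/-! ## The volume form of a radial immersion -/

section RadialVolume

/-- The determinant as a continuous multilinear map of the rows. -/
noncomputable def detCMM (n : ℕ) :
    ContinuousMultilinearMap ℝ (fun _ : Fin n => Fin n → ℝ) ℝ where
  toMultilinearMap := (Matrix.detRowAlternating (n := Fin n) (R := ℝ)).toMultilinearMap
  cont := by
    change Continuous fun m : Fin n → Fin n → ℝ => Matrix.det (Matrix.of m)
    exact Continuous.matrix_det continuous_id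

theorem detCMM_apply (n : ℕ) (w : Fin n → Fin n → ℝ) :
    detCMM n w = Matrix.detRowAlternating (n := Fin n) (R := ℝ) w := rfl

variable {n : ℕ} {M : Type*} [TopologicalSpace M] [ChartedSpace (EuclideanSpace ℝ (Fin n)) M]
  [IsManifold (𝓡 n) ∞ M] {f : M → Fin (n + 1) → ℝ} {U : Set M}

theorem eventually_eq_of_mvfderiv_eq_zero {F : Type*} [NormedAddCommGroup F] [NormedSpace ℝ F]
    {h : M → F} (hU : IsOpen U) (hh : ContMDiffOn (𝓡 n) 𝓘(ℝ, F) ∞ h U)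
    (h0 : ∀ x ∈ U, ∀ v, mvfderiv (𝓡 n) h x v = 0) {x : M} (hx : x ∈ U) :
    ∀ᶠ z in 𝓝 x, h z = h x := by
  have hxs : x ∈ chartSource n x := mem_chart_source _ x
  have hI := isOpen_chartImage (n := n) x hU
  have hc := contDiffOn_inChart le_rfl hh x
  have hxI := chartMap_mem_chartImage (n := n) hxs hx
  obtain ⟨ε, hε, hB⟩ := Metric.isOpen_iff.1 hI _ hxI
  have hd : ∀ e ∈ chartImage n x U, DifferentiableAt ℝ (inChart n x h) e := fun e he =>
    (hc.contDiffAt (hI.mem_nhds he)).differentiableAt (by simp)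
  have hzero : ∀ e ∈ chartImage n x U, fderiv ℝ (inChart n x h) e = 0 := by
    intro e he
    have h1 : (extChartAt (𝓡 n) x).symm e ∈ chartSource n x := by
      simpa using (extChartAt (𝓡 n) x).map_target he.1
    have h2 : chartMap n x ((extChartAt (𝓡 n) x).symm e) = e := (extChartAt (𝓡 n) x).right_inv he.1
    ext a
    have h3 := mvfderiv_eq_inChart h1 (h := h) (by rw [h2]; exact hd e he)
      (coordField x a ((extChartAt (𝓡 n) x).symm e))
    rw [h0 _ he.2, mvfderiv_chartMap_coordField h1, h2] at h3
    exact h3.symm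
  have hconst : ∀ e ∈ Metric.ball (chartMap n x x) ε,
      inChart n x h e = inChart n x h (chartMap n x x) := fun e he =>
    Metric.isOpen_ball.is_const_of_fderiv_eq_zero (convex_ball _ _).isPreconnected
      (fun e he => (hd e (hB he)).differentiableWithinAt) (fun e he => hzero e (hB he)) he
      (Metric.mem_ball_self hε)
  have hcont : ContinuousAt (chartMap n x) x := continuousAt_extChartAt x
  filter_upwards [hcont.eventually (Metric.ball_mem_nhds _ hε),
    (isOpen_chartSource x).mem_nhds hxs] with z hz hzs
  have := hconst _ hz
  rwa [inChart_chartMap hzs, inChart_chartMap hxs] at this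

theorem mvfderiv_detCMM {m : ℕ} {G : Fin m → M → Fin m → ℝ} {x : M}
    (hG : ∀ i, ContMDiffAt (𝓡 n) 𝓘(ℝ, Fin m → ℝ) ∞ (G i) x) (v : TangentSpace (𝓡 n) x) :
    mvfderiv (𝓡 n) (fun z => detCMM m (fun i => G i z)) x v =
      ∑ i, detCMM m (Function.update (fun i => G i x) i (mvfderiv (𝓡 n) (G i) x v)) := by
  have hp : MDifferentiableAt (𝓡 n) 𝓘(ℝ, Fin m → Fin m → ℝ) (fun z i => G i z) x :=
    (contMDiffAt_pi_space.2 hG).mdifferentiableAt (by simp)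
  have h1 := mvfderiv_comp_fderiv (h := detCMM m) ((detCMM m).hasFDerivAt _).differentiableAt hp v
  rw [h1, ((detCMM m).hasFDerivAt _).fderiv, ContinuousMultilinearMap.linearDeriv_apply]
  refine Finset.sum_congr rfl fun i _ => ?_
  congr 2
  exact (mvfderiv_clm_comp (ContinuousLinearMap.proj (R := ℝ)
    (φ := fun _ : Fin m => Fin m → ℝ) i) hp v).symm

/-- The volume form `det(f, df, …, df)` of a radial immersion. -/
noncomputable def radialVol (f : M → Fin (n + 1) → ℝ) (x : M) :
    (TangentSpace (𝓡 n) x) [⋀^Fin n]→ₗ[ℝ] ℝ :=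
  ((Matrix.detRowAlternating (n := Fin (n + 1)) (R := ℝ)).curryLeft (f x)).compLinearMap
    (mvfderiv (𝓡 n) f x).toLinearMap

theorem radialVol_apply (f : M → Fin (n + 1) → ℝ) (x : M) (Y : Fin n → TangentSpace (𝓡 n) x) :
    radialVol f x Y = detCMM (n + 1) (Matrix.vecCons (f x) fun i => mvfderiv (𝓡 n) f x (Y i)) := rfl

theorem IsRadialImmersionOn.contMDiffOn_radialVol (hf : IsRadialImmersionOn f U)
    {Y : Fin n → Π x : M, TangentSpace (𝓡 n) x} (hY : ∀ i, IsSmoothFieldOn (Y i) U) :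
    ContMDiffOn (𝓡 n) 𝓘(ℝ, ℝ) ∞ (fun z => radialVol f z (fun i => Y i z)) U := by
  refine ((detCMM (n + 1)).contDiff.contMDiff (n := ∞)).comp_contMDiffOn
    (contMDiffOn_pi_space.2 fun k => ?_)
  refine Fin.cases ?_ (fun i => ?_) k
  · exact hf.smooth
  · exact contMDiffOn_mvfderiv_apply hf.isOpen hf.smooth (hY i)

theorem IsRadialImmersionOn.radialVol_ne_zero (hf : IsRadialImmersionOn f U) {x : M} (hx : x ∈ U)
    {Y : Fin n → TangentSpace (𝓡 n) x} (hY : LinearIndependent ℝ Y) : radialVol f x Y ≠ 0 := by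
  have h1 : LinearIndependent ℝ (Fin.cons (f x) fun i => mvfderiv (𝓡 n) f x (Y i) :
      Fin (n + 1) → Fin (n + 1) → ℝ) := by
    refine linearIndependent_finCons.2 ⟨?_, fun hmem => ?_⟩
    · exact hY.map' (mvfderiv (𝓡 n) f x).toLinearMap
        (LinearMap.ker_eq_bot.2 (hf.injective_mvfderiv hx))
    · have h2 : Submodule.span ℝ (range fun i => mvfderiv (𝓡 n) f x (Y i)) ≤
          LinearMap.range (mvfderiv (𝓡 n) f x).toLinearMap :=
        Submodule.span_le.2 (range_subset_iff.2 fun i => ⟨Y i, rfl⟩)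
      obtain ⟨v, hv⟩ := h2 hmem
      have h3 : radialFrame f x (v, 0) = radialFrame f x (0, 1) := by
        rw [radialFrame_apply, radialFrame_apply, zero_smul, add_zero, one_smul, map_zero, zero_add]
        exact hv
      simpa using hf.injective x hx h3
  have h2 : IsUnit (Matrix.of (Fin.cons (f x) fun i => mvfderiv (𝓡 n) f x (Y i) :
      Fin (n + 1) → Fin (n + 1) → ℝ)) := Matrix.linearIndependent_rows_iff_isUnit.1 h1
  exact ((Matrix.isUnit_iff_isUnit_det _).1 h2).ne_zero

theorem radialVol_mulVec (hf : IsRadialImmersionOn f U) (A : Matrix (Fin (n + 1)) (Fin (n + 1)) ℝ)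
    {x : M} (hx : x ∈ U) :
    radialVol (fun z => A.mulVecLin.toContinuousLinearMap (f z)) x = A.det • radialVol f x := by
  ext Y
  rw [AlternatingMap.smul_apply, radialVol_apply, radialVol_apply]
  simp only [mvfderiv_clm_comp A.mulVecLin.toContinuousLinearMap (hf.mdifferentiableAt hx)]
  set R : Matrix (Fin (n + 1)) (Fin (n + 1)) ℝ := Matrix.of
    (Matrix.vecCons (f x) fun i => mvfderiv (𝓡 n) f x (Y i))
  have h1 : (Matrix.vecCons (A.mulVecLin.toContinuousLinearMap (f x))
      fun i => A.mulVecLin.toContinuousLinearMap (mvfderiv (𝓡 n) f x (Y i))) = R * A.transpose := by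
    funext k
    have h2 : ∀ w : Fin (n + 1) → ℝ, A.mulVecLin.toContinuousLinearMap w =
        Matrix.vecMul w A.transpose := fun w => by
      rw [Matrix.vecMul_transpose]; rfl
    refine Fin.cases ?_ (fun i => ?_) k
    · rw [Matrix.cons_val_zero, h2]; rfl
    · rw [Matrix.cons_val_succ, h2]; rfl
  rw [h1]
  change Matrix.det (R * A.transpose) = A.det * Matrix.det R
  rw [Matrix.det_mul, Matrix.det_transpose, mul_comm]

variable {D : (Π x : M, TangentSpace (𝓡 n) x) →
      (Π x : M, TangentSpace (𝓡 n) x →L[ℝ] TangentSpace (𝓡 n) x)}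
    {g : Π x : M, TangentSpace (𝓡 n) x →L[ℝ] TangentSpace (𝓡 n) x →L[ℝ] ℝ}

/-- The volume form of a radial immersion is parallel. -/
theorem IsRadialFor.mvfderiv_radialVol (hf : IsRadialFor D g f U)
    {Y : Fin n → Π x : M, TangentSpace (𝓡 n) x} (hY : ∀ i, IsSmoothFieldOn (Y i) U) {x : M}
    (hx : x ∈ U) (v : TangentSpace (𝓡 n) x) :
    mvfderiv (𝓡 n) (fun z => radialVol f z (fun i => Y i z)) x v =
      ∑ i, radialVol f x (Function.update (fun j => Y j x) i (D (Y i) x v)) := by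
  set G : Fin (n + 1) → M → Fin (n + 1) → ℝ := fun k z =>
    Matrix.vecCons (f z) (fun i => mvfderiv (𝓡 n) f z (Y i z)) k
  have hG : ∀ k, ContMDiffAt (𝓡 n) 𝓘(ℝ, Fin (n + 1) → ℝ) ∞ (G k) x := by
    intro k
    refine Fin.cases ?_ (fun i => ?_) k
    · exact hf.smooth.contMDiffAt (hf.isOpen.mem_nhds hx)
    · exact (contMDiffOn_mvfderiv_apply hf.isOpen hf.smooth (hY i)).contMDiffAt
        (hf.isOpen.mem_nhds hx)
  have h1 := mvfderiv_detCMM hG v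
  change mvfderiv (𝓡 n) (fun z => detCMM (n + 1) (fun k => G k z)) x v = _
  rw [h1, Fin.sum_univ_succ]
  have hrow : ∀ w : Fin (n + 1) → ℝ, (fun k => G k x) =
      Matrix.vecCons (f x) (fun i => mvfderiv (𝓡 n) f x (Y i x)) := fun _ => rfl
  -- Differentiating the first row replaces `f` by `df(v)`; then all `n + 1` rows lie in the image
  -- of the `n`-dimensional tangent space.
  have h2 : detCMM (n + 1) (Function.update (fun k => G k x) 0 (mvfderiv (𝓡 n) (G 0) x v)) = 0 := by
    have e : Function.update (fun k => G k x) 0 (mvfderiv (𝓡 n) (G 0) x v) =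
        (mvfderiv (𝓡 n) f x).toLinearMap ∘ (Fin.cons v fun i => Y i x :
          Fin (n + 1) → TangentSpace (𝓡 n) x) := by
      funext k
      refine Fin.cases ?_ (fun i => ?_) k
      · rw [Function.update_self]; rfl
      · rw [Function.update_of_ne (Fin.succ_ne_zero i)]; rfl
    rw [e, detCMM_apply]
    refine AlternatingMap.map_linearDependent _ _ fun hli => ?_
    have h3 := (LinearIndependent.of_comp _ hli).fintype_card_le_finrank
    rw [finrank_tangentSpace, Fintype.card_fin] at h3
    omega
  rw [h2, zero_add]
  refine Finset.sum_congr rfl fun i _ => ?_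
  have h3 : mvfderiv (𝓡 n) (G i.succ) x v = mvfderiv (𝓡 n) f x (D (Y i) x v) +
      g x (Y i x) v • f x := hf.second x hx (Y i) ((hY i).isDiffFieldAt hf.isOpen hx) v
  rw [h3, ContinuousMultilinearMap.map_update_add, ContinuousMultilinearMap.map_update_smul]
  -- The radial part of the second derivative repeats the first row, so only the term with `D`
  -- survives.
  have h4 : detCMM (n + 1) (Function.update (fun k => G k x) i.succ (f x)) = 0 := by
    rw [detCMM_apply]
    refine AlternatingMap.map_eq_zero_of_eq _ _ (i := 0) (j := i.succ) ?_ (Fin.succ_ne_zero i).symm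
    rw [Function.update_self, Function.update_of_ne (Fin.succ_ne_zero i).symm]
    rfl
  rw [h4, smul_zero, add_zero, radialVol_apply]
  congr 1
  funext k
  refine Fin.cases ?_ (fun j => ?_) k
  · rw [Function.update_of_ne (Fin.succ_ne_zero i).symm]; rfl
  · rcases eq_or_ne j i with rfl | hj
    · rw [Function.update_self, Matrix.cons_val_succ, Function.update_self]
    · rw [Function.update_of_ne (fun h => hj (Fin.succ_injective _ h)), Matrix.cons_val_succ,
        Function.update_of_ne hj]
      rfl

/-- Forms of top degree are determined by one value on a basis, since a permutation of the basis
only contributes a sign. -/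
theorem AlternatingMap.eq_smul_of_apply_ne_zero {V : Type*} [AddCommGroup V] [Module ℝ V]
    (b : Module.Basis (Fin n) ℝ V) (μ η : V [⋀^Fin n]→ₗ[ℝ] ℝ) (h : η b ≠ 0) :
    μ = (μ b / η b) • η := by
  refine Module.Basis.ext_alternating b fun i hi => ?_
  obtain ⟨σ, hσ⟩ : ∃ σ : Equiv.Perm (Fin n), ⇑σ = i :=
    ⟨Equiv.ofBijective i (Finite.injective_iff_bijective.1 hi), rfl⟩
  have h1 : (fun k => b (i k)) = b ∘ σ := by rw [hσ]; rfl
  rw [h1, AlternatingMap.smul_apply, AlternatingMap.map_perm, AlternatingMap.map_perm]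
  simp only [smul_eq_mul]
  rw [mul_smul_comm, div_mul_cancel₀ _ h]

/-- The basis of coordinate fields. -/
noncomputable def coordBasis {x₀ z : M} (hz : z ∈ chartSource n x₀) :
    Module.Basis (Fin n) ℝ (TangentSpace (𝓡 n) z) :=
  (EuclideanSpace.basisFun (Fin n) ℝ).toBasis.map
    (LinearEquiv.ofBijective (mvfderiv (𝓡 n) (chartMap n x₀) z).toLinearMap
      (by
        obtain ⟨e, he⟩ := isInvertible_mvfderiv_chartMap (n := n) hz
        rw [← he]
        exact e.bijective)).symm

theorem coordBasis_apply {x₀ z : M} (hz : z ∈ chartSource n x₀) (i : Fin n) :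
    coordBasis hz i = coordField x₀ (EuclideanSpace.single i 1) z := by
  rw [← coordField_mvfderiv_chartMap hz (coordBasis hz i)]
  congr 1
  have : ∀ e : TangentSpace (𝓡 n) z ≃ₗ[ℝ] EuclideanSpace ℝ (Fin n), ∀ w, e (e.symm w) = w := by simp
  simp only [coordBasis, Module.Basis.map_apply, OrthonormalBasis.coe_toBasis,
    EuclideanSpace.basisFun_apply]
  exact LinearEquiv.apply_symm_apply (LinearEquiv.ofBijective
    (mvfderiv (𝓡 n) (chartMap n x₀) z).toLinearMap _) _

omit [IsManifold (𝓡 n) ∞ M] in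
theorem mulVecLin_injective {A : Matrix (Fin (n + 1)) (Fin (n + 1)) ℝ} (hA : A.det ≠ 0) :
    Function.Injective A.mulVecLin.toContinuousLinearMap :=
  Matrix.mulVec_injective_of_isUnit ((Matrix.isUnit_iff_isUnit_det A).2 (isUnit_iff_ne_zero.2 hA))

/-- A parallel volume form is a constant multiple of the one given by a radial immersion. -/
theorem IsRadialFor.eventually_vol_eq_smul [T2Space M] {D : TangentConnection n M}
    (hf : IsRadialFor D.toFun g f U) {vol : Π x : M, (TangentSpace (𝓡 n) x) [⋀^Fin n]→ₗ[ℝ] ℝ}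
    (hvol : IsVolumeForm vol) (hpar : PreservesForm D vol) {x₀ : M} (hx₀ : x₀ ∈ U) :
    ∃ c : ℝ, c ≠ 0 ∧ ∀ᶠ z in 𝓝 x₀, vol z = c • radialVol f z := by
  have hO := isOpen_chartSource (n := n) x₀
  have hxs : x₀ ∈ chartSource n x₀ := mem_chart_source _ x₀
  choose Y hY hYe using fun i : Fin n => exists_smooth_field_eventuallyEq hO
    (isSmoothFieldOn_coordField x₀ (EuclideanSpace.single i 1)) hxs
  obtain ⟨W, hWsub, hW, hxW⟩ := mem_nhds_iff.1 (Filter.inter_mem (Filter.inter_mem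
    (hO.mem_nhds hxs) (hf.isOpen.mem_nhds hx₀)) (Filter.eventually_all.2 hYe))
  have hfW := hf.restrict hW fun z hz => (hWsub hz).1.2
  have hYb : ∀ z (hz : z ∈ W), (fun i => Y i z) = coordBasis (hWsub hz).1.1 := by
    intro z hz
    funext i
    rw [coordBasis_apply, (hWsub hz).2 i]
  have hYW : ∀ i, IsSmoothFieldOn (Y i) W := fun i => ContMDiffOn.mono (hY i) (subset_univ _)
  set v : M → ℝ := fun z => vol z fun i => Y i z
  set w : M → ℝ := fun z => radialVol f z fun i => Y i z
  have hw0 : ∀ z ∈ W, w z ≠ 0 := fun z hz => hfW.radialVol_ne_zero hz (by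
    rw [hYb z hz]; exact (coordBasis _).linearIndependent)
  have hv : ContMDiffOn (𝓡 n) 𝓘(ℝ, ℝ) ∞ v W := (hvol.smooth Y hY).contMDiffOn
  have hw : ContMDiffOn (𝓡 n) 𝓘(ℝ, ℝ) ∞ w W := hfW.contMDiffOn_radialVol hYW
  set q : M → ℝ := fun z => v z / w z
  have hq : ContMDiffOn (𝓡 n) 𝓘(ℝ, ℝ) ∞ q W := hv.div₀ hw hw0
  have hvq : ∀ z ∈ W, vol z = q z • radialVol f z := by
    intro z hz
    have h0 := hw0 z hz
    simp only [q, v, w] at h0 ⊢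
    rw [hYb z hz] at h0 ⊢
    exact AlternatingMap.eq_smul_of_apply_ne_zero _ _ _ h0
  -- Both forms are parallel, so the derivatives of `v` and `w` are given by the same sum and `dv =
  -- q dw`. With `v = q w` this leaves `w dq = 0`.
  have hdq : ∀ z ∈ W, ∀ a, mvfderiv (𝓡 n) q z a = 0 := by
    intro z hz a
    have hqz := (hq.contMDiffAt (hW.mem_nhds hz)).mdifferentiableAt (by simp)
    have hwz := (hw.contMDiffAt (hW.mem_nhds hz)).mdifferentiableAt (by simp)
    have h1 := mvfderiv_smul_apply hqz hwz a
    have h2 : mvfderiv (𝓡 n) (fun z => q z • w z) z a = mvfderiv (𝓡 n) v z a := by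
      refine congrArg (fun A : TangentSpace (𝓡 n) z →L[ℝ] ℝ => A a) (mvfderiv_congr ?_)
      filter_upwards [hW.mem_nhds hz] with u hu
      exact div_mul_cancel₀ _ (hw0 u hu)
    rw [h2, hpar Y hY z a, hfW.mvfderiv_radialVol hYW hz a, hvq z hz, Finset.smul_sum] at h1
    simp only [AlternatingMap.smul_apply] at h1
    have h3 := add_eq_right.1 h1.symm
    exact (mul_eq_zero.1 h3).resolve_right (hw0 z hz)
  refine ⟨q x₀, fun h0 => hvol.ne_zero x₀ ?_, ?_⟩
  · rw [hvq x₀ hxW, h0, zero_smul]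
  · filter_upwards [eventually_eq_of_mvfderiv_eq_zero hW hq hdq hxW, hW.mem_nhds hxW] with z hz hzW
    rw [hvq z hzW, hz]

theorem exists_isRadialFor_vol [T2Space M] {D : TangentConnection n M} {h : SymmTwoTensor n M}
    (hD : CovariantDerivative.ContMDiffCovariantDerivative D ∞)
    (hflat : IsFlatOn (EuclideanSpace ℝ (Fin n) × ℝ) (extendedConnection D h).toFun univ)
    {vol : Π x : M, (TangentSpace (𝓡 n) x) [⋀^Fin n]→ₗ[ℝ] ℝ}
    (hvol : IsVolumeForm vol) (hpar : PreservesForm D vol) (x₀ : M) :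
    ∃ (f : M → Fin (n + 1) → ℝ) (U : Set M), x₀ ∈ U ∧ IsRadialFor D.toFun h.toFun f U ∧
      ∀ z ∈ U, radialVol f z = vol z := by
  obtain ⟨f, U, hx, hf⟩ := exists_isRadialFor hD hflat x₀
  obtain ⟨c, hc, he⟩ := hf.eventually_vol_eq_smul hvol hpar hx
  obtain ⟨W, hWsub, hW, hxW⟩ := mem_nhds_iff.1 (Filter.inter_mem (hf.isOpen.mem_nhds hx) he)
  -- The matrix with diagonal `(c, 1, …, 1)` has determinant `c`, and composing with it multiplies
  -- the volume form of `f` by `c`.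
  set A : Matrix (Fin (n + 1)) (Fin (n + 1)) ℝ := Matrix.diagonal (Function.update 1 0 c)
  have hA : A.det = c := by
    rw [Matrix.det_diagonal, Fin.prod_univ_succ, Function.update_self]
    simp
  have hfW := hf.restrict hW fun z hz => (hWsub hz).1
  refine ⟨_, W, hxW, hfW.clm_comp (mulVecLin_injective (by rwa [hA])), fun z hz => ?_⟩
  rw [radialVol_mulVec hfW.toIsRadialImmersionOn A hz, hA, (hWsub hz).2]

end RadialVolume

/-! ## Uniqueness of radial immersions, and the developing map -/

section Transition

variable {n : ℕ} {M : Type*} [TopologicalSpace M] [ChartedSpace (EuclideanSpace ℝ (Fin n)) M]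
  [IsManifold (𝓡 n) ∞ M] {f f' f'' : M → Fin (n + 1) → ℝ} {U U' U'' : Set M}

/-- The linear map that takes the frame of `f` to the frame of `f'`. -/
noncomputable def transition (f f' : M → Fin (n + 1) → ℝ) (z : M) :
    (Fin (n + 1) → ℝ) →L[ℝ] (Fin (n + 1) → ℝ) :=
  (radialFrame f' z).comp (radialFrame f z).inverse

theorem IsRadialImmersionOn.transition_radialFrame (hf : IsRadialImmersionOn f U) {z : M}
    (hz : z ∈ U) (p : TangentSpace (𝓡 n) z × ℝ) :
    transition f f' z (radialFrame f z p) = radialFrame f' z p := by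
  obtain ⟨e, he⟩ := hf.isInvertible hz
  rw [transition, ContinuousLinearMap.comp_apply, ← he]
  simp

theorem IsRadialImmersionOn.exists_radialFrame_eq (hf : IsRadialImmersionOn f U) {z : M}
    (hz : z ∈ U) (w : Fin (n + 1) → ℝ) : ∃ p, radialFrame f z p = w :=
  ⟨(radialTangent f z w, radialCoeff f z w), by rw [radialFrame_apply, hf.decomp hz]⟩

theorem radialFrame_zero_one (z : M) : radialFrame f z (0, 1) = f z := by
  rw [radialFrame_apply, map_zero, zero_add, one_smul]

theorem IsRadialImmersionOn.transition_apply (hf : IsRadialImmersionOn f U) {z : M}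
    (hz : z ∈ U) : transition f f' z (f z) = f' z := by
  rw [← radialFrame_zero_one (f := f) z, hf.transition_radialFrame hz, radialFrame_zero_one]

theorem IsRadialImmersionOn.transition_self (hf : IsRadialImmersionOn f U) {z : M}
    (hz : z ∈ U) : transition f f z = ContinuousLinearMap.id ℝ _ := by
  ext1 w
  obtain ⟨p, rfl⟩ := hf.exists_radialFrame_eq hz w
  rw [hf.transition_radialFrame hz]
  rfl

theorem IsRadialImmersionOn.transition_comp (hf : IsRadialImmersionOn f U)
    (hf' : IsRadialImmersionOn f' U') {z : M} (hz : z ∈ U) (hz' : z ∈ U') :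
    (transition f' f'' z).comp (transition f f' z) = transition f f'' z := by
  ext1 w
  obtain ⟨p, rfl⟩ := hf.exists_radialFrame_eq hz w
  rw [ContinuousLinearMap.comp_apply, hf.transition_radialFrame hz, hf.transition_radialFrame hz,
    hf'.transition_radialFrame hz']

variable {D : (Π x : M, TangentSpace (𝓡 n) x) →
      (Π x : M, TangentSpace (𝓡 n) x →L[ℝ] TangentSpace (𝓡 n) x)}
    {g : Π x : M, TangentSpace (𝓡 n) x →L[ℝ] TangentSpace (𝓡 n) x →L[ℝ] ℝ}

/-- Decompose a fixed vector as `w = df(u) + r f`. Since `w` does not depend on the point, the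
structure equation gives `D u + r id = 0` and `g(u, ·) + dr = 0`. These equations do not involve
`f`, so `df'(u) + r f'`, the image of `w` under the transition, is locally constant as well. -/
theorem IsRadialFor.eventually_transition_eq (hf : IsRadialFor D g f U)
    (hf' : IsRadialFor D g f' U') {x : M} (hx : x ∈ U) (hx' : x ∈ U') :
    ∀ᶠ z in 𝓝 x, transition f f' z = transition f f' x := by
  set W := U ∩ U'
  have hW : IsOpen W := hf.isOpen.inter hf'.isOpen
  have hfW := hf.restrict hW inter_subset_left
  have hfW' := hf'.restrict hW inter_subset_right
  have key : ∀ w : Fin (n + 1) → ℝ, ∀ᶠ z in 𝓝 x, transition f f' z w = transition f f' x w := by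
    intro w
    set u : Π z : M, TangentSpace (𝓡 n) z := fun z => radialTangent f z w
    set r : M → ℝ := fun z => radialCoeff f z w
    have hu : IsSmoothFieldOn u W := hfW.isSmoothFieldOn_radialTangent contMDiffOn_const
    have hr : ContMDiffOn (𝓡 n) 𝓘(ℝ, ℝ) ∞ r W := hfW.contMDiffOn_radialCoeff contMDiffOn_const
    have hdec : ∀ z ∈ W, mvfderiv (𝓡 n) f z (u z) + r z • f z = w := fun z hz =>
      hfW.decomp hz w
    have htr : ∀ z ∈ W, transition f f' z w = mvfderiv (𝓡 n) f' z (u z) + r z • f' z := by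
      intro z hz
      rw [← radialFrame_apply, ← hfW.transition_radialFrame hz, radialFrame_apply, hdec z hz]
    have hder : ∀ (F : M → Fin (n + 1) → ℝ), IsRadialFor D g F W → ∀ z ∈ W, ∀ v,
        mvfderiv (𝓡 n) (fun z => mvfderiv (𝓡 n) F z (u z) + r z • F z) z v =
          radialFrame F z (D u z v + r z • v, g z (u z) v + mvfderiv (𝓡 n) r z v) := by
      intro F hF z hz v
      have hrz := (hr.contMDiffAt (hW.mem_nhds hz)).mdifferentiableAt (by simp)
      have huz := hu.isDiffFieldAt hW hz
      have hFz := hF.mdifferentiableAt hz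
      have h1 := mvfderiv_add_apply (φ := fun z => mvfderiv (𝓡 n) F z (u z))
        (h := fun z => r z • F z)
        (mdifferentiableAt_mvfderiv_apply hW hF.smooth hz huz) (hrz.smul hFz) v
      rw [h1, hF.second z hz u huz v, mvfderiv_smul_apply hrz hFz, radialFrame_apply, map_add,
        map_smul]
      module
    have hzero : ∀ z ∈ W, ∀ v, (D u z v + r z • v, g z (u z) v + mvfderiv (𝓡 n) r z v) =
        ((0 : TangentSpace (𝓡 n) z × ℝ)) := by
      intro z hz v
      refine (injective_iff_map_eq_zero (radialFrame f z)).1 (hfW.injective z hz) _ ?_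
      rw [← hder f hfW z hz v]
      refine mvfderiv_eq_zero_of_eventually_const (c := w) ?_ v
      filter_upwards [hW.mem_nhds hz] with y hy using hdec y hy
    have hsm : ContMDiffOn (𝓡 n) 𝓘(ℝ, Fin (n + 1) → ℝ) ∞
        (fun z => mvfderiv (𝓡 n) f' z (u z) + r z • f' z) W :=
      (contMDiffOn_mvfderiv_apply hW hfW'.smooth hu).add (ContMDiffOn.smul hr hfW'.smooth)
    have h1 := eventually_eq_of_mvfderiv_eq_zero hW hsm (fun z hz v => by
      rw [hder f' hfW' z hz v, hzero z hz v, map_zero]) ⟨hx, hx'⟩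
    filter_upwards [h1, hW.mem_nhds ⟨hx, hx'⟩] with z hz hzW
    rw [htr z hzW, hz, htr x ⟨hx, hx'⟩]
  have h2 := Filter.eventually_all.2 fun i => key (Pi.single i 1)
  filter_upwards [h2] with z hz
  refine ContinuousLinearMap.coe_injective ((Pi.basisFun ℝ (Fin (n + 1))).ext fun i => ?_)
  simpa using hz i

theorem IsRadialFor.eventually_eq_transition (hf : IsRadialFor D g f U)
    (hf' : IsRadialFor D g f' U') {x : M} (hx : x ∈ U) (hx' : x ∈ U') :
    ∀ᶠ z in 𝓝 x, f' z = transition f f' x (f z) := by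
  filter_upwards [hf.eventually_transition_eq hf' hx hx', hf.isOpen.mem_nhds hx] with z hz hzU
  rw [← hz, hf.transition_apply hzU]

/-- The matrix of `transition`. -/
noncomputable def transitionMatrix (f f' : M → Fin (n + 1) → ℝ) (z : M) :
    Matrix (Fin (n + 1)) (Fin (n + 1)) ℝ :=
  LinearMap.toMatrix' (transition f f' z).toLinearMap

theorem transitionMatrix_mulVec (z : M) (w : Fin (n + 1) → ℝ) :
    (transitionMatrix f f' z).mulVec w = transition f f' z w :=
  LinearMap.toMatrix'_mulVec _ _

theorem radialVol_congr {x : M} (h : f =ᶠ[𝓝 x] f') : radialVol f x = radialVol f' x := by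
  ext Y
  rw [radialVol_apply, radialVol_apply, mvfderiv_congr h, h.self_of_nhds]

theorem exists_linearIndependent_tangent (x : M) :
    ∃ Y : Fin n → TangentSpace (𝓡 n) x, LinearIndependent ℝ Y :=
  ⟨_, (Module.finBasisOfFinrankEq ℝ _ (finrank_tangentSpace (n := n) x)).linearIndependent⟩

theorem IsRadialFor.det_transitionMatrix (hf : IsRadialFor D g f U)
    (hf' : IsRadialFor D g f' U') {x : M} (hx : x ∈ U) (hx' : x ∈ U')
    (hvol : radialVol f x = radialVol f' x) : (transitionMatrix f f' x).det = 1 := by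
  have h1 : f' =ᶠ[𝓝 x] fun z =>
      (transitionMatrix f f' x).mulVecLin.toContinuousLinearMap (f z) := by
    filter_upwards [hf.eventually_eq_transition hf' hx hx'] with z hz
    rw [hz, ← transitionMatrix_mulVec]
    rfl
  have h2 := radialVol_congr h1
  rw [radialVol_mulVec hf.toIsRadialImmersionOn _ hx, ← hvol] at h2
  obtain ⟨Y, hY⟩ := exists_linearIndependent_tangent (n := n) x
  have h3 := congrArg (fun η => η Y) h2
  simp only [AlternatingMap.smul_apply, smul_eq_mul] at h3
  exact (mul_eq_right₀ (hf.radialVol_ne_zero hx hY)).1 h3.symm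

/-- `SL(n+1,ℝ)` with the discrete topology. -/
structure DiscreteSL (n : ℕ) where
  val : Matrix.SpecialLinearGroup (Fin (n + 1)) ℝ

instance (n : ℕ) : TopologicalSpace (DiscreteSL n) := ⊥

instance (n : ℕ) : DiscreteTopology (DiscreteSL n) := ⟨rfl⟩

/-- A matrix of determinant one as an element of `SL`. -/
def mkSL (A : Matrix (Fin (n + 1)) (Fin (n + 1)) ℝ) (h : A.det = 1) :
    Matrix.SpecialLinearGroup (Fin (n + 1)) ℝ := ⟨A, h⟩

theorem coe_mkSL (A : Matrix (Fin (n + 1)) (Fin (n + 1)) ℝ) (h : A.det = 1) :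
    (mkSL A h : Matrix (Fin (n + 1)) (Fin (n + 1)) ℝ) = A := rfl

open Classical in
/-- A matrix of determinant one as an element of `SL`, and `1` for other matrices. -/
noncomputable def toSL (A : Matrix (Fin (n + 1)) (Fin (n + 1)) ℝ) :
    Matrix.SpecialLinearGroup (Fin (n + 1)) ℝ :=
  if h : A.det = 1 then mkSL A h else 1

theorem coe_toSL {A : Matrix (Fin (n + 1)) (Fin (n + 1)) ℝ} (hA : A.det = 1) :
    (toSL A : Matrix (Fin (n + 1)) (Fin (n + 1)) ℝ) = A := by
  rw [toSL, dif_pos hA, coe_mkSL]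

theorem toSL_mul {A B : Matrix (Fin (n + 1)) (Fin (n + 1)) ℝ} (hA : A.det = 1)
    (hB : B.det = 1) : toSL (A * B) = toSL A * toSL B := by
  refine Matrix.SpecialLinearGroup.ext _ _ fun i j => ?_
  rw [coe_toSL (by rw [Matrix.det_mul, hA, hB, mul_one]), Matrix.SpecialLinearGroup.coe_mul,
    coe_toSL hA, coe_toSL hB]

theorem toSL_one : toSL (1 : Matrix (Fin (n + 1)) (Fin (n + 1)) ℝ) = 1 := by
  refine Matrix.SpecialLinearGroup.ext _ _ fun i j => ?_
  rw [coe_toSL Matrix.det_one, Matrix.SpecialLinearGroup.coe_one]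

/-- A covering of `M` by domains of radial immersions with the same volume form. -/
structure RadialAtlas (D : (Π x : M, TangentSpace (𝓡 n) x) →
      (Π x : M, TangentSpace (𝓡 n) x →L[ℝ] TangentSpace (𝓡 n) x))
    (g : Π x : M, TangentSpace (𝓡 n) x →L[ℝ] TangentSpace (𝓡 n) x →L[ℝ] ℝ)
    (vol : Π x : M, (TangentSpace (𝓡 n) x) [⋀^Fin n]→ₗ[ℝ] ℝ) where
  map : M → M → Fin (n + 1) → ℝ
  domain : M → Set M
  mem : ∀ x, x ∈ domain x
  radial : ∀ x, IsRadialFor D g (map x) (domain x)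
  vol_eq : ∀ x, ∀ z ∈ domain x, radialVol (map x) z = vol z

variable {vol : Π x : M, (TangentSpace (𝓡 n) x) [⋀^Fin n]→ₗ[ℝ] ℝ}

theorem RadialAtlas.det_eq (𝒜 : RadialAtlas D g vol) {x y z : M} (hx : z ∈ 𝒜.domain x)
    (hy : z ∈ 𝒜.domain y) : (transitionMatrix (𝒜.map x) (𝒜.map y) z).det = 1 :=
  (𝒜.radial x).det_transitionMatrix (𝒜.radial y) hx hy
    ((𝒜.vol_eq x z hx).trans (𝒜.vol_eq y z hy).symm)

theorem transitionMatrix_mul (hf : IsRadialImmersionOn f U)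
    (hf' : IsRadialImmersionOn f' U') {z : M} (hz : z ∈ U) (hz' : z ∈ U') :
    transitionMatrix f' f'' z * transitionMatrix f f' z = transitionMatrix f f'' z := by
  rw [transitionMatrix, transitionMatrix, transitionMatrix, ← LinearMap.toMatrix'_comp]
  exact congrArg (fun T : (Fin (n + 1) → ℝ) →L[ℝ] (Fin (n + 1) → ℝ) =>
    LinearMap.toMatrix' T.toLinearMap) (hf.transition_comp hf' hz hz')

/-- The flat principal `SL`-bundle of frames of radial immersions. -/
noncomputable def RadialAtlas.bundle (𝒜 : RadialAtlas D g vol) :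
    FiberBundleCore M M (DiscreteSL n) where
  baseSet := 𝒜.domain
  isOpen_baseSet x := (𝒜.radial x).isOpen
  indexAt x := x
  mem_baseSet_at := 𝒜.mem
  -- The coordinate `A` over the domain `i` stands for the germ `A fᵢ`. Writing `fᵢ = T fⱼ` turns it
  -- into `(A T) fⱼ`, hence multiplication on the right. The transitions are locally constant, so
  -- the discrete topology on the fibre is the right one and the bundle is a covering.
  coordChange i j z A := ⟨A.val * toSL (transitionMatrix (𝒜.map j) (𝒜.map i) z)⟩
  coordChange_self i z hz A := by
    have h1 : transitionMatrix (𝒜.map i) (𝒜.map i) z = 1 := by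
      rw [transitionMatrix, (𝒜.radial i).transition_self hz]
      exact LinearMap.toMatrix'_id
    simp only [h1, toSL_one, mul_one]
  continuousOn_coordChange i j := by
    rintro ⟨z, A⟩ ⟨⟨hi, hj⟩, -⟩
    refine ContinuousAt.continuousWithinAt ?_
    have h1 : ∀ᶠ q : M × DiscreteSL n in 𝓝 (z, A), q.2 = A ∧
        transition (𝒜.map j) (𝒜.map i) q.1 = transition (𝒜.map j) (𝒜.map i) z := by
      refine Filter.Eventually.and ?_ ?_
      · exact continuousAt_snd.eventually ((isOpen_discrete {A}).mem_nhds (mem_singleton A))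
      · exact continuousAt_fst.eventually ((𝒜.radial j).eventually_transition_eq (𝒜.radial i) hj hi)
    refine ContinuousAt.congr (f := fun _ => ⟨A.val * toSL
      (transitionMatrix (𝒜.map j) (𝒜.map i) z)⟩) continuousAt_const ?_
    filter_upwards [h1] with q hq
    rw [transitionMatrix, transitionMatrix, hq.1, hq.2]
  coordChange_comp i j k z hz A := by
    rw [mul_assoc, ← toSL_mul (𝒜.det_eq hz.1.2 hz.1.1) (𝒜.det_eq hz.2 hz.1.2),
      transitionMatrix_mul (𝒜.radial k).toIsRadialImmersionOn (𝒜.radial j).toIsRadialImmersionOn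
        hz.2 hz.1.2]

/-- `F` is locally the composition of `p` with a radial immersion with volume form `vol`. -/
def IsDevelopment {M' : Type*} [TopologicalSpace M'] (D : (Π x : M, TangentSpace (𝓡 n) x) →
      (Π x : M, TangentSpace (𝓡 n) x →L[ℝ] TangentSpace (𝓡 n) x))
    (g : Π x : M, TangentSpace (𝓡 n) x →L[ℝ] TangentSpace (𝓡 n) x →L[ℝ] ℝ)
    (vol : Π x : M, (TangentSpace (𝓡 n) x) [⋀^Fin n]→ₗ[ℝ] ℝ) (p : M' → M)
    (F : M' → Fin (n + 1) → ℝ) : Prop :=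
  ∀ x : M', ∃ (f : M → Fin (n + 1) → ℝ) (U : Set M), p x ∈ U ∧ IsRadialFor D g f U ∧
    (∀ z ∈ U, radialVol f z = vol z) ∧ ∀ᶠ z in 𝓝 x, F z = f (p z)

/-- The developing map of a radial atlas on a simply connected covering. -/
theorem RadialAtlas.exists_isDevelopment (𝒜 : RadialAtlas D g vol) {M' : Type*}
    [TopologicalSpace M'] [LocallyPathConnectedSpace M'] [SimplyConnectedSpace M'] (p : C(M', M)) :
    ∃ F : M' → Fin (n + 1) → ℝ, IsDevelopment D g vol p F := by
  let Z := 𝒜.bundle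
  have hcov : IsCoveringMap (Bundle.TotalSpace.proj : Z.TotalSpace → M) :=
    FiberBundle.isCoveringMap (F := DiscreteSL n) (E := Z.Fiber)
  obtain ⟨a₀⟩ : Nonempty M' := inferInstance
  -- Simple connectedness of `M'` lifts `p` to the covering. The starting value `1` is a choice.
  obtain ⟨s, ⟨-, hs⟩, -⟩ := hcov.existsUnique_continuousMap_lifts p a₀
    ⟨p a₀, (⟨1⟩ : DiscreteSL n)⟩ rfl
  have hs' : ∀ x, (s x).proj = p x := fun x => congrFun hs x
  let A : M' → Matrix.SpecialLinearGroup (Fin (n + 1)) ℝ := fun x => DiscreteSL.val (s x).snd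
  refine ⟨fun x => (A x).1.mulVec (𝒜.map (p x) (p x)), fun x => ?_⟩
  set i := p x
  have hdom : ∀ᶠ z in 𝓝 x, p z ∈ 𝒜.domain i :=
    p.continuous.continuousAt.eventually ((𝒜.radial i).isOpen.mem_nhds (𝒜.mem i))
  set B : M' → DiscreteSL n := fun z => (Z.localTriv i (s z)).2
  have hBval : ∀ z, B z = ⟨A z *
      toSL (transitionMatrix (𝒜.map i) (𝒜.map (p z)) (p z))⟩ := by
    intro z
    simp only [B]
    rw [FiberBundleCore.localTriv_apply, ← hs' z]
    rfl
  -- In a fixed trivialisation the lift has a continuous, hence locally constant, discrete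
  -- coordinate `C`, so the map is `C fᵢ ∘ p` near `x`.
  have hB : ∀ᶠ z in 𝓝 x, B z = B x := by
    have hc : ContinuousAt B x := by
      have h1 : s x ∈ (Z.localTriv i).source := by
        rw [Z.mem_localTriv_source, hs']
        exact 𝒜.mem i
      exact continuousAt_snd.comp (((Z.localTriv i).continuousAt h1).comp s.continuous.continuousAt)
    exact hc.eventually ((isOpen_discrete {B x}).mem_nhds rfl)
  let C : Matrix.SpecialLinearGroup (Fin (n + 1)) ℝ := (B x).val
  have hC : C.1.det = 1 := C.2
  refine ⟨fun z => C.1.mulVecLin.toContinuousLinearMap (𝒜.map i z), 𝒜.domain i, 𝒜.mem i,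
    (𝒜.radial i).clm_comp (mulVecLin_injective (by rw [hC]; exact one_ne_zero)), ?_, ?_⟩
  · intro z hz
    rw [radialVol_mulVec (𝒜.radial i).toIsRadialImmersionOn C.1 hz, hC, one_smul, 𝒜.vol_eq i z hz]
  · filter_upwards [hB, hdom] with z hz hzd
    have h1 := 𝒜.det_eq hzd (𝒜.mem (p z))
    have h2 : C = A z * toSL (transitionMatrix (𝒜.map i) (𝒜.map (p z)) (p z)) := by
      have := hBval z
      rw [hz] at this
      exact congrArg DiscreteSL.val this
    change _ = C.1.mulVec (𝒜.map i (p z))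
    rw [h2, Matrix.SpecialLinearGroup.coe_mul, coe_toSL h1, ← Matrix.mulVec_mulVec, transitionMatrix_mulVec,
      (𝒜.radial i).transition_apply hzd]

variable {M' : Type*} [TopologicalSpace M'] {p : M' → M} {F : M' → Fin (n + 1) → ℝ}

/-- The values of `f` and of its differential at `x` span `ℝⁿ⁺¹`, so a matrix is determined by its
action on the germ of `f`. -/
theorem eq_of_mulVec_eventually_eq {A B : Matrix (Fin (n + 1)) (Fin (n + 1)) ℝ}
    (hf : IsRadialImmersionOn f U) {x : M} (hx : x ∈ U)
    (h : ∀ᶠ z in 𝓝 x, A.mulVec (f z) = B.mulVec (f z)) : A = B := by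
  refine Matrix.toLin'.injective (LinearMap.ext fun w => ?_)
  obtain ⟨q, rfl⟩ := hf.exists_radialFrame_eq hx w
  have e : (fun z => A.mulVecLin.toContinuousLinearMap (f z)) =ᶠ[𝓝 x]
    fun z => B.mulVecLin.toContinuousLinearMap (f z) := h
  have h1 := radialFrame_congr e
  have h2 := radialFrame_clm_comp hf A.mulVecLin.toContinuousLinearMap hx q
  rw [h1, radialFrame_clm_comp hf B.mulVecLin.toContinuousLinearMap hx q] at h2
  exact h2.symm

/-- The developing map is equivariant under deck transformations. -/
theorem IsDevelopment.existsUnique_holonomy [PreconnectedSpace M'] [Nonempty M']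
    (hF : IsDevelopment D g vol p F) (hp : Continuous p) (hp' : IsOpenMap p) (γ : M' ≃ₜ M')
    (hγ : ∀ x, p (γ x) = p x) :
    ∃! A : Matrix.SpecialLinearGroup (Fin (n + 1)) ℝ, ∀ x, F (γ x) = A.1.mulVec (F x) := by
  have hex : ∀ x : M', ∃ A : Matrix.SpecialLinearGroup (Fin (n + 1)) ℝ,
      ∀ᶠ z in 𝓝 x, F (γ z) = A.1.mulVec (F z) := by
    intro x
    obtain ⟨f, U, hxU, hf, hvol, he⟩ := hF x
    obtain ⟨f', U', hxU', hf', hvol', he'⟩ := hF (γ x)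
    rw [hγ] at hxU'
    refine ⟨mkSL (transitionMatrix f f' (p x)) (hf.det_transitionMatrix hf' hxU hxU'
      ((hvol _ hxU).trans (hvol' _ hxU').symm)), ?_⟩
    filter_upwards [he, γ.continuous.continuousAt.eventually he',
      hp.continuousAt.eventually (hf.eventually_eq_transition hf' hxU hxU')] with z h1 h2 h3
    rw [h2, hγ, h3, h1]
    exact (transitionMatrix_mulVec _ _).symm
  have huniq : ∀ (x : M') (A B : Matrix.SpecialLinearGroup (Fin (n + 1)) ℝ),
      (∀ᶠ z in 𝓝 x, F (γ z) = A.1.mulVec (F z)) → (∀ᶠ z in 𝓝 x, F (γ z) = B.1.mulVec (F z)) →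
      A = B := by
    intro x A B hA hB
    obtain ⟨f, U, hxU, hf, -, he⟩ := hF x
    refine Subtype.ext (eq_of_mulVec_eventually_eq hf.toIsRadialImmersionOn hxU ?_)
    have h1 : ∀ᶠ z in 𝓝 x, A.1.mulVec (f (p z)) = B.1.mulVec (f (p z)) := by
      filter_upwards [hA, hB, he] with z h1 h2 h3
      rw [← h3, ← h1, h2]
    have h2 := hp'.image_mem_nhds h1
    filter_upwards [h2]
    rintro _ ⟨z, hz, rfl⟩
    exact hz
  choose A hA using hex
  -- The matrix chosen at `x` also works at nearby points, where uniqueness identifies it with the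
  -- one chosen there.
  have hlc : IsLocallyConstant A := by
    rw [IsLocallyConstant.iff_eventually_eq]
    intro x
    filter_upwards [(hA x).eventually_nhds] with z hz
    exact huniq z _ _ (hA z) hz
  obtain ⟨x₀⟩ := ‹Nonempty M'›
  refine ⟨A x₀, fun x => ?_, fun B hB => ?_⟩
  · rw [hlc.apply_eq_of_preconnectedSpace x₀ x]
    exact (hA x).self_of_nhds
  · exact huniq x₀ _ _ (Filter.Eventually.of_forall hB) (hA x₀)

/-- The holonomy of a developing map. -/
noncomputable def IsDevelopment.holonomy [PreconnectedSpace M'] [Nonempty M']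
    (hF : IsDevelopment D g vol p F) (hp : Continuous p) (hp' : IsOpenMap p) :
    DeckGroup p →* Matrix.SpecialLinearGroup (Fin (n + 1)) ℝ :=
  MonoidHom.mk' (fun γ => (hF.existsUnique_holonomy hp hp' γ.1 γ.2).choose) fun γ δ => by
    have hs := fun γ : DeckGroup p => (hF.existsUnique_holonomy hp hp' γ.1 γ.2).choose_spec
    refine ((hs (γ * δ)).2 _ fun x => ?_).symm
    change F (γ.1 (δ.1 x)) = _
    rw [(hs γ).1, (hs δ).1, Matrix.SpecialLinearGroup.coe_mul, Matrix.mulVec_mulVec]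

theorem IsDevelopment.holonomy_spec [PreconnectedSpace M'] [Nonempty M']
    (hF : IsDevelopment D g vol p F) (hp : Continuous p) (hp' : IsOpenMap p) (γ : DeckGroup p)
    (x : M') : F (γ.1 x) = (hF.holonomy hp hp' γ).1.mulVec (F x) :=
  (hF.existsUnique_holonomy hp hp' γ.1 γ.2).choose_spec.1 x

end Transition

/-! ## Koszul's convexity theorem -/

section Koszul

/-- A convex function lies above its tangent line at `0`; the interval is half-open because it is
applied up to a blow-up time. -/
theorem add_mul_le_of_hasDerivAt2_nonneg {u u1 u2 : ℝ → ℝ} {b : ℝ}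
    (h1 : ∀ t ∈ Ico 0 b, HasDerivAt u (u1 t) t) (h2 : ∀ t ∈ Ico 0 b, HasDerivAt u1 (u2 t) t)
    (h3 : ∀ t ∈ Ico 0 b, 0 ≤ u2 t) {t : ℝ} (ht : t ∈ Ico 0 b) : u 0 + u1 0 * t ≤ u t := by
  have h0 : (0 : ℝ) ∈ Ico 0 b := ⟨le_rfl, ht.1.trans_lt ht.2⟩
  have hmono : MonotoneOn u1 (Ico 0 b) := monotoneOn_of_hasDerivWithinAt_nonneg (convex_Ico 0 b)
    (fun s hs => (h2 s hs).continuousAt.continuousWithinAt)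
    (fun s hs => (h2 s (interior_subset hs)).hasDerivWithinAt) fun s hs => h3 s (interior_subset hs)
  have hmono2 : MonotoneOn (fun s => u s - u1 0 * s) (Ico 0 b) :=
    monotoneOn_of_hasDerivWithinAt_nonneg (f' := fun s => u1 s - u1 0) (convex_Ico 0 b)
      (fun s hs => ((h1 s hs).continuousAt.sub (by fun_prop)).continuousWithinAt)
      (fun s hs => by
        have := (h1 s (interior_subset hs)).sub ((hasDerivAt_id s).const_mul (u1 0))
        simp only [mul_one] at this
        exact this.hasDerivWithinAt)
      fun s hs => sub_nonneg.2 (hmono h0 (interior_subset hs) (interior_subset hs).1)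
  have := hmono2 h0 ht ht.1
  simp only [mul_zero, sub_zero] at this
  linarith

variable {N V : Type*} [TopologicalSpace N] [NormedAddCommGroup V] [NormedSpace ℝ V]

/-- `σ` is a continuous section of `q` on `C`. -/
structure IsSectionOn (q : N → V) (σ : V → N) (C : Set V) : Prop where
  cont : ContinuousOn σ C
  right_inv : ∀ v ∈ C, q (σ v) = v

variable {q : N → V} {σ σ' : V → N} {C C' : Set V}

theorem IsSectionOn.mono (h : IsSectionOn q σ C) (hC : C' ⊆ C) : IsSectionOn q σ C' :=
  ⟨h.cont.mono hC, fun v hv => h.right_inv v (hC hv)⟩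

theorem IsSectionOn.eqOn [T2Space N] (hq : IsLocalHomeomorph q) (h : IsSectionOn q σ C)
    (h' : IsSectionOn q σ' C) (hC : IsPreconnected C) {a : V} (ha : a ∈ C) (e : σ a = σ' a) :
    EqOn σ σ' C :=
  (T2Space.isSeparatedMap q).eqOn_of_comp_eqOn hq.isLocallyInjective hC h.cont h'.cont
    (fun v hv => (h.right_inv v hv).trans (h'.right_inv v hv).symm) ha e

theorem IsSectionOn.eventually_apply (hq : IsLocalHomeomorph q) (h : IsSectionOn q σ C)
    (hC : IsOpen C) {m : N} (hm : q m ∈ C) (e : σ (q m) = m) :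
    ∀ᶠ m' in 𝓝 m, q m' ∈ C ∧ σ (q m') = m' := by
  obtain ⟨O, hO, hmO, hinj⟩ := hq.isLocallyInjective m
  have h1 : ∀ᶠ v in 𝓝 (q m), σ v ∈ O := by
    refine (h.cont.continuousAt (hC.mem_nhds hm)).eventually (hO.mem_nhds ?_)
    rwa [e]
  filter_upwards [hq.continuous.continuousAt.eventually h1,
    hq.continuous.continuousAt.eventually (hC.mem_nhds hm), hO.mem_nhds hmO] with m' h2 h3 h4
  exact ⟨h3, hinj h2 h4 (h.right_inv _ h3)⟩

/-- A section on a compact convex set extends to a convex neighbourhood. -/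
theorem exists_section_of_injOn (hq : IsLocalHomeomorph q) {T : Set N} (hT : IsCompact T)
    (hne : T.Nonempty) (hinj : InjOn q T) (hconv : Convex ℝ (q '' T)) :
    ∃ (C : Set V) (σ : V → N), IsOpen C ∧ Convex ℝ C ∧ q '' T ⊆ C ∧ IsSectionOn q σ C ∧
      ∀ m ∈ T, σ (q m) = m := by
  obtain ⟨m₀, hm₀⟩ := hne
  have : Nonempty N := ⟨m₀⟩
  obtain ⟨O, hO, hTO, hinjO⟩ := hinj.exists_isOpen_superset hT
    (fun m _ => hq.continuous.continuousAt) fun m _ => by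
      obtain ⟨W, hW, hmW, hi⟩ := hq.isLocallyInjective m
      exact ⟨W, hW.mem_nhds hmW, hi⟩
  obtain ⟨δ, hδ, hsub⟩ := (hT.image hq.continuous).exists_thickening_subset_open
    (hq.isOpenMap O hO) (image_mono hTO)
  set σ := Function.invFunOn q O
  have hσ : ∀ m ∈ O, σ (q m) = m := fun m hm => hinjO.leftInvOn_invFunOn hm
  refine ⟨Metric.thickening δ (q '' T), σ, Metric.isOpen_thickening, hconv.thickening δ,
    Metric.self_subset_thickening hδ _, ⟨?_, ?_⟩, fun m hm => hσ m (hTO hm)⟩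
  · intro v hv
    obtain ⟨m, hm, rfl⟩ := hsub hv
    refine ContinuousAt.continuousWithinAt ?_
    intro W hW
    rw [hσ m hm] at hW
    have h1 := hq.isOpenMap.image_mem_nhds (Filter.inter_mem hW (hO.mem_nhds hm))
    refine Filter.mem_map.2 (Filter.mem_of_superset h1 ?_)
    rintro _ ⟨m', ⟨h2, h3⟩, rfl⟩
    rw [mem_preimage, hσ m' h3]
    exact h2
  · intro v hv
    obtain ⟨m, hm, rfl⟩ := hsub hv
    rw [hσ m hm]

variable (q) in
/-- The points that can be reached from `n` by a section of `q` on a convex open set. -/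
def Reach (n : N) : Set V :=
  {v | ∃ (C : Set V) (σ : V → N), IsOpen C ∧ Convex ℝ C ∧ q n ∈ C ∧ v ∈ C ∧ IsSectionOn q σ C ∧
    σ (q n) = n}

open Classical in
variable (q) in
/-- The canonical section of `q` on `Reach q n`. -/
noncomputable def expo (n : N) (v : V) : N :=
  if h : v ∈ Reach q n then h.choose_spec.choose v else n

theorem isOpen_reach (n : N) : IsOpen (Reach q n) := by
  rw [isOpen_iff_mem_nhds]
  rintro v ⟨C, σ, hC, hc, hn, hv, hσ, e⟩
  exact Filter.mem_of_superset (hC.mem_nhds hv) fun w hw => ⟨C, σ, hC, hc, hn, hw, hσ, e⟩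

theorem subset_reach {n : N} (hC : IsOpen C) (hc : Convex ℝ C) (hn : q n ∈ C)
    (hσ : IsSectionOn q σ C) (e : σ (q n) = n) : C ⊆ Reach q n :=
  fun _ hv => ⟨C, σ, hC, hc, hn, hv, hσ, e⟩

/-- Two convex sets containing `q n` meet in a convex, hence connected, set, on which the two
sections agree by uniqueness of lifts. This makes the choice in `expo` harmless. -/
theorem expo_eq [T2Space N] (hq : IsLocalHomeomorph q) {n : N} (hc : Convex ℝ C) (hC : IsOpen C)
    (hn : q n ∈ C) (hσ : IsSectionOn q σ C) (e : σ (q n) = n) : EqOn (expo q n) σ C := by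
  intro v hv
  have h : v ∈ Reach q n := subset_reach hC hc hn hσ e hv
  obtain ⟨h1, h2, h3, h4, h5, h6⟩ := h.choose_spec.choose_spec
  rw [expo, dif_pos h]
  exact (h5.mono inter_subset_left).eqOn hq (hσ.mono inter_subset_right) (h2.inter hc).isPreconnected
    ⟨h3, hn⟩ (h6.trans e.symm) ⟨h4, hv⟩

theorem isSectionOn_expo [T2Space N] (hq : IsLocalHomeomorph q) (n : N) :
    IsSectionOn q (expo q n) (Reach q n) := by
  constructor
  · rintro v ⟨C, σ, hC, hc, hn, hv, hσ, e⟩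
    refine ContinuousAt.continuousWithinAt ?_
    refine (hσ.cont.continuousAt (hC.mem_nhds hv)).congr ?_
    filter_upwards [hC.mem_nhds hv] with w hw using (expo_eq hq hc hC hn hσ e hw).symm
  · rintro v ⟨C, σ, hC, hc, hn, hv, hσ, e⟩
    rw [expo_eq hq hc hC hn hσ e hv, hσ.right_inv v hv]

theorem self_mem_reach (hq : IsLocalHomeomorph q) (n : N) : q n ∈ Reach q n := by
  obtain ⟨C, σ, hC, hc, hsub, hσ, e⟩ := exists_section_of_injOn hq (isCompact_singleton (x := n))
    (singleton_nonempty n)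
    (injOn_singleton q n) (by rw [image_singleton]; exact convex_singleton _)
  have hn : q n ∈ C := hsub ⟨n, rfl, rfl⟩
  exact subset_reach hC hc hn hσ (e n rfl) hn

theorem expo_self [T2Space N] (hq : IsLocalHomeomorph q) (n : N) : expo q n (q n) = n := by
  obtain ⟨C, σ, hC, hc, hn, -, hσ, e⟩ := self_mem_reach hq n
  rw [expo_eq hq hc hC hn hσ e hn, e]

theorem starConvex_reach (n : N) : StarConvex ℝ (q n) (Reach q n) := by
  rintro v ⟨C, σ, hC, hc, hn, hv, hσ, e⟩ a b ha hb hab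
  exact subset_reach hC hc hn hσ e (hc hn hv ha hb hab)

theorem add_smul_mem_reach {n : N} {v : V} (hv : v ∈ Reach q n) {t : ℝ} (ht : t ∈ Icc (0 : ℝ) 1) :
    q n + t • (v - q n) ∈ Reach q n :=
  (starConvex_reach n).add_smul_sub_mem hv ht.1 ht.2

/-- A function `τ` on `N` with its first and second derivatives along the lines of `V`, such
that the second derivatives control how far sections of `q` exist. -/
structure KoszulData (q : N → V) (τ : N → ℝ) (L Q : N → V → ℝ) : Prop where
  local_homeo : IsLocalHomeomorph q
  first : ∀ (C : Set V) (σ : V → N), IsOpen C → IsSectionOn q σ C → ∀ (a w : V) (t : ℝ),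
    a + t • w ∈ C → HasDerivAt (fun t => τ (σ (a + t • w))) (L (σ (a + t • w)) w) t
  second : ∀ (C : Set V) (σ : V → N), IsOpen C → IsSectionOn q σ C → ∀ (a w : V) (t : ℝ),
    a + t • w ∈ C → HasDerivAt (fun t => L (σ (a + t • w)) w) (Q (σ (a + t • w)) w) t
  nonneg : ∀ n w, 0 ≤ Q n w
  smul : ∀ n (c : ℝ) w, Q n (c • w) = c ^ 2 * Q n w
  lift : ∃ ε : ℝ, 0 < ε ∧ ∀ n w, Q n w < ε → q n + w ∈ Reach q n

variable {τ : N → ℝ} {L Q : N → V → ℝ}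

theorem tendsto_neg_log_one_sub :
    Filter.Tendsto (fun t : ℝ => -Real.log (1 - t)) (𝓝[<] 1) Filter.atTop := by
  refine Filter.tendsto_neg_atBot_atTop.comp (Real.tendsto_log_nhdsGT_zero.comp ?_)
  refine tendsto_nhdsWithin_iff.2 ⟨?_, ?_⟩
  · have : ContinuousAt (fun t : ℝ => 1 - t) 1 := by fun_prop
    have h := this.tendsto
    rw [sub_self] at h
    exact h.mono_left nhdsWithin_le_nhds
  · filter_upwards [self_mem_nhdsWithin] with t ht
    exact mem_Ioi.2 (sub_pos.2 (mem_Iio.1 ht))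

/-- If a segment leaves `Reach q n` then `τ` is not bounded along it. -/
theorem KoszulData.tendsto_atTop [T2Space N] (hK : KoszulData q τ L Q) {n : N} {v : V}
    (hseg : ∀ t ∈ Ico (0 : ℝ) 1, q n + t • (v - q n) ∈ Reach q n) (hv : v ∉ Reach q n) :
    Filter.Tendsto (fun t : ℝ => τ (expo q n (q n + t • (v - q n)))) (𝓝[<] 1) Filter.atTop := by
  have hq := hK.local_homeo
  have hR := isOpen_reach (q := q) n
  have hs := isSectionOn_expo hq n
  set a := q n
  set w := v - a
  set e := expo q n
  obtain ⟨ε, hε, hlift⟩ := hK.lift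
  -- If the remaining vector `(1 - t) w` had Hessian norm below `ε`, a section at `e(a + t w)` would
  -- reach `v`. Gluing its lift of the last piece to the lift already constructed gives an injective
  -- compact lift of the whole segment, and `exists_section_of_injOn` thickens it to a convex
  -- neighbourhood, so `v` would be reached from `n`.
  have hbound : ∀ t ∈ Ico (0 : ℝ) 1, ε ≤ Q (e (a + t • w)) ((1 - t) • w) := by
    intro t ht
    by_contra hlt
    refine hv ?_
    have hm := hlift _ _ (not_le.1 hlt)
    set x := a + t • w
    have hqe : q (e x) = x := hs.right_inv _ (hseg t ht)
    rw [hqe] at hm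
    have hxv : x + (1 - t) • w = v := by simp only [x, w]; module
    rw [hxv] at hm
    obtain ⟨C, σ, hC, hc, hxC, hvC, hσ, heq⟩ := hm
    rw [hqe] at hxC heq
    set S₁ := (fun s : ℝ => a + s • w) '' Icc 0 t
    set S₂ := (fun s : ℝ => a + s • w) '' Icc t 1
    have hcont : Continuous fun s : ℝ => a + s • w := by fun_prop
    have hS₁ : IsCompact S₁ := isCompact_Icc.image hcont
    have hS₂ : IsCompact S₂ := isCompact_Icc.image hcont
    have hS₁R : S₁ ⊆ Reach q n := by
      rintro _ ⟨s, hs, rfl⟩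
      exact hseg s ⟨hs.1, hs.2.trans_lt ht.2⟩
    have hS₂C : S₂ ⊆ C := by
      rintro _ ⟨s, hs, rfl⟩
      have h1t : 0 < 1 - t := sub_pos.2 ht.2
      have := hc.add_smul_sub_mem hxC hvC (t := (s - t) / (1 - t))
        ⟨div_nonneg (sub_nonneg.2 hs.1) h1t.le, (div_le_one h1t).2 (by linarith [hs.2])⟩
      have h2 : x + ((s - t) / (1 - t)) • (v - x) = a + s • w := by
        rw [← hxv, add_sub_cancel_left, smul_smul, div_mul_cancel₀ _ h1t.ne']
        simp only [x]
        module
      rwa [h2] at this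
    have hT : IsCompact (e '' S₁ ∪ σ '' S₂) :=
      (hS₁.image_of_continuousOn (hs.cont.mono hS₁R)).union
        (hS₂.image_of_continuousOn (hσ.cont.mono hS₂C))
    have hq₁ : ∀ y ∈ S₁, q (e y) = y := fun y hy => hs.right_inv y (hS₁R hy)
    have hq₂ : ∀ y ∈ S₂, q (σ y) = y := fun y hy => hσ.right_inv y (hS₂C hy)
    -- The two pieces of the segment meet only at `x`, where both lifts take the value `e x`; the
    -- case `w = 0` is degenerate.
    have hinter : ∀ y ∈ S₁, y ∈ S₂ → e y = σ y := by
      rintro _ ⟨s, hs1, rfl⟩ ⟨s', hs2, h⟩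
      have h1 : (s' - s) • w = 0 := by
        have h2 := add_left_cancel h
        rw [sub_smul, h2, sub_self]
      have h3 : a + s • w = x := by
        rcases smul_eq_zero.1 h1 with h4 | h4
        · have : s = t := le_antisymm hs1.2 (by linarith [hs2.1])
          rw [this]
        · simp only [x, h4, smul_zero]
      simp only [h3]
      exact heq.symm
    have himage : q '' (e '' S₁ ∪ σ '' S₂) = segment ℝ a v := by
      have h1 : ∀ (f : V → N) (S : Set V), (∀ y ∈ S, q (f y) = y) → q '' (f '' S) = S := by
        intro f S hf
        rw [image_image]
        exact (image_congr hf).trans (image_id' S)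
      rw [image_union, h1 e S₁ hq₁, h1 σ S₂ hq₂, ← image_union, Icc_union_Icc_eq_Icc ht.1 ht.2.le,
        segment_eq_image']
    have hinj : InjOn q (e '' S₁ ∪ σ '' S₂) := by
      rintro _ (⟨y, hy, rfl⟩ | ⟨y, hy, rfl⟩) _ (⟨y', hy', rfl⟩ | ⟨y', hy', rfl⟩) h
      · rw [hq₁ y hy, hq₁ y' hy'] at h; rw [h]
      · rw [hq₁ y hy, hq₂ y' hy'] at h; subst h; exact hinter y hy hy'
      · rw [hq₂ y hy, hq₁ y' hy'] at h; subst h; exact (hinter y hy' hy).symm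
      · rw [hq₂ y hy, hq₂ y' hy'] at h; rw [h]
    have hn : n ∈ e '' S₁ ∪ σ '' S₂ := Or.inl ⟨a, ⟨0, ⟨le_rfl, ht.1⟩, by simp⟩, expo_self hq n⟩
    obtain ⟨C', σ', hC', hc', hsub, hσ', he'⟩ := exists_section_of_injOn hq hT ⟨n, hn⟩ hinj
      (by rw [himage]; exact convex_segment a v)
    rw [himage] at hsub
    exact subset_reach hC' hc' (hsub (left_mem_segment ℝ a v)) hσ' (he' n hn)
      (hsub (right_mem_segment ℝ a v))
  set u := fun t : ℝ => τ (e (a + t • w))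
  set u1 := fun t : ℝ => L (e (a + t • w)) w
  have hlog : ∀ t ∈ Ico (0 : ℝ) 1, HasDerivAt (fun t => ε * Real.log (1 - t))
      (-(ε * (1 - t)⁻¹)) t := by
    intro t ht
    have h1t : 1 - t ≠ 0 := (sub_pos.2 ht.2).ne'
    exact ((((hasDerivAt_id' t).const_sub 1).log h1t).const_mul ε).congr_deriv (by field_simp)
  have hlog2 : ∀ t ∈ Ico (0 : ℝ) 1, HasDerivAt (fun t => -(ε * (1 - t)⁻¹))
      (-(ε * ((1 - t) ^ 2)⁻¹)) t := by
    intro t ht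
    have h1t : 1 - t ≠ 0 := (sub_pos.2 ht.2).ne'
    exact (((((hasDerivAt_id' t).const_sub 1).fun_inv h1t).const_mul ε).fun_neg).congr_deriv
      (by field_simp)
  -- `hbound` says `u'' ≥ ε / (1 - t)²`, that is, `u + ε log(1 - t)` is convex; its tangent line at
  -- `0` bounds it from below.
  have key : ∀ t ∈ Ico (0 : ℝ) 1, u 0 + (u1 0 - ε) * t ≤ u t + ε * Real.log (1 - t) := by
    intro t ht
    have h := add_mul_le_of_hasDerivAt2_nonneg (u := fun t => u t + ε * Real.log (1 - t))
      (u1 := fun t => u1 t + -(ε * (1 - t)⁻¹))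
      (u2 := fun t => Q (e (a + t • w)) w + -(ε * ((1 - t) ^ 2)⁻¹)) (b := 1)
      (fun s hs' => (hK.first _ e hR hs a w s (hseg s hs')).add (hlog s hs'))
      (fun s hs' => (hK.second _ e hR hs a w s (hseg s hs')).add (hlog2 s hs'))
      (fun s hs' => by
        have h1 := hbound s hs'
        rw [hK.smul] at h1
        have h2 : 0 < (1 - s) ^ 2 := pow_pos (sub_pos.2 hs'.2) 2
        have h3 : ε * ((1 - s) ^ 2)⁻¹ ≤ Q (e (a + s • w)) w := by
          rw [← div_eq_mul_inv, div_le_iff₀ h2]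
          linarith
        linarith) ht
    simpa [sub_eq_add_neg] using h
  have hlim : Filter.Tendsto (fun t : ℝ => (u 0 - |u1 0 - ε|) + ε * -Real.log (1 - t)) (𝓝[<] 1)
      Filter.atTop :=
    Filter.tendsto_atTop_add_const_left _ _ (tendsto_neg_log_one_sub.const_mul_atTop hε)
  refine Filter.tendsto_atTop_mono' _ ?_ hlim
  have hmem : Ico (0 : ℝ) 1 ∈ 𝓝[<] (1 : ℝ) := Ico_mem_nhdsLT (by norm_num)
  filter_upwards [hmem] with t ht
  have h1 := key t ht
  have h2 : -|u1 0 - ε| ≤ (u1 0 - ε) * t := by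
    have h3 : |(u1 0 - ε) * t| ≤ |u1 0 - ε| := by
      rw [abs_mul, abs_of_nonneg ht.1]
      exact mul_le_of_le_one_right (abs_nonneg _) ht.2.le
    exact (neg_le_neg h3).trans (neg_abs_le _)
  change u 0 - |u1 0 - ε| + ε * -Real.log (1 - t) ≤ u t
  linarith

theorem KoszulData.convexOn_line (hK : KoszulData q τ L Q) (hC : IsOpen C)
    (hσ : IsSectionOn q σ C) {a b : V} (hab : ∀ r ∈ Icc (0 : ℝ) 1, a + r • (b - a) ∈ C) {r : ℝ}
    (hr : r ∈ Icc (0 : ℝ) 1) : τ (σ (a + r • (b - a))) ≤ max (τ (σ a)) (τ (σ b)) := by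
  have h1 : ConvexOn ℝ (Icc (0 : ℝ) 1) fun t => τ (σ (a + t • (b - a))) :=
    convexOn_of_hasDerivWithinAt2_nonneg (convex_Icc 0 1)
      (fun t ht => (hK.first C σ hC hσ a (b - a) t (hab t ht)).continuousAt.continuousWithinAt)
      (fun t ht => (hK.first C σ hC hσ a (b - a) t (hab t (interior_subset ht))).hasDerivWithinAt)
      (fun t ht => (hK.second C σ hC hσ a (b - a) t (hab t (interior_subset ht))).hasDerivWithinAt)
      fun t _ => hK.nonneg _ _
  have h2 := h1.le_max_of_mem_Icc (x := 0) (y := 1) (by simp) (by simp) hr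
  simpa using h2

theorem KoszulData.continuousOn (hK : KoszulData q τ L Q) (hC : IsOpen C)
    (hσ : IsSectionOn q σ C) (a w : V) {t : ℝ} (ht : a + t • w ∈ C) :
    ContinuousAt (fun t => τ (σ (a + t • w))) t :=
  (hK.first C σ hC hσ a w t ht).continuousAt

/-- For `v` and `w` in the reachable set, the triangle with vertices `q n`, `v`, `w` is swept by the
segments parallel to its side `[v, w]`. If a first such segment contained an unreachable point, `τ`
would blow up along the ray to that point. But `τ` is convex on the earlier parallel segments, so it
is bounded there by its values on the sides `[q n, v]` and `[q n, w]`, which are compact and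
reachable. -/
theorem KoszulData.convex_reach [T2Space N] (hK : KoszulData q τ L Q) (n : N) :
    Convex ℝ (Reach q n) := by
  have hq := hK.local_homeo
  have hR := isOpen_reach (q := q) n
  have hs := isSectionOn_expo hq n
  rw [convex_iff_segment_subset]
  intro v hv w hw
  set a := q n
  set c := fun r : ℝ => v + r • (w - v)
  have hc : Continuous c := by fun_prop
  -- `S` consists of the scales at which the whole shrunken segment is reachable. It is shown to
  -- contain `[0, 1]` by an open–closed argument: openness is compactness of the segment, and
  -- closedness is the blow-up of `τ`.
  set S : Set ℝ := {s | ∀ r ∈ Icc (0 : ℝ) 1, a + s • (c r - a) ∈ Reach q n}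
  have hdown : ∀ s ∈ S, ∀ s' ∈ Icc 0 s, s' ∈ S := by
    intro s hsS s' hs' r hr
    rcases hs'.1.eq_or_lt with h0 | h0
    · rw [← h0, zero_smul, add_zero]
      exact self_mem_reach hq n
    · have h1 := add_smul_mem_reach (hsS r hr) (t := s' / s)
        ⟨div_nonneg hs'.1 (hs'.1.trans hs'.2), div_le_one_of_le₀ hs'.2 (hs'.1.trans hs'.2)⟩
      have h2 : a + (s' / s) • (a + s • (c r - a) - a) = a + s' • (c r - a) := by
        rw [add_sub_cancel_left, smul_smul, div_mul_cancel₀ _ (h0.trans_le hs'.2).ne']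
      rwa [← h2]
  have hbdd : ∀ y ∈ Reach q n, ∃ B, ∀ t ∈ Icc (0 : ℝ) 1,
      τ (expo q n (a + t • (y - a))) ≤ B := by
    intro y hy
    have h1 : ContinuousOn (fun t : ℝ => τ (expo q n (a + t • (y - a)))) (Icc 0 1) := fun t ht =>
      (hK.continuousOn hR hs a (y - a) (add_smul_mem_reach hy ht)).continuousWithinAt
    obtain ⟨B, hB⟩ := (isCompact_Icc.image_of_continuousOn h1).bddAbove
    exact ⟨B, fun t ht => hB ⟨t, ht, rfl⟩⟩
  have hsub : Icc (0 : ℝ) 1 ⊆ S := by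
    refine IsClosed.Icc_subset_of_forall_mem_nhdsWithin ?_ ?_ ?_
    · refine isClosed_of_closure_subset fun x hx => ?_
      have hx01 : x ∈ Icc (0 : ℝ) 1 :=
        isClosed_Icc.closure_subset_iff.2 inter_subset_right hx
      refine ⟨?_, hx01⟩
      have hlt : ∀ s ∈ Ico 0 x, s ∈ S := by
        intro s hs'
        obtain ⟨y, hy1, hy2⟩ := mem_closure_iff.1 hx (Ioi s) isOpen_Ioi hs'.2
        exact hdown y hy2.1 s ⟨hs'.1, le_of_lt hy1⟩
      intro r hr
      by_contra hnot
      set y := a + x • (c r - a)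
      have hya : ∀ t : ℝ, a + t • (y - a) = a + (t * x) • (c r - a) := by
        intro t
        simp only [y]
        rw [add_sub_cancel_left, smul_smul]
      have hx0 : 0 < x := by
        rcases hx01.1.eq_or_lt with h0 | h0
        · exact absurd (self_mem_reach hq n) (by simpa [y, ← h0] using hnot)
        · exact h0
      have htx : ∀ t ∈ Ico (0 : ℝ) 1, t * x ∈ Ico 0 x := fun t ht =>
        ⟨mul_nonneg ht.1 hx01.1, mul_lt_of_lt_one_left hx0 ht.2⟩
      have h1 := hK.tendsto_atTop (v := y) (fun t ht => by
        rw [hya]; exact hlt _ (htx t ht) r hr) hnot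
      obtain ⟨B₁, hB₁⟩ := hbdd v hv
      obtain ⟨B₂, hB₂⟩ := hbdd w hw
      have h2 := (h1.eventually (Filter.eventually_gt_atTop (max B₁ B₂))).and
        (Ico_mem_nhdsLT (show (0 : ℝ) < 1 by norm_num))
      obtain ⟨t, h3, ht⟩ := h2.exists
      have ht' := htx t ht
      have e1 : ∀ r : ℝ, a + (t * x) • (c r - a) = (a + (t * x) • (v - a)) +
          r • ((a + (t * x) • (w - a)) - (a + (t * x) • (v - a))) := by
        intro r
        simp only [c]
        module
      have h4 := hK.convexOn_line hR hs (a := a + (t * x) • (v - a)) (b := a + (t * x) • (w - a))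
        (fun r hr => by rw [← e1]; exact hlt _ ht' r hr) hr
      rw [← e1, ← hya] at h4
      have h5 : t * x ∈ Icc (0 : ℝ) 1 := ⟨ht'.1, ht'.2.le.trans hx01.2⟩
      exact absurd (h4.trans (max_le_max (hB₁ _ h5) (hB₂ _ h5))) (not_le.2 h3)
    · intro r _
      rw [zero_smul, add_zero]
      exact self_mem_reach hq n
    · rintro s ⟨hsS, -⟩
      refine mem_nhdsWithin_of_mem_nhds ?_
      have h1 := isCompact_Icc.eventually_forall_of_forall_eventually (x₀ := s) (K := Icc (0 : ℝ) 1)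
        (P := fun s r => a + s • (c r - a) ∈ Reach q n) (fun r hr => by
          have h2 : Continuous fun z : ℝ × ℝ => a + z.1 • (c z.2 - a) := by fun_prop
          exact h2.continuousAt.eventually (hR.mem_nhds (hsS r hr)))
      exact h1
  rw [segment_eq_image']
  rintro _ ⟨r, hr, rfl⟩
  have := hsub (right_mem_Icc.2 zero_le_one) r hr
  rwa [one_smul, add_sub_cancel] at this

/-- The reachable set of `n`, now known to be convex, is itself an admissible domain for the base
point `expo q n b`. -/
theorem KoszulData.reach_subset [T2Space N] (hK : KoszulData q τ L Q) {n : N} {b : V}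
    (hb : b ∈ Reach q n) : Reach q n ⊆ Reach q (expo q n b) ∧
      EqOn (expo q (expo q n b)) (expo q n) (Reach q n) := by
  have hq := hK.local_homeo
  have hs := isSectionOn_expo hq n
  have e := hs.right_inv b hb
  have hb' : q (expo q n b) ∈ Reach q n := by rwa [e]
  have e' : expo q n (q (expo q n b)) = expo q n b := by rw [e]
  exact ⟨subset_reach (isOpen_reach n) (hK.convex_reach n) hb' hs e',
    expo_eq hq (hK.convex_reach n) (isOpen_reach n) hb' hs e'⟩

/-- The starting point `n` is in turn reached from `expo q n b`, so the inclusion of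
`KoszulData.reach_subset` can be reversed. -/
theorem KoszulData.reach_eq [T2Space N] (hK : KoszulData q τ L Q) {n : N} {b : V}
    (hb : b ∈ Reach q n) : Reach q (expo q n b) = Reach q n := by
  have hq := hK.local_homeo
  obtain ⟨h1, h2⟩ := hK.reach_subset hb
  have hn := self_mem_reach hq n
  have h3 : expo q (expo q n b) (q n) = n := by rw [h2 hn, expo_self hq]
  have h4 := (hK.reach_subset (h1 hn)).1
  rw [h3] at h4
  exact h4.antisymm h1

/-- The image is open because `q` is locally injective. For closedness, take `m` in the image near a
limit point `m'`, inside a local section through `m'`. If `q m'` were not reachable from `m`, `τ`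
would blow up along the segment from `q m` at its first unreachable point; but there it agrees with
`τ` on the local section, which stays bounded. -/
theorem KoszulData.image_expo_eq_univ [T2Space N] [PreconnectedSpace N] (hK : KoszulData q τ L Q)
    (n : N) : expo q n '' Reach q n = univ := by
  have hq := hK.local_homeo
  have hs := isSectionOn_expo hq n
  refine IsClopen.eq_univ ⟨?_, ?_⟩ ⟨_, mem_image_of_mem _ (self_mem_reach hq n)⟩
  · refine isClosed_of_closure_subset fun m' hm' => ?_
    obtain ⟨C, σ, hC, hc, hm'C, -, hσ, he⟩ := self_mem_reach hq m'
    obtain ⟨m, ⟨hmC, hσm⟩, b, hb, hbm⟩ := mem_closure_iff_nhds.1 hm' _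
      (hσ.eventually_apply hq hC hm'C he)
    have hRm : Reach q m = Reach q n := by rw [← hbm]; exact hK.reach_eq hb
    have hem : EqOn (expo q m) (expo q n) (Reach q n) := by
      rw [← hbm]; exact (hK.reach_subset hb).2
    have hsm := isSectionOn_expo hq m
    have hqm := self_mem_reach hq m
    have hagree : EqOn (expo q m) σ (Reach q m ∩ C) :=
      (hsm.mono inter_subset_left).eqOn hq (hσ.mono inter_subset_right)
        ((hK.convex_reach m).inter hc).isPreconnected ⟨hqm, hmC⟩ (by rw [expo_self hq, hσm])
    suffices h : q m' ∈ Reach q m by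
      refine ⟨q m', hRm ▸ h, ?_⟩
      rw [← hem (hRm ▸ h), hagree ⟨h, hm'C⟩, he]
    by_contra hnot
    set w := q m' - q m
    -- The first exit time exists as the minimum of this nonempty compact set of unreachable
    -- parameters.
    set T : Set ℝ := Icc 0 1 ∩ {t | q m + t • w ∉ Reach q m}
    have hlin : Continuous fun t : ℝ => q m + t • w := by fun_prop
    have hT : IsClosed T :=
      isClosed_Icc.inter ((isOpen_reach (q := q) m).isClosed_compl.preimage hlin)
    have h1T : (1 : ℝ) ∈ T := ⟨right_mem_Icc.2 zero_le_one, by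
      change q m + (1 : ℝ) • w ∉ Reach q m
      rwa [one_smul, add_sub_cancel]⟩
    have hbd : BddBelow T := ⟨0, fun t ht => ht.1.1⟩
    set t₀ := sInf T
    obtain ⟨ht₀, hx⟩ : t₀ ∈ T := hT.csInf_mem ⟨1, h1T⟩ hbd
    set x := q m + t₀ • w
    have hxa : ∀ t : ℝ, q m + t • (x - q m) = q m + (t * t₀) • w := by
      intro t
      simp only [x]
      rw [add_sub_cancel_left, smul_smul]
    have ht₀pos : 0 < t₀ := by
      rcases ht₀.1.eq_or_lt with h0 | h0
      · refine absurd hqm ?_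
        have : x = q m := by simp only [x, ← h0, zero_smul, add_zero]
        rw [← this]
        exact hx
      · exact h0
    have hlt : ∀ t ∈ Ico (0 : ℝ) 1, q m + t • (x - q m) ∈ Reach q m := by
      intro t ht
      rw [hxa]
      by_contra h
      have h1 : t * t₀ < t₀ := mul_lt_of_lt_one_left ht₀pos ht.2
      exact absurd (csInf_le hbd (show t * t₀ ∈ T from
        ⟨⟨mul_nonneg ht.1 ht₀.1, h1.le.trans ht₀.2⟩, h⟩)) (not_le.2 h1)
    have h1 := hK.tendsto_atTop hlt hx
    have hseg : ∀ t ∈ Icc (0 : ℝ) 1, q m + t • (x - q m) ∈ C := by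
      intro t ht
      rw [hxa]
      exact hc.add_smul_sub_mem hmC hm'C ⟨mul_nonneg ht.1 ht₀.1, mul_le_one₀ ht.2 ht₀.1 ht₀.2⟩
    have h2 : Filter.Tendsto (fun t : ℝ => τ (σ (q m + t • (x - q m)))) (𝓝[<] 1)
        (𝓝 (τ (σ (q m + (1 : ℝ) • (x - q m))))) :=
      ((hK.continuousOn hC hσ (q m) (x - q m)
        (hseg 1 (right_mem_Icc.2 zero_le_one))).tendsto).mono_left nhdsWithin_le_nhds
    have h3 : (fun t : ℝ => τ (expo q m (q m + t • (x - q m)))) =ᶠ[𝓝[<] 1]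
        fun t : ℝ => τ (σ (q m + t • (x - q m))) := by
      filter_upwards [Ico_mem_nhdsLT (show (0 : ℝ) < 1 by norm_num)] with t ht
      rw [hagree ⟨hlt t ht, hseg t ⟨ht.1, ht.2.le⟩⟩]
    exact not_tendsto_atTop_of_tendsto_nhds h2 (h1.congr' h3)
  · rw [isOpen_iff_mem_nhds]
    rintro _ ⟨b, hb, rfl⟩
    have e := hs.right_inv b hb
    have h1 := hs.eventually_apply hq (isOpen_reach n) (m := expo q n b) (by rwa [e]) (by rw [e])
    filter_upwards [h1] with m hm
    exact ⟨q m, hm.1, hm.2⟩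

/-- **Koszul's theorem.** -/
theorem KoszulData.injective [T2Space N] [PreconnectedSpace N] (hK : KoszulData q τ L Q) :
    Function.Injective q := by
  intro m m' h
  have hs := isSectionOn_expo hK.local_homeo m
  obtain ⟨b, hb, hbm⟩ : m' ∈ expo q m '' Reach q m := by
    rw [hK.image_expo_eq_univ m]; exact mem_univ m'
  have h1 : b = q m := by rw [h, ← hbm, hs.right_inv b hb]
  rw [← hbm, h1, expo_self hK.local_homeo]

theorem KoszulData.convex_range [T2Space N] [PreconnectedSpace N] [Nonempty N]
    (hK : KoszulData q τ L Q) : Convex ℝ (range q) := by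
  obtain ⟨n⟩ := ‹Nonempty N›
  have hs := isSectionOn_expo hK.local_homeo n
  have h : range q = Reach q n := by
    ext v
    constructor
    · rintro ⟨m, rfl⟩
      obtain ⟨b, hb, rfl⟩ : m ∈ expo q n '' Reach q n := by
        rw [hK.image_expo_eq_univ n]; exact mem_univ m
      rwa [hs.right_inv b hb]
    · exact fun hv => ⟨_, hs.right_inv v hv⟩
  rw [h]
  exact hK.convex_reach n

end Koszul

/-! ## Koszul data from local potentials -/

section Potential

variable {N V : Type*} [TopologicalSpace N] [NormedAddCommGroup V] [NormedSpace ℝ V]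

/-- `ψ` is a smooth function near `q n` that pulls back to `τ` near `n`. -/
def IsPotentialAt (q : N → V) (τ : N → ℝ) (n : N) (ψ : V → ℝ) : Prop :=
  (∀ᶠ v in 𝓝 (q n), ContDiffAt ℝ 3 ψ v) ∧ ∀ᶠ m in 𝓝 n, ψ (q m) = τ m

open Classical in
/-- The differential of `τ`, seen on `V`. -/
noncomputable def potentialDeriv (q : N → V) (τ : N → ℝ) (n : N) : V →L[ℝ] ℝ :=
  if h : ∃ ψ, IsPotentialAt q τ n ψ then fderiv ℝ h.choose (q n) else 0

open Classical in
/-- The Hessian of `τ`, seen on `V`. -/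
noncomputable def potentialHess (q : N → V) (τ : N → ℝ) (n : N) : V →L[ℝ] V →L[ℝ] ℝ :=
  if h : ∃ ψ, IsPotentialAt q τ n ψ then fderiv ℝ (fderiv ℝ h.choose) (q n) else 0

variable {q : N → V} {τ : N → ℝ} {n : N} {ψ ψ' : V → ℝ}

/-- A local homeomorphism maps neighbourhoods onto neighbourhoods, so the germ of a potential is
unique and the choices in `potentialDeriv` and `potentialHess` do not matter. -/
theorem IsPotentialAt.eventuallyEq (hq : IsLocalHomeomorph q) (h : IsPotentialAt q τ n ψ)
    (h' : IsPotentialAt q τ n ψ') : ψ =ᶠ[𝓝 (q n)] ψ' := by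
  rw [← hq.map_nhds_eq n]
  refine Filter.eventually_map.2 ?_
  filter_upwards [h.2, h'.2] with m h1 h2
  rw [h1, h2]

theorem IsPotentialAt.eventually (hq : IsLocalHomeomorph q) (h : IsPotentialAt q τ n ψ) :
    ∀ᶠ m in 𝓝 n, IsPotentialAt q τ m ψ := by
  have h1 := hq.continuous.continuousAt.eventually h.1.eventually_nhds
  filter_upwards [h1, h.2.eventually_nhds] with m h2 h3
  exact ⟨h2, h3⟩

theorem IsPotentialAt.deriv_eq (hq : IsLocalHomeomorph q) (h : IsPotentialAt q τ n ψ) :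
    potentialDeriv q τ n = fderiv ℝ ψ (q n) := by
  have h1 : ∃ ψ, IsPotentialAt q τ n ψ := ⟨ψ, h⟩
  rw [potentialDeriv, dif_pos h1]
  exact (h1.choose_spec.eventuallyEq hq h).fderiv_eq

theorem IsPotentialAt.hess_eq (hq : IsLocalHomeomorph q) (h : IsPotentialAt q τ n ψ) :
    potentialHess q τ n = fderiv ℝ (fderiv ℝ ψ) (q n) := by
  have h1 : ∃ ψ, IsPotentialAt q τ n ψ := ⟨ψ, h⟩
  rw [potentialHess, dif_pos h1]
  exact (h1.choose_spec.eventuallyEq hq h).fderiv.fderiv_eq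

theorem ContDiffAt.fderiv_two {v : V} (h : ContDiffAt ℝ 3 ψ v) :
    ContDiffAt ℝ 2 (fderiv ℝ ψ) v := h.fderiv_right (m := 2) (by norm_num)

theorem IsPotentialAt.differentiableAt (h : IsPotentialAt q τ n ψ) :
    DifferentiableAt ℝ ψ (q n) := h.1.self_of_nhds.differentiableAt (by simp)

theorem IsPotentialAt.differentiableAt_fderiv (h : IsPotentialAt q τ n ψ) :
    DifferentiableAt ℝ (fderiv ℝ ψ) (q n) :=
  h.1.self_of_nhds.fderiv_two.differentiableAt (by simp)

variable {C : Set V} {σ : V → N}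

theorem IsPotentialAt.hasDerivAt_first (hq : IsLocalHomeomorph q) (hC : IsOpen C)
    (hσ : IsSectionOn q σ C) {a w : V} {t : ℝ} (ht : a + t • w ∈ C)
    (h : IsPotentialAt q τ (σ (a + t • w)) ψ) :
    HasDerivAt (fun t => τ (σ (a + t • w))) (potentialDeriv q τ (σ (a + t • w)) w) t := by
  have e := hσ.right_inv _ ht
  rw [h.deriv_eq hq, e]
  have h1 : HasDerivAt (fun t : ℝ => a + t • w) w t := by
    simpa using ((hasDerivAt_id t).smul_const w).const_add a
  have h2 := h.differentiableAt.hasFDerivAt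
  rw [e] at h2
  refine (h2.comp_hasDerivAt t h1).congr_of_eventuallyEq ?_
  have h3 := h1.continuousAt.eventually
    (((hσ.cont.continuousAt (hC.mem_nhds ht)).eventually h.2).and (hC.mem_nhds ht))
  filter_upwards [h3] with s hs
  rw [← hs.1, hσ.right_inv _ hs.2]
  rfl

theorem IsPotentialAt.hasDerivAt_second (hq : IsLocalHomeomorph q) (hC : IsOpen C)
    (hσ : IsSectionOn q σ C) {a w : V} {t : ℝ} (ht : a + t • w ∈ C)
    (h : IsPotentialAt q τ (σ (a + t • w)) ψ) :
    HasDerivAt (fun t => potentialDeriv q τ (σ (a + t • w)) w)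
      (potentialHess q τ (σ (a + t • w)) w w) t := by
  have e := hσ.right_inv _ ht
  rw [h.hess_eq hq, e]
  have h1 : HasDerivAt (fun t : ℝ => a + t • w) w t := by
    simpa using ((hasDerivAt_id t).smul_const w).const_add a
  have h2 := h.differentiableAt_fderiv.hasFDerivAt
  rw [e] at h2
  have h5 : HasDerivAt (fun s : ℝ => fderiv ℝ ψ (a + s • w))
    (fderiv ℝ (fderiv ℝ ψ) (a + t • w) w) t := h2.comp_hasDerivAt t h1
  have h4 : HasDerivAt (fun s : ℝ => fderiv ℝ ψ (a + s • w) w)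
      (fderiv ℝ (fderiv ℝ ψ) (a + t • w) w w) t := by
    have h6 := h5.clm_apply (hasDerivAt_const t w)
    rwa [map_zero, add_zero] at h6
  refine h4.congr_of_eventuallyEq ?_
  have h3 := h1.continuousAt.eventually
    (((hσ.cont.continuousAt (hC.mem_nhds ht)).eventually (h.eventually hq)).and (hC.mem_nhds ht))
  filter_upwards [h3] with s hs
  rw [hs.1.deriv_eq hq, hσ.right_inv _ hs.2]

/-- If the Hessian of a potential is positive definite then it controls the domain of sections. -/
theorem IsPotentialAt.exists_lift [FiniteDimensional ℝ V] (hq : IsLocalHomeomorph q)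
    (h : IsPotentialAt q τ n ψ) (hpos : ∀ w, w ≠ 0 → 0 < potentialHess q τ n w w) :
    ∃ ε : ℝ, 0 < ε ∧ ∀ᶠ m in 𝓝 n, ∀ w, potentialHess q τ m w w < ε → q m + w ∈ Reach q m := by
  obtain ⟨C, σ, hC, hc, hn, -, hσ, e⟩ := self_mem_reach hq n
  obtain ⟨r, hr, hball⟩ := Metric.isOpen_iff.1 hC _ hn
  have hcont : ContinuousAt (fderiv ℝ (fderiv ℝ ψ)) (q n) :=
    (h.1.self_of_nhds.fderiv_two.fderiv_right (m := 1) (by norm_num)).continuousAt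
  -- Compactness of the unit sphere gives a lower bound for the Hessian on unit vectors that is
  -- uniform near `q n`. The first component of the parameter is the bound itself, which is then
  -- chosen positive.
  have h1 := (isCompact_sphere (0 : V) 1).eventually_forall_of_forall_eventually
    (x₀ := ((0 : ℝ), q n)) (P := fun x w => x.1 < fderiv ℝ (fderiv ℝ ψ) x.2 w w) (by
      intro w hw
      have hw0 : w ≠ 0 := by
        rintro rfl
        simp at hw
      have h2 := hpos w hw0
      rw [h.hess_eq hq] at h2
      have h4 : ContinuousAt (fun z : (ℝ × V) × V => z.1.1) (((0 : ℝ), q n), w) := by fun_prop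
      have h5 : ContinuousAt (fun z : (ℝ × V) × V => fderiv ℝ (fderiv ℝ ψ) z.1.2)
          (((0 : ℝ), q n), w) := ContinuousAt.comp' (g := fderiv ℝ (fderiv ℝ ψ)) hcont (by fun_prop)
      have h6 : ContinuousAt (fun z : (ℝ × V) × V => z.2) (((0 : ℝ), q n), w) := by fun_prop
      exact h4.eventually_lt ((h5.clm_apply h6).clm_apply h6) h2)
  rw [nhds_prod_eq] at h1
  obtain ⟨c, hc1, hc0⟩ := ((h1.curry.filter_mono (nhdsWithin_le_nhds (s := Ioi (0 : ℝ)))).and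
    self_mem_nhdsWithin).exists
  have hc0' : 0 < c := hc0
  -- A vector with Hessian norm below this value is shorter than `r / 2`; starting within `r / 2` of
  -- `q n`, it stays in the ball covered by a local section.
  refine ⟨c * (r / 2) ^ 2, by positivity, ?_⟩
  filter_upwards [hq.continuous.continuousAt.eventually hc1, h.eventually hq,
    hσ.eventually_apply hq hC hn e,
    hq.continuous.continuousAt.eventually (Metric.ball_mem_nhds (q n) (half_pos hr))]
    with m h3 h4 h5 h6 w hw
  refine subset_reach hC hc h5.1 hσ h5.2 (hball ?_)
  rw [h4.hess_eq hq] at hw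
  have hwr : ‖w‖ < r / 2 := by
    by_contra hle
    rw [not_lt] at hle
    have hw0 : 0 < ‖w‖ := (half_pos hr).trans_le hle
    have h7 := h3 (‖w‖⁻¹ • w) (by simp [norm_smul, hw0.ne'])
    rw [map_smul, map_smul, smul_apply, smul_eq_mul, smul_eq_mul, ← mul_assoc, ← mul_inv,
      inv_mul_eq_div, lt_div_iff₀ (mul_pos hw0 hw0)] at h7
    have h8 : c * (r / 2) ^ 2 ≤ c * (‖w‖ * ‖w‖) := by
      rw [← sq]
      gcongr
    linarith
  rw [dist_eq_norm] at h6
  rw [Metric.mem_ball, dist_eq_norm]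
  calc ‖q m + w - q n‖ = ‖(q m - q n) + w‖ := by congr 1; abel
    _ ≤ ‖q m - q n‖ + ‖w‖ := norm_add_le _ _
    _ < r := by linarith

/-- A symmetry of `(q, τ)`. -/
structure IsPotentialSymmetry (q : N → V) (τ : N → ℝ) (h : N ≃ₜ N) (A : V ≃L[ℝ] V) : Prop where
  apply_eq : ∀ m, q (h m) = A (q m)
  exists_add : ∃ c : ℝ, ∀ m, τ (h m) = τ m + c

/-- `ψ ∘ A - c` is a potential at `n` whenever `ψ` is one at `h n`, and neither the constant nor the
linear map `A` contributes a second derivative of its own. -/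
theorem IsPotentialSymmetry.hess_eq (hq : IsLocalHomeomorph q) {h : N ≃ₜ N} {A : V ≃L[ℝ] V}
    (hs : IsPotentialSymmetry q τ h A) (hψ : IsPotentialAt q τ (h n) ψ) (w : V) :
    potentialHess q τ n w w = potentialHess q τ (h n) (A w) (A w) := by
  obtain ⟨c, hc⟩ := hs.exists_add
  have e := hs.apply_eq n
  have h1 : IsPotentialAt q τ n fun v => ψ (A v) - c := by
    constructor
    · have h2 := hψ.1
      rw [e] at h2
      filter_upwards [A.continuous.continuousAt.eventually h2] with v hv
      exact (hv.comp v A.contDiff.contDiffAt).sub contDiffAt_const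
    · filter_upwards [h.continuous.continuousAt.eventually hψ.2] with m hm
      rw [← hs.apply_eq, hm, hc, add_sub_cancel_right]
  rw [h1.hess_eq hq, hψ.hess_eq hq, e]
  have h2 : fderiv ℝ (fun v => ψ (A v) - c) = fun v => (fderiv ℝ ψ (A v)).comp (A : V →L[ℝ] V) := by
    ext1 v
    rw [fderiv_sub_const]
    exact A.comp_right_fderiv
  rw [h2]
  have h3 := hψ.differentiableAt_fderiv.hasFDerivAt
  rw [e] at h3
  have h4 := (h3.comp (q n) A.hasFDerivAt).clm_comp (hasFDerivAt_const (A : V →L[ℝ] V) (q n))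
  have h5 := h4.fderiv
  change fderiv ℝ (fun v => (fderiv ℝ ψ (A v)).comp (A : V →L[ℝ] V)) (q n) = _ at h5
  rw [h5]
  simp

theorem IsPotentialSymmetry.mem_reach {h : N ≃ₜ N} {A : V ≃L[ℝ] V}
    (hs : IsPotentialSymmetry q τ h A) {v : V} (hv : v ∈ Reach q n) : A v ∈ Reach q (h n) := by
  obtain ⟨C, σ, hC, hc, hn, hv, hσ, e⟩ := hv
  refine ⟨A.symm ⁻¹' C, fun w => h (σ (A.symm w)), hC.preimage A.symm.continuous,
    hc.linear_preimage (A.symm : V →ₗ[ℝ] V), ?_, ?_, ⟨?_, ?_⟩, ?_⟩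
  · rw [mem_preimage, hs.apply_eq, A.symm_apply_apply]
    exact hn
  · rwa [mem_preimage, A.symm_apply_apply]
  · exact h.continuous.comp_continuousOn
      (hσ.cont.comp A.symm.continuous.continuousOn fun w hw => hw)
  · intro w hw
    rw [hs.apply_eq, hσ.right_inv _ hw, A.apply_symm_apply]
  · change h (σ (A.symm (q (h n)))) = h n
    rw [hs.apply_eq, A.symm_apply_apply, e]

/-- Local potentials with positive definite Hessian and a cocompact symmetry give Koszul data. -/
theorem koszulData_of_potential [FiniteDimensional ℝ V] (hq : IsLocalHomeomorph q)
    (hψ : ∀ n, ∃ ψ, IsPotentialAt q τ n ψ)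
    (hpos : ∀ n w, w ≠ 0 → 0 < potentialHess q τ n w w)
    {K : Set N} (hK : IsCompact K) (hsymm : ∀ n, ∃ k ∈ K, ∃ h A, IsPotentialSymmetry q τ h A ∧
      h k = n) :
    KoszulData q τ (fun n w => potentialDeriv q τ n w) (fun n w => potentialHess q τ n w w) where
  local_homeo := hq
  first C σ hC hσ a w t ht := (hψ _).choose_spec.hasDerivAt_first hq hC hσ ht
  second C σ hC hσ a w t ht := (hψ _).choose_spec.hasDerivAt_second hq hC hσ ht
  nonneg n w := by
    rcases eq_or_ne w 0 with rfl | hw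
    · simp
    · exact (hpos n w hw).le
  smul n c w := by
    rw [map_smul, map_smul, smul_apply, smul_eq_mul, smul_eq_mul]
    ring
  lift := by
    -- A finite subcover of `K` makes `ε` uniform there, and the symmetries transport the bound to
    -- all of `N` because they preserve both the Hessian and the reachable sets.
    have h1 : ∃ ε : ℝ, 0 < ε ∧ ∀ m ∈ K, ∀ w, potentialHess q τ m w w < ε → q m + w ∈ Reach q m := by
      refine hK.induction_on (p := fun S => ∃ ε : ℝ, 0 < ε ∧ ∀ m ∈ S, ∀ w,
        potentialHess q τ m w w < ε → q m + w ∈ Reach q m) ⟨1, one_pos, by simp⟩ ?_ ?_ ?_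
      · rintro s t hst ⟨ε, hε, h⟩
        exact ⟨ε, hε, fun m hm => h m (hst hm)⟩
      · rintro s t ⟨ε, hε, h⟩ ⟨ε', hε', h'⟩
        refine ⟨min ε ε', lt_min hε hε', ?_⟩
        rintro m (hm | hm) w hw
        · exact h m hm w (hw.trans_le (min_le_left _ _))
        · exact h' m hm w (hw.trans_le (min_le_right _ _))
      · intro m _
        obtain ⟨ε, hε, h⟩ := (hψ m).choose_spec.exists_lift hq (hpos m)
        exact ⟨_, mem_nhdsWithin_of_mem_nhds h, ε, hε, fun m hm => hm⟩
    obtain ⟨ε, hε, h2⟩ := h1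
    refine ⟨ε, hε, fun n w hw => ?_⟩
    obtain ⟨k, hk, h, A, hs, rfl⟩ := hsymm n
    have h3 := h2 k hk (A.symm w) (by
      rwa [hs.hess_eq hq (hψ _).choose_spec, A.apply_symm_apply])
    have h4 := hs.mem_reach h3
    rwa [map_add, A.apply_symm_apply, ← hs.apply_eq] at h4

end Potential

/-! ## Properness of the image -/

section Proper

/-- A solution of `y ^ 2 ≤ y'` on a half line is not positive. -/
theorem not_pos_of_sq_le_deriv {y y' : ℝ → ℝ} {a : ℝ} (h : ∀ t, a ≤ t → HasDerivAt y (y' t) t)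
    (hsq : ∀ t, a ≤ t → y t ^ 2 ≤ y' t) : ¬ 0 < y a := by
  intro ha
  have hmono : MonotoneOn y (Ici a) := monotoneOn_of_hasDerivWithinAt_nonneg (convex_Ici a)
    (fun t ht => (h t ht).continuousAt.continuousWithinAt)
    (fun t ht => (h t (interior_subset ht)).hasDerivWithinAt)
    fun t ht => (sq_nonneg _).trans (hsq t (interior_subset ht))
  have hpos : ∀ t, a ≤ t → 0 < y t := fun t ht =>
    ha.trans_le (hmono self_mem_Ici ht ht)
  -- The derivative of `-1/y` is `y'/y² ≥ 1`, so `1/y` would reach zero no later than `a + 1/y(a)`.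
  have hmono2 : MonotoneOn (fun t => -(y t)⁻¹ - t) (Ici a) :=
    monotoneOn_of_hasDerivWithinAt_nonneg (f' := fun t => y' t / y t ^ 2 - 1) (convex_Ici a)
      (fun t ht => (((h t ht).continuousAt.inv₀ (hpos t ht).ne').neg.sub
        continuousAt_id).continuousWithinAt)
      (fun t ht => (((((h t (interior_subset ht)).fun_inv
        (hpos t (interior_subset ht)).ne').fun_neg).sub (hasDerivAt_id' t)).congr_deriv
          (by ring)).hasDerivWithinAt)
      fun t ht => by
        have h2 := pow_pos (hpos t (interior_subset ht)) 2
        rw [sub_nonneg, le_div_iff₀ h2, one_mul]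
        exact hsq t (interior_subset ht)
  have h3 : a ≤ a + (y a)⁻¹ := le_add_of_nonneg_right (inv_pos.2 ha).le
  have h4 := hmono2 self_mem_Ici (mem_Ici.2 h3) h3
  have h5 := inv_pos.2 (hpos _ h3)
  simp only at h4
  linarith

variable {N V : Type*} [TopologicalSpace N] [NormedAddCommGroup V] [NormedSpace ℝ V]
  {q : N → V} {τ : N → ℝ} {L Q : N → V → ℝ}

theorem KoszulData.isSectionOn_range [Nonempty N] (hK : KoszulData q τ L Q)
    (hinj : Function.Injective q) : IsSectionOn q (Function.invFun q) (range q) := by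
  have h0 := Function.leftInverse_invFun hinj
  constructor
  · rintro _ ⟨m, rfl⟩
    refine ContinuousAt.continuousWithinAt ?_
    intro W hW
    rw [h0 m] at hW
    refine Filter.mem_map.2 (Filter.mem_of_superset
      (hK.local_homeo.isOpenMap.image_mem_nhds hW) ?_)
    rintro _ ⟨m', h2, rfl⟩
    rwa [mem_preimage, h0 m']
  · rintro _ ⟨m, rfl⟩
    rw [h0 m]

/-- Along the ray, `y = L w` has derivative `Q w`, which is positive and at least `y²`. If `y` were
nonnegative at time `0` it would be positive at time `1`, and `not_pos_of_sq_le_deriv` excludes this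
on a half line. -/
theorem KoszulData.deriv_neg_of_ray (hK : KoszulData q τ L Q) (hinj : Function.Injective q)
    (hpos : ∀ n w, w ≠ 0 → 0 < Q n w) (hsq : ∀ n w, L n w ^ 2 ≤ Q n w) (n : N) {w : V}
    (hw : w ≠ 0) (hray : ∀ t : ℝ, 0 ≤ t → q n + t • w ∈ range q) : L n w < 0 := by
  have : Nonempty N := ⟨n⟩
  have hσ := hK.isSectionOn_range hinj
  have hO : IsOpen (range q) := hK.local_homeo.isOpenMap.isOpen_range
  by_contra hle
  rw [not_lt] at hle
  set y := fun t : ℝ => L (Function.invFun q (q n + t • w)) w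
  set y' := fun t : ℝ => Q (Function.invFun q (q n + t • w)) w
  have h : ∀ t, 0 ≤ t → HasDerivAt y (y' t) t := fun t ht =>
    hK.second _ _ hO hσ (q n) w t (hray t ht)
  have h0 : y 0 = L n w := by
    simp only [y, zero_smul, add_zero, Function.leftInverse_invFun hinj n]
  have hmono : StrictMonoOn y (Ici 0) := strictMonoOn_of_hasDerivWithinAt_pos (convex_Ici 0)
    (fun t ht => (h t ht).continuousAt.continuousWithinAt)
    (fun t ht => (h t (interior_subset ht)).hasDerivWithinAt) fun t _ => hpos _ _ hw
  have h1 : 0 < y 1 := by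
    have h2 := hmono self_mem_Ici (mem_Ici.2 zero_le_one) one_pos
    rw [h0] at h2
    exact hle.trans_lt h2
  exact not_pos_of_sq_le_deriv (fun t ht => h t (zero_le_one.trans ht)) (fun t _ => hsq _ _) h1

theorem add_mem_of_mem_closure_cone {Ω : Set V} (hO : IsOpen Ω) (hc : Convex ℝ Ω)
    (hcone : ∀ c : ℝ, 0 < c → ∀ v ∈ Ω, c • v ∈ Ω) {v w : V} (hv : v ∈ Ω) (hw : w ∈ closure Ω) :
    v + w ∈ Ω := by
  have h1 : (1 / 2 : ℝ) • v + (1 / 2 : ℝ) • w ∈ interior Ω :=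
    hc.combo_interior_closure_mem_interior (by rwa [hO.interior_eq]) hw (by norm_num) (by norm_num)
      (by norm_num)
  have h2 := hcone 2 two_pos _ (interior_subset h1)
  rwa [← smul_add, smul_smul, show (2 : ℝ) * (1 / 2) = 1 by norm_num, one_smul] at h2

theorem smul_mem_closure_cone {Ω : Set V} (hcone : ∀ c : ℝ, 0 < c → ∀ v ∈ Ω, c • v ∈ Ω)
    {c : ℝ} (hc : 0 < c) {w : V} (hw : w ∈ closure Ω) : c • w ∈ closure Ω :=
  map_mem_closure (f := fun v : V => c • v) (by fun_prop) hw fun v hv => hcone c hc v hv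

/-- Every nonzero vector in the closure of the open convex cone spans a ray that stays in the cone
from any of its points. So `ℓ = -L n` is positive on that closure, and compactness of its unit
vectors gives the constant. -/
theorem KoszulData.exists_bound [FiniteDimensional ℝ V] (hK : KoszulData q τ L Q)
    (hinj : Function.Injective q) (hconv : Convex ℝ (range q))
    (hcone : ∀ c : ℝ, 0 < c → ∀ v ∈ range q, c • v ∈ range q)
    (hpos : ∀ n w, w ≠ 0 → 0 < Q n w) (hsq : ∀ n w, L n w ^ 2 ≤ Q n w) (n : N)
    (ℓ : V →L[ℝ] ℝ) (hℓ : ∀ w, L n w = -ℓ w) :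
    ∃ c : ℝ, 0 < c ∧ ∀ w ∈ range q, c * ‖w‖ ≤ ℓ w := by
  have hO : IsOpen (range q) := hK.local_homeo.isOpenMap.isOpen_range
  have key : ∀ w ∈ closure (range q), w ≠ 0 → 0 < ℓ w := by
    intro w hw hw0
    have h1 := hK.deriv_neg_of_ray hinj hpos hsq n hw0 fun t ht => by
      rcases ht.eq_or_lt with rfl | ht
      · rw [zero_smul, add_zero]; exact mem_range_self n
      · exact add_mem_of_mem_closure_cone hO hconv hcone (mem_range_self n)
          (smul_mem_closure_cone hcone ht hw)
    rw [hℓ] at h1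
    linarith
  have hcpt : IsCompact (Metric.sphere (0 : V) 1 ∩ closure (range q)) :=
    (isCompact_sphere 0 1).inter_right isClosed_closure
  obtain ⟨c, hc, h2⟩ := hcpt.exists_forall_le' (f := ℓ) (a := 0) ℓ.continuous.continuousOn
    fun w hw => key w hw.2 (by
      rintro rfl
      simpa using hw.1)
  refine ⟨c, hc, fun w hw => ?_⟩
  rcases eq_or_ne w 0 with rfl | hw0
  · simp
  have hw1 : 0 < ‖w‖ := norm_pos_iff.2 hw0
  have h3 := h2 (‖w‖⁻¹ • w) ⟨by simp [norm_smul, hw1.ne'],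
    subset_closure (hcone _ (inv_pos.2 hw1) w hw)⟩
  rwa [map_smul, smul_eq_mul, inv_mul_eq_div, le_div_iff₀ hw1] at h3

end Proper

/-! ## The cone over a radial immersion -/

section Cone

/-- The map `(x, t) ↦ exp(t) f(x)`. -/
noncomputable def coneMap {X V : Type*} [AddCommGroup V] [Module ℝ V] (f : X → V) (z : X × ℝ) : V :=
  Real.exp z.2 • f z.1

variable {E V : Type*} [NormedAddCommGroup E] [NormedSpace ℝ E] [NormedAddCommGroup V]
  [NormedSpace ℝ V] {f : E → V} {e : E}

theorem contDiffAt_coneMap (hf : ContDiffAt ℝ 3 f e) (t : ℝ) :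
    ContDiffAt ℝ 3 (coneMap f) (e, t) := by
  have h1 : ContDiffAt ℝ 3 (fun z : E × ℝ => f z.1) (e, t) :=
    ContDiffAt.comp (g := f) (f := Prod.fst) (e, t) hf contDiffAt_fst
  exact ContDiffAt.smul (contDiffAt_snd.exp) h1

theorem hasFDerivAt_coneMap (hf : DifferentiableAt ℝ f e) (t : ℝ) :
    HasFDerivAt (coneMap f) (Real.exp t • (fderiv ℝ f e).coprod
      (ContinuousLinearMap.toSpanSingleton ℝ (f e))) (e, t) := by
  have h1 : HasFDerivAt (fun z : E × ℝ => f z.1)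
      ((fderiv ℝ f e).comp (ContinuousLinearMap.fst ℝ E ℝ)) (e, t) :=
    HasFDerivAt.comp (g := f) (f := Prod.fst) (e, t) hf.hasFDerivAt hasFDerivAt_fst
  have h2 : HasFDerivAt (fun z : E × ℝ => Real.exp z.2)
      (Real.exp t • ContinuousLinearMap.snd ℝ E ℝ) (e, t) :=
    HasFDerivAt.exp (f := Prod.snd) (x := (e, t)) hasFDerivAt_snd
  refine (h2.smul h1).congr_fderiv ?_
  refine ContinuousLinearMap.ext fun p => ?_
  simp [smul_smul]

/-- The local inverse of `coneMap`. -/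
theorem exists_coneChart [FiniteDimensional ℝ E] [FiniteDimensional ℝ V]
    (hdim : Module.finrank ℝ E + 1 = Module.finrank ℝ V) (hf : ContDiffAt ℝ 3 f e)
    (hinj : ∀ (a : E) (r : ℝ), fderiv ℝ f e a + r • f e = 0 → a = 0 ∧ r = 0) (t : ℝ) :
    ∃ Φ : OpenPartialHomeomorph (E × ℝ) V, (e, t) ∈ Φ.source ∧ (∀ z, Φ z = coneMap f z) ∧
      ContDiffAt ℝ 3 Φ.symm (coneMap f (e, t)) := by
  have hd : DifferentiableAt ℝ f e := hf.differentiableAt (by simp)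
  set A := Real.exp t • (fderiv ℝ f e).coprod (ContinuousLinearMap.toSpanSingleton ℝ (f e))
  have hA : Function.Injective A := by
    refine (injective_iff_map_eq_zero A).2 ?_
    rintro ⟨a, r⟩ h
    have h1 : Real.exp t • (fderiv ℝ f e a + r • f e) = 0 := by simpa [A] using h
    obtain ⟨rfl, rfl⟩ := hinj a r ((smul_eq_zero.1 h1).resolve_left (Real.exp_pos t).ne')
    rfl
  have hdim' : Module.finrank ℝ (E × ℝ) = Module.finrank ℝ V := by
    rw [Module.finrank_prod, Module.finrank_self, hdim]
  set B := (LinearEquiv.ofInjectiveOfFinrankEq (A : E × ℝ →ₗ[ℝ] V) hA hdim').toContinuousLinearEquiv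
  have hB : HasFDerivAt (coneMap f) (B : E × ℝ →L[ℝ] V) (e, t) := hasFDerivAt_coneMap hd t
  have hc := contDiffAt_coneMap hf t
  exact ⟨hc.toOpenPartialHomeomorph _ hB (by simp), hc.mem_toOpenPartialHomeomorph_source hB _,
    fun z => rfl, hc.to_localInverse hB (by simp)⟩

/-- Differentiating `ψ(c(s)) = α + β s` twice: the Hessian term and the acceleration term `dψ(c'')`
cancel. -/
theorem hess_of_comp_affine {ψ : V → ℝ} {c c' : ℝ → V} {c'' : V} {α β : ℝ}
    (hψ : ∀ᶠ v in 𝓝 (c 0), ContDiffAt ℝ 3 ψ v) (hc : ∀ᶠ s in 𝓝 (0 : ℝ), HasDerivAt c (c' s) s)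
    (hc' : HasDerivAt c' c'' 0) (h : ∀ᶠ s in 𝓝 (0 : ℝ), ψ (c s) = α + β * s) :
    fderiv ℝ ψ (c 0) (c' 0) = β ∧
      fderiv ℝ (fderiv ℝ ψ) (c 0) (c' 0) (c' 0) = -fderiv ℝ ψ (c 0) c'' := by
  have h1 : ∀ᶠ s in 𝓝 (0 : ℝ), fderiv ℝ ψ (c s) (c' s) = β := by
    filter_upwards [h.eventually_nhds, hc.self_of_nhds.continuousAt.eventually hψ, hc]
      with s hs hψs hcs
    have h2 : HasDerivAt (fun s => ψ (c s)) (fderiv ℝ ψ (c s) (c' s)) s :=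
      (hψs.differentiableAt (by simp)).hasFDerivAt.comp_hasDerivAt s hcs
    have h3 : HasDerivAt (fun s : ℝ => α + β * s) β s := by
      simpa using ((hasDerivAt_id s).const_mul β).const_add α
    exact (h2.congr_of_eventuallyEq (hs.mono fun _ h => h.symm)).unique h3
  refine ⟨h1.self_of_nhds, ?_⟩
  have h4 : HasDerivAt (fun s => fderiv ℝ ψ (c s)) (fderiv ℝ (fderiv ℝ ψ) (c 0) (c' 0)) 0 :=
    (hψ.self_of_nhds.fderiv_two.differentiableAt (by simp)).hasFDerivAt.comp_hasDerivAt 0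
      hc.self_of_nhds
  have h5 := (h4.clm_apply hc').congr_of_eventuallyEq (f₁ := fun _ => β) (h1.mono fun _ h => h.symm)
  have h6 := h5.unique (hasDerivAt_const 0 β)
  linarith

/-- Derivatives of a function `ψ` with `ψ(exp(t) f(e)) = -t`. -/
theorem hess_of_coneMap {ψ : V → ℝ} (hf : ∀ᶠ x in 𝓝 e, ContDiffAt ℝ 3 f x) (t : ℝ)
    (hψ : ∀ᶠ v in 𝓝 (coneMap f (e, t)), ContDiffAt ℝ 3 ψ v)
    (h : ∀ᶠ z in 𝓝 (e, t), ψ (coneMap f z) = -z.2) :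
    (∀ a r, fderiv ℝ ψ (coneMap f (e, t)) (Real.exp t • (fderiv ℝ f e a + r • f e)) = -r) ∧
    ∀ a r k γ, fderiv ℝ (fderiv ℝ f) e a a = fderiv ℝ f e k + γ • f e →
      fderiv ℝ (fderiv ℝ ψ) (coneMap f (e, t)) (Real.exp t • (fderiv ℝ f e a + r • f e))
        (Real.exp t • (fderiv ℝ f e a + r • f e)) = γ + r ^ 2 := by
  have hlin : ∀ (a : E) (r s : ℝ), HasDerivAt (fun s : ℝ => (e + s • a, t + r * s)) (a, r) s := by
    intro a r s
    have h1 : HasDerivAt (fun s : ℝ => e + s • a) a s := by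
      simpa using ((hasDerivAt_id s).smul_const a).const_add e
    have h2 : HasDerivAt (fun s : ℝ => t + r * s) r s := by
      simpa using ((hasDerivAt_id s).const_mul r).const_add t
    exact h1.prodMk h2
  have h0 : ∀ (a : E) (r : ℝ), (e + (0 : ℝ) • a, t + r * 0) = (e, t) := by simp
  have first : ∀ a r,
      fderiv ℝ ψ (coneMap f (e, t)) (Real.exp t • (fderiv ℝ f e a + r • f e)) = -r := by
    intro a r
    have h1 := hasFDerivAt_coneMap (hf.self_of_nhds.differentiableAt (by simp)) t
    have h2 : HasFDerivAt (fun z => ψ (coneMap f z)) _ (e, t) :=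
      (hψ.self_of_nhds.differentiableAt (by simp)).hasFDerivAt.comp (e, t) h1
    have h3 : HasFDerivAt (fun z : E × ℝ => -z.2) (-ContinuousLinearMap.snd ℝ E ℝ) (e, t) :=
      hasFDerivAt_snd.fun_neg
    have h4 := (h2.congr_of_eventuallyEq (h.mono fun _ h => h.symm)).unique h3
    have h5 := congrArg (fun A : E × ℝ →L[ℝ] ℝ => A (a, r)) h4
    simpa [mul_add] using h5
  refine ⟨first, fun a r k γ hk => ?_⟩
  have hev : ∀ᶠ s in 𝓝 (0 : ℝ), ContDiffAt ℝ 3 f (e + s • a) := by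
    have hc : ContinuousAt (fun s : ℝ => e + s • a) 0 := by fun_prop
    refine hc.eventually ?_
    simpa using hf
  -- Along the image of a straight line in `(e, t)` the function `ψ` is affine, so the Hessian in
  -- the direction `c'(0)` is `-dψ(c''(0))`.
  set c := fun s : ℝ => coneMap f (e + s • a, t + r * s)
  set c' := fun s : ℝ => Real.exp (t + r * s) • (fderiv ℝ f (e + s • a) a + r • f (e + s • a))
  have hc : ∀ᶠ s in 𝓝 (0 : ℝ), HasDerivAt c (c' s) s := by
    filter_upwards [hev] with s hs
    have h1 := (hasFDerivAt_coneMap (hs.differentiableAt (by simp)) (t + r * s)).comp_hasDerivAt s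
      (hlin a r s)
    exact h1.congr_deriv (by simp [c'])
  have hd : DifferentiableAt ℝ f e := hf.self_of_nhds.differentiableAt (by simp)
  have hd2 : DifferentiableAt ℝ (fderiv ℝ f) e :=
    (hf.self_of_nhds.fderiv_right (m := 2) (by norm_num)).differentiableAt (by simp)
  have hl : HasDerivAt (fun s : ℝ => e + s • a) a 0 := by
    simpa using ((hasDerivAt_id (0 : ℝ)).smul_const a).const_add e
  have he : HasDerivAt (fun s : ℝ => Real.exp (t + r * s)) (Real.exp t * r) 0 := by
    have h2 : HasDerivAt (fun s : ℝ => t + r * s) r 0 := by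
      simpa using ((hasDerivAt_id (0 : ℝ)).const_mul r).const_add t
    simpa using h2.exp
  have hf1 : HasDerivAt (fun s : ℝ => f (e + s • a)) (fderiv ℝ f e a) 0 := by
    refine HasFDerivAt.comp_hasDerivAt 0 ?_ hl
    simpa using hd.hasFDerivAt
  have hf2 : HasDerivAt (fun s : ℝ => fderiv ℝ f (e + s • a) a) (fderiv ℝ (fderiv ℝ f) e a a) 0 := by
    have h3 : HasDerivAt (fun s : ℝ => fderiv ℝ f (e + s • a)) (fderiv ℝ (fderiv ℝ f) e a) 0 := by
      refine HasFDerivAt.comp_hasDerivAt 0 ?_ hl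
      simpa using hd2.hasFDerivAt
    simpa using h3.clm_apply (hasDerivAt_const 0 a)
  have hc' := he.fun_smul (hf2.fun_add (hf1.fun_const_smul r))
  have hc0 : c 0 = coneMap f (e, t) := by simp only [c, h0]
  have hψ0 : ∀ᶠ s in 𝓝 (0 : ℝ), ψ (c s) = -t + -r * s := by
    have h1 := (hlin a r 0).continuousAt.tendsto
    rw [h0] at h1
    filter_upwards [h1.eventually h] with s hs
    rw [hs]
    ring
  have h1 := (hess_of_comp_affine (c := c) (c' := c') (by rwa [hc0]) hc hc' hψ0).2
  have hc'0 : c' 0 = Real.exp t • (fderiv ℝ f e a + r • f e) := by simp [c']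
  rw [hc0, hc'0] at h1
  rw [h1]
  -- This is the acceleration `c''(0)`. Its tangential part is killed by `dψ`; the radial
  -- coefficient is `γ` from the structure equation plus `r²` from the exponential.
  have h2 : Real.exp (t + r * 0) • (fderiv ℝ (fderiv ℝ f) e a a + r • fderiv ℝ f e a) +
      (Real.exp t * r) • (fderiv ℝ f (e + (0 : ℝ) • a) a + r • f (e + (0 : ℝ) • a)) =
      Real.exp t • (fderiv ℝ f e (k + (2 * r) • a) + (γ + r ^ 2) • f e) := by
    rw [hk, mul_zero, add_zero, zero_smul, add_zero, map_add, map_smul]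
    module
  rw [h2, first, neg_neg]

end Cone

/-! ### The cone over a development and its Hessian potential. -/

section ConeOfDevelopment

variable {n : ℕ} {M : Type*} [TopologicalSpace M] [ChartedSpace (EuclideanSpace ℝ (Fin n)) M]
  [IsManifold (𝓡 n) ∞ M] {f : M → Fin (n + 1) → ℝ} {U : Set M}

theorem IsRadialImmersionOn.fderiv_inChart (hf : IsRadialImmersionOn f U) {x : M} (hx : x ∈ U)
    (v : TangentSpace (𝓡 n) x) :
    fderiv ℝ (inChart n x f) (chartMap n x x) (mvfderiv (𝓡 n) (chartMap n x) x v) =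
      mvfderiv (𝓡 n) f x v := by
  have hx' : x ∈ chartSource n x := mem_chart_source _ x
  refine (mvfderiv_eq_inChart hx' ?_ v).symm
  exact ((contDiffOn_inChart le_rfl hf.smooth x).contDiffAt ((isOpen_chartImage x hf.isOpen).mem_nhds
    (chartMap_mem_chartImage (n := n) hx' hx))).differentiableAt (by simp)

theorem exists_mvfderiv_chartMap_eq (x : M) (a : EuclideanSpace ℝ (Fin n)) :
    ∃ v : TangentSpace (𝓡 n) x, mvfderiv (𝓡 n) (chartMap n x) x v = a :=
  ⟨coordField x a x, mvfderiv_chartMap_coordField (mem_chart_source _ x) a⟩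

variable {D : (Π x : M, TangentSpace (𝓡 n) x) →
      (Π x : M, TangentSpace (𝓡 n) x →L[ℝ] TangentSpace (𝓡 n) x)}
    {g : Π x : M, TangentSpace (𝓡 n) x →L[ℝ] TangentSpace (𝓡 n) x →L[ℝ] ℝ}

/-- The structure equation applied to a coordinate field. The Christoffel terms go into the
unspecified tangential vector `k`; only the radial coefficient enters the Hessian of the potential.
-/
theorem IsRadialFor.fderiv_fderiv_inChart (hf : IsRadialFor D g f U) {x : M} (hx : x ∈ U)
    (v : TangentSpace (𝓡 n) x) :
    ∃ k, fderiv ℝ (fderiv ℝ (inChart n x f)) (chartMap n x x)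
        (mvfderiv (𝓡 n) (chartMap n x) x v) (mvfderiv (𝓡 n) (chartMap n x) x v) =
      fderiv ℝ (inChart n x f) (chartMap n x x) k + g x v v • f x := by
  have hx' : x ∈ chartSource n x := mem_chart_source _ x
  set a := mvfderiv (𝓡 n) (chartMap n x) x v
  have hY : IsDiffFieldAt (coordField x a) x :=
    (isSmoothFieldOn_coordField x a).isDiffFieldAt (isOpen_chartSource (n := n) x) hx'
  have hYx : coordField x a x = v := coordField_mvfderiv_chartMap hx' v
  have h1 := hf.second x hx _ hY v
  rw [hYx, ← hf.fderiv_inChart hx] at h1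
  refine ⟨_, Eq.trans ?_ h1⟩
  have hcd : ContDiffAt ℝ ∞ (inChart n x f) (chartMap n x x) :=
    (contDiffOn_inChart le_rfl hf.smooth x).contDiffAt
    ((isOpen_chartImage x hf.isOpen).mem_nhds (chartMap_mem_chartImage (n := n) hx' hx))
  have h2 : DifferentiableAt ℝ (fun y => fderiv ℝ (inChart n x f) y a) (chartMap n x x) :=
    DifferentiableAt.clm_apply ((hcd.fderiv_right (m := ∞) le_rfl).differentiableAt (by simp))
      (differentiableAt_const a)
  have h3 : (fun z => mvfderiv (𝓡 n) f z (coordField x a z)) =ᶠ[𝓝 x]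
      fun z => fderiv ℝ (inChart n x f) (chartMap n x z) a := by
    filter_upwards [mvfderiv_field_eventuallyEq hf.isOpen (hf.smooth.of_le (by simp)) hx' hx
      (coordField x a), (isOpen_chartSource (n := n) x).mem_nhds hx'] with z hz hz'
    rw [hz, mvfderiv_chartMap_coordField hz']
  rw [mvfderiv_congr h3, mvfderiv_comp_fderiv h2 (mdifferentiableAt_chartMap hx')]
  rw [fderiv_clm_apply ((hcd.fderiv_right (m := ∞) le_rfl).differentiableAt (by simp))
    (differentiableAt_const a)]
  simp [a]

variable {vol : Π x : M, (TangentSpace (𝓡 n) x) [⋀^Fin n]→ₗ[ℝ] ℝ}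
  {M' : Type*} [TopologicalSpace M'] {p : M' → M} {F : M' → Fin (n + 1) → ℝ}

/-- The cone over a development is locally homeomorphic to `ℝⁿ⁺¹`, and the function `-t` on it
has potentials with positive definite Hessian. -/
theorem IsDevelopment.exists_chart_potential (hF : IsDevelopment D g vol p F)
    (hp : IsLocalHomeomorph p) (hg : ∀ (x : M) (v : TangentSpace (𝓡 n) x), v ≠ 0 → 0 < g x v v)
    (m : M' × ℝ) :
    (∃ e : OpenPartialHomeomorph (M' × ℝ) (Fin (n + 1) → ℝ), m ∈ e.source ∧
      EqOn (coneMap F) e e.source) ∧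
    ∃ ψ, IsPotentialAt (coneMap F) (fun m => -m.2) m ψ ∧ fderiv ℝ ψ (coneMap F m) (coneMap F m) = -1 ∧
      ∀ w, fderiv ℝ ψ (coneMap F m) w ^ 2 ≤ fderiv ℝ (fderiv ℝ ψ) (coneMap F m) w w ∧
        (w ≠ 0 → 0 < fderiv ℝ (fderiv ℝ ψ) (coneMap F m) w w) := by
  obtain ⟨z, t⟩ := m
  obtain ⟨f, U, hxU, hf, -, hFf⟩ := hF z
  set x := p z
  have hx' : x ∈ chartSource n x := mem_chart_source _ x
  set fh := inChart n x f
  set y := chartMap n x x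
  have hev : ∀ᶠ u in 𝓝 y, ContDiffAt ℝ 3 fh u := by
    filter_upwards [(isOpen_chartImage x hf.isOpen).mem_nhds
      (chartMap_mem_chartImage (n := n) hx' hxU)] with u hu
    exact ((contDiffOn_inChart le_rfl hf.smooth x).contDiffAt
      ((isOpen_chartImage x hf.isOpen).mem_nhds hu)).of_le (WithTop.coe_le_coe.2 (le_top : (3 : ℕ∞) ≤ ⊤))
  have hfy : fh y = f x := inChart_chartMap hx' f
  have hinj : ∀ (a : EuclideanSpace ℝ (Fin n)) (r : ℝ),
      fderiv ℝ fh y a + r • fh y = 0 → a = 0 ∧ r = 0 := by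
    intro a r h
    obtain ⟨v, rfl⟩ := exists_mvfderiv_chartMap_eq x a
    rw [hfy, hf.fderiv_inChart hxU, ← radialFrame_apply] at h
    have h1 : (v, r) = (0 : TangentSpace (𝓡 n) x × ℝ) :=
      hf.injective x hxU (h.trans (map_zero _).symm)
    rw [Prod.mk_eq_zero] at h1
    rw [h1.1, h1.2]
    simp
  obtain ⟨Φ, hΦs, hΦ, hΦd⟩ := exists_coneChart (by simp) hev.self_of_nhds hinj t
  obtain ⟨pe, hpe, hpe'⟩ := hp z
  obtain ⟨S, hS, hSo, hzS⟩ := eventually_nhds_iff.1 hFf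
  -- The cone map is, near `(z, t)`, the composition of `p`, a chart of `M` and the local cone chart
  -- `Φ`, restricted to where `F = f ∘ p`.
  set c := pe.trans (chartAt (EuclideanSpace ℝ (Fin n)) x)
  set e := ((c.prod (OpenPartialHomeomorph.refl ℝ)).trans Φ).restrOpen (S ×ˢ univ)
    (hSo.prod isOpen_univ)
  have hc : ∀ z' ∈ c.source, c z' = chartMap n x (p z') ∧ p z' ∈ chartSource n x := by
    intro z' hz'
    have h1 : pe z' ∈ chartSource n x := hz'.2
    rw [← hpe'] at h1
    refine ⟨?_, h1⟩
    rw [hpe']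
    rfl
  have hzc : z ∈ c.source := by
    refine ⟨hpe, ?_⟩
    change pe z ∈ chartSource n x
    rw [← hpe']
    exact hx'
  have hsource : ∀ m ∈ e.source, (c m.1, m.2) ∈ Φ.source ∧ m.1 ∈ c.source ∧
      coneMap F m = Φ (c m.1, m.2) := by
    rintro ⟨z', t'⟩ ⟨⟨⟨h1, -⟩, h2⟩, h3, -⟩
    refine ⟨h2, h1, ?_⟩
    obtain ⟨h4, h5⟩ := hc z' h1
    rw [hΦ, h4]
    change Real.exp t' • F z' = Real.exp t' • fh (chartMap n x (p z'))
    rw [hS z' h3, show fh (chartMap n x (p z')) = f (p z') from inChart_chartMap h5 f]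
  have hmem : (z, t) ∈ e.source := by
    refine ⟨⟨⟨hzc, mem_univ _⟩, ?_⟩, hzS, mem_univ _⟩
    change (c z, t) ∈ Φ.source
    rw [(hc z hzc).1]
    exact hΦs
  have hq : coneMap F (z, t) = coneMap fh (y, t) := by
    rw [(hsource _ hmem).2.2, hΦ]
    change coneMap fh (c z, t) = _
    rw [(hc z hzc).1]
  -- The potential is `-t`, where `t` is the second coordinate of the inverse of the cone chart.
  refine ⟨⟨e, hmem, fun m hm => (hsource m hm).2.2⟩, fun v => -(Φ.symm v).2, ⟨?_, ?_⟩, ?_⟩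
  · rw [hq]
    filter_upwards [hΦd.eventually (by simp)] with v hv
    exact (contDiff_snd.contDiffAt.comp v hv).neg
  · filter_upwards [e.open_source.mem_nhds hmem] with m hm
    obtain ⟨h1, -, h2⟩ := hsource m hm
    rw [h2, Φ.left_inv h1]
  obtain ⟨first, second⟩ := hess_of_coneMap (ψ := fun v => -(Φ.symm v).2) hev t
    (by
      filter_upwards [hΦd.eventually (by simp)] with v hv
      exact (contDiff_snd.contDiffAt.comp v hv).neg)
    (by
      filter_upwards [Φ.open_source.mem_nhds hΦs] with u hu
      rw [← hΦ, Φ.left_inv hu])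
  rw [hq]
  constructor
  · have h1 := first 0 1
    rwa [map_zero, zero_add, one_smul] at h1
  · intro w
    -- With `w = exp(t) (df(v) + r f)`, the first derivative of the potential is `-r` and the second
    -- is `g(v, v) + r²`; both claims are read off from this.
    have h0 := hf.decomp hxU (Real.exp (-t) • w)
    set v := radialTangent f x (Real.exp (-t) • w)
    set r := radialCoeff f x (Real.exp (-t) • w)
    rw [← hf.fderiv_inChart hxU, ← hfy] at h0
    have h1 : w = Real.exp t • (fderiv ℝ fh y (mvfderiv (𝓡 n) (chartMap n x) x v) + r • fh y) := by
      rw [h0, smul_smul, ← Real.exp_add, add_neg_cancel, Real.exp_zero, one_smul]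
    obtain ⟨k, hk⟩ := hf.fderiv_fderiv_inChart hxU v
    rw [← hfy] at hk
    rw [h1, first, second _ r k _ hk]
    have hgv : 0 ≤ g x v v := by
      rcases eq_or_ne v 0 with hv | hv
      · rw [hv, map_zero]
      · exact (hg x v hv).le
    refine ⟨by linarith [neg_sq r], fun hw => ?_⟩
    by_contra hle
    have hr : r = 0 := by
      have := sq_nonneg r
      exact pow_eq_zero_iff two_ne_zero |>.1 (by linarith)
    have hv : v = 0 := by
      by_contra hv
      have := hg x v hv
      have := sq_nonneg r
      linarith
    rw [hr, hv] at hw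
    simp at hw

end ConeOfDevelopment

/-! ## Universal coverings -/

section Covering

variable {M' M : Type*} [TopologicalSpace M'] [TopologicalSpace M] {p : M' → M}

theorem IsCoveringMap.t2Space [T2Space M] (hp : IsCoveringMap p) : T2Space M' := by
  refine ⟨fun x y hxy => ?_⟩
  by_cases h : p x = p y
  · exact hp.isSeparatedMap x y h hxy
  · obtain ⟨U, V, hU, hV, hx, hy, hd⟩ := t2_separation h
    exact ⟨_, _, hU.preimage hp.continuous, hV.preimage hp.continuous, hx, hy, hd.preimage p⟩

theorem IsCoveringMap.surjective_of_pathConnectedSpace [PathConnectedSpace M] [Nonempty M']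
    (hp : IsCoveringMap p) : Function.Surjective p := by
  intro y
  obtain ⟨x⟩ := ‹Nonempty M'›
  let γ := PathConnectedSpace.somePath (p x) y
  obtain ⟨Γ, h, -⟩ := hp.exists_path_lifts γ.toContinuousMap x γ.source
  exact ⟨Γ 1, (congrFun h 1).trans γ.target⟩

/-- The deck group of a universal covering is transitive on the fibres. -/
theorem IsCoveringMap.exists_deck [SimplyConnectedSpace M'] [LocallyPathConnectedSpace M']
    (hp : IsCoveringMap p) {x y : M'} (h : p x = p y) : ∃ γ : DeckGroup p, γ.1 x = y := by
  have hex := fun x y h => (hp.existsUnique_continuousMap_lifts ⟨p, hp.continuous⟩ x y h).exists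
  have huniq : ∀ (f : C(M', M')) (x : M'), f x = x → p ∘ f = p → f = ContinuousMap.id M' :=
    fun f x h1 h2 => (hp.existsUnique_continuousMap_lifts ⟨p, hp.continuous⟩ x x rfl).unique
      ⟨h1, h2⟩ ⟨rfl, rfl⟩
  obtain ⟨F, hF, hF'⟩ := hex x y h.symm
  obtain ⟨G, hG, hG'⟩ := hex y x h
  have h1 : F.comp G = ContinuousMap.id M' := huniq _ y
    ((congrArg F hG).trans hF) (by
      change (p ∘ F) ∘ G = p
      rw [hF']; exact hG')
  have h2 : G.comp F = ContinuousMap.id M' := huniq _ x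
    ((congrArg G hF).trans hG) (by
      change (p ∘ G) ∘ F = p
      rw [hG']; exact hF')
  exact ⟨⟨⟨⟨F, G, fun z => congrArg (fun f : C(M', M') => f z) h2,
    fun z => congrArg (fun f : C(M', M') => f z) h1⟩, F.continuous, G.continuous⟩,
    fun z => congrFun hF' z⟩, hF⟩

/-- The images of compact neighbourhoods of chosen preimages cover `M`, and finitely many suffice.
-/
theorem exists_isCompact_image_eq_univ [CompactSpace M] [WeaklyLocallyCompactSpace M']
    (hc : IsOpenMap p) (hs : Function.Surjective p) : ∃ K : Set M', IsCompact K ∧ p '' K = univ := by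
  have h : ∀ x : M', ∃ K : Set M', IsCompact K ∧ K ∈ 𝓝 x := exists_compact_mem_nhds
  choose K hK hKx using h
  choose s hs using hs
  obtain ⟨t, ht⟩ := isCompact_univ.elim_nhds_subcover' (fun y _ => p '' K (s y))
    fun y _ => by
      have := hc.image_mem_nhds (hKx (s y))
      rwa [hs] at this
  refine ⟨⋃ y ∈ t, K (s y.1), t.isCompact_biUnion fun y _ => hK _, ?_⟩
  rw [← univ_subset_iff]
  refine ht.trans ?_
  rw [image_iUnion₂]

end Covering

/-! ## The cone over a development is convex -/

section ConvexDevelopment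

variable {n : ℕ} {M : Type*} [TopologicalSpace M] [ChartedSpace (EuclideanSpace ℝ (Fin n)) M]
  [IsManifold (𝓡 n) ∞ M]
  {D : (Π x : M, TangentSpace (𝓡 n) x) →
      (Π x : M, TangentSpace (𝓡 n) x →L[ℝ] TangentSpace (𝓡 n) x)}
    {g : Π x : M, TangentSpace (𝓡 n) x →L[ℝ] TangentSpace (𝓡 n) x →L[ℝ] ℝ}
  {vol : Π x : M, (TangentSpace (𝓡 n) x) [⋀^Fin n]→ₗ[ℝ] ℝ}
  {M' : Type*} [TopologicalSpace M'] {p : M' → M} {F : M' → Fin (n + 1) → ℝ}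

theorem coneMap_zero {X V : Type*} [AddCommGroup V] [Module ℝ V] (f : X → V) (x : X) :
    coneMap f (x, 0) = f x := by
  rw [coneMap, Real.exp_zero, one_smul]

theorem smul_mem_range_coneMap {X V : Type*} [AddCommGroup V] [Module ℝ V] {f : X → V} {c : ℝ}
    (hc : 0 < c) {v : V} (hv : v ∈ range (coneMap f)) : c • v ∈ range (coneMap f) := by
  obtain ⟨⟨x, t⟩, rfl⟩ := hv
  refine ⟨(x, Real.log c + t), ?_⟩
  rw [coneMap, coneMap, Real.exp_add, Real.exp_log hc, smul_smul]

/-- The linear automorphism `exp(t) A` of `ℝⁿ⁺¹`. -/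
noncomputable def scaledSL (A : Matrix.SpecialLinearGroup (Fin (n + 1)) ℝ) (t : ℝ) :
    (Fin (n + 1) → ℝ) ≃L[ℝ] (Fin (n + 1) → ℝ) :=
  ((Matrix.SpecialLinearGroup.toLin' A).trans
    (LinearEquiv.smulOfNeZero ℝ _ (Real.exp t) (Real.exp_pos t).ne')).toContinuousLinearEquiv

theorem scaledSL_apply (A : Matrix.SpecialLinearGroup (Fin (n + 1)) ℝ) (t : ℝ)
    (v : Fin (n + 1) → ℝ) : scaledSL A t v = Real.exp t • A.1.mulVec v := rfl

theorem IsDevelopment.isLocalHomeomorph_coneMap (hF : IsDevelopment D g vol p F)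
    (hp : IsLocalHomeomorph p) (hg : ∀ (x : M) (v : TangentSpace (𝓡 n) x), v ≠ 0 → 0 < g x v v) :
    IsLocalHomeomorph (coneMap F) :=
  IsLocalHomeomorph.mk _ fun m => (hF.exists_chart_potential hp hg m).1

/-- A deck transformation combined with a translation by `t` acts on the cone as `exp(t)` times the
holonomy, and changes `-t` only by a constant. These symmetries move the compact set `K ×ˢ {0}` over
all of `M' × ℝ`. -/
theorem IsDevelopment.koszulData [CompactSpace M] [PathConnectedSpace M] [SimplyConnectedSpace M']
    [LocallyPathConnectedSpace M'] [WeaklyLocallyCompactSpace M'] (hF : IsDevelopment D g vol p F)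
    (hp : IsCoveringMap p) (hg : ∀ (x : M) (v : TangentSpace (𝓡 n) x), v ≠ 0 → 0 < g x v v) :
    KoszulData (coneMap F) (fun m => -m.2)
      (fun m w => potentialDeriv (coneMap F) (fun m => -m.2) m w)
      (fun m w => potentialHess (coneMap F) (fun m => -m.2) m w w) := by
  have hq := hF.isLocalHomeomorph_coneMap hp.isLocalHomeomorph hg
  obtain ⟨K, hK, hKM⟩ := exists_isCompact_image_eq_univ hp.isOpenMap
    hp.surjective_of_pathConnectedSpace
  refine koszulData_of_potential hq
    (fun m => (hF.exists_chart_potential hp.isLocalHomeomorph hg m).2.imp fun _ h => h.1)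
    (fun m w hw => ?_) (hK.prod (isCompact_singleton (x := (0 : ℝ)))) fun m => ?_
  · obtain ⟨ψ, hψ, -, h⟩ := (hF.exists_chart_potential hp.isLocalHomeomorph hg m).2
    rw [hψ.hess_eq hq]
    exact (h w).2 hw
  · obtain ⟨z, t⟩ := m
    obtain ⟨k, hk, hkz⟩ : p z ∈ p '' K := by rw [hKM]; exact mem_univ _
    obtain ⟨γ, hγ⟩ := hp.exists_deck hkz
    refine ⟨(k, 0), ⟨hk, rfl⟩, γ.1.prodCongr (Homeomorph.addRight t),
      scaledSL (hF.holonomy hp.continuous hp.isOpenMap γ) t, ⟨?_, -t, ?_⟩, ?_⟩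
    · rintro ⟨k', s⟩
      change Real.exp (s + t) • F (γ.1 k') = _
      rw [scaledSL_apply, hF.holonomy_spec hp.continuous hp.isOpenMap, coneMap, Matrix.mulVec_smul,
        smul_smul, ← Real.exp_add, add_comm s t]
    · rintro ⟨k', s⟩
      exact neg_add s t
    · exact Prod.ext hγ (zero_add t)

/-- The cone over a development is injective, and its image is an open convex cone that contains
no line. -/
theorem IsDevelopment.convex_coneMap [T2Space M] [CompactSpace M] [PathConnectedSpace M]
    [SimplyConnectedSpace M']
    [LocallyPathConnectedSpace M'] [WeaklyLocallyCompactSpace M'] (hF : IsDevelopment D g vol p F)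
    (hp : IsCoveringMap p) (hg : ∀ (x : M) (v : TangentSpace (𝓡 n) x), v ≠ 0 → 0 < g x v v) :
    Function.Injective (coneMap F) ∧ Convex ℝ (range (coneMap F)) ∧
      ∃ (ℓ : (Fin (n + 1) → ℝ) →L[ℝ] ℝ) (c : ℝ), 0 < c ∧
        ∀ w ∈ range (coneMap F), c * ‖w‖ ≤ ℓ w := by
  have hq := hF.isLocalHomeomorph_coneMap hp.isLocalHomeomorph hg
  have hK := hF.koszulData hp hg
  have := hp.t2Space
  have hinj := hK.injective
  have hconv := hK.convex_range
  refine ⟨hinj, hconv, ?_⟩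
  obtain ⟨z⟩ : Nonempty M' := inferInstance
  -- The linear form is minus the differential of `-t` at the point `(z, 0)`, with `z` arbitrary.
  obtain ⟨c, hc, h⟩ := hK.exists_bound hinj hconv (fun c hc v hv => smul_mem_range_coneMap hc hv)
    (fun m w hw => by
      obtain ⟨ψ, hψ, -, h⟩ := (hF.exists_chart_potential hp.isLocalHomeomorph hg m).2
      rw [hψ.hess_eq hq]
      exact (h w).2 hw)
    (fun m w => by
      obtain ⟨ψ, hψ, -, h⟩ := (hF.exists_chart_potential hp.isLocalHomeomorph hg m).2
      rw [hψ.hess_eq hq, hψ.deriv_eq hq]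
      exact (h w).1)
    (z, 0) (-potentialDeriv (coneMap F) (fun m => -m.2) (z, 0)) (fun w => by simp)
  exact ⟨_, c, hc, h⟩

theorem IsDevelopment.isRadialImmersionOn [ChartedSpace (EuclideanSpace ℝ (Fin n)) M']
    [IsManifold (𝓡 n) ∞ M'] (hF : IsDevelopment D g vol p F)
    (hp : IsLocalDiffeomorph (𝓡 n) (𝓡 n) ∞ p) : IsRadialImmersionOn F univ where
  isOpen := isOpen_univ
  smooth := by
    refine contMDiffOn_univ.2 fun z => ?_
    obtain ⟨f, U, hxU, hf, -, hFf⟩ := hF z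
    refine ContMDiffAt.congr_of_eventuallyEq ?_ hFf
    exact ContMDiffAt.comp (g := f) z (hf.smooth.contMDiffAt (hf.isOpen.mem_nhds hxU))
      (hp.contMDiff z)
  injective z _ := by
    obtain ⟨f, U, hxU, hf, -, hFf⟩ := hF z
    have hpz : MDifferentiableAt (𝓡 n) (𝓡 n) p z := (hp.contMDiff z).mdifferentiableAt (by simp)
    rw [radialFrame_congr hFf]
    refine (injective_iff_map_eq_zero (radialFrame (fun z => f (p z)) z)).2 ?_
    rintro ⟨v, r⟩ h
    rw [radialFrame_apply, mvfderiv_comp_mfderiv (hf.mdifferentiableAt hxU) hpz,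
      ← radialFrame_apply] at h
    have h1 : (mfderiv (𝓡 n) (𝓡 n) p z v, r) = (0 : TangentSpace (𝓡 n) (p z) × ℝ) :=
      hf.injective _ hxU (h.trans (map_zero _).symm)
    rw [Prod.mk_eq_zero] at h1
    have h2 : Function.Injective (mfderiv (𝓡 n) (𝓡 n) p z) :=
      ((hp z).mfderivToContinuousLinearEquiv (by simp)).injective
    rw [h1.2, h2 (h1.1.trans (map_zero _).symm)]
    rfl

end ConvexDevelopment

/-! ### Passage from the cone to projective space. -/

section Projective

variable {n : ℕ} {X : Type*} [TopologicalSpace X] {F : X → Fin (n + 1) → ℝ}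

/-- The map to projective space given by a nowhere vanishing map to `ℝⁿ⁺¹`. -/
noncomputable def projMap (F : X → Fin (n + 1) → ℝ) (h0 : ∀ x, F x ≠ 0) (x : X) :
    ℙ ℝ (Fin (n + 1) → ℝ) := Projectivization.mk ℝ (F x) (h0 x)

theorem continuous_projMap (h0 : ∀ x, F x ≠ 0) (hF : Continuous F) : Continuous (projMap F h0) :=
  continuous_coinduced_rng.comp (hF.subtype_mk h0)

/-- Two representatives of a point differ by a nonzero scalar; the cone map contains the positive
multiples only, so the sign must be recorded. -/
theorem mk_mem_image_projMap_iff (h0 : ∀ x, F x ≠ 0) {v : Fin (n + 1) → ℝ} (hv : v ≠ 0)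
    {O : Set X} : Projectivization.mk ℝ v hv ∈ projMap F h0 '' O ↔
      v ∈ coneMap F '' (O ×ˢ univ) ∨ -v ∈ coneMap F '' (O ×ˢ univ) := by
  constructor
  · rintro ⟨x, hx, h⟩
    obtain ⟨a, ha⟩ := (Projectivization.mk_eq_mk_iff' ℝ _ _ hv (h0 x)).1 h.symm
    have ha0 : a ≠ 0 := by
      rintro rfl
      exact hv (by rw [← ha, zero_smul])
    rcases lt_or_gt_of_ne ha0 with h1 | h1
    · refine Or.inr ⟨(x, Real.log (-a)), ⟨hx, mem_univ _⟩, ?_⟩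
      rw [coneMap, Real.exp_log (neg_pos.2 h1), neg_smul, ha]
    · refine Or.inl ⟨(x, Real.log a), ⟨hx, mem_univ _⟩, ?_⟩
      rw [coneMap, Real.exp_log h1, ha]
  · rintro (⟨⟨x, t⟩, ⟨hx, -⟩, h⟩ | ⟨⟨x, t⟩, ⟨hx, -⟩, h⟩)
    · exact ⟨x, hx, ((Projectivization.mk_eq_mk_iff' ℝ _ _ hv (h0 x)).2 ⟨Real.exp t, h⟩).symm⟩
    · refine ⟨x, hx, ((Projectivization.mk_eq_mk_iff' ℝ _ _ hv (h0 x)).2 ⟨-Real.exp t, ?_⟩).symm⟩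
      rw [neg_smul, neg_eq_iff_eq_neg]
      exact h

variable {ℓ : (Fin (n + 1) → ℝ) →L[ℝ] ℝ} {c : ℝ}

theorem neg_notMem_range_coneMap (hpos : ∀ x, 0 < ℓ (F x)) {v : Fin (n + 1) → ℝ} (hv : 0 < ℓ v) :
    -v ∉ range (coneMap F) := by
  rintro ⟨⟨x, t⟩, h⟩
  have h1 := congrArg ℓ h
  rw [coneMap, map_smul, map_neg, smul_eq_mul] at h1
  have := mul_pos (Real.exp_pos t) (hpos x)
  simp only at h1
  linarith

/-- Positivity of `ℓ` excludes opposite representatives, so injectivity on the cone passes to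
projective space. Images of open sets are open because their preimages in `ℝⁿ⁺¹` are a union of an
open cone and its negative. -/
theorem isEmbedding_projMap (h0 : ∀ x, F x ≠ 0) (hq : IsLocalHomeomorph (coneMap F))
    (hinj : Function.Injective (coneMap F)) (hpos : ∀ x, 0 < ℓ (F x)) :
    IsEmbedding (projMap F h0) := by
  have hc : Continuous F := by
    have h1 : Continuous fun x => coneMap F (x, 0) := hq.continuous.comp (by fun_prop)
    simpa only [coneMap_zero] using h1
  refine (IsOpenEmbedding.of_continuous_injective_isOpenMap (continuous_projMap h0 hc) ?_
    fun O hO => ?_).isEmbedding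
  · intro x y hxy
    have h1 : projMap F h0 x ∈ projMap F h0 '' {y} := ⟨y, rfl, hxy.symm⟩
    rcases (mk_mem_image_projMap_iff h0 (h0 x)).1 h1 with ⟨⟨y', t⟩, ⟨rfl, -⟩, h2⟩ | h2
    · rw [← coneMap_zero F x] at h2
      exact (congrArg Prod.fst (hinj h2)).symm
    · exact absurd (image_subset_range _ _ h2) (neg_notMem_range_coneMap hpos (hpos x))
  · refine isOpen_coinduced.2 ?_
    have h1 : IsOpen (coneMap F '' (O ×ˢ univ)) := hq.isOpenMap _ (hO.prod isOpen_univ)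
    have h2 : (fun v : {v : Fin (n + 1) → ℝ // v ≠ 0} => Projectivization.mk' ℝ v) ⁻¹'
        (projMap F h0 '' O) = Subtype.val ⁻¹' (coneMap F '' (O ×ˢ univ) ∪
          Neg.neg ⁻¹' (coneMap F '' (O ×ˢ univ))) := by
      ext ⟨v, hv⟩
      exact mk_mem_image_projMap_iff h0 hv
    rw [h2]
    exact (h1.union (h1.preimage continuous_neg)).preimage continuous_subtype_val

/-- In the affine chart of `ℓ` the image is the slice `ℓ = 1` of the convex cone, and `c ‖v‖ ≤ ℓ v =
1` confines it to a ball of radius `1 / c`. -/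
theorem isProperlyConvexSet_range_projMap [Nonempty X] (h0 : ∀ x, F x ≠ 0)
    (hconv : Convex ℝ (range (coneMap F))) (hc : 0 < c)
    (hℓ : ∀ w ∈ range (coneMap F), c * ‖w‖ ≤ ℓ w) :
    IsProperlyConvexSet (range (projMap F h0)) := by
  have hpos : ∀ x, 0 < ℓ (F x) := fun x =>
    (mul_pos hc (norm_pos_iff.2 (h0 x))).trans_le (hℓ _ ⟨(x, 0), coneMap_zero F x⟩)
  have hset : {v | ℓ v = 1 ∧ ∃ hv : v ≠ 0, Projectivization.mk ℝ v hv ∈ range (projMap F h0)} =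
      {v | ℓ v = 1} ∩ range (coneMap F) := by
    ext v
    refine and_congr_right fun h1 => ?_
    have hv : v ≠ 0 := by
      rintro rfl
      simp at h1
    have h1' : 0 < ℓ v := by
      rw [show ℓ v = 1 from h1]
      exact one_pos
    rw [exists_prop_of_true hv, ← image_univ, mk_mem_image_projMap_iff h0 hv, univ_prod_univ,
      image_univ, or_iff_left (neg_notMem_range_coneMap hpos h1')]
  have hplane : Convex ℝ {v : Fin (n + 1) → ℝ | ℓ v = 1} :=
    convex_hyperplane (f := ℓ) (r := 1) ⟨map_add ℓ, map_smul ℓ⟩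
  obtain ⟨x₀⟩ := ‹Nonempty X›
  refine ⟨ℓ.toLinearMap, ?_, ?_, ?_, {v | ℓ v = 1} ∩ Metric.closedBall 0 (1 / c), inter_subset_left,
    ?_, hplane.inter (convex_closedBall _ _), ?_⟩
  · intro h
    exact (hpos x₀).ne' (congrArg (fun l : (Fin (n + 1) → ℝ) →ₗ[ℝ] ℝ => l (F x₀)) h)
  · rintro _ ⟨x, rfl⟩
    obtain ⟨a, ha⟩ := Projectivization.exists_smul_eq_mk_rep ℝ (F x) (h0 x)
    change ℓ (Projectivization.mk ℝ (F x) (h0 x)).rep ≠ 0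
    rw [← ha, Units.smul_def, map_smul]
    exact mul_ne_zero a.ne_zero (hpos x).ne'
  · change Convex ℝ {v | ℓ v = 1 ∧ ∃ hv : v ≠ 0,
      Projectivization.mk ℝ v hv ∈ range (projMap F h0)}
    rw [hset]
    exact hplane.inter hconv
  · exact (isCompact_closedBall _ _).inter_left (isClosed_eq ℓ.continuous continuous_const)
  · change {v | ℓ v = 1 ∧ ∃ hv : v ≠ 0,
      Projectivization.mk ℝ v hv ∈ range (projMap F h0)} ⊆ _
    rw [hset]
    rintro v ⟨h1, h2⟩
    refine ⟨h1, ?_⟩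
    rw [mem_closedBall_zero_iff, le_div_iff₀ hc, mul_comm, ← show ℓ v = 1 from h1]
    exact hℓ v h2

end Projective

/-! ## Projective structures from radial immersions -/

section ProjectiveStructure

variable {n : ℕ} {M : Type*} [TopologicalSpace M] [ChartedSpace (EuclideanSpace ℝ (Fin n)) M]
  [IsManifold (𝓡 n) ∞ M]
  {g : Π x : M, TangentSpace (𝓡 n) x →L[ℝ] TangentSpace (𝓡 n) x →L[ℝ] ℝ}

theorem isProjectivelyFlat_of_isRadialFor {D : TangentConnection n M}
    (h : ∀ x, ∃ f U, x ∈ U ∧ IsRadialFor D.toFun g f U) : IsProjectivelyFlat D := by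
  intro x
  obtain ⟨f, U, hxU, hf⟩ := h x
  obtain ⟨O, i, hO, hxO, hOU, hi⟩ := hf.exists_affine hxU
  have hfO := hf.restrict hO hOU
  have hy := contMDiffOn_affineCoord hfO.smooth hi
  have hinv := fun z hz => hfO.isInvertible_affineCoord hi (x := z) hz
  exact ⟨O, hO, hxO, pullbackFlat (affineCoord i f), isCovariantDerivativeOn_pullbackFlat hO hy hinv,
    contMDiffCovariantDerivativeOn_pullbackFlat hO hy hinv,
    isTorsionFreeOn_pullbackFlat hO hy hinv, isFlatOn_pullbackFlat hO hy hinv, hfO.projEquivOn hi⟩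

variable {M' : Type*} [TopologicalSpace M'] [ChartedSpace (EuclideanSpace ℝ (Fin n)) M']
  {p : M' → M}

/-- A smooth local section of a local diffeomorphism. -/
theorem exists_local_section (hp : IsLocalDiffeomorph (𝓡 n) (𝓡 n) ∞ p) (x₀ : M') :
    ∃ (s : M → M') (U : Set M), IsOpen U ∧ p x₀ ∈ U ∧ s (p x₀) = x₀ ∧
      ContMDiffOn (𝓡 n) (𝓡 n) ∞ s U ∧ ∀ x ∈ U, p (s x) = x := by
  obtain ⟨Φ, hΦ, h⟩ := hp x₀
  refine ⟨Φ.symm, Φ.target, Φ.open_target, ?_, ?_, Φ.contMDiffOn_invFun, fun x hx => ?_⟩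
  · rw [h hΦ]; exact Φ.map_source hΦ
  · rw [h hΦ]; exact Φ.left_inv hΦ
  · have h1 : Φ.symm x ∈ Φ.source := Φ.toPartialEquiv.map_target hx
    rw [h h1]
    exact Φ.right_inv hx

theorem FlatProjStructure.isDefinedBy_of_isRadialFor (hp : IsLocalDiffeomorph (𝓡 n) (𝓡 n) ∞ p)
    {S : FlatProjStructure n p} {D : TangentConnection n M}
    (h : ∀ x₀ : M', ∃ f U, p x₀ ∈ U ∧ IsRadialFor D.toFun g f U ∧
      ∀ᶠ z in 𝓝 x₀, ∃ h0 : f (p z) ≠ 0, S.dev z = Projectivization.mk ℝ (f (p z)) h0) :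
    S.IsDefinedBy D := by
  intro x₀
  obtain ⟨f, U, hxU, hf, hdev⟩ := h x₀
  obtain ⟨s, W, hW, hxW, hsx, hs, hps⟩ := exists_local_section hp x₀
  obtain ⟨O, i, hO, hxO, hOU, hi⟩ := hf.exists_affine hxU
  obtain ⟨A, hA, hAo, hxA⟩ := eventually_nhds_iff.1 hdev
  set B := O ∩ (W ∩ s ⁻¹' A)
  have hB : IsOpen B := hO.inter (hs.continuousOn.isOpen_inter_preimage hW hAo)
  have hxB : p x₀ ∈ B := ⟨hxO, hxW, by rw [mem_preimage, hsx]; exact hxA⟩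
  have hfB := hf.restrict hB (inter_subset_left.trans hOU)
  have hiB : ∀ z ∈ B, f z i ≠ 0 := fun z hz => hi z hz.1
  have hy := contMDiffOn_affineCoord hfB.smooth hiB
  have hinv := fun z hz => hfB.isInvertible_affineCoord hiB (x := z) hz
  have hdevs : ∀ z ∈ B, ∃ h0 : f z ≠ 0, S.dev (s z) = Projectivization.mk ℝ (f z) h0 := by
    intro z hz
    have h1 := hA (s z) hz.2.2
    rwa [hps z hz.2.1] at h1
  have haff : ∀ z ∈ B, affineChart i (S.dev (s z)) = affineCoord i f z := by
    intro z hz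
    obtain ⟨h0, h1⟩ := hdevs z hz
    rw [h1, affineChart_mk_eq]
  refine ⟨B, s, i, hB, hxB, hsx, hs.mono fun z hz => hz.2.1, fun z hz => ⟨hps z hz.2.1, ?_⟩,
    pullbackFlat (affineCoord i f), isCovariantDerivativeOn_pullbackFlat hB hy hinv, ?_,
    hfB.projEquivOn hiB⟩
  · obtain ⟨h0, h1⟩ := hdevs z hz
    rw [h1, mk_mem_affineDomain]
    exact hiB z hz
  · intro Y x hx _ v
    have h1 : ∀ z ∈ B, (fun w => affineChart i (S.dev (s w))) =ᶠ[𝓝 z] affineCoord i f := by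
      intro z hz
      filter_upwards [hB.mem_nhds hz] with w hw using haff w hw
    have h2 : (fun z => mvfderiv (𝓡 n) (fun w => affineChart i (S.dev (s w))) z (Y z)) =ᶠ[𝓝 x]
        fun z => mvfderiv (𝓡 n) (affineCoord i f) z (Y z) := by
      filter_upwards [hB.mem_nhds hx] with z hz
      rw [mvfderiv_congr (h1 z hz)]
    rw [mvfderiv_congr (h1 x hx), mvfderiv_congr h2]
    exact mvfderiv_pullbackFlat hinv _ hx v

variable [IsManifold (𝓡 n) ∞ M']
  {D : (Π x : M, TangentSpace (𝓡 n) x) →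
      (Π x : M, TangentSpace (𝓡 n) x →L[ℝ] TangentSpace (𝓡 n) x)}
  {vol : Π x : M, (TangentSpace (𝓡 n) x) [⋀^Fin n]→ₗ[ℝ] ℝ} {F : M' → Fin (n + 1) → ℝ}

/-- The flat projective structure of a development. -/
noncomputable def IsDevelopment.flatProjStructure [PreconnectedSpace M'] [Nonempty M']
    (hF : IsDevelopment D g vol p F) (hp : IsLocalDiffeomorph (𝓡 n) (𝓡 n) ∞ p) :
    FlatProjStructure n p where
  dev := projMap F fun x => (hF.isRadialImmersionOn hp).ne_zero (mem_univ x)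
  hol := hF.holonomy hp.contMDiff.continuous hp.isOpenMap
  continuous_dev := continuous_projMap _
    (contMDiffOn_univ.1 (hF.isRadialImmersionOn hp).smooth).continuous
  localDiffeo x i hx := by
    have hr := hF.isRadialImmersionOn hp
    have h1 : (fun z => affineChart i (projMap F (fun x => hr.ne_zero (mem_univ x)) z)) =
        affineCoord i F := by
      funext z
      exact affineChart_mk_eq i (hr.ne_zero (mem_univ z))
    rw [h1]
    have hO : IsOpen {z | F z i ≠ 0} :=
      isOpen_ne_fun ((continuous_apply i).comp (contMDiffOn_univ.1 hr.smooth).continuous)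
        continuous_const
    have hrO := hr.mono hO (subset_univ _)
    exact isLocalDiffeomorphAt_of_isInvertible hO
      (contMDiffOn_affineCoord hrO.smooth fun z hz => hz)
      (fun z hz => hrO.isInvertible_affineCoord (fun z hz => hz) hz)
      ((mk_mem_affineDomain i (F x) (hr.ne_zero (mem_univ x))).1 hx)
  equivariant γ x := by
    have h1 := hF.holonomy_spec hp.contMDiff.continuous hp.isOpenMap γ x
    simp only [projMap, h1]
    rfl

/-- A solution of Condition (E) with positive definite `g` defines a properly convex projective
structure. -/
theorem exists_flatProjStructure_of_conditionE [T2Space M] [CompactSpace M] [ConnectedSpace M]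
    [SimplyConnectedSpace M'] (hp : IsCoveringMap p) (hp' : IsLocalDiffeomorph (𝓡 n) (𝓡 n) ∞ p)
    {D : TangentConnection n M} {g : SymmTwoTensor n M} (hE : ConditionE D g) (hg : g.IsPosDef) :
    IsProjectivelyFlat D ∧ ∃ S : FlatProjStructure n p, S.IsDefinedBy D ∧ S.IsProperlyConvex := by
  obtain ⟨vol, hvol, hpar⟩ := hE.preservesVolume
  have hloc := exists_isRadialFor_vol hE.smooth hE.flat hvol hpar
  have hM' : LocallyPathConnectedSpace M' :=
    ChartedSpace.locallyPathConnectedSpace (EuclideanSpace ℝ (Fin n)) M'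
  have hM : LocallyPathConnectedSpace M :=
    ChartedSpace.locallyPathConnectedSpace (EuclideanSpace ℝ (Fin n)) M
  have : PathConnectedSpace M := pathConnectedSpace_iff_connectedSpace.2 inferInstance
  have : LocallyCompactSpace M' := ChartedSpace.locallyCompactSpace (EuclideanSpace ℝ (Fin n)) M'
  refine ⟨isProjectivelyFlat_of_isRadialFor (g := g.toFun) fun x => ?_, ?_⟩
  · obtain ⟨f, U, hx, hf, -⟩ := hloc x
    exact ⟨f, U, hx, hf⟩
  choose f U hx hf hv using hloc
  let 𝒜 : RadialAtlas D.toFun g.toFun vol := ⟨f, U, hx, hf, hv⟩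
  obtain ⟨F, hF⟩ : ∃ F, IsDevelopment D.toFun g.toFun vol p F :=
    𝒜.exists_isDevelopment ⟨p, hp.continuous⟩
  obtain ⟨hinj, hconv, ℓ, c, hc, hℓ⟩ := hF.convex_coneMap hp hg
  have h0 : ∀ x, F x ≠ 0 := fun x => (hF.isRadialImmersionOn hp').ne_zero (mem_univ x)
  have hpos : ∀ x, 0 < ℓ (F x) := fun x =>
    (mul_pos hc (norm_pos_iff.2 (h0 x))).trans_le (hℓ _ ⟨(x, 0), coneMap_zero F x⟩)
  refine ⟨hF.flatProjStructure hp', FlatProjStructure.isDefinedBy_of_isRadialFor (g := g.toFun) hp'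
    fun x₀ => ?_, isEmbedding_projMap h0 (hF.isLocalHomeomorph_coneMap hp.isLocalHomeomorph hg) hinj
      hpos, isProperlyConvexSet_range_projMap h0 hconv hc hℓ⟩
  obtain ⟨f, U, hxU, hf, -, hFf⟩ := hF x₀
  refine ⟨f, U, hxU, hf, ?_⟩
  filter_upwards [hFf] with z hz
  refine ⟨hz ▸ h0 z, ?_⟩
  change Projectivization.mk ℝ (F z) _ = _
  simp only [hz]

end ProjectiveStructure

/-! ## Laplace transforms -/

section Laplace

open MeasureTheory

theorem one_add_pow_le_exp {b : ℝ} (hb : 0 < b) (m : ℕ) :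
    ∃ A : ℝ, 0 ≤ A ∧ ∀ t : ℝ, 0 ≤ t → (1 + t) ^ m ≤ A * Real.exp (b * t) := by
  refine ⟨(m.factorial : ℝ) * Real.exp b / b ^ m, by positivity, fun t ht => ?_⟩
  have h1 := Real.pow_div_factorial_le_exp (b * (1 + t)) (by positivity) m
  have h2 : Real.exp (b * (1 + t)) = Real.exp b * Real.exp (b * t) := by
    rw [← Real.exp_add]; ring_nf
  rw [div_le_iff₀ (by positivity), mul_pow, h2] at h1
  rw [div_mul_eq_mul_div, le_div_iff₀ (by positivity)]
  linarith

variable {E : Type} {W : Type*} [NormedAddCommGroup E] [NormedSpace ℝ E] [NormedAddCommGroup W]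
  [NormedSpace ℝ W] [MeasurableSpace W] [BorelSpace W] [FiniteDimensional ℝ W]

theorem integrable_one_add_norm_pow_mul_exp (μ : Measure W) [μ.IsAddHaarMeasure] {b : ℝ}
    (hb : 0 < b) (m : ℕ) : Integrable (fun y : W => (1 + ‖y‖) ^ m * Real.exp (-(b * ‖y‖))) μ := by
  set r : ℕ := Module.finrank ℝ W + 1
  obtain ⟨A, hA, h⟩ := one_add_pow_le_exp hb (m + r)
  have h1 : Integrable (fun y : W => A * (1 + ‖y‖) ^ (-(r : ℝ))) μ :=
    (integrable_one_add_norm (by simp [r])).const_mul A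
  refine h1.mono' (by fun_prop) (Filter.Eventually.of_forall fun y => ?_)
  have hy : 0 < 1 + ‖y‖ := by positivity
  rw [Real.norm_of_nonneg (by positivity), Real.rpow_neg hy.le, Real.rpow_natCast, Real.exp_neg,
    ← div_eq_mul_inv, ← div_eq_mul_inv, div_le_div_iff₀ (by positivity) (by positivity), ← pow_add]
  exact h _ (norm_nonneg y)

variable (B : E →L[ℝ] W →L[ℝ] ℝ) (K : Set W) (μ : Measure W)

/-- The Laplace transform of `G` on `K`. -/
noncomputable def laplace {F : Type*} [NormedAddCommGroup F] [NormedSpace ℝ F] (G : W → F) (v : E) :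
    F := ∫ y in K, Real.exp (-(B v y)) • G y ∂μ

/-- The derivative of the Laplace transform is a Laplace transform. -/
noncomputable def laplaceDeriv {F : Type*} [NormedAddCommGroup F] [NormedSpace ℝ F] (G : W → F)
    (y : W) : E →L[ℝ] F := -(B.flip y).smulRight (G y)

/-- `B v` is coercive on `K`. -/
def IsCoerciveAt (v : E) : Prop := ∃ δ : ℝ, 0 < δ ∧ ∀ y ∈ K, δ * ‖y‖ ≤ B v y

variable {B K μ} {F : Type*} [NormedAddCommGroup F] [NormedSpace ℝ F] {G : W → F}

/-- Continuous with polynomial growth. -/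
def IsTempered (G : W → F) : Prop :=
  Continuous G ∧ ∃ (c : ℝ) (k : ℕ), 0 ≤ c ∧ ∀ y, ‖G y‖ ≤ c * (1 + ‖y‖) ^ k

/-- Differentiating under the integral brings down a factor linear in `y`, so the growth exponent
increases by one. -/
theorem IsTempered.laplaceDeriv (hG : IsTempered G) : IsTempered (laplaceDeriv B G) := by
  obtain ⟨hc, c, k, hc0, h⟩ := hG
  refine ⟨((ContinuousLinearMap.smulRightL ℝ E F).continuous₂.comp
    ((B.flip.continuous).prodMk hc)).neg, ‖B.flip‖ * c, k + 1, by positivity, fun y => ?_⟩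
  have hy : ‖y‖ ≤ 1 + ‖y‖ := by linarith
  rw [_root_.laplaceDeriv, norm_neg, ContinuousLinearMap.norm_smulRight_apply]
  calc ‖B.flip y‖ * ‖G y‖ ≤ (‖B.flip‖ * (1 + ‖y‖)) * (c * (1 + ‖y‖) ^ k) :=
        mul_le_mul ((B.flip.le_opNorm y).trans (by gcongr)) (h y) (norm_nonneg _) (by positivity)
    _ = ‖B.flip‖ * c * (1 + ‖y‖) ^ (k + 1) := by ring

variable [μ.IsAddHaarMeasure]

theorem IsTempered.integrableOn (hG : IsTempered G) (hK : MeasurableSet K) {v : E}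
    (hv : IsCoerciveAt B K v) : IntegrableOn (fun y => Real.exp (-(B v y)) • G y) K μ := by
  obtain ⟨δ, hδ, h⟩ := hv
  obtain ⟨hc, c, k, hc0, hk⟩ := hG
  have h1 := (integrable_one_add_norm_pow_mul_exp μ hδ k).const_mul c
  refine Integrable.mono' h1.restrict ?_ ?_
  · exact (Continuous.smul (by fun_prop) hc).aestronglyMeasurable
  · filter_upwards [ae_restrict_mem hK] with y hy
    rw [norm_smul, Real.norm_of_nonneg (Real.exp_pos _).le, ← mul_assoc, mul_comm]
    exact mul_le_mul (hk y) (Real.exp_le_exp.2 (neg_le_neg (h y hy))) (Real.exp_pos _).le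
      (by positivity)

theorem IsTempered.hasFDerivAt_laplace [CompleteSpace F] (hG : IsTempered G) (hK : MeasurableSet K)
    {v : E} (hv : IsCoerciveAt B K v) :
    HasFDerivAt (laplace B K μ G) (laplace B K μ (_root_.laplaceDeriv B G) v) v := by
  have hint := hG.integrableOn (μ := μ) hK hv
  obtain ⟨δ, hδ, h⟩ := hv
  have hG' := hG.laplaceDeriv (B := B)
  obtain ⟨hc', c, k, hc0, hk⟩ := hG'
  -- Small enough that half of the coercivity constant survives on the ball, which provides an
  -- integrable bound that does not depend on `w`.
  set ε := δ / 2 / (‖B‖ + 1)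
  have hε : 0 < ε := by positivity
  have hnear : ∀ w ∈ Metric.ball v ε, ∀ y ∈ K, δ / 2 * ‖y‖ ≤ B w y := by
    intro w hw y hy
    have h1 : |B (w - v) y| ≤ δ / 2 * ‖y‖ := by
      refine ((B (w - v)).le_opNorm y).trans ?_
      gcongr
      refine (B.le_opNorm _).trans ?_
      rw [Metric.mem_ball, dist_eq_norm] at hw
      calc ‖B‖ * ‖w - v‖ ≤ (‖B‖ + 1) * ε := by gcongr; linarith
        _ = δ / 2 := by simp only [ε]; field_simp
    have h2 : B w y = B v y + B (w - v) y := by rw [map_sub, sub_apply]; ring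
    rw [h2]
    have := h y hy
    have := neg_abs_le (B (w - v) y)
    linarith
  refine hasFDerivAt_integral_of_dominated_of_fderiv_le (Metric.ball_mem_nhds v hε)
    (F' := fun w y => Real.exp (-(B w y)) • _root_.laplaceDeriv B G y)
    (bound := fun y => c * ((1 + ‖y‖) ^ k * Real.exp (-(δ / 2 * ‖y‖)))) ?_ hint ?_ ?_ ?_ ?_
  · refine Filter.Eventually.of_forall fun w => ?_
    have h1 : Continuous fun y => Real.exp (-(B w y)) := by fun_prop
    exact (h1.smul hG.1).aestronglyMeasurable
  · have h1 : Continuous fun y => Real.exp (-(B v y)) := by fun_prop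
    exact (h1.smul hc').aestronglyMeasurable
  · filter_upwards [ae_restrict_mem hK] with y hy w hw
    rw [norm_smul, Real.norm_of_nonneg (Real.exp_pos _).le, ← mul_assoc, mul_comm]
    exact mul_le_mul (hk y) (Real.exp_le_exp.2 (neg_le_neg (hnear w hw y hy))) (Real.exp_pos _).le
      (by positivity)
  · exact ((integrable_one_add_norm_pow_mul_exp μ (half_pos hδ) k).const_mul c).restrict
  · refine Filter.Eventually.of_forall fun y w _ => ?_
    have h1 : HasFDerivAt (fun w => -(B w y)) (-(B.flip y)) w := (B.flip y).hasFDerivAt.fun_neg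
    refine (h1.exp.smul_const (G y)).congr_fderiv ?_
    ext u
    simp [_root_.laplaceDeriv, smul_smul]

/-- The derivative is again a Laplace transform of a tempered function, with values in linear maps.
The target space therefore changes at each step, so it is quantified inside the induction. -/
theorem contDiffOn_laplace {C : Set E} (hC : IsOpen C) (hK : MeasurableSet K)
    (hcoer : ∀ v ∈ C, IsCoerciveAt B K v) (m : ℕ) : ∀ {F : Type} [NormedAddCommGroup F]
    [NormedSpace ℝ F] [CompleteSpace F] {G : W → F}, IsTempered G →
    ContDiffOn ℝ m (laplace B K μ G) C := by
  induction m with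
  | zero =>
    intro F _ _ _ G hG
    exact contDiffOn_zero.2 fun v hv =>
      (hG.hasFDerivAt_laplace hK (hcoer v hv)).continuousAt.continuousWithinAt
  | succ m ih =>
    intro F _ _ _ G hG
    push_cast
    rw [contDiffOn_succ_iff_fderiv_of_isOpen hC]
    refine ⟨fun v hv => (hG.hasFDerivAt_laplace hK
      (hcoer v hv)).differentiableAt.differentiableWithinAt, by simp, ?_⟩
    exact (ih (hG.laplaceDeriv (B := B))).congr fun v hv =>
      (hG.hasFDerivAt_laplace hK (hcoer v hv)).fderiv

end Laplace

/-! ## The characteristic function of a convex cone -/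

section CharacteristicFunction

open MeasureTheory

variable {n : ℕ}

/-- The standard pairing of `ℝⁿ⁺¹` with itself. -/
noncomputable def dotPairing (n : ℕ) :
    (Fin (n + 1) → ℝ) →L[ℝ] (Fin (n + 1) → ℝ) →L[ℝ] ℝ :=
  ∑ i, (ContinuousLinearMap.proj (R := ℝ) (φ := fun _ : Fin (n + 1) => ℝ) i).smulRight
    (ContinuousLinearMap.proj (R := ℝ) (φ := fun _ : Fin (n + 1) => ℝ) i)

theorem dotPairing_apply (v w : Fin (n + 1) → ℝ) : dotPairing n v w = v ⬝ᵥ w := by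
  simp [dotPairing, dotProduct]

/-- The dual cone. -/
def dualCone (C : Set (Fin (n + 1) → ℝ)) : Set (Fin (n + 1) → ℝ) :=
  {y | ∀ v ∈ C, 0 ≤ v ⬝ᵥ y}

theorem isClosed_dualCone (C : Set (Fin (n + 1) → ℝ)) : IsClosed (dualCone C) := by
  have h : dualCone C = ⋂ v ∈ C, {y | 0 ≤ dotPairing n v y} := by
    ext y
    simp [dualCone, dotPairing_apply]
  rw [h]
  exact isClosed_biInter fun v _ => isClosed_le continuous_const (dotPairing n v).continuous

variable {C : Set (Fin (n + 1) → ℝ)}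

/-- A ball about `v` lies in `C`, so `y` may be tested against `v - s eᵢ` for `|s| < r`; this gives
`s yᵢ ≤ ⟨v, y⟩` for both signs of `s`, hence a bound on the sup norm of `y`. -/
theorem isCoerciveAt_dualCone (hC : IsOpen C) {v : Fin (n + 1) → ℝ} (hv : v ∈ C) :
    IsCoerciveAt (dotPairing n) (dualCone C) v := by
  obtain ⟨r, hr, hball⟩ := Metric.isOpen_iff.1 hC v hv
  refine ⟨r / 2, by positivity, fun y hy => ?_⟩
  have h1 : ∀ i (s : ℝ), |s| < r → s * y i ≤ v ⬝ᵥ y := by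
    intro i s hs
    have h2 := hy (v - Pi.single i s) (hball (by
      rw [Metric.mem_ball, dist_eq_norm, sub_sub_cancel_left, norm_neg, Pi.norm_single]
      exact hs))
    rw [sub_dotProduct, single_dotProduct] at h2
    linarith
  have h0 : 0 ≤ v ⬝ᵥ y := hy v hv
  rw [dotPairing_apply, mul_comm, ← le_div_iff₀ (by positivity)]
  refine (pi_norm_le_iff_of_nonneg (by positivity)).2 fun i => ?_
  rw [le_div_iff₀ (by positivity), Real.norm_eq_abs, mul_comm]
  have hr2 : |r / 2| < r := by rw [abs_of_pos (by positivity)]; linarith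
  rcases abs_cases (y i) with ⟨h, -⟩ | ⟨h, -⟩
  · rw [h]; exact h1 i _ hr2
  · rw [h]
    have := h1 i (-(r / 2)) (by rwa [abs_neg])
    linarith

/-- The characteristic function of a cone. -/
noncomputable def coneChar (C : Set (Fin (n + 1) → ℝ)) (v : Fin (n + 1) → ℝ) : ℝ :=
  laplace (dotPairing n) (dualCone C) volume (fun _ => (1 : ℝ)) v

theorem isTempered_one : IsTempered (fun _ : Fin (n + 1) → ℝ => (1 : ℝ)) :=
  ⟨continuous_const, 1, 0, zero_le_one, fun _ => by simp⟩

theorem contDiffOn_coneChar (hC : IsOpen C) : ContDiffOn ℝ ∞ (coneChar C) C :=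
  contDiffOn_infty.2 fun m => contDiffOn_laplace hC (isClosed_dualCone C).measurableSet
    (fun _ hv => isCoerciveAt_dualCone hC hv) m isTempered_one

theorem coneChar_eq (v : Fin (n + 1) → ℝ) :
    coneChar C v = ∫ y in dualCone C, Real.exp (-(v ⬝ᵥ y)) := by
  simp [coneChar, laplace, dotPairing_apply]

/-- Change of variables by the transpose of `A`, which preserves the dual cone because `A` preserves
`C`. -/
theorem coneChar_mulVec {A : Matrix (Fin (n + 1)) (Fin (n + 1)) ℝ} (hA : A.det ≠ 0)
    (hAC : ∀ v, A.mulVec v ∈ C ↔ v ∈ C) (v : Fin (n + 1) → ℝ) :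
    coneChar C (A.mulVec v) = |A.det|⁻¹ * coneChar C v := by
  have hT : A.transpose.det ≠ 0 := by rwa [Matrix.det_transpose]
  have hdot : ∀ w y : Fin (n + 1) → ℝ, w ⬝ᵥ A.transpose.mulVec y = A.mulVec w ⬝ᵥ y := by
    intro w y
    rw [Matrix.mulVec_transpose, dotProduct_comm w, ← Matrix.dotProduct_mulVec, dotProduct_comm]
  have hsurj : ∀ w, ∃ w', A.mulVec w' = w := by
    intro w
    refine ⟨A⁻¹.mulVec w, ?_⟩
    rw [Matrix.mulVec_mulVec, Matrix.mul_nonsing_inv _ (isUnit_iff_ne_zero.2 hA), Matrix.one_mulVec]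
  have hpre : Matrix.toLin' A.transpose ⁻¹' dualCone C = dualCone C := by
    ext y
    constructor
    · intro h w hw
      obtain ⟨w', rfl⟩ := hsurj w
      rw [← hdot]
      exact h w' ((hAC w').1 hw)
    · intro h w hw
      change 0 ≤ w ⬝ᵥ A.transpose.mulVec y
      rw [hdot]
      exact h _ ((hAC w).2 hw)
  have hmap := Real.map_matrix_volume_pi_eq_smul_volume_pi hT
  have hcont : Continuous (Matrix.toLin' A.transpose) := LinearMap.continuous_of_finiteDimensional _
  have hexp : Continuous fun y : Fin (n + 1) → ℝ => Real.exp (-(v ⬝ᵥ y)) := by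
    simp only [← dotPairing_apply]
    fun_prop
  have h1 := setIntegral_map (μ := volume) (isClosed_dualCone C).measurableSet
    (f := fun y => Real.exp (-(v ⬝ᵥ y))) (g := Matrix.toLin' A.transpose)
    hexp.aestronglyMeasurable hcont.measurable.aemeasurable
  rw [hmap, Measure.restrict_smul, integral_smul_measure, hpre, Matrix.det_transpose,
    ENNReal.toReal_ofReal (abs_nonneg _), abs_inv, smul_eq_mul] at h1
  rw [coneChar_eq, coneChar_eq, h1]
  simp only [Matrix.toLin'_apply, hdot]

/-- The vector representing `ℓ` is interior to the dual cone: a perturbation changes the pairing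
with `v` by at most `c ‖v‖`, which is at most `ℓ v`. -/
theorem ball_subset_dualCone {ℓ : (Fin (n + 1) → ℝ) →L[ℝ] ℝ} {c : ℝ} (hc : 0 < c)
    (hℓ : ∀ v ∈ C, c * ‖v‖ ≤ ℓ v) : ∃ (y₀ : Fin (n + 1) → ℝ) (r : ℝ), 0 < r ∧
      Metric.ball y₀ r ⊆ dualCone C := by
  set y₀ : Fin (n + 1) → ℝ := fun i => ℓ (Pi.single i 1)
  have h0 : ∀ v, v ⬝ᵥ y₀ = ℓ v := by
    intro v
    rw [dotProduct]
    conv_rhs => rw [pi_eq_sum_univ' v]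
    simp only [map_sum, y₀]
    refine Finset.sum_congr rfl fun i _ => ?_
    rw [map_smul, smul_eq_mul]
  refine ⟨y₀, c / (‖dotPairing n‖ + 1), by positivity, fun y hy v hv => ?_⟩
  rw [Metric.mem_ball, dist_eq_norm, lt_div_iff₀ (by positivity)] at hy
  have h1 : v ⬝ᵥ y = ℓ v + dotPairing n v (y - y₀) := by
    rw [map_sub, dotPairing_apply, dotPairing_apply, h0]
    ring
  have h2 : |dotPairing n v (y - y₀)| ≤ c * ‖v‖ := by
    calc |dotPairing n v (y - y₀)| ≤ ‖dotPairing n v‖ * ‖y - y₀‖ := (dotPairing n v).le_opNorm _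
      _ ≤ ‖dotPairing n‖ * ‖v‖ * ‖y - y₀‖ := by gcongr; exact (dotPairing n).le_opNorm v
      _ ≤ ‖y - y₀‖ * (‖dotPairing n‖ + 1) * ‖v‖ := by nlinarith [norm_nonneg v, norm_nonneg (y - y₀)]
      _ ≤ c * ‖v‖ := by gcongr
  rw [h1]
  have := hℓ v hv
  have := neg_abs_le (dotPairing n v (y - y₀))
  linarith

theorem integral_pos_of_ball {K O : Set (Fin (n + 1) → ℝ)} {f : (Fin (n + 1) → ℝ) → ℝ}
    (hO : IsOpen O) (hne : O.Nonempty) (hOK : O ⊆ K) (hf : IntegrableOn f K) (h0 : ∀ y, 0 ≤ f y)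
    (hpos : ∀ y ∈ O, 0 < f y) : 0 < ∫ y in K, f y := by
  rw [setIntegral_pos_iff_support_of_nonneg_ae (Filter.Eventually.of_forall h0) hf]
  exact (hO.measure_pos volume hne).trans_le
    (measure_mono fun y hy => ⟨(hpos y hy).ne', hOK hy⟩)

theorem coneChar_pos (hC : IsOpen C) {y₀ : Fin (n + 1) → ℝ} {r : ℝ} (hr : 0 < r)
    (hball : Metric.ball y₀ r ⊆ dualCone C) {v : Fin (n + 1) → ℝ} (hv : v ∈ C) :
    0 < coneChar C v :=
  integral_pos_of_ball Metric.isOpen_ball ⟨y₀, Metric.mem_ball_self hr⟩ hball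
    (isTempered_one.integrableOn (isClosed_dualCone C).measurableSet (isCoerciveAt_dualCone hC hv))
    (fun y => by positivity) fun y _ => by positivity

theorem IsTempered.integral_apply {W : Type*} [NormedAddCommGroup W] [NormedSpace ℝ W]
    [MeasurableSpace W] [BorelSpace W] [FiniteDimensional ℝ W] {E : Type} [NormedAddCommGroup E]
    [NormedSpace ℝ E] {B : E →L[ℝ] W →L[ℝ] ℝ} {K : Set W} {μ : Measure W} [μ.IsAddHaarMeasure]
    {F : Type*} [NormedAddCommGroup F] [NormedSpace ℝ F] [CompleteSpace F] {G : W → E →L[ℝ] F}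
    (hG : IsTempered G) (hK : MeasurableSet K) {v : E} (hv : IsCoerciveAt B K v) (u : E) :
    laplace B K μ G v u = laplace B K μ (fun y => G y u) v := by
  rw [laplace, laplace, ContinuousLinearMap.integral_apply (hG.integrableOn hK hv)]
  rfl

theorem fderiv_coneChar (hC : IsOpen C) {v : Fin (n + 1) → ℝ} (hv : v ∈ C)
    (u : Fin (n + 1) → ℝ) : fderiv ℝ (coneChar C) v u =
      -∫ y in dualCone C, Real.exp (-(v ⬝ᵥ y)) * (u ⬝ᵥ y) := by
  have hK := (isClosed_dualCone C).measurableSet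
  have h1 := (isTempered_one.hasFDerivAt_laplace (μ := volume) hK
    (isCoerciveAt_dualCone hC hv)).fderiv
  change fderiv ℝ (coneChar C) v = _ at h1
  rw [h1, isTempered_one.laplaceDeriv.integral_apply hK (isCoerciveAt_dualCone hC hv)]
  rw [laplace, ← integral_neg]
  simp [laplaceDeriv, dotPairing_apply]

theorem fderiv_fderiv_coneChar (hC : IsOpen C) {v : Fin (n + 1) → ℝ} (hv : v ∈ C)
    (u : Fin (n + 1) → ℝ) : fderiv ℝ (fderiv ℝ (coneChar C)) v u u =
      ∫ y in dualCone C, Real.exp (-(v ⬝ᵥ y)) * (u ⬝ᵥ y) ^ 2 := by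
  have hK := (isClosed_dualCone C).measurableSet
  have hco := isCoerciveAt_dualCone hC hv
  have h0 : fderiv ℝ (coneChar C) =ᶠ[𝓝 v] laplace (dotPairing n) (dualCone C) volume
      (laplaceDeriv (dotPairing n) (fun _ => (1 : ℝ))) := by
    filter_upwards [hC.mem_nhds hv] with w hw
    exact (isTempered_one.hasFDerivAt_laplace (μ := volume) hK
      (isCoerciveAt_dualCone hC hw)).fderiv
  have hT := (isTempered_one (n := n)).laplaceDeriv (B := dotPairing n)
  have hT2 := hT.laplaceDeriv (B := dotPairing n)
  rw [h0.fderiv_eq, (hT.hasFDerivAt_laplace (μ := volume) hK hco).fderiv,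
    hT2.integral_apply hK hco]
  have h1 : IsTempered fun y => laplaceDeriv (dotPairing n)
      (laplaceDeriv (dotPairing n) fun _ => (1 : ℝ)) y u := by
    obtain ⟨hc, c, k, hc0, h⟩ := hT2
    refine ⟨hc.clm_apply continuous_const, c * ‖u‖, k, by positivity, fun y => ?_⟩
    refine (ContinuousLinearMap.le_opNorm _ _).trans ?_
    calc _ ≤ c * (1 + ‖y‖) ^ k * ‖u‖ := by gcongr; exact h y
      _ = _ := by ring
  rw [h1.integral_apply hK hco, laplace]
  refine integral_congr_ae (Filter.Eventually.of_forall fun y => ?_)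
  simp [laplaceDeriv, dotPairing_apply]
  ring

theorem isTempered_dotProduct_pow (u : Fin (n + 1) → ℝ) (k : ℕ) :
    IsTempered fun y : Fin (n + 1) → ℝ => (u ⬝ᵥ y) ^ k := by
  simp only [← dotPairing_apply]
  refine ⟨by fun_prop, ‖dotPairing n u‖ ^ k, k, by positivity, fun y => ?_⟩
  rw [norm_pow, ← mul_pow]
  gcongr
  refine ((dotPairing n u).le_opNorm y).trans ?_
  gcongr
  linarith

/-- The characteristic function is strictly logarithmically convex. -/
theorem sq_fderiv_coneChar_lt (hC : IsOpen C) {y₀ : Fin (n + 1) → ℝ} {r : ℝ} (hr : 0 < r)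
    (hball : Metric.ball y₀ r ⊆ dualCone C) {v u : Fin (n + 1) → ℝ} (hv : v ∈ C) (hu : u ≠ 0) :
    fderiv ℝ (coneChar C) v u ^ 2 <
      coneChar C v * fderiv ℝ (fderiv ℝ (coneChar C)) v u u := by
  have hφ := coneChar_pos hC hr hball hv
  have hint : ∀ k : ℕ, IntegrableOn (fun y => Real.exp (-(v ⬝ᵥ y)) * (u ⬝ᵥ y) ^ k) (dualCone C) := by
    intro k
    have h1 := (isTempered_dotProduct_pow u k).integrableOn (μ := volume)
      (isClosed_dualCone C).measurableSet (isCoerciveAt_dualCone hC hv)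
    simpa only [dotPairing_apply, smul_eq_mul] using h1
  have h0 := hint 0
  have h1 := hint 1
  have h2 := hint 2
  simp only [pow_zero, mul_one, pow_one] at h0 h1
  rw [fderiv_coneChar hC hv, fderiv_fderiv_coneChar hC hv, neg_sq]
  rw [coneChar_eq] at hφ ⊢
  set a := ∫ y in dualCone C, Real.exp (-(v ⬝ᵥ y))
  set b := ∫ y in dualCone C, Real.exp (-(v ⬝ᵥ y)) * (u ⬝ᵥ y)
  set c := ∫ y in dualCone C, Real.exp (-(v ⬝ᵥ y)) * (u ⬝ᵥ y) ^ 2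
  -- `t` is the mean of `⟨u, y⟩` for the weight `exp(-⟨v, y⟩)`, and the inequality says that the
  -- variance is positive.
  set t := b / a
  have hfun : (fun y => Real.exp (-(v ⬝ᵥ y)) * (u ⬝ᵥ y - t) ^ 2) = fun y =>
      Real.exp (-(v ⬝ᵥ y)) * (u ⬝ᵥ y) ^ 2 - 2 * t * (Real.exp (-(v ⬝ᵥ y)) * (u ⬝ᵥ y)) +
        t ^ 2 * Real.exp (-(v ⬝ᵥ y)) := by
    funext y
    ring
  have h21 : IntegrableOn (fun y => Real.exp (-(v ⬝ᵥ y)) * (u ⬝ᵥ y) ^ 2 -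
      2 * t * (Real.exp (-(v ⬝ᵥ y)) * (u ⬝ᵥ y))) (dualCone C) := h2.sub (h1.const_mul _)
  have hi : ∫ y in dualCone C, Real.exp (-(v ⬝ᵥ y)) * (u ⬝ᵥ y - t) ^ 2 =
      c - 2 * t * b + t ^ 2 * a := by
    rw [hfun, integral_add h21 (h0.const_mul _),
      integral_sub h2 (h1.const_mul _), integral_const_mul, integral_const_mul]
  have hint' : IntegrableOn (fun y => Real.exp (-(v ⬝ᵥ y)) * (u ⬝ᵥ y - t) ^ 2) (dualCone C) := by
    rw [hfun]
    exact h21.add (h0.const_mul _)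
  have hcont : Continuous fun y => u ⬝ᵥ y := by
    simp only [← dotPairing_apply]
    fun_prop
  have hpos : 0 < ∫ y in dualCone C, Real.exp (-(v ⬝ᵥ y)) * (u ⬝ᵥ y - t) ^ 2 := by
    refine integral_pos_of_ball (O := Metric.ball y₀ r ∩ {y | u ⬝ᵥ y ≠ t})
      (Metric.isOpen_ball.inter (isOpen_ne_fun hcont continuous_const)) ?_
      (inter_subset_left.trans hball) hint' (fun y => by positivity) ?_
    -- The variance is strict because `⟨u, y⟩` is not constant on the ball: if the centre gives the
    -- value `t`, moving in the direction `u` changes it.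
    · by_cases h : u ⬝ᵥ y₀ = t
      · refine ⟨y₀ + (r / 2 / ‖u‖) • u, ?_, ?_⟩
        · have hu' : ‖u‖ ≠ 0 := norm_ne_zero_iff.2 hu
          rw [Metric.mem_ball, dist_eq_norm, add_sub_cancel_left, norm_smul, norm_div, norm_norm,
            div_mul_cancel₀ _ hu', Real.norm_of_nonneg (by positivity)]
          linarith
        · change ¬ (u ⬝ᵥ (y₀ + (r / 2 / ‖u‖) • u) = t)
          have h3 : 0 < r / 2 / ‖u‖ := by
            have := norm_pos_iff.2 hu
            positivity
          rw [dotProduct_add, dotProduct_smul, h, add_eq_left, smul_eq_zero]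
          simp [h3.ne', hu]
      · exact ⟨y₀, Metric.mem_ball_self hr, h⟩
    · rintro y ⟨-, hy⟩
      have h4 : 0 < (u ⬝ᵥ y - t) ^ 2 := by
        have := sub_ne_zero.2 hy
        positivity
      positivity
  rw [hi] at hpos
  have h3 : t * a = b := div_mul_cancel₀ _ hφ.ne'
  have h4 := mul_pos hφ hpos
  have h5 : a * (c - 2 * t * b + t ^ 2 * a) = a * c - b ^ 2 := by
    rw [← h3]; ring
  linarith

/-- The normalised logarithm of the characteristic function. -/
noncomputable def logChar (C : Set (Fin (n + 1) → ℝ)) (v : Fin (n + 1) → ℝ) : ℝ :=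
  Real.log (coneChar C v) / (n + 1)

variable {y₀ : Fin (n + 1) → ℝ} {r : ℝ}

theorem contDiffOn_logChar (hC : IsOpen C) (hr : 0 < r) (hball : Metric.ball y₀ r ⊆ dualCone C) :
    ContDiffOn ℝ ∞ (logChar C) C :=
  ((contDiffOn_coneChar hC).log fun _ hv => (coneChar_pos hC hr hball hv).ne').div_const _

theorem logChar_mulVec {A : Matrix (Fin (n + 1)) (Fin (n + 1)) ℝ} (hA : |A.det| = 1)
    (hAC : ∀ v, A.mulVec v ∈ C ↔ v ∈ C) (v : Fin (n + 1) → ℝ) :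
    logChar C (A.mulVec v) = logChar C v := by
  have hA0 : A.det ≠ 0 := fun h => by simp [h] at hA
  rw [logChar, coneChar_mulVec hA0 hAC, hA, inv_one, one_mul, logChar]

/-- `coneChar_mulVec` for the homothety `c`, of determinant `c ^ (n + 1)`; the division by `n + 1`
in `logChar` compensates the exponent. -/
theorem logChar_smul (hC : IsOpen C) (hr : 0 < r) (hball : Metric.ball y₀ r ⊆ dualCone C)
    (hcone : ∀ c : ℝ, 0 < c → ∀ v ∈ C, c • v ∈ C) {c : ℝ} (hc : 0 < c)
    {v : Fin (n + 1) → ℝ} (hv : v ∈ C) : logChar C (c • v) = logChar C v - Real.log c := by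
  have hdet : (c • (1 : Matrix (Fin (n + 1)) (Fin (n + 1)) ℝ)).det = c ^ (n + 1) := by
    rw [Matrix.det_smul, Matrix.det_one, mul_one, Fintype.card_fin]
  have hmul : ∀ w, (c • (1 : Matrix (Fin (n + 1)) (Fin (n + 1)) ℝ)).mulVec w = c • w := by
    intro w
    rw [Matrix.smul_mulVec, Matrix.one_mulVec]
  have h1 := coneChar_mulVec (C := C) (A := c • (1 : Matrix (Fin (n + 1)) (Fin (n + 1)) ℝ))
    (by rw [hdet]; positivity) (fun w => by
      rw [hmul]
      refine ⟨fun h => ?_, hcone c hc w⟩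
      have := hcone c⁻¹ (inv_pos.2 hc) _ h
      rwa [smul_smul, inv_mul_cancel₀ hc.ne', one_smul] at this) v
  rw [hmul, hdet, abs_of_pos (by positivity)] at h1
  rw [logChar, logChar, h1, Real.log_mul (by positivity) (coneChar_pos hC hr hball hv).ne',
    Real.log_inv, Real.log_pow]
  push_cast
  field_simp
  ring

/-- The Hessian of `logChar` is positive definite. -/
theorem hess_logChar_pos (hC : IsOpen C) (hr : 0 < r) (hball : Metric.ball y₀ r ⊆ dualCone C)
    {v u : Fin (n + 1) → ℝ} (hv : v ∈ C) (hu : u ≠ 0) :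
    0 < fderiv ℝ (fderiv ℝ (logChar C)) v u u := by
  have hφ := coneChar_pos hC hr hball hv
  have hline : HasDerivAt (fun s : ℝ => v + s • u) u 0 := by
    simpa using ((hasDerivAt_id (0 : ℝ)).smul_const u).const_add v
  have hev : ∀ᶠ s in 𝓝 (0 : ℝ), v + s • u ∈ C :=
    hline.continuousAt.eventually (hC.mem_nhds (by simpa using hv))
  have hlog := contDiffOn_logChar hC hr hball
  have hchar := contDiffOn_coneChar hC
  have hcd : ∀ w ∈ C, ContDiffAt ℝ ∞ (coneChar C) w := fun w hw => hchar.contDiffAt (hC.mem_nhds hw)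
  have along : ∀ f : (Fin (n + 1) → ℝ) → ℝ, ContDiffOn ℝ ∞ f C →
      HasDerivAt (fun s : ℝ => f (v + s • u)) (fderiv ℝ f v u) 0 ∧
      HasDerivAt (fun s : ℝ => fderiv ℝ f (v + s • u) u) (fderiv ℝ (fderiv ℝ f) v u u) 0 := by
    intro f hf
    have hfv := hf.contDiffAt (hC.mem_nhds hv)
    constructor
    · refine HasFDerivAt.comp_hasDerivAt 0 ?_ hline
      simpa using (hfv.differentiableAt (by simp)).hasFDerivAt
    · have h1 : HasDerivAt (fun s : ℝ => fderiv ℝ f (v + s • u)) (fderiv ℝ (fderiv ℝ f) v u) 0 := by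
        refine HasFDerivAt.comp_hasDerivAt 0 ?_ hline
        simpa using ((hfv.fderiv_right (m := ∞) le_rfl).differentiableAt (by simp)).hasFDerivAt
      simpa using h1.clm_apply (hasDerivAt_const 0 u)
  obtain ⟨h1, h2⟩ := along _ hchar
  have h3 := (along _ hlog).2
  have h0 : coneChar C (v + (0 : ℝ) • u) = coneChar C v := by rw [zero_smul, add_zero]
  have h4 := (h2.fun_div h1 (by rw [h0]; exact hφ.ne')).div_const ((n : ℝ) + 1)
  have h5 : (fun s : ℝ => fderiv ℝ (logChar C) (v + s • u) u) =ᶠ[𝓝 0] fun s : ℝ =>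
      fderiv ℝ (coneChar C) (v + s • u) u / coneChar C (v + s • u) / (n + 1) := by
    filter_upwards [hev] with s hs
    have hd : HasFDerivAt (logChar C) ((n + 1 : ℝ)⁻¹ • ((coneChar C (v + s • u))⁻¹ •
        fderiv ℝ (coneChar C) (v + s • u))) (v + s • u) := by
      have h6 := ((((hcd _ hs).differentiableAt (by simp)).hasFDerivAt).log
        (coneChar_pos hC hr hball hs).ne').const_mul ((n + 1 : ℝ)⁻¹)
      refine h6.congr_of_eventuallyEq (Filter.Eventually.of_forall fun w => ?_)
      rw [logChar, div_eq_inv_mul]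
    rw [hd.fderiv, smul_apply, smul_apply, smul_eq_mul, smul_eq_mul]
    ring
  have h6 := h3.unique (h4.congr_of_eventuallyEq h5)
  rw [h6, zero_smul, add_zero]
  -- The second derivative of a logarithm is `(f f'' - f'²) / f²`, so strict log-convexity is what
  -- is needed.
  have h7 := sq_fderiv_coneChar_lt hC hr hball hv hu
  have h8 : (0 : ℝ) < n + 1 := by positivity
  refine div_pos (div_pos ?_ (by positivity)) h8
  linarith

end CharacteristicFunction

/-! ## Lifting the developing map to a convex cone -/

section Lift

variable {n : ℕ}

/-- The inclusion `ℝⁿ → ℝⁿ⁺¹` that inserts a zero in position `i`. -/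
noncomputable def affineInsert (i : Fin (n + 1)) :
    EuclideanSpace ℝ (Fin n) →L[ℝ] (Fin (n + 1) → ℝ) :=
  ContinuousLinearMap.pi fun k => Fin.insertNth (α := fun _ => EuclideanSpace ℝ (Fin n) →L[ℝ] ℝ) i 0
    (fun j => EuclideanSpace.proj j) k

theorem affineInsert_same (i : Fin (n + 1)) (y : EuclideanSpace ℝ (Fin n)) :
    affineInsert i y i = 0 := by
  simp [affineInsert]

theorem affineInsert_succAbove (i : Fin (n + 1)) (y : EuclideanSpace ℝ (Fin n)) (j : Fin n) :
    affineInsert i y (i.succAbove j) = y j := by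
  simp [affineInsert]

theorem affineInsert_affineChart {i : Fin (n + 1)} {q : ℙ ℝ (Fin (n + 1) → ℝ)}
    (hq : q ∈ affineDomain i) :
    q.rep = q.rep i • (affineInsert i (affineChart i q) + Pi.single i (1 : ℝ)) := by
  have hq' : q.rep i ≠ 0 := hq
  funext k
  rcases eq_or_ne k i with rfl | hk
  · simp [affineInsert_same]
  · obtain ⟨j, rfl⟩ := Fin.exists_succAbove_eq hk
    simp only [Pi.smul_apply, Pi.add_apply, affineInsert_succAbove, affineChart, smul_eq_mul]
    rw [Pi.single_eq_of_ne hk, add_zero, mul_div_cancel₀ _ hq']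

theorem isOpen_affineDomain (i : Fin (n + 1)) : IsOpen (affineDomain (n := n) i) := by
  refine isOpen_coinduced.2 ?_
  have h : (fun v : {v : Fin (n + 1) → ℝ // v ≠ 0} => Projectivization.mk' ℝ v) ⁻¹'
      affineDomain i = Subtype.val ⁻¹' {v : Fin (n + 1) → ℝ | v i ≠ 0} := by
    ext ⟨v, hv⟩
    exact mk_mem_affineDomain i v hv
  rw [h]
  exact (isOpen_ne_fun (continuous_apply i) continuous_const).preimage continuous_subtype_val

/-! ### Rescaling radial immersions, and openness of their cones. -/

section Immersion

variable {M : Type*} [TopologicalSpace M] [ChartedSpace (EuclideanSpace ℝ (Fin n)) M]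
  [IsManifold (𝓡 n) ∞ M] {f f' : M → Fin (n + 1) → ℝ} {U : Set M}

theorem IsRadialImmersionOn.congr (hf : IsRadialImmersionOn f U) (h : ∀ x ∈ U, f' x = f x) :
    IsRadialImmersionOn f' U where
  isOpen := hf.isOpen
  smooth := hf.smooth.congr h
  injective x hx := by
    have h1 : f' =ᶠ[𝓝 x] f := by
      filter_upwards [hf.isOpen.mem_nhds hx] with z hz using h z hz
    rw [radialFrame_congr h1]
    exact hf.injective x hx

/-- Rescaling changes `df` to `φ df + dφ f`, so the frame is altered by an invertible triangular
transformation. -/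
theorem IsRadialImmersionOn.smul (hf : IsRadialImmersionOn f U) {φ : M → ℝ}
    (hφ : ContMDiffOn (𝓡 n) 𝓘(ℝ, ℝ) ∞ φ U) (h0 : ∀ x ∈ U, φ x ≠ 0) :
    IsRadialImmersionOn (fun x => φ x • f x) U where
  isOpen := hf.isOpen
  smooth := hφ.smul hf.smooth
  injective x hx := by
    refine (injective_iff_map_eq_zero (radialFrame (fun x => φ x • f x) x)).2 ?_
    rintro ⟨v, r⟩ h
    have hφx := (hφ.contMDiffAt (hf.isOpen.mem_nhds hx)).mdifferentiableAt (by simp)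
    rw [radialFrame_apply, mvfderiv_smul_apply hφx (hf.mdifferentiableAt hx)] at h
    have h1 : radialFrame f x (φ x • v, mvfderiv (𝓡 n) φ x v + r * φ x) = 0 := by
      rw [radialFrame_apply, map_smul, ← h]
      module
    have h2 : (φ x • v, mvfderiv (𝓡 n) φ x v + r * φ x) = (0 : TangentSpace (𝓡 n) x × ℝ) :=
      hf.injective x hx (h1.trans (map_zero _).symm)
    rw [Prod.mk_eq_zero] at h2
    have hv : v = 0 := (smul_eq_zero.1 h2.1).resolve_left (h0 x hx)
    subst hv
    have hr : r = 0 := by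
      have h3 := h2.2
      rw [map_zero, zero_add] at h3
      exact (mul_eq_zero.1 h3).resolve_right (h0 x hx)
    rw [hr]
    rfl

theorem isOpen_range_coneMap (hf : IsRadialImmersionOn f univ) : IsOpen (range (coneMap f)) := by
  rw [isOpen_iff_mem_nhds]
  rintro _ ⟨⟨x, t⟩, rfl⟩
  have hx' : x ∈ chartSource n x := mem_chart_source _ x
  have hcd : ContDiffAt ℝ 3 (inChart n x f) (chartMap n x x) :=
    ((contDiffOn_inChart le_rfl hf.smooth x).contDiffAt ((isOpen_chartImage x hf.isOpen).mem_nhds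
      (chartMap_mem_chartImage (n := n) hx' (mem_univ x)))).of_le
        (WithTop.coe_le_coe.2 (le_top : (3 : ℕ∞) ≤ ⊤))
  have hfy : inChart n x f (chartMap n x x) = f x := inChart_chartMap hx' f
  obtain ⟨Φ, hΦs, hΦ, -⟩ := exists_coneChart (by simp) hcd (fun a r h => by
    obtain ⟨v, rfl⟩ := exists_mvfderiv_chartMap_eq x a
    rw [hfy, hf.fderiv_inChart (mem_univ x), ← radialFrame_apply] at h
    have h1 : (v, r) = (0 : TangentSpace (𝓡 n) x × ℝ) :=
      hf.injective x (mem_univ x) (h.trans (map_zero _).symm)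
    rw [Prod.mk_eq_zero] at h1
    rw [h1.1, h1.2]
    simp) t
  have h1 := Φ.map_source hΦs
  rw [hΦ] at h1
  have h2 : coneMap (inChart n x f) (chartMap n x x, t) = coneMap f (x, t) := by
    rw [coneMap, coneMap, hfy]
  rw [h2] at h1
  refine Filter.mem_of_superset (Φ.open_target.mem_nhds h1) fun v hv => ?_
  rw [← Φ.right_inv hv, hΦ]
  exact ⟨((extChartAt (𝓡 n) x).symm (Φ.symm v).1, (Φ.symm v).2), rfl⟩

end Immersion

variable {M' M : Type*} [TopologicalSpace M'] [TopologicalSpace M] {p : M' → M}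
  [ChartedSpace (EuclideanSpace ℝ (Fin n)) M']

/-- The lift of the developing map to the affine hyperplane `ℓ = 1`. -/
noncomputable def FlatProjStructure.lift (S : FlatProjStructure n p)
    (ℓ : (Fin (n + 1) → ℝ) →L[ℝ] ℝ) (x : M') : Fin (n + 1) → ℝ :=
  (ℓ (S.dev x).rep)⁻¹ • (S.dev x).rep

variable {S : FlatProjStructure n p} {ℓ : (Fin (n + 1) → ℝ) →L[ℝ] ℝ}
  (hrep : ∀ x, ℓ (S.dev x).rep ≠ 0)

include hrep

theorem FlatProjStructure.apply_lift (x : M') : ℓ (S.lift ℓ x) = 1 := by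
  rw [lift, map_smul, smul_eq_mul, inv_mul_cancel₀ (hrep x)]

theorem FlatProjStructure.lift_ne_zero (x : M') : S.lift ℓ x ≠ 0 := by
  intro h
  have := FlatProjStructure.apply_lift hrep x
  simp [h] at this

theorem FlatProjStructure.mk_lift (x : M') (h : S.lift ℓ x ≠ 0) :
    Projectivization.mk ℝ (S.lift ℓ x) h = S.dev x := by
  conv_rhs => rw [← (S.dev x).mk_rep]
  exact (Projectivization.mk_eq_mk_iff' ℝ _ _ _ _).2 ⟨_, rfl⟩

theorem FlatProjStructure.eq_smul_lift {x : M'} {v : Fin (n + 1) → ℝ} (hv : v ≠ 0)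
    (h : Projectivization.mk ℝ v hv = S.dev x) : v = ℓ v • S.lift ℓ x := by
  rw [← FlatProjStructure.mk_lift hrep x (FlatProjStructure.lift_ne_zero hrep x)] at h
  obtain ⟨a, ha⟩ := (Projectivization.mk_eq_mk_iff' ℝ _ _ _ _).1 h
  rw [← ha, map_smul, FlatProjStructure.apply_lift hrep, smul_eq_mul, mul_one]

/-- Where the developing map takes values in the affine chart `i`, with coordinates `y`, inserting
`1` in position `i` gives a vector `k` that is a radial immersion because `y` is a local
diffeomorphism. The lift is `k / ℓ(k)`. -/
theorem FlatProjStructure.isRadialImmersionOn_lift [IsManifold (𝓡 n) ∞ M'] :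
    IsRadialImmersionOn (S.lift ℓ) univ := by
  suffices h : ∀ x, ∃ U, x ∈ U ∧ IsRadialImmersionOn (S.lift ℓ) U by
    refine ⟨isOpen_univ, fun x _ => ?_, fun x _ => ?_⟩
    · obtain ⟨U, hx, hU⟩ := h x
      exact (hU.smooth.contMDiffAt (hU.isOpen.mem_nhds hx)).contMDiffWithinAt
    · obtain ⟨U, hx, hU⟩ := h x
      exact hU.injective x hx
  intro x
  obtain ⟨i, hi⟩ := Function.ne_iff.1 ((S.dev x).rep_nonzero)
  set U := S.dev ⁻¹' affineDomain i
  have hU : IsOpen U := (isOpen_affineDomain i).preimage S.continuous_dev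
  set y : M' → EuclideanSpace ℝ (Fin n) := fun z => affineChart i (S.dev z)
  have hyd : ∀ z ∈ U, IsLocalDiffeomorphAt (𝓡 n) (𝓡 n) ∞ y z := fun z hz => S.localDiffeo z i hz
  have hy : ContMDiffOn (𝓡 n) (𝓡 n) ∞ y U := fun z hz => (hyd z hz).contMDiffAt.contMDiffWithinAt
  set k : M' → Fin (n + 1) → ℝ := fun z => affineInsert i (y z) + Pi.single i (1 : ℝ)
  have hkc : ContDiff ℝ ∞ fun w : EuclideanSpace ℝ (Fin n) =>
      affineInsert i w + Pi.single i (1 : ℝ) := (affineInsert i).contDiff.add contDiff_const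
  have hk : IsRadialImmersionOn k U := by
    refine ⟨hU, hkc.contMDiff.comp_contMDiffOn hy, fun z hz => ?_⟩
    have hyz : MDifferentiableAt (𝓡 n) 𝓘(ℝ, EuclideanSpace ℝ (Fin n)) y z :=
      (hyd z hz).contMDiffAt.mdifferentiableAt (by simp)
    have hdk : ∀ v, mvfderiv (𝓡 n) k z v = affineInsert i (mvfderiv (𝓡 n) y z v) := by
      intro v
      have h1 := mvfderiv_comp_fderiv ((hkc.differentiable (by simp)) (y z)) hyz v
      rw [fderiv_add_const, (affineInsert i).fderiv] at h1
      exact h1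
    refine (injective_iff_map_eq_zero (radialFrame k z)).2 ?_
    rintro ⟨v, r⟩ h
    rw [radialFrame_apply, hdk] at h
    have hr : r = 0 := by
      have h1 := congrFun h i
      simpa [k, affineInsert_same] using h1
    subst hr
    rw [zero_smul, add_zero] at h
    have h2 : mvfderiv (𝓡 n) y z v = 0 := by
      ext j
      have h1 := congrFun h (i.succAbove j)
      rwa [affineInsert_succAbove] at h1
    have h3 : Function.Injective (mvfderiv (𝓡 n) y z) :=
      ((hyd z hz).mfderivToContinuousLinearEquiv (by simp)).injective
    rw [h3 (h2.trans (map_zero _).symm)]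
    rfl
  have hrepk : ∀ z ∈ U, (S.dev z).rep = (S.dev z).rep i • k z :=
    fun z hz => affineInsert_affineChart hz
  have hℓk : ∀ z ∈ U, ℓ (k z) ≠ 0 := by
    intro z hz h
    refine hrep z ?_
    rw [hrepk z hz, map_smul, h, smul_zero]
  refine ⟨U, hi, (hk.smul (φ := fun z => (ℓ (k z))⁻¹)
    ((ℓ.contDiff.contMDiff.comp_contMDiffOn hk.smooth).inv₀ hℓk)
    fun z hz => inv_ne_zero (hℓk z hz)).congr fun z hz => ?_⟩
  have hzi : (S.dev z).rep i ≠ 0 := hz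
  rw [lift, hrepk z hz, map_smul, smul_smul, smul_eq_mul, mul_inv, mul_right_comm,
    inv_mul_cancel₀ hzi, one_mul]

end Lift

/-! ## The invariant hypersurface over a properly convex set -/

section InvariantLift

variable {n : ℕ}

/-- A logarithmically homogeneous function with positive definite Hessian. -/
structure IsConePotential (C : Set (Fin (n + 1) → ℝ)) (φ : (Fin (n + 1) → ℝ) → ℝ) : Prop where
  isOpen : IsOpen C
  smooth : ContDiffOn ℝ ∞ φ C
  homogeneous : ∀ c : ℝ, 0 < c → ∀ v ∈ C, φ (c • v) = φ v - Real.log c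
  hess_pos : ∀ v ∈ C, ∀ u, u ≠ 0 → 0 < fderiv ℝ (fderiv ℝ φ) v u u

variable {C : Set (Fin (n + 1) → ℝ)} {φ : (Fin (n + 1) → ℝ) → ℝ}

/-- Euler's identity for logarithmic homogeneity: differentiate `φ(s v) = φ(v) - log s` at `s = 1`.
-/
theorem IsConePotential.fderiv_self (h : IsConePotential C φ) {v : Fin (n + 1) → ℝ} (hv : v ∈ C) :
    fderiv ℝ φ v v = -1 := by
  have h1 : HasDerivAt (fun s : ℝ => s • v) v 1 := by
    simpa using (hasDerivAt_id (1 : ℝ)).smul_const v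
  have h2 : HasDerivAt (fun s : ℝ => φ (s • v)) (fderiv ℝ φ v v) 1 := by
    refine HasFDerivAt.comp_hasDerivAt 1 ?_ h1
    rw [one_smul]
    exact ((h.smooth.contDiffAt (h.isOpen.mem_nhds hv)).differentiableAt (by simp)).hasFDerivAt
  have h3 : HasDerivAt (fun s : ℝ => φ v - Real.log s) (-1) 1 := by
    simpa using (Real.hasDerivAt_log (one_ne_zero)).const_sub (φ v)
  refine h2.unique (h3.congr_of_eventuallyEq ?_)
  filter_upwards [lt_mem_nhds (zero_lt_one' ℝ)] with s hs using h.homogeneous s hs v hv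

theorem isConePotential_logChar (hC : IsOpen C) (hcone : ∀ c : ℝ, 0 < c → ∀ v ∈ C, c • v ∈ C)
    {ℓ : (Fin (n + 1) → ℝ) →L[ℝ] ℝ} {c : ℝ} (hc : 0 < c) (hℓ : ∀ v ∈ C, c * ‖v‖ ≤ ℓ v) :
    IsConePotential C (logChar C) := by
  obtain ⟨y₀, r, hr, hball⟩ := ball_subset_dualCone hc hℓ
  exact ⟨hC, contDiffOn_logChar hC hr hball,
    fun c hc v hv => logChar_smul hC hr hball hcone hc hv,
    fun v hv u hu => hess_logChar_pos hC hr hball hv hu⟩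

variable {M' M : Type*} [TopologicalSpace M'] [TopologicalSpace M] {p : M' → M}
  [ChartedSpace (EuclideanSpace ℝ (Fin n)) M'] [IsManifold (𝓡 n) ∞ M']
  {S : FlatProjStructure n p} {ℓ : (Fin (n + 1) → ℝ) →L[ℝ] ℝ}

/-- Equivariance holds only for lines, so the holonomy `A` maps the lift at `x` to `ℓ(A f(x))` times
the lift at `γ x`. This factor is continuous and nowhere zero, hence of constant sign on the
connected `M'`. If it is negative, `-A` is used instead, at the price of a determinant `±1`. -/
theorem FlatProjStructure.exists_matrix_lift [PreconnectedSpace M']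
    (hrep : ∀ x, ℓ (S.dev x).rep ≠ 0) (γ : DeckGroup p) :
    ∃ (B : Matrix (Fin (n + 1)) (Fin (n + 1)) ℝ) (a : M' → ℝ), |B.det| = 1 ∧
      ∀ x, 0 < a x ∧ B.mulVec (S.lift ℓ x) = a x • S.lift ℓ (γ.1 x) := by
  set A := (S.hol γ).1
  have hA : A.det = 1 := (S.hol γ).2
  have hAinj := mulVecLin_injective (A := A) (by rw [hA]; exact one_ne_zero)
  have hne := fun x => FlatProjStructure.lift_ne_zero hrep x
  have hAne : ∀ x, A.mulVec (S.lift ℓ x) ≠ 0 := fun x h =>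
    hne x (hAinj (h.trans (Matrix.mulVec_zero A).symm))
  have h1 : ∀ x, A.mulVec (S.lift ℓ x) = ℓ (A.mulVec (S.lift ℓ x)) • S.lift ℓ (γ.1 x) := by
    intro x
    refine FlatProjStructure.eq_smul_lift hrep (hAne x) ?_
    rw [S.equivariant, ← FlatProjStructure.mk_lift hrep x (hne x)]
    rfl
  have ha0 : ∀ x, ℓ (A.mulVec (S.lift ℓ x)) ≠ 0 := by
    intro x h
    refine hAne x ?_
    rw [h1 x, h, zero_smul]
  have hcont : Continuous fun x => ℓ (A.mulVec (S.lift ℓ x)) := by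
    have h2 : Continuous (S.lift ℓ) :=
      (contMDiffOn_univ.1 (FlatProjStructure.isRadialImmersionOn_lift hrep).smooth).continuous
    have h3 : Continuous fun v : Fin (n + 1) → ℝ => A.mulVec v :=
      A.mulVecLin.continuous_of_finiteDimensional
    exact ℓ.continuous.comp (h3.comp h2)
  by_cases hpos : ∀ x, 0 < ℓ (A.mulVec (S.lift ℓ x))
  · exact ⟨A, _, by rw [hA, abs_one], fun x => ⟨hpos x, h1 x⟩⟩
  · push Not at hpos
    obtain ⟨x₀, hx₀⟩ := hpos
    have hneg : ∀ x, ℓ (A.mulVec (S.lift ℓ x)) < 0 := by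
      intro x
      by_contra hx
      obtain ⟨z, hz⟩ := mem_range_of_exists_le_of_exists_ge hcont ⟨x₀, hx₀⟩ ⟨x, not_lt.1 hx⟩
      exact ha0 z hz
    refine ⟨-A, fun x => -ℓ (A.mulVec (S.lift ℓ x)), ?_, fun x => ⟨neg_pos.2 (hneg x), ?_⟩⟩
    · rw [Matrix.det_neg, hA, mul_one, abs_pow, abs_neg, abs_one, one_pow]
    · rw [Matrix.neg_mulVec, neg_smul, ← h1]

/-- The developing map of a properly convex projective structure lifts to a level set of a
potential on a cone, equivariantly with respect to linear automorphisms. -/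
theorem FlatProjStructure.IsProperlyConvex.exists_lift [PreconnectedSpace M']
    (hS : S.IsProperlyConvex) : ∃ (C : Set (Fin (n + 1) → ℝ)) (φ : (Fin (n + 1) → ℝ) → ℝ)
      (f : M' → Fin (n + 1) → ℝ), IsConePotential C φ ∧ IsRadialImmersionOn f univ ∧
      (∀ x, f x ∈ C ∧ φ (f x) = 0) ∧
      (∀ x, ∃ h : f x ≠ 0, S.dev x = Projectivization.mk ℝ (f x) h) ∧
      ∀ γ : DeckGroup p, ∃ B : Matrix (Fin (n + 1)) (Fin (n + 1)) ℝ, |B.det| = 1 ∧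
        (∀ v, B.mulVec v ∈ C ↔ v ∈ C) ∧ (∀ v, φ (B.mulVec v) = φ v) ∧
        ∀ x, f (γ.1 x) = B.mulVec (f x) := by
  obtain ⟨-, ℓ', -, hrep', -, K, -, hK, -, hsub⟩ := hS
  set ℓ : (Fin (n + 1) → ℝ) →L[ℝ] ℝ := ℓ'.toContinuousLinearMap
  have hrep : ∀ x, ℓ (S.dev x).rep ≠ 0 := fun x => hrep' _ ⟨x, rfl⟩
  set f₀ := S.lift ℓ
  set C := range (coneMap f₀)
  have hf₀ : IsRadialImmersionOn f₀ univ := FlatProjStructure.isRadialImmersionOn_lift hrep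
  have hne : ∀ x, f₀ x ≠ 0 := fun x => FlatProjStructure.lift_ne_zero hrep x
  have hC : IsOpen C := isOpen_range_coneMap hf₀
  have hcone : ∀ c : ℝ, 0 < c → ∀ v ∈ C, c • v ∈ C := fun c hc v hv => smul_mem_range_coneMap hc hv
  obtain ⟨R, hR, hKR⟩ := hK.isBounded.exists_pos_norm_le
  -- The lift lies in the compact set of the definition of proper convexity, which has norm at most
  -- `R`, while `ℓ = 1` on it; both sides scale along rays.
  have hℓ : ∀ v ∈ C, R⁻¹ * ‖v‖ ≤ ℓ v := by
    rintro _ ⟨⟨x, t⟩, rfl⟩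
    have h1 := hKR (f₀ x) (hsub ⟨FlatProjStructure.apply_lift hrep x, hne x, x,
      (FlatProjStructure.mk_lift hrep x (hne x)).symm⟩)
    rw [coneMap, map_smul, FlatProjStructure.apply_lift hrep, smul_eq_mul, mul_one, norm_smul,
      Real.norm_of_nonneg (Real.exp_pos t).le, inv_mul_le_iff₀ hR, mul_comm]
    exact mul_le_mul_of_nonneg_right h1 (Real.exp_pos t).le
  have hφ := isConePotential_logChar hC hcone (inv_pos.2 hR) hℓ
  set φ := logChar C
  have hmem : ∀ x, f₀ x ∈ C := fun x => ⟨(x, 0), coneMap_zero f₀ x⟩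
  have hφf : ContMDiff (𝓡 n) 𝓘(ℝ, ℝ) ∞ fun x => Real.exp (φ (f₀ x)) := by
    have h1 : ContMDiffOn (𝓡 n) 𝓘(ℝ, ℝ) ∞ (fun x => Real.exp (φ (f₀ x))) univ :=
      (Real.contDiff_exp.comp_contDiffOn hφ.smooth).contMDiffOn.comp hf₀.smooth fun x _ => hmem x
    exact contMDiffOn_univ.1 h1
  -- By logarithmic homogeneity, multiplication by `exp(φ)` moves each point along its ray to the
  -- level `φ = 0`.
  refine ⟨C, φ, fun x => Real.exp (φ (f₀ x)) • f₀ x, hφ,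
    hf₀.smul hφf.contMDiffOn fun x _ => (Real.exp_pos _).ne', fun x => ?_, fun x => ?_, fun γ => ?_⟩
  · refine ⟨hcone _ (Real.exp_pos _) _ (hmem x), ?_⟩
    rw [hφ.homogeneous _ (Real.exp_pos _) _ (hmem x), Real.log_exp, sub_self]
  · refine ⟨smul_ne_zero (Real.exp_pos _).ne' (hne x), ?_⟩
    rw [← FlatProjStructure.mk_lift hrep x (hne x)]
    symm
    exact (Projectivization.mk_eq_mk_iff' ℝ _ _ _ _).2 ⟨_, rfl⟩
  · obtain ⟨B, a, hB, ha⟩ := FlatProjStructure.exists_matrix_lift hrep γ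
    have hBinj := mulVecLin_injective (A := B) fun h => by simp [h] at hB
    -- `B` sends the ray over `x` to the ray over `γ x`, and `γ` is a bijection. The invariance of
    -- `φ`, and with it the exact equivariance of the rescaled lift, follows.
    have hBC : ∀ v, B.mulVec v ∈ C ↔ v ∈ C := by
      intro v
      constructor
      · rintro ⟨⟨y, t⟩, hy⟩
        obtain ⟨x, rfl⟩ := γ.1.surjective y
        obtain ⟨hax, hx⟩ := ha x
        have h1 : B.mulVec ((Real.exp t * (a x)⁻¹) • f₀ x) = B.mulVec v := by
          rw [← hy, Matrix.mulVec_smul, hx, smul_smul, mul_assoc, inv_mul_cancel₀ hax.ne', mul_one]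
          rfl
        rw [← hBinj h1]
        exact hcone _ (mul_pos (Real.exp_pos t) (inv_pos.2 hax)) _ (hmem x)
      · rintro ⟨⟨x, t⟩, rfl⟩
        rw [coneMap, Matrix.mulVec_smul, (ha x).2]
        exact hcone _ (Real.exp_pos t) _ (hcone _ (ha x).1 _ (hmem _))
    have hφB : ∀ v, φ (B.mulVec v) = φ v := fun v => logChar_mulVec hB hBC v
    refine ⟨B, hB, hBC, hφB, fun x => ?_⟩
    obtain ⟨hax, hx⟩ := ha x
    have h1 : φ (f₀ (γ.1 x)) = φ (f₀ x) + Real.log (a x) := by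
      have h2 := hφ.homogeneous _ hax _ (hmem (γ.1 x))
      have h3 := hφB (f₀ x)
      rw [hx] at h3
      linarith
    change Real.exp (φ (f₀ (γ.1 x))) • f₀ (γ.1 x) = B.mulVec (Real.exp (φ (f₀ x)) • f₀ x)
    rw [Matrix.mulVec_smul, hx, smul_smul, h1, Real.exp_add, Real.exp_log hax]

end InvariantLift

/-! ## Condition (E) from radial immersions -/

section ConditionEOfRadial

variable {n : ℕ} {M : Type*} [TopologicalSpace M] [ChartedSpace (EuclideanSpace ℝ (Fin n)) M]
  [IsManifold (𝓡 n) ∞ M] {D : TangentConnection n M}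

theorem IsRadialFor.eq_radialConnection
    {D : (Π x : M, TangentSpace (𝓡 n) x) →
      (Π x : M, TangentSpace (𝓡 n) x →L[ℝ] TangentSpace (𝓡 n) x)}
    {g : Π x : M, TangentSpace (𝓡 n) x →L[ℝ] TangentSpace (𝓡 n) x →L[ℝ] ℝ}
    {f : M → Fin (n + 1) → ℝ} {U : Set M} (hf : IsRadialFor D g f U)
    {Y : Π x : M, TangentSpace (𝓡 n) x} {x : M} (hx : x ∈ U) (hY : IsDiffFieldAt Y x) :
    D Y x = radialConnection f Y x := by
  ext1 v
  exact (hf.radialTangent_eq hx (hf.second x hx Y hY v).symm).1.symm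

theorem torsion_eq_zero_of_isRadialFor
    {g : Π x : M, TangentSpace (𝓡 n) x →L[ℝ] TangentSpace (𝓡 n) x →L[ℝ] ℝ}
    (h : ∀ x, ∃ f U, x ∈ U ∧ IsRadialFor D.toFun g f U) : D.torsion = 0 := by
  refine (CovariantDerivative.torsion_eq_zero_iff D).2 fun {X Y x} hX hY => ?_
  obtain ⟨f, U, hx, hf⟩ := h x
  have h1 := hf.toIsRadialImmersionOn.isTorsionFreeOn X Y x hx hX hY
  rwa [← hf.eq_radialConnection hx hX, ← hf.eq_radialConnection hx hY] at h1

theorem contMDiffCovariantDerivative_of_isRadialFor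
    {g : Π x : M, TangentSpace (𝓡 n) x →L[ℝ] TangentSpace (𝓡 n) x →L[ℝ] ℝ}
    (h : ∀ x, ∃ f U, x ∈ U ∧ IsRadialFor D.toFun g f U) :
    CovariantDerivative.ContMDiffCovariantDerivative D ∞ := by
  refine ⟨⟨fun {σ} hσ x _ => ?_⟩⟩
  obtain ⟨f, U, hx, hf⟩ := h x
  refine (contMDiffAt_hom_of_coordField _ x fun e => ?_).contMDiffWithinAt
  have hO := hf.isOpen.inter (isOpen_chartSource (n := n) x)
  have hxO : x ∈ U ∩ chartSource n x := ⟨hx, mem_chart_source _ x⟩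
  have h1 : IsSmoothFieldOn σ (U ∩ chartSource n x) :=
    ContMDiffOn.mono (ContMDiffOn.of_le hσ (by simp)) (subset_univ _)
  have h2 : IsSmoothFieldOn (coordField x e) (U ∩ chartSource n x) :=
    ContMDiffOn.mono (isSmoothFieldOn_coordField x e) inter_subset_right
  have hfO := hf.restrict hO inter_subset_left
  refine ContMDiffAt.congr_of_eventuallyEq ((hfO.toIsRadialImmersionOn.isSmoothFieldOn_radialConnection
    h1 h2).contMDiffAt (hO.mem_nhds hxO)) ?_
  filter_upwards [hO.mem_nhds hxO] with z hz
  rw [← hfO.eq_radialConnection hz (h1.isDiffFieldAt hO hz)]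

theorem contMDiffOn_tangentPlusLine {σ : Π x : M, TangentPlusLine n M x} {U : Set M}
    (hσ : IsSmoothSectionOn n (EuclideanSpace ℝ (Fin n) × ℝ) σ U) :
    IsSmoothFieldOn (fun x => (σ x).1) U ∧
      ContMDiffOn (𝓡 n) 𝓘(ℝ, ℝ) ∞ (fun x => ((σ x).2 : ℝ)) U := by
  have key := fun x hx => contMDiffWithinAt_section.1 (hσ x hx)
  constructor
  · intro x hx
    exact contMDiffWithinAt_section.2
      ((contDiff_fst (𝕜 := ℝ) (n := ∞) (E := EuclideanSpace ℝ (Fin n)) (F := ℝ)).contMDiff.contMDiffAt.comp_contMDiffWithinAt x (key x hx))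
  · intro x hx
    exact ContMDiffWithinAt.comp (I' := 𝓘(ℝ, EuclideanSpace ℝ (Fin n) × ℝ))
      (f := fun b => (trivializationAt (EuclideanSpace ℝ (Fin n) × ℝ)
        (TangentPlusLine n M) x ⟨b, σ b⟩).2) x (t := univ)
      (contDiff_snd (𝕜 := ℝ) (n := ∞) (E := EuclideanSpace ℝ (Fin n))
        (F := ℝ)).contMDiff.contMDiffAt.contMDiffWithinAt (key x hx) (mapsTo_univ _ _)

/-- The connection `∇^g` is trivialized by `(Z, l) ↦ df(Z) + l f`. -/
theorem IsRadialFor.radialFrame_extendedConnection {g : SymmTwoTensor n M}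
    {f : M → Fin (n + 1) → ℝ} {U : Set M} (hf : IsRadialFor D.toFun g.toFun f U) {x : M}
    (hx : x ∈ U) {σ : Π x : M, TangentPlusLine n M x} (h1 : IsDiffFieldAt (fun z => (σ z).1) x)
    (h2 : MDifferentiableAt (𝓡 n) 𝓘(ℝ, ℝ) (fun z => ((σ z).2 : ℝ)) x) (v : TangentSpace (𝓡 n) x) :
    radialFrame f x (extendedConnection D g σ x v) =
      mvfderiv (𝓡 n) (fun z => radialFrame f z (σ z)) x v := by
  have e : (fun z => radialFrame f z (σ z)) =
      fun z => mvfderiv (𝓡 n) f z (σ z).1 + ((σ z).2 : ℝ) • f z := by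
    funext z
    exact radialFrame_apply f z (σ z).1 (σ z).2
  have h3 := mdifferentiableAt_mvfderiv_apply hf.isOpen hf.smooth hx h1
  rw [e, mvfderiv_add_apply (φ := fun z => mvfderiv (𝓡 n) f z (σ z).1)
    (h := fun z => ((σ z).2 : ℝ) • f z) h3 (h2.smul (hf.mdifferentiableAt hx)),
    mvfderiv_smul_apply h2 (hf.mdifferentiableAt hx), hf.second x hx _ h1]
  refine (radialFrame_apply f x _ _).trans ?_
  change mvfderiv (𝓡 n) f x (D (fun z => (σ z).1) x v + ((σ x).2 : ℝ) • v) +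
    (mvfderiv (𝓡 n) (fun z => ((σ z).2 : ℝ)) x v + g.toFun x (σ x).1 v) • f x = _
  rw [map_add, map_smul]
  module

/-- The radial frame turns the extended connection into the trivial one, and
`curvatureOp_eq_zero_of_trivialization` applies. -/
theorem isFlatOn_extendedConnection_of_isRadialFor {g : SymmTwoTensor n M}
    (h : ∀ x, ∃ f U, x ∈ U ∧ IsRadialFor D.toFun g.toFun f U) :
    IsFlatOn (EuclideanSpace ℝ (Fin n) × ℝ) (extendedConnection D g).toFun univ := by
  intro X Y σ hX hY hσ x _
  obtain ⟨f, U, hx, hf⟩ := h x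
  have hXU : IsSmoothFieldOn X U := ContMDiffOn.mono hX (subset_univ _)
  have hYU : IsSmoothFieldOn Y U := ContMDiffOn.mono hY (subset_univ _)
  obtain ⟨h1, h2⟩ := contMDiffOn_tangentPlusLine (U := U) (ContMDiffOn.mono hσ (subset_univ _))
  have hdiff : ∀ {φ : M → ℝ}, ContMDiffOn (𝓡 n) 𝓘(ℝ, ℝ) ∞ φ U → ∀ z ∈ U,
      MDifferentiableAt (𝓡 n) 𝓘(ℝ, ℝ) φ z := fun hφ z hz =>
    (hφ.contMDiffAt (hf.isOpen.mem_nhds hz)).mdifferentiableAt (by simp)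
  have hsm : ContMDiffOn (𝓡 n) 𝓘(ℝ, Fin (n + 1) → ℝ) ∞ (fun z => radialFrame f z (σ z)) U := by
    refine ContMDiffOn.congr (f := fun z => mvfderiv (𝓡 n) f z (σ z).1 + ((σ z).2 : ℝ) • f z) ?_
      fun z _ => radialFrame_apply f z (σ z).1 (σ z).2
    exact ContMDiffOn.add (contMDiffOn_mvfderiv_apply hf.isOpen hf.smooth h1) (h2.smul hf.smooth)
  have hσ' : ∀ z ∈ U, ∀ v, radialFrame f z (extendedConnection D g σ z v) =
      mvfderiv (𝓡 n) (fun z => radialFrame f z (σ z)) z v := fun z hz v =>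
    hf.radialFrame_extendedConnection hz (h1.isDiffFieldAt hf.isOpen hz) (hdiff h2 z hz) v
  -- To trivialise the second derivative, the components of the first one must be differentiable.
  -- They are the tangential and radial parts of a smooth function with values in `ℝⁿ⁺¹`.
  have hD : ∀ Z : Π x : M, TangentSpace (𝓡 n) x, IsSmoothFieldOn Z U → ∀ z ∈ U, ∀ v,
      radialFrame f z (extendedConnection D g (fun z => extendedConnection D g σ z (Z z)) z v) =
        mvfderiv (𝓡 n) (fun z => radialFrame f z (extendedConnection D g σ z (Z z))) z v := by
    intro Z hZ z hz v
    have hw := contMDiffOn_mvfderiv_apply hf.isOpen hsm hZ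
    have heq : ∀ y ∈ U, radialTangent f y (mvfderiv (𝓡 n) (fun z => radialFrame f z (σ z)) y (Z y)) =
        (extendedConnection D g σ y (Z y)).1 ∧
        radialCoeff f y (mvfderiv (𝓡 n) (fun z => radialFrame f z (σ z)) y (Z y)) =
        ((extendedConnection D g σ y (Z y)).2 : ℝ) := by
      intro y hy
      refine hf.radialTangent_eq hy ?_
      rw [← hσ' y hy]
      exact (radialFrame_apply f y _ _).symm
    refine hf.radialFrame_extendedConnection hz ?_ ?_ v
    · refine IsSmoothFieldOn.isDiffFieldAt (U := U) ?_ hf.isOpen hz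
      refine ContMDiffOn.congr (hf.isSmoothFieldOn_radialTangent hw) fun y hy => ?_
      exact congrArg (TotalSpace.mk' (EuclideanSpace ℝ (Fin n)) y) (heq y hy).1.symm
    · exact hdiff ((hf.contMDiffOn_radialCoeff hw).congr fun y hy => (heq y hy).2.symm) z hz
  exact curvatureOp_eq_zero_of_trivialization (V := TangentPlusLine n M)
    (Φ := fun z => (radialFrame f z : _ →ₗ[ℝ] (Fin (n + 1) → ℝ)))
    hf.isOpen hf.injective hsm hσ' (hD X hXU) (hD Y hYU) hx
    (hXU.isDiffFieldAt hf.isOpen hx) (hYU.isDiffFieldAt hf.isOpen hx)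

end ConditionEOfRadial

/-! ## Immersions in the level set of a potential -/

section LevelImmersion

variable {n : ℕ} {M : Type*} [TopologicalSpace M] [ChartedSpace (EuclideanSpace ℝ (Fin n)) M]
  [IsManifold (𝓡 n) ∞ M] {f f' : M → Fin (n + 1) → ℝ} {U U' : Set M}

/-- The connection and the two-tensor of a radial immersion only depend on its germ up to a linear
automorphism. -/
theorem IsRadialFor.eq_of_eventuallyEq_clm_comp
    {D D' : (Π x : M, TangentSpace (𝓡 n) x) →
      (Π x : M, TangentSpace (𝓡 n) x →L[ℝ] TangentSpace (𝓡 n) x)}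
    {g g' : Π x : M, TangentSpace (𝓡 n) x →L[ℝ] TangentSpace (𝓡 n) x →L[ℝ] ℝ}
    (hf : IsRadialFor D g f U) (hf' : IsRadialFor D' g' f' U')
    {T : (Fin (n + 1) → ℝ) →L[ℝ] (Fin (n + 1) → ℝ)} (hT : Function.Injective T) {x : M}
    (hx : x ∈ U) (hx' : x ∈ U') (h : f' =ᶠ[𝓝 x] fun z => T (f z)) :
    (∀ Y, IsDiffFieldAt Y x → D Y x = D' Y x) ∧ g x = g' x := by
  have key : ∀ Y, IsDiffFieldAt Y x → ∀ v, D Y x v = D' Y x v ∧ g x (Y x) v = g' x (Y x) v := by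
    intro Y hY v
    have h1 := (hf.clm_comp hT).second x hx Y hY v
    have h2 := hf'.second x hx' Y hY v
    have h3 : (fun z => mvfderiv (𝓡 n) f' z (Y z)) =ᶠ[𝓝 x]
        fun z => mvfderiv (𝓡 n) (fun z => T (f z)) z (Y z) := by
      filter_upwards [h.eventually_nhds] with z hz
      rw [mvfderiv_congr hz]
    rw [mvfderiv_congr h3, h1, ← mvfderiv_congr h,
      show T (f x) = f' x from h.self_of_nhds.symm] at h2
    have h4 := hf'.radialTangent_eq hx' rfl (v := D Y x v) (r := g x (Y x) v)
    have h5 := hf'.radialTangent_eq hx' h2.symm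
    exact ⟨h4.1.symm.trans h5.1, h4.2.symm.trans h5.2⟩
  refine ⟨fun Y hY => ContinuousLinearMap.ext fun v => (key Y hY v).1, ?_⟩
  ext u v
  have hxs : x ∈ chartSource n x := mem_chart_source _ x
  have h1 := (key _ ((isSmoothFieldOn_coordField x (mvfderiv (𝓡 n) (chartMap n x) x u)).isDiffFieldAt
    (isOpen_chartSource x) hxs) v).2
  rwa [coordField_mvfderiv_chartMap hxs] at h1

/-- The pullback of the Hessian of `φ` by `f`. -/
noncomputable def hessPullback (φ : (Fin (n + 1) → ℝ) → ℝ) (f : M → Fin (n + 1) → ℝ) (x : M) :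
    TangentSpace (𝓡 n) x →L[ℝ] TangentSpace (𝓡 n) x →L[ℝ] ℝ :=
  ((mvfderiv (𝓡 n) f x).precomp ℝ).comp ((fderiv ℝ (fderiv ℝ φ) (f x)).comp (mvfderiv (𝓡 n) f x))

theorem hessPullback_apply (φ : (Fin (n + 1) → ℝ) → ℝ) (f : M → Fin (n + 1) → ℝ) (x : M)
    (u v : TangentSpace (𝓡 n) x) : hessPullback φ f x u v =
      fderiv ℝ (fderiv ℝ φ) (f x) (mvfderiv (𝓡 n) f x u) (mvfderiv (𝓡 n) f x v) := rfl

variable {C : Set (Fin (n + 1) → ℝ)} {φ : (Fin (n + 1) → ℝ) → ℝ}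

theorem IsConePotential.contDiffAt (hφ : IsConePotential C φ) {v : Fin (n + 1) → ℝ} (hv : v ∈ C) :
    ContDiffAt ℝ ∞ φ v :=
  hφ.smooth.contDiffAt (hφ.isOpen.mem_nhds hv)

theorem IsConePotential.contDiffAt_fderiv (hφ : IsConePotential C φ) {v : Fin (n + 1) → ℝ}
    (hv : v ∈ C) : ContDiffAt ℝ ∞ (fderiv ℝ φ) v :=
  (hφ.contDiffAt hv).fderiv_right (by simp)

theorem IsConePotential.hess_symm (hφ : IsConePotential C φ) {v : Fin (n + 1) → ℝ} (hv : v ∈ C)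
    (a b : Fin (n + 1) → ℝ) : fderiv ℝ (fderiv ℝ φ) v a b = fderiv ℝ (fderiv ℝ φ) v b a :=
  (hφ.contDiffAt hv).isSymmSndFDerivAt (by simp [two_le_infty]) a b

theorem hessPullback_symm (hφ : IsConePotential C φ) {x : M} (hx : f x ∈ C)
    (u v : TangentSpace (𝓡 n) x) : hessPullback φ f x u v = hessPullback φ f x v u :=
  hφ.hess_symm hx _ _

theorem hessPullback_pos (hφ : IsConePotential C φ) (hf : IsRadialImmersionOn f U) {x : M}
    (hx : x ∈ U) (hxC : f x ∈ C) {v : TangentSpace (𝓡 n) x} (hv : v ≠ 0) :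
    0 < hessPullback φ f x v v := by
  refine hφ.hess_pos _ hxC _ fun h => hv (hf.injective_mvfderiv hx ?_)
  exact h.trans (map_zero (mvfderiv (𝓡 n) f x)).symm

theorem contMDiffOn_hessPullback (hφ : IsConePotential C φ) (hf : IsRadialImmersionOn f U)
    (hC : ∀ x ∈ U, f x ∈ C) {X Y : Π x : M, TangentSpace (𝓡 n) x} (hX : IsSmoothFieldOn X U)
    (hY : IsSmoothFieldOn Y U) :
    ContMDiffOn (𝓡 n) 𝓘(ℝ, ℝ) ∞ (fun z => hessPullback φ f z (X z) (Y z)) U := by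
  have h1 : ContMDiffOn (𝓡 n) 𝓘(ℝ, (Fin (n + 1) → ℝ) →L[ℝ] (Fin (n + 1) → ℝ) →L[ℝ] ℝ) ∞
      (fun z => fderiv ℝ (fderiv ℝ φ) (f z)) U := by
    intro x hx
    exact ((hφ.contDiffAt_fderiv (hC x hx)).fderiv_right
      (m := ∞) (by simp)).contMDiffAt.comp_contMDiffWithinAt x (hf.smooth x hx)
  exact (h1.clm_apply (contMDiffOn_mvfderiv_apply hf.isOpen hf.smooth hX)).clm_apply
    (contMDiffOn_mvfderiv_apply hf.isOpen hf.smooth hY)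

/-- The second derivative of an immersion in a level set of a potential on a cone. -/
theorem IsRadialImmersionOn.isRadialFor (hφ : IsConePotential C φ) (hf : IsRadialImmersionOn f U)
    (hC : ∀ x ∈ U, f x ∈ C ∧ φ (f x) = 0) :
    IsRadialFor (radialConnection f) (hessPullback φ f) f U where
  toIsRadialImmersionOn := hf
  second x hx Y hY v := by
    have hdφ : ∀ z ∈ U, DifferentiableAt ℝ φ (f z) := fun z hz =>
      (hφ.contDiffAt (hC z hz).1).differentiableAt (by simp)
    -- `φ ∘ f` is constant. Differentiating this identity once more relates the Hessian of `φ` to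
    -- `dφ` of the second derivative of `f`.
    have h1 : ∀ z ∈ U, ∀ w, fderiv ℝ φ (f z) (mvfderiv (𝓡 n) f z w) = 0 := by
      intro z hz w
      rw [← mvfderiv_comp_fderiv (hdφ z hz) (hf.mdifferentiableAt hz)]
      refine mvfderiv_eq_zero_of_eventually_const (c := 0) ?_ w
      filter_upwards [hf.isOpen.mem_nhds hz] with y hy using (hC y hy).2
    have hd2 : DifferentiableAt ℝ (fderiv ℝ φ) (f x) :=
      (hφ.contDiffAt_fderiv (hC x hx).1).differentiableAt (by simp)
    have h2 : mvfderiv (𝓡 n) (fun z => fderiv ℝ φ (f z) (mvfderiv (𝓡 n) f z (Y z))) x v = 0 := by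
      refine mvfderiv_eq_zero_of_eventually_const (c := 0) ?_ v
      filter_upwards [hf.isOpen.mem_nhds hx] with y hy using h1 y hy _
    have h3 : MDifferentiableAt (𝓡 n) 𝓘(ℝ, (Fin (n + 1) → ℝ) →L[ℝ] ℝ)
        (fun z => fderiv ℝ φ (f z)) x := hd2.mdifferentiableAt.comp x (hf.mdifferentiableAt hx)
    rw [MDifferentiableAt.mvfderiv_clm_apply h3
      (mdifferentiableAt_mvfderiv_apply hf.isOpen hf.smooth hx hY),
      mvfderiv_comp_fderiv hd2 (hf.mdifferentiableAt hx)] at h2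
    set w := mvfderiv (𝓡 n) (fun z => mvfderiv (𝓡 n) f z (Y z)) x v
    have h4 := hf.decomp hx w
    -- `dφ` kills the tangential part of `w` and equals `-1` on `f`, so the radial coefficient is
    -- the Hessian term.
    have h5 : radialCoeff f x w = hessPullback φ f x (Y x) v := by
      rw [← h4, map_add, h1 x hx, map_smul, hφ.fderiv_self (hC x hx).1] at h2
      rw [hessPullback_apply, hφ.hess_symm (hC x hx).1]
      simp only [smul_eq_mul] at h2
      linarith
    rw [← h5]
    exact h4.symm

end LevelImmersion

/-! ## Gluing local immersions in a level set -/

section Gluing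

variable {n : ℕ} {M : Type*} [TopologicalSpace M] [ChartedSpace (EuclideanSpace ℝ (Fin n)) M]
  [IsManifold (𝓡 n) ∞ M]

/-- Local immersions in a level set of a potential on a cone that differ by unimodular
automorphisms. -/
structure LevelAtlas (M : Type*) [TopologicalSpace M] [ChartedSpace (EuclideanSpace ℝ (Fin n)) M]
    [IsManifold (𝓡 n) ∞ M] (C : Set (Fin (n + 1) → ℝ)) (φ : (Fin (n + 1) → ℝ) → ℝ) where
  f : M → M → Fin (n + 1) → ℝ
  U : M → Set M
  mem : ∀ x, x ∈ U x
  isRadialImmersionOn : ∀ x, IsRadialImmersionOn (f x) (U x)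
  level : ∀ x, ∀ z ∈ U x, f x z ∈ C ∧ φ (f x z) = 0
  compat : ∀ x, ∀ z ∈ U x, ∃ B : Matrix (Fin (n + 1)) (Fin (n + 1)) ℝ, |B.det| = 1 ∧
    f z =ᶠ[𝓝 z] fun w => B.mulVec (f x w)

namespace LevelAtlas

variable {C : Set (Fin (n + 1) → ℝ)} {φ : (Fin (n + 1) → ℝ) → ℝ} (𝒜 : LevelAtlas M C φ)

/-- The glued connection. -/
noncomputable def connection : TangentConnection n M where
  toFun Y x := radialConnection (𝒜.f x) Y x
  isCovariantDerivativeOnUniv :=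
    { add := fun {_ _ x} hσ hσ' _ =>
        (𝒜.isRadialImmersionOn x).isCovariantDerivativeOn.add hσ hσ' (𝒜.mem x)
      leibniz := fun {_ _ x} hσ hg _ =>
        (𝒜.isRadialImmersionOn x).isCovariantDerivativeOn.leibniz hσ hg (𝒜.mem x) }

/-- The immersions centred at `x` and at `z` differ near `z` by a linear automorphism, which changes
neither the connection nor the two-tensor. So the pointwise definitions agree with a single smooth
local model. -/
theorem eq_of_mem (hφ : IsConePotential C φ) {x z : M} (hz : z ∈ 𝒜.U x) :
    (∀ Y, IsDiffFieldAt Y z → 𝒜.connection.toFun Y z = radialConnection (𝒜.f x) Y z) ∧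
      hessPullback φ (𝒜.f z) z = hessPullback φ (𝒜.f x) z := by
  obtain ⟨B, hB, h⟩ := 𝒜.compat x z hz
  have hBinj := mulVecLin_injective (A := B) fun h => by simp [h] at hB
  have h1 := IsRadialFor.eq_of_eventuallyEq_clm_comp
    ((𝒜.isRadialImmersionOn x).isRadialFor hφ (𝒜.level x))
    ((𝒜.isRadialImmersionOn z).isRadialFor hφ (𝒜.level z)) hBinj hz (𝒜.mem z) h
  exact ⟨fun Y hY => (h1.1 Y hY).symm, h1.2.symm⟩

/-- The glued metric. -/
noncomputable def metric (hφ : IsConePotential C φ) : SymmTwoTensor n M where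
  toFun x := hessPullback φ (𝒜.f x) x
  symm x v w := hessPullback_symm hφ (𝒜.level x x (𝒜.mem x)).1 v w
  smooth := by
    intro x
    have hf := 𝒜.isRadialImmersionOn x
    -- Smoothness of the two-tensor is reduced to that of its components on coordinate fields, one
    -- argument at a time.
    refine contMDiffAt_hom_of_coordField (F := EuclideanSpace ℝ (Fin n) →L[ℝ] ℝ)
      (V := fun y : M => TangentSpace (𝓡 n) y →L[ℝ] Bundle.Trivial M ℝ y) _ x fun e => ?_
    refine contMDiffAt_hom_of_coordField (F := ℝ) (V := Bundle.Trivial M ℝ) _ x fun e' => ?_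
    refine (contMDiffAt_section x).2 ?_
    have hO := hf.isOpen.inter (isOpen_chartSource (n := n) x)
    have hfO := hf.mono hO inter_subset_left
    have hX : ∀ e, IsSmoothFieldOn (coordField x e) (𝒜.U x ∩ chartSource n x) := fun e =>
      ContMDiffOn.mono (isSmoothFieldOn_coordField x e) inter_subset_right
    have hxO : x ∈ 𝒜.U x ∩ chartSource n x := ⟨𝒜.mem x, mem_chart_source _ x⟩
    refine ((contMDiffOn_hessPullback hφ hfO (fun z hz => (𝒜.level x z hz.1).1) (hX e)
      (hX e')).contMDiffAt (hO.mem_nhds hxO)).congr_of_eventuallyEq ?_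
    filter_upwards [hO.mem_nhds hxO] with z hz
    rw [← (𝒜.eq_of_mem hφ hz.1).2]
    rfl

theorem isPosDef_metric (hφ : IsConePotential C φ) : (𝒜.metric hφ).IsPosDef := fun x _ hv =>
  hessPullback_pos hφ (𝒜.isRadialImmersionOn x) (𝒜.mem x) (𝒜.level x x (𝒜.mem x)).1 hv

theorem isRadialFor (hφ : IsConePotential C φ) (x : M) :
    IsRadialFor 𝒜.connection.toFun (𝒜.metric hφ).toFun (𝒜.f x) (𝒜.U x) where
  toIsRadialImmersionOn := 𝒜.isRadialImmersionOn x
  second z hz Y hY v := by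
    obtain ⟨h1, h2⟩ := 𝒜.eq_of_mem hφ hz
    rw [h1 Y hY, show (𝒜.metric hφ).toFun z = _ from h2]
    exact ((𝒜.isRadialImmersionOn x).isRadialFor hφ (𝒜.level x)).second z hz Y hY v

end LevelAtlas

/-- A volume form has constant sign with respect to the one given by a radial immersion. -/
theorem IsRadialImmersionOn.exists_sign [T2Space M] {f : M → Fin (n + 1) → ℝ} {U : Set M}
    (hf : IsRadialImmersionOn f U) {vol : Π x : M, (TangentSpace (𝓡 n) x) [⋀^Fin n]→ₗ[ℝ] ℝ}
    (hvol : IsVolumeForm vol) {x : M} (hx : x ∈ U) :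
    ∃ s : ℝ, |s| = 1 ∧ ∀ᶠ z in 𝓝 x, ∃ c : ℝ, 0 < c ∧ s • radialVol f z = c • vol z := by
  have hO := isOpen_chartSource (n := n) x
  have hxs : x ∈ chartSource n x := mem_chart_source _ x
  choose Y hY hYe using fun i : Fin n => exists_smooth_field_eventuallyEq hO
    (isSmoothFieldOn_coordField x (EuclideanSpace.single i 1)) hxs
  obtain ⟨W, hWsub, hW, hxW⟩ := mem_nhds_iff.1 (Filter.inter_mem (Filter.inter_mem
    (hO.mem_nhds hxs) (hf.isOpen.mem_nhds hx)) (Filter.eventually_all.2 hYe))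
  have hfW := hf.mono hW fun z hz => (hWsub hz).1.2
  have hYb : ∀ z (hz : z ∈ W), (fun i => Y i z) = coordBasis (hWsub hz).1.1 := by
    intro z hz
    funext i
    rw [coordBasis_apply, (hWsub hz).2 i]
  have hYW : ∀ i, IsSmoothFieldOn (Y i) W := fun i => ContMDiffOn.mono (hY i) (subset_univ _)
  set v : M → ℝ := fun z => vol z fun i => Y i z
  set w : M → ℝ := fun z => radialVol f z fun i => Y i z
  have hw0 : ∀ z ∈ W, w z ≠ 0 := fun z hz => hfW.radialVol_ne_zero hz (by
    rw [hYb z hz]; exact (coordBasis _).linearIndependent)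
  have hv0 : ∀ z ∈ W, v z ≠ 0 := by
    intro z hz h0
    refine hvol.ne_zero z (Module.Basis.ext_alternating (coordBasis (hWsub hz).1.1) fun i hi => ?_)
    obtain ⟨σ, hσ⟩ : ∃ σ : Equiv.Perm (Fin n), ⇑σ = i :=
      ⟨Equiv.ofBijective i (Finite.injective_iff_bijective.1 hi), rfl⟩
    have h1 : (fun k => coordBasis (hWsub hz).1.1 (i k)) = coordBasis (hWsub hz).1.1 ∘ σ := by
      rw [hσ]; rfl
    simp only [v] at h0
    rw [hYb z hz] at h0
    rw [h1, AlternatingMap.map_perm, h0, smul_zero]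
    rfl
  have hvc : ContinuousAt v x := (hvol.smooth Y hY).continuous.continuousAt
  have hwc : ContinuousAt w x := ((hfW.contMDiffOn_radialVol hYW).contMDiffAt
    (hW.mem_nhds hxW)).continuousAt
  have hq : ContinuousAt (fun z => w z / v z) x := hwc.div hvc (hv0 x hxW)
  have hq0 : w x / v x ≠ 0 := div_ne_zero (hw0 x hxW) (hv0 x hxW)
  have hrep : ∀ z ∈ W, radialVol f z = (w z / v z) • vol z := by
    intro z hz
    have h0 := hv0 z hz
    simp only [v, w] at h0 ⊢
    rw [hYb z hz] at h0 ⊢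
    exact AlternatingMap.eq_smul_of_apply_ne_zero _ _ _ h0
  rcases hq0.lt_or_gt with h | h
  · refine ⟨-1, by simp, ?_⟩
    filter_upwards [hW.mem_nhds hxW, hq.eventually (gt_mem_nhds h)] with z hz hz'
    exact ⟨-(w z / v z), neg_pos.2 hz', by rw [hrep z hz, smul_smul, neg_one_mul]⟩
  · refine ⟨1, by simp, ?_⟩
    filter_upwards [hW.mem_nhds hxW, hq.eventually (lt_mem_nhds h)] with z hz hz'
    exact ⟨w z / v z, hz', by rw [hrep z hz, one_smul]⟩

theorem eq_of_smul_eq_smul_pos {V : Type*} [AddCommGroup V] [Module ℝ V] {η μ : V} (hμ : μ ≠ 0)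
    {s s' c c' : ℝ} (hs : |s| = 1) (hs' : |s'| = 1) (hc : 0 < c) (hc' : 0 < c')
    (h : s • η = c • μ) (h' : s' • η = c' • μ) : s = s' := by
  rcases abs_eq_abs.1 (hs.trans hs'.symm) with h1 | h1
  · exact h1
  · exfalso
    rw [h1, neg_smul, h', ← neg_smul] at h
    have := smul_left_injective ℝ hμ h
    linarith

/-- On an orientable manifold, the volume forms of the local immersions can be glued. -/
theorem LevelAtlas.exists_parallel_volumeForm [T2Space M] {C : Set (Fin (n + 1) → ℝ)}
    {φ : (Fin (n + 1) → ℝ) → ℝ} (𝒜 : LevelAtlas M C φ) (hφ : IsConePotential C φ)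
    (hM : IsOrientableManifold n M) :
    ∃ vol : Π x : M, (TangentSpace (𝓡 n) x) [⋀^Fin n]→ₗ[ℝ] ℝ,
      IsVolumeForm vol ∧ PreservesForm 𝒜.connection vol := by
  obtain ⟨μ, hμ⟩ := hM
  choose s hs hsμ using fun x => (𝒜.isRadialImmersionOn x).exists_sign hμ (𝒜.mem x)
  set vol : Π x : M, (TangentSpace (𝓡 n) x) [⋀^Fin n]→ₗ[ℝ] ℝ := fun x => s x • radialVol (𝒜.f x) x
  -- The forms of the immersions at `x` and `z` differ by `det B = ±1`. Both signs `s` compare with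
  -- the same orientation form, so they absorb this determinant and the signed forms coincide.
  have hloc : ∀ x, ∀ᶠ z in 𝓝 x, vol z = s x • radialVol (𝒜.f x) z := by
    intro x
    filter_upwards [hsμ x, (𝒜.isRadialImmersionOn x).isOpen.mem_nhds (𝒜.mem x)] with z hz hzU
    obtain ⟨c, hc, h1⟩ := hz
    obtain ⟨c', hc', h2⟩ := (hsμ z).self_of_nhds
    obtain ⟨B, hB, h3⟩ := 𝒜.compat x z hzU
    have h4 : radialVol (𝒜.f z) z = B.det • radialVol (𝒜.f x) z := by
      rw [← radialVol_mulVec (𝒜.isRadialImmersionOn x) B hzU]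
      exact radialVol_congr h3
    rw [h4, smul_smul] at h2
    simp only [vol]
    rw [h4, smul_smul, eq_of_smul_eq_smul_pos (hμ.ne_zero z)
      (by rw [abs_mul, hs, hB, one_mul]) (hs x) hc' hc h2 h1]
  refine ⟨vol, ⟨fun X hX => fun x => ?_, fun x h0 => ?_⟩, fun Y hY x v => ?_⟩
  · have h1 := (𝒜.isRadialImmersionOn x).contMDiffOn_radialVol (Y := X)
      fun i => ContMDiffOn.mono (hX i) (subset_univ _)
    have h2 := (((s x • ContinuousLinearMap.id ℝ ℝ).contDiff (n := ∞)).contMDiff.contMDiffAt).comp x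
      (h1.contMDiffAt ((𝒜.isRadialImmersionOn x).isOpen.mem_nhds (𝒜.mem x)))
    refine h2.congr_of_eventuallyEq ?_
    filter_upwards [hloc x] with z hz
    rw [hz]
    rfl
  · obtain ⟨c, hc, h1⟩ := (hsμ x).self_of_nhds
    exact smul_ne_zero hc.ne' (hμ.ne_zero x) (h1.symm.trans h0)
  · have hf := 𝒜.isRadialFor hφ x
    have hYU : ∀ i, IsSmoothFieldOn (Y i) (𝒜.U x) := fun i => ContMDiffOn.mono (hY i) (subset_univ _)
    have h1 := hf.mvfderiv_radialVol hYU (𝒜.mem x) v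
    have h2 : (fun z => vol z fun i => Y i z) =ᶠ[𝓝 x]
        fun z => (s x • ContinuousLinearMap.id ℝ ℝ) (radialVol (𝒜.f x) z fun i => Y i z) := by
      filter_upwards [hloc x] with z hz
      rw [hz]
      rfl
    have h3 := ((𝒜.isRadialImmersionOn x).contMDiffOn_radialVol hYU).contMDiffAt
      ((𝒜.isRadialImmersionOn x).isOpen.mem_nhds (𝒜.mem x))
    rw [mvfderiv_congr h2, mvfderiv_clm_comp _ (h3.mdifferentiableAt (by simp)), h1]
    simp only [vol, smul_apply, ContinuousLinearMap.id_apply, Finset.smul_sum,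
      AlternatingMap.smul_apply]

theorem LevelAtlas.conditionE [T2Space M] {C : Set (Fin (n + 1) → ℝ)}
    {φ : (Fin (n + 1) → ℝ) → ℝ} (𝒜 : LevelAtlas M C φ) (hφ : IsConePotential C φ)
    (hM : IsOrientableManifold n M) : ConditionE 𝒜.connection (𝒜.metric hφ) := by
  have h : ∀ x, ∃ f U, x ∈ U ∧ IsRadialFor 𝒜.connection.toFun (𝒜.metric hφ).toFun f U :=
    fun x => ⟨𝒜.f x, 𝒜.U x, 𝒜.mem x, 𝒜.isRadialFor hφ x⟩
  exact ⟨contMDiffCovariantDerivative_of_isRadialFor h, torsion_eq_zero_of_isRadialFor h,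
    𝒜.exists_parallel_volumeForm hφ hM, isFlatOn_extendedConnection_of_isRadialFor h⟩

end Gluing

/-! ## Descent to the quotient -/

section Descent

variable {n : ℕ} {M : Type*} [TopologicalSpace M] [ChartedSpace (EuclideanSpace ℝ (Fin n)) M]
  [IsManifold (𝓡 n) ∞ M] {M' : Type*} [TopologicalSpace M']
  [ChartedSpace (EuclideanSpace ℝ (Fin n)) M'] [IsManifold (𝓡 n) ∞ M'] {p : M' → M}
  {F : M' → Fin (n + 1) → ℝ} {s : M → M'} {U : Set M}

/-- `p ∘ s = id` makes the derivative of `s` injective, so injectivity of the frame is inherited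
from `F`. -/
theorem IsRadialImmersionOn.comp_section (hF : IsRadialImmersionOn F univ)
    (hp : ContMDiff (𝓡 n) (𝓡 n) ∞ p) (hU : IsOpen U) (hs : ContMDiffOn (𝓡 n) (𝓡 n) ∞ s U)
    (hps : ∀ x ∈ U, p (s x) = x) : IsRadialImmersionOn (fun x => F (s x)) U where
  isOpen := hU
  smooth := hF.smooth.comp hs fun _ _ => mem_univ _
  injective x hx := by
    have hsx : MDifferentiableAt (𝓡 n) (𝓡 n) s x :=
      (hs.contMDiffAt (hU.mem_nhds hx)).mdifferentiableAt (by simp)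
    have hpx : MDifferentiableAt (𝓡 n) (𝓡 n) p (s x) := (hp _).mdifferentiableAt (by simp)
    have hxs : p (s x) ∈ chartSource n x := by rw [hps x hx]; exact mem_chart_source _ x
    have hcp : MDifferentiableAt (𝓡 n) (𝓡 n) (fun y => chartMap n x (p y)) (s x) :=
      (mdifferentiableAt_chartMap hxs).comp (s x) hpx
    have h1 : (fun z => chartMap n x (p (s z))) =ᶠ[𝓝 x] chartMap n x := by
      filter_upwards [hU.mem_nhds hx] with z hz
      rw [hps z hz]
    have hinj : Function.Injective (mfderiv (𝓡 n) (𝓡 n) s x) := by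
      intro v w h
      have h2 := mvfderiv_comp_mfderiv hcp hsx v
      have h3 := mvfderiv_comp_mfderiv hcp hsx w
      rw [h, ← h3, mvfderiv_congr h1] at h2
      rw [← coordField_mvfderiv_chartMap (mem_chart_source _ x) v, h2,
        coordField_mvfderiv_chartMap (mem_chart_source _ x)]
    rintro ⟨v, r⟩ ⟨v', r'⟩ h
    rw [radialFrame_apply, radialFrame_apply,
      mvfderiv_comp_mfderiv (hF.mdifferentiableAt (mem_univ _)) hsx,
      mvfderiv_comp_mfderiv (hF.mdifferentiableAt (mem_univ _)) hsx, ← radialFrame_apply,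
      ← radialFrame_apply] at h
    have h3 := Prod.ext_iff.1 (hF.injective _ (mem_univ _) h)
    exact Prod.ext (hinj h3.1) h3.2

/-- An equivariant map agrees, up to the holonomy, with its composition with a local section. -/
theorem eventually_eq_mulVec_section [SimplyConnectedSpace M'] [LocallyPathConnectedSpace M']
    (hp : IsCoveringMap p) (hequiv : ∀ γ : DeckGroup p, ∃ B : Matrix (Fin (n + 1)) (Fin (n + 1)) ℝ,
      |B.det| = 1 ∧ ∀ x, F (γ.1 x) = B.mulVec (F x))
    (hU : IsOpen U) (hs : ContinuousOn s U) (hps : ∀ x ∈ U, p (s x) = x) {x₀ : M'}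
    (hx₀ : p x₀ ∈ U) : ∃ B : Matrix (Fin (n + 1)) (Fin (n + 1)) ℝ, |B.det| = 1 ∧
      ∀ᶠ y in 𝓝 x₀, F y = B.mulVec (F (s (p y))) := by
  -- The deck transformation that moves `s (p x₀)` to `x₀` also moves `s (p y)` to `y` for nearby
  -- `y`, because `p` is locally injective; `B` is the matrix attached to it.
  obtain ⟨γ, hγ⟩ := hp.exists_deck (hps _ hx₀)
  obtain ⟨B, hB, hF⟩ := hequiv γ
  refine ⟨B, hB, ?_⟩
  obtain ⟨V, hV, hxV, hinj⟩ := hp.isLocalHomeomorph.isLocallyInjective x₀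
  have hc : ContinuousAt (fun y => γ.1 (s (p y))) x₀ :=
    γ.1.continuous.continuousAt.comp
      (ContinuousAt.comp (hs.continuousAt (hU.mem_nhds hx₀)) hp.continuous.continuousAt)
  have h1 : ∀ᶠ y in 𝓝 x₀, γ.1 (s (p y)) ∈ V :=
    hc.eventually (hV.mem_nhds (show γ.1 (s (p x₀)) ∈ V by rw [hγ]; exact hxV))
  filter_upwards [h1, hV.mem_nhds hxV, hp.continuous.continuousAt.eventually (hU.mem_nhds hx₀)]
    with y hy hyV hyU
  rw [← hF]
  congr 1
  exact hinj hyV hy (by rw [γ.2, hps _ hyU])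

/-- A properly convex projective structure on an orientable closed manifold is defined by a solution
of Condition (E). -/
theorem FlatProjStructure.IsProperlyConvex.exists_conditionE [T2Space M] [PathConnectedSpace M]
    [SimplyConnectedSpace M'] (hp : IsCoveringMap p) (hp' : IsLocalDiffeomorph (𝓡 n) (𝓡 n) ∞ p)
    (hM : IsOrientableManifold n M) {S : FlatProjStructure n p} (hS : S.IsProperlyConvex) :
    ∃ (D : TangentConnection n M) (g : SymmTwoTensor n M),
      ConditionE D g ∧ g.IsPosDef ∧ IsProjectivelyFlat D ∧ S.IsDefinedBy D := by
  have hM' : LocallyPathConnectedSpace M' :=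
    ChartedSpace.locallyPathConnectedSpace (EuclideanSpace ℝ (Fin n)) M'
  obtain ⟨C, φ, F, hφ, hF, hlevel, hdev, hequiv'⟩ := hS.exists_lift
  have hequiv : ∀ γ : DeckGroup p, ∃ B : Matrix (Fin (n + 1)) (Fin (n + 1)) ℝ,
      |B.det| = 1 ∧ ∀ x, F (γ.1 x) = B.mulVec (F x) := fun γ =>
    (hequiv' γ).imp fun B hB => ⟨hB.1, hB.2.2.2⟩
  choose σ hσ using hp.surjective_of_pathConnectedSpace
  choose s U hU hmem hsσ hs hps using fun x => exists_local_section hp' (σ x)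
  simp only [hσ] at hmem hsσ
  -- The local immersions are the compositions of the equivariant lift with local sections of the
  -- covering. Different sections differ by deck transformations, so compatibility is equivariance.
  let 𝒜 : LevelAtlas M C φ :=
    { f := fun x z => F (s x z)
      U := U
      mem := hmem
      isRadialImmersionOn := fun x => hF.comp_section hp'.contMDiff (hU x) (hs x) (hps x)
      level := fun x z _ => hlevel _
      compat := by
        intro x z hz
        obtain ⟨B, hB, h⟩ := eventually_eq_mulVec_section hp hequiv (hU x) (hs x).continuousOn (hps x)
          (x₀ := s z z) (by rwa [hps z z (hmem z)])
        refine ⟨B, hB, ?_⟩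
        have hc : ContinuousAt (s z) z := (hs z).continuousOn.continuousAt ((hU z).mem_nhds (hmem z))
        filter_upwards [hc.eventually h, (hU z).mem_nhds (hmem z)] with w hw hwU
        rw [hw, hps z w hwU] }
  refine ⟨𝒜.connection, 𝒜.metric hφ, 𝒜.conditionE hφ hM, 𝒜.isPosDef_metric hφ,
    isProjectivelyFlat_of_isRadialFor fun x => ⟨_, _, hmem x, 𝒜.isRadialFor hφ x⟩,
    FlatProjStructure.isDefinedBy_of_isRadialFor (g := (𝒜.metric hφ).toFun) hp' fun x₀ => ?_⟩
  obtain ⟨B, hB, h⟩ := eventually_eq_mulVec_section hp hequiv (hU (p x₀)) (hs (p x₀)).continuousOn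
    (hps (p x₀)) (hmem (p x₀))
  refine ⟨_, U (p x₀), hmem _, (𝒜.isRadialFor hφ (p x₀)).clm_comp
    (mulVecLin_injective (A := B) fun h => by simp [h] at hB), ?_⟩
  filter_upwards [h] with z hz
  obtain ⟨h0, h1⟩ := hdev z
  rw [h1]
  simp only [hz] at h0 ⊢
  exact ⟨h0, rfl⟩

end Descent

/-! ### The correspondence between Condition (E) and proper convexity. -/

theorem mainTheorem4 (n : ℕ) {M : Type*} [TopologicalSpace M]
    [ChartedSpace (EuclideanSpace ℝ (Fin n)) M] [IsManifold (𝓡 n) ∞ M]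
    [T2Space M] [CompactSpace M] [ConnectedSpace M]
    {M' : Type*} [TopologicalSpace M'] [ChartedSpace (EuclideanSpace ℝ (Fin n)) M']
    [IsManifold (𝓡 n) ∞ M'] [SimplyConnectedSpace M']
    (p : M' → M) (hp : IsCoveringMap p) (hp' : IsLocalDiffeomorph (𝓡 n) (𝓡 n) ∞ p) :
    (∀ (D : TangentConnection n M) (g : SymmTwoTensor n M), ConditionE D g → g.IsPosDef →
      IsProjectivelyFlat D ∧
        ∃ S : FlatProjStructure n p, S.IsDefinedBy D ∧ S.IsProperlyConvex) ∧
    (IsOrientableManifold n M → ∀ S : FlatProjStructure n p, S.IsProperlyConvex →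
      ∃ (D : TangentConnection n M) (g : SymmTwoTensor n M),
        ConditionE D g ∧ g.IsPosDef ∧ IsProjectivelyFlat D ∧ S.IsDefinedBy D) := by
  have hM : LocallyPathConnectedSpace M :=
    ChartedSpace.locallyPathConnectedSpace (EuclideanSpace ℝ (Fin n)) M
  have : PathConnectedSpace M := pathConnectedSpace_iff_connectedSpace.2 inferInstance
  exact ⟨fun _ _ hE hg => exists_flatProjStructure_of_conditionE hp hp' hE hg,
    fun hor _ hS => hS.exists_conditionE hp hp' hor⟩
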